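/- All graphs are finite, simple and have at least one vertex; "contains" refers to induced subgraphs. A path is always chordless: a sequence of distinct vertices in which two vertices are adjacent if and only if they are consecutive. An $ab$-path is a path with ends $a$ and $b$, its length is its number of edges, and its interior is the set of its vertices other than $a$ and $b$. A hole is a chordless cycle of length at least $4$. A theta is a graph made of three $ab$-paths of length at least $2$, pairwise vertex-disjoint apart from $a$ and $b$, with no other vertices and no edges other than those of the paths. A wac is a graph formed by a hole $H$ and two adjacent vertices outside $H$, each with at least three neighbours in $H$. A graph is (theta, triangle, wac)-free if none of its induced subgraphs is a theta, a triangle or a wac. Let $C=c_1\dots c_kc_1$ be a hole (indices modulo $k$). A petal centred at $c_i$ is a path $P=x\dots y$ disjoint from $C$ such that $x$ is adjacent to $c_{i-1}$, $y$ is adjacent to $c_{i+1}$, $c_i$ is adjacent to at least one internal vertex of $P$, no edge of $c_{i-1}xPyc_{i+1}$ has both its ends adjacent to $c_i$, and the only other edges between $P$ and $C$ are incident to $c_i$. A daisy is a graph formed by a hole $C$ and pairwise disjoint petals with respect to $C$, with distinct centres and no edges between distinct petals, such that the centres induce a (possibly empty) subpath of $C$ or all of $C$. A graph is basic if it is isomorphic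 to $K_1$, $K_2$, the cube (the graph of the $3$-dimensional cube) or a daisy. Gluing operations (all up to isomorphism): (1) Gluing along a clique. Given $k\ge 2$ disjoint graphs $G_1,\dots,G_k$, each $G_i$ containing a clique $K_i$ on $\ell$ vertices, where $\ell\in\{0,1,2\}$ is the same for all $i$, identify $K_1,\dots,K_k$ by bijections (for $\ell=0$, take the disjoint union). (2) Gluing along a proper 2-separator. Let $G_X$ and $G_Y$ be disjoint graphs, $Q$ an $a_Xb_X$-path of $G_X$ and $P$ an $a_Yb_Y$-path of $G_Y$, both of length at least $2$, whose internal vertices all have degree $2$ (in $G_X$, resp. $G_Y$). Identify $a_X$ with $a_Y$ and $b_X$ with $b_Y$, and delete the interiors of $P$ and $Q$. (3) Gluing along a proper $P_3$-separator. Let $G_X$ and $G_Y$ be disjoint graphs such that: - $G_X$ contains a path $a_Xc_Xb_X$, an $a_Xb_X$-path $Q$ of length at least $2$ that avoids $c_X$ and has at least one internal vertex adjacent to $c_X$, and an $a_Xb_X$-path that avoids $c_X$ and has no internal vertex adjacent to $c_X$; every internal vertex of $Q$ has degree $2$ in $G_X$, or has degree $3$ in $G_X$ and is adjacent to $c_X$;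 - $G_Y$ contains a path $a_Yc_Yb_Y$ and an $a_Yb_Y$-path $P$ of length at least $2$ that avoids $c_Y$, has no internal vertex adjacent to $c_Y$, and all of whose internal vertices have degree $2$ in $G_Y$; every $a_Yb_Y$-path of $G_Y$ other than $P$ and $a_Yc_Yb_Y$ has an internal vertex adjacent to $c_Y$. Identify $a_X$ with $a_Y$, $c_X$ with $c_Y$ and $b_X$ with $b_Y$, and delete the interiors of $P$ and $Q$. Theorem. A graph is (theta, triangle, wac)-free if and only if it can be obtained from basic graphs by repeatedly applying the gluing operations (1), (2) and (3). -/

import Mathlib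

open SimpleGraph

/-- A path of the graph `G` from `a` to `b`, that is, an `ab`-path. All paths here are chordless:
a sequence of distinct vertices, two of which are adjacent if and only if they are consecutive. -/
structure ABPath {V : Type*} (G : SimpleGraph V) (a b : V) where
  /-- the number of edges of the path -/
  length : ℕ
  toEmb : pathGraph (length + 1) ↪g G
  first_eq : toEmb 0 = a
  last_eq : toEmb (Fin.last length) = b

/-- The vertex set of a path. -/
def ABPath.verts {V : Type*} {G : SimpleGraph V} {a b : V} (P : ABPath G a b) : Set V :=
  Set.range P.toEmb

/-- The set of internal vertices of a path. -/
def ABPath.interior {V : Type*} {G : SimpleGraph V} {a b : V} (P : ABPath G a b) : Set V :=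
  {v | v ∈ P.verts ∧ v ≠ a ∧ v ≠ b}

/-- A hole of `G`: a chordless cycle `c 0, c 1, …` of length `m + 4`, hence of length at least 4.
The indices live in `Fin (m + 4)`, so that they are added and subtracted modulo the length. -/
structure Hole {V : Type*} (G : SimpleGraph V) where
  m : ℕ
  c : cycleGraph (m + 4) ↪g G

/-- The graph `G` is a theta: three chordless `ab`-paths of length at least 2, vertex-disjoint
apart from `a` and `b`, with no other vertices and no other edges. -/
def IsTheta {V : Type*} (G : SimpleGraph V) : Prop :=
  ∃ (a b : V) (P : Fin 3 → ABPath G a b),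
    (∀ i, 2 ≤ (P i).length) ∧
    (∀ i j, i ≠ j → (P i).verts ∩ (P j).verts = {a, b}) ∧
    (∀ v, ∃ i, v ∈ (P i).verts) ∧
    (∀ u v, G.Adj u v → ∃ i, u ∈ (P i).verts ∧ v ∈ (P i).verts)

/-- The graph `G` is a wac: it consists of a hole and of two adjacent vertices outside it, each
with at least three neighbours in the hole. -/
def IsWac {V : Type*} (G : SimpleGraph V) : Prop :=
  ∃ (C : Hole G) (x y : V),
    x ∉ Set.range C.c ∧ y ∉ Set.range C.c ∧ G.Adj x y ∧
    3 ≤ {i | G.Adj x (C.c i)}.ncard ∧ 3 ≤ {i | G.Adj y (C.c i)}.ncard ∧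
    (∀ v, v ∈ Set.range C.c ∨ v = x ∨ v = y)

/-- No induced subgraph of `G` is a theta. -/
def ThetaFree {V : Type*} (G : SimpleGraph V) : Prop :=
  ∀ s : Set V, ¬ IsTheta (G.induce s)

/-- No induced subgraph of `G` is a wac. -/
def WacFree {V : Type*} (G : SimpleGraph V) : Prop :=
  ∀ s : Set V, ¬ IsWac (G.induce s)

/-- A petal `x … y` centred at `c i` with respect to a hole `C`. -/
structure Petal {V : Type*} (G : SimpleGraph V) (C : Hole G) (i : Fin (C.m + 4)) where
  x : V
  y : V
  path : ABPath G x y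
  disjoint : Disjoint path.verts (Set.range C.c)
  adj_x : G.Adj x (C.c (i - 1))
  adj_y : G.Adj y (C.c (i + 1))
  /-- the centre has a neighbour in the interior of the petal -/
  centre_adj : ∃ v ∈ path.interior, G.Adj (C.c i) v
  /-- no edge of the petal, nor the edge from `c (i - 1)` to `x` or from `y` to `c (i + 1)`, has
  both its ends adjacent to the centre (`c (i - 1)` and `c (i + 1)` are adjacent to it) -/
  no_edge : ∀ u ∈ path.verts, ∀ v ∈ path.verts, G.Adj u v →
    ¬ (G.Adj (C.c i) u ∧ G.Adj (C.c i) v)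
  no_edge_x : ¬ G.Adj (C.c i) x
  no_edge_y : ¬ G.Adj (C.c i) y
  /-- there are no other edges between the petal and the hole -/
  only : ∀ v ∈ path.verts, ∀ j, G.Adj v (C.c j) →
    (v = x ∧ j = i - 1) ∨ (v = y ∧ j = i + 1) ∨ j = i

/-- The graph `G` is a daisy: a hole together with petals with distinct centres, one for each `i`
in the set `I`. The centres form a (possibly empty) subpath of the hole or the whole hole, distinct
petals are disjoint and there are no edges between them, and there are no other vertices. -/
def IsDaisy {V : Type*} (G : SimpleGraph V) : Prop :=
  ∃ (C : Hole G) (I : Set (Fin (C.m + 4))) (P : ∀ i : I, Petal G C i),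
    (I = Set.univ ∨ ∃ (n : ℕ) (p : pathGraph n ↪g cycleGraph (C.m + 4)), Set.range p = I) ∧
    (∀ i j : I, i ≠ j → ∀ u ∈ (P i).path.verts, ∀ v ∈ (P j).path.verts, u ≠ v ∧ ¬ G.Adj u v) ∧
    (∀ v, v ∈ Set.range C.c ∨ ∃ i, v ∈ (P i).path.verts)

/-- The cube: its vertices are the 0/1-triples, adjacent when they differ in exactly one place. -/
def cubeGraph : SimpleGraph (Fin 3 → Bool) where
  Adj u v := hammingDist u v = 1
  symm := ⟨fun u v h => by rw [hammingDist_comm]; exact h⟩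
  loopless := ⟨fun u h => by simp at h⟩

/-- Basic graphs: `K₁`, `K₂`, the cube and the daisies. -/
def IsBasic {V : Type*} (G : SimpleGraph V) : Prop :=
  Nonempty (G ≃g completeGraph (Fin 1)) ∨ Nonempty (G ≃g completeGraph (Fin 2)) ∨
    Nonempty (G ≃g cubeGraph) ∨ IsDaisy G

/-- `G` is (isomorphic to) the graph obtained from the disjoint union of the graphs `H i` by
identifying, for every `j`, all the vertices `t i j` into one vertex. -/
def IsGluing {ι J V : Type*} {W : ι → Type*} (H : ∀ i, SimpleGraph (W i)) (t : ∀ i, J → W i)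
    (G : SimpleGraph V) : Prop :=
  ∃ f : ∀ i, W i → V,
    (∀ i, Function.Injective (f i)) ∧
    (∀ v, ∃ i w, f i w = v) ∧
    (∀ i i', i ≠ i' → ∀ w w', f i w = f i' w' ↔ ∃ j, w = t i j ∧ w' = t i' j) ∧
    (∀ u v, G.Adj u v ↔ ∃ i w w', (H i).Adj w w' ∧ f i w = u ∧ f i w' = v)

/-- `G` is (isomorphic to) the graph obtained from the disjoint union of `GX` and `GY` by
identifying `tX j` with `tY j` for every `j` and deleting the vertices of `DX` and of `DY`
(which are disjoint from the ranges of `tX` and `tY` wherever this is used). -/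
def IsGluingDeleting {A B J V : Type*} (GX : SimpleGraph A) (GY : SimpleGraph B)
    (tX : J → A) (tY : J → B) (DX : Set A) (DY : Set B) (G : SimpleGraph V) : Prop :=
  ∃ (f : ↥DXᶜ → V) (g : ↥DYᶜ → V),
    Function.Injective f ∧ Function.Injective g ∧
    (∀ v, (∃ x, f x = v) ∨ (∃ y, g y = v)) ∧
    (∀ x y, f x = g y ↔ ∃ j, (x : A) = tX j ∧ (y : B) = tY j) ∧
    (∀ u v, G.Adj u v ↔
      (∃ x x' : ↥DXᶜ, GX.Adj x x' ∧ f x = u ∧ f x' = v) ∨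
      (∃ y y' : ↥DYᶜ, GY.Adj y y' ∧ g y = u ∧ g y' = v))

/-- `G` is obtained from the graphs `H i` by gluing along cliques on `l ≤ 2` vertices; the clique
chosen in `H i` is `{t i j | j : Fin l}`. -/
def IsCliqueGluing {ι V : Type*} {W : ι → Type*} (H : ∀ i, SimpleGraph (W i))
    (G : SimpleGraph V) : Prop :=
  ∃ (l : ℕ) (t : ∀ i, Fin l → W i), l ≤ 2 ∧
    (∀ i j j', j ≠ j' → (H i).Adj (t i j) (t i j')) ∧ IsGluing H t G

/-- `G` is obtained from `GX` and `GY` by gluing along a proper 2-separator. -/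
def IsTwoGluing {A B V : Type*} (GX : SimpleGraph A) (GY : SimpleGraph B)
    (G : SimpleGraph V) : Prop :=
  ∃ (aX bX : A) (aY bY : B) (Q : ABPath GX aX bX) (P : ABPath GY aY bY),
    2 ≤ Q.length ∧ 2 ≤ P.length ∧
    (∀ v ∈ Q.interior, (GX.neighborSet v).ncard = 2) ∧
    (∀ v ∈ P.interior, (GY.neighborSet v).ncard = 2) ∧
    IsGluingDeleting GX GY ![aX, bX] ![aY, bY] Q.interior P.interior G

/-- `acb` is a (chordless) path on three vertices. -/
def IsP3 {V : Type*} (G : SimpleGraph V) (a c b : V) : Prop :=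
  a ≠ b ∧ G.Adj a c ∧ G.Adj c b ∧ ¬ G.Adj a b

/-- `G` is obtained from `GX` and `GY` by gluing along a proper `P₃`-separator. -/
def IsP3Gluing {A B V : Type*} (GX : SimpleGraph A) (GY : SimpleGraph B)
    (G : SimpleGraph V) : Prop :=
  ∃ (aX cX bX : A) (aY cY bY : B) (Q : ABPath GX aX bX) (P : ABPath GY aY bY),
    -- the conditions on `GX`
    IsP3 GX aX cX bX ∧ 2 ≤ Q.length ∧ cX ∉ Q.verts ∧ (∃ v ∈ Q.interior, GX.Adj cX v) ∧
    (∃ R : ABPath GX aX bX, cX ∉ R.verts ∧ ∀ v ∈ R.interior, ¬ GX.Adj cX v) ∧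
    (∀ v ∈ Q.interior, (GX.neighborSet v).ncard = 2 ∨
      ((GX.neighborSet v).ncard = 3 ∧ GX.Adj cX v)) ∧
    -- the conditions on `GY`
    IsP3 GY aY cY bY ∧ 2 ≤ P.length ∧ cY ∉ P.verts ∧ (∀ v ∈ P.interior, ¬ GY.Adj cY v) ∧
    (∀ R : ABPath GY aY bY, R.verts ≠ P.verts → R.verts ≠ {aY, cY, bY} →
      ∃ v ∈ R.interior, GY.Adj cY v) ∧
    (∀ v ∈ P.interior, (GY.neighborSet v).ncard = 2) ∧
    IsGluingDeleting GX GY ![aX, cX, bX] ![aY, cY, bY] Q.interior P.interior G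

universe u

/-- The graphs that can be obtained from basic graphs by repeatedly gluing along cliques, proper
2-separators and proper `P₃`-separators. -/
inductive Buildable : ∀ {V : Type u}, SimpleGraph V → Prop
  | basic {V : Type u} (G : SimpleGraph V) : IsBasic G → Buildable G
  | clique {V : Type u} (G : SimpleGraph V) (k : ℕ) (W : Fin k → Type u)
      (H : ∀ i, SimpleGraph (W i)) : 2 ≤ k → (∀ i, Buildable (H i)) → IsCliqueGluing H G →
      Buildable G
  | two {V A B : Type u} (G : SimpleGraph V) (GX : SimpleGraph A) (GY : SimpleGraph B) :
      Buildable GX → Buildable GY → IsTwoGluing GX GY G → Buildable G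
  | p3 {V A B : Type u} (G : SimpleGraph V) (GX : SimpleGraph A) (GY : SimpleGraph B) :
      Buildable GX → Buildable GY → IsP3Gluing GX GY G → Buildable G

/-!
# The structure of (theta, triangle, wac)-free graphs

All arguments use a set form of the forbidden configurations, called `Free`: the three paths of a theta
are replaced by three pairwise anticomplete connected sets that attach to both branch vertices (a shortest
path through each of the sets gives back a path, see `thetaFree_iff`), and a wac is a hole with two
adjacent vertices outside it, each with three neighbours in it. In a free graph a vertex with two
neighbours in a hole has three (`Free.three`), so that two adjacent vertices never both have two
neighbours in a hole.

**Decomposition.** A free graph without the separators underlying the three gluing operations is basic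
(`Free.isBasic`). Without a clique separator, a cube is the whole graph (`Free.eq_cube`), a graph without
a hole is complete, and a graph with a hole is either that hole or contains a wheel, that is, a hole with
a vertex `v` outside it adjacent to the ends of one of its two parts but to nothing inside that part (a
sector). In a wheel without a cube the inside of the sector and the inside of the rest of the hole are not
joined outside the wheel (`Wheel.separated`). Hence the ends of the sector and `v` separate them. If there
is a vertex outside the wheel, then the sector can be chosen so that its inside is joined to such a
vertex; in the absence of a proper `P₃`-separator the other part then has no neighbours outside the wheel,
so that it is a petal, with centre `v`, for the hole formed by `v` and the sector
(`Indecomposable.exists_centre`). Among the holes with such petals one takes `C` with the maximum number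
of centres. No vertex outside `C` has two neighbours in `C`, as otherwise the hole could be rerouted
through it and would gain a centre (`Indecomposable.not_two`). It follows that all vertices outside `C`
belong to petals (`Indecomposable.exists_fullPetal`), and the centres are consecutive because otherwise
there is a proper 2-separator (`centres_interval`). So the graph is a daisy. If there is one of the
separators, then the graph is glued from proper induced subgraphs, which are free, and induction on the
number of vertices applies (`Free.buildable`).

**Composition.** In the basic graphs each vertex that is not on the hole of a daisy has degree at most
three, and the configurations are excluded by looking at the neighbours of a branch vertex of a theta or
of one of the two vertices of a wac (`IsBasic.free`). For the gluing operations, a forbidden configuration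
of the glued graph is moved into one of the two blocks: what it does in the other side is replaced by the
path of the block that was deleted in the gluing (`Block.no_theta_side`, `Block.no_wac_cross`). A theta
with its branch vertices in different sides is impossible, as its three connected sets would need three
pairwise nonadjacent vertices in the separator (`Block.no_branch`). The remaining case is a theta whose
branch vertices are the ends `a`, `b` of the separator; two of its connected sets lie in one side, for if
one of them contains the middle vertex `c`, then by the condition on the paths of the second graph the
other two lie in the first side, and with the path of the block they form a theta
(`Amalgam.no_theta_sep`).
-/

/-! ### Connected sets, attachments and thetas -/

/-- The set `A` is connected in `G`: a subset of `A` that is nonempty and closed under taking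
neighbours inside `A` is all of `A`. The empty set is connected in this sense. -/
def Conn {V : Type*} (G : SimpleGraph V) (A : Set V) : Prop :=
  ∀ B : Set V, (∃ x ∈ A, x ∈ B) → (∀ x ∈ A, x ∈ B → ∀ y ∈ A, G.Adj x y → y ∈ B) → A ⊆ B

/-- The vertex `u` has a neighbour in `A`. -/
def Att {V : Type*} (G : SimpleGraph V) (u : V) (A : Set V) : Prop := ∃ x ∈ A, G.Adj u x

/-- The sets `A` and `B` are disjoint and there are no edges between them. -/
def Anti {V : Type*} (G : SimpleGraph V) (A B : Set V) : Prop :=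
  ∀ x ∈ A, ∀ y ∈ B, x ≠ y ∧ ¬ G.Adj x y

/-- The set form of `ThetaFree`: no two distinct nonadjacent vertices are joined through three
pairwise disjoint and anticomplete connected sets. See `thetaFree_iff`. -/
def NoTheta {V : Type*} (G : SimpleGraph V) : Prop :=
  ∀ (u w : V) (A : Fin 3 → Set V), u ≠ w → ¬ G.Adj u w → (∀ i, Conn G (A i)) →
    (∀ i, Att G u (A i)) → (∀ i, Att G w (A i)) → (∀ i j, i ≠ j → Anti G (A i) (A j)) → False

/-- `p 0, …, p n` is a chordless path of `G`. -/
def IsP {V : Type*} (G : SimpleGraph V) (p : ℕ → V) (n : ℕ) : Prop :=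
  ∀ i j, i < j → j ≤ n → p i ≠ p j ∧ (G.Adj (p i) (p j) ↔ j = i + 1)

/-- The vertices `p i, …, p j`. -/
def seg {V : Type*} (p : ℕ → V) (i j : ℕ) : Set V := {x | ∃ k, i ≤ k ∧ k ≤ j ∧ p k = x}

section
variable {V : Type*} {G : SimpleGraph V}

theorem Anti.symm {A B : Set V} (h : Anti G A B) : Anti G B A :=
  fun x hx y hy => ⟨fun e => (h y hy x hx).1 e.symm, fun e => (h y hy x hx).2 e.symm⟩

theorem NoTheta.elim (h : NoTheta G) (u w : V) (A B C : Set V) (huw : u ≠ w) (hn : ¬ G.Adj u w)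
    (cA : Conn G A) (cB : Conn G B) (cC : Conn G C) (uA : Att G u A) (uB : Att G u B)
    (uC : Att G u C) (wA : Att G w A) (wB : Att G w B) (wC : Att G w C)
    (AB : Anti G A B) (AC : Anti G A C) (BC : Anti G B C) : False := by
  refine h u w ![A, B, C] huw hn ?_ ?_ ?_ ?_
  · intro i; fin_cases i <;> assumption
  · intro i; fin_cases i <;> assumption
  · intro i; fin_cases i <;> assumption
  · intro i j hij
    fin_cases i <;> fin_cases j <;> first | exact absurd rfl hij | assumption | (apply Anti.symm; assumption)

theorem conn_singleton (x : V) : Conn G {x} := by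
  rintro B ⟨y, hy, hB⟩ _ z hz
  obtain rfl : y = x := hy
  obtain rfl : z = y := hz
  exact hB

theorem Conn.union {A B : Set V} (hA : Conn G A) (hB : Conn G B)
    (h : ∃ x ∈ A, ∃ y ∈ B, x = y ∨ G.Adj x y) : Conn G (A ∪ B) := by
  obtain ⟨x, hx, y, hy, hxy⟩ := h
  rintro C ⟨z, hz, hzC⟩ hC
  have key : x ∈ C ∨ y ∈ C := by
    rcases hz with hz | hz
    · exact Or.inl (hA C ⟨z, hz, hzC⟩
        (fun x hx hxC y hy hxy => hC x (Or.inl hx) hxC y (Or.inl hy) hxy) hx)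
    · exact Or.inr (hB C ⟨z, hz, hzC⟩
        (fun x hx hxC y hy hxy => hC x (Or.inr hx) hxC y (Or.inr hy) hxy) hy)
  have hx' : x ∈ C := by
    rcases key with h | h
    · exact h
    · rcases hxy with rfl | e
      · exact h
      · exact hC y (Or.inr hy) h x (Or.inl hx) e.symm
  have hy' : y ∈ C := by
    rcases key with h | h
    · rcases hxy with rfl | e
      · exact h
      · exact hC x (Or.inl hx) h y (Or.inr hy) e
    · exact h
  exact Set.union_subset
    (hA C ⟨x, hx, hx'⟩ (fun x hx hxC y hy hxy => hC x (Or.inl hx) hxC y (Or.inl hy) hxy))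
    (hB C ⟨y, hy, hy'⟩ (fun x hx hxC y hy hxy => hC x (Or.inr hx) hxC y (Or.inr hy) hxy))

/-- The vertices of a walk form a connected set. -/
theorem conn_seg_walk {p : ℕ → V} {i j : ℕ} (h : ∀ k, i ≤ k → k < j → G.Adj (p k) (p (k + 1))) :
    Conn G (seg p i j) := by
  rintro B ⟨x, ⟨k, hik, hkj, rfl⟩, hB⟩ hC
  have up : ∀ d, k + d ≤ j → p (k + d) ∈ B := by
    intro d
    induction d with
    | zero => intro _; exact hB
    | succ d ih =>
      intro hd
      exact hC _ ⟨k + d, by omega, by omega, rfl⟩ (ih (by omega)) _ ⟨k + d + 1, by omega, by omega, rfl⟩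
        (h (k + d) (by omega) (by omega))
  have down : ∀ d, i + d ≤ k → p (k - d) ∈ B := by
    intro d
    induction d with
    | zero => intro _; exact hB
    | succ d ih =>
      intro hd
      have e := h (k - (d + 1)) (by omega) (by omega)
      rw [show k - (d + 1) + 1 = k - d by omega] at e
      exact hC _ ⟨k - d, by omega, by omega, rfl⟩ (ih (by omega)) _ ⟨k - (d + 1), by omega, by omega, rfl⟩
        e.symm
  rintro _ ⟨l, hl, hlj, rfl⟩
  rcases le_total k l with hkl | hkl
  · have := up (l - k) (by omega)
    rwa [show k + (l - k) = l by omega] at this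
  · have := down (k - l) (by omega)
    rwa [show k - (k - l) = l by omega] at this

theorem IsP.adj_iff {p : ℕ → V} {n : ℕ} (h : IsP G p n) {i j : ℕ} (hi : i ≤ n) (hj : j ≤ n) :
    G.Adj (p i) (p j) ↔ j = i + 1 ∨ i = j + 1 := by
  rcases lt_trichotomy i j with hij | rfl | hij
  · rw [(h i j hij hj).2]; omega
  · simp
  · rw [G.adj_comm, (h j i hij hi).2]; omega

theorem IsP.inj {p : ℕ → V} {n : ℕ} (h : IsP G p n) {i j : ℕ} (hi : i ≤ n) (hj : j ≤ n) :
    p i = p j ↔ i = j := by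
  rcases lt_trichotomy i j with hij | rfl | hij
  · have := (h i j hij hj).1
    constructor
    · intro e; exact absurd e this
    · intro e; omega
  · simp
  · have := (h j i hij hi).1
    constructor
    · intro e; exact absurd e.symm this
    · intro e; omega

/-- Vertices of a chordless path that are neither equal nor consecutive. -/
theorem IsP.far {p : ℕ → V} {n : ℕ} (h : IsP G p n) {i j : ℕ} (hi : i ≤ n) (hj : j ≤ n)
    (hij : i + 2 ≤ j ∨ j + 2 ≤ i) : p i ≠ p j ∧ ¬ G.Adj (p i) (p j) := by
  rw [h.adj_iff hi hj, ne_eq, h.inj hi hj]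
  omega

theorem IsP.conn {p : ℕ → V} {n i j : ℕ} (h : IsP G p n) (hj : j ≤ n) : Conn G (seg p i j) :=
  conn_seg_walk fun _ _ hk => (h.adj_iff (by omega) (by omega)).2 (Or.inl rfl)

theorem IsP.sub {p : ℕ → V} {n : ℕ} (h : IsP G p n) {i l : ℕ} (hl : i + l ≤ n) :
    IsP G (fun k => p (i + k)) l := fun a b hab hb => by
  refine ⟨(h _ _ (by omega) (by omega)).1, ?_⟩
  rw [(h _ _ (by omega : i + a < i + b) (by omega)).2]; omega

theorem IsP.rev {p : ℕ → V} {n : ℕ} (h : IsP G p n) : IsP G (fun k => p (n - k)) n :=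
  fun a b hab hb => by
  refine ⟨fun e => (h _ _ (by omega : n - b < n - a) (by omega)).1 e.symm, ?_⟩
  dsimp only
  rw [h.adj_iff (by omega) (by omega)]; omega

/-- A connected set that meets `A` and `B` contains a chordless path from `A` to `B` that meets
`A` and `B` only at its ends. -/
theorem Conn.exists_path {D A B : Set V} (hD : Conn G D) (hA : ∃ x ∈ D, x ∈ A)
    (hB : ∃ x ∈ D, x ∈ B) :
    ∃ (p : ℕ → V) (n : ℕ), IsP G p n ∧ (∀ i ≤ n, p i ∈ D) ∧ p 0 ∈ A ∧ p n ∈ B ∧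
      (∀ i ≤ n, p i ∈ A → i = 0) ∧ (∀ i ≤ n, p i ∈ B → i = n) := by
  classical
  have ex : ∃ n, ∃ p : ℕ → V, (∀ i ≤ n, p i ∈ D) ∧ (∀ i < n, G.Adj (p i) (p (i + 1))) ∧
      p 0 ∈ A ∧ p n ∈ B := by
    obtain ⟨b, hbD, hbB⟩ := hB
    obtain ⟨a, haD, haA⟩ := hA
    let R : Set V := {y | ∃ n, ∃ p : ℕ → V, (∀ i ≤ n, p i ∈ D) ∧
      (∀ i < n, G.Adj (p i) (p (i + 1))) ∧ p 0 ∈ A ∧ p n = y}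
    have : b ∈ R := by
      have ha : a ∈ R := ⟨0, fun _ => a, fun _ _ => haD, fun _ h => absurd h (by omega), haA, rfl⟩
      refine hD R ⟨a, haD, ha⟩ ?_ hbD
      · rintro x hx ⟨n, p, hp, hpa, h0, rfl⟩ y hy hxy
        refine ⟨n + 1, fun k => if k ≤ n then p k else y, ?_, ?_, by simpa using h0, by simp⟩
        · intro i hi
          by_cases h : i ≤ n
          · simpa [h] using hp i h
          · simpa [h] using hy
        · intro i hi
          by_cases h : i + 1 ≤ n
          · simpa [h, show i ≤ n by omega] using hpa i (by omega)
          · obtain rfl : i = n := by omega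
            simpa using hxy
    obtain ⟨n, p, h1, h2, h3, h4⟩ := this
    exact ⟨n, p, h1, h2, h3, h4 ▸ hbB⟩
  obtain ⟨n, hn, hmin⟩ : ∃ n, (∃ p : ℕ → V, (∀ i ≤ n, p i ∈ D) ∧
      (∀ i < n, G.Adj (p i) (p (i + 1))) ∧ p 0 ∈ A ∧ p n ∈ B) ∧ ∀ m < n, ¬ ∃ p : ℕ → V,
      (∀ i ≤ m, p i ∈ D) ∧ (∀ i < m, G.Adj (p i) (p (i + 1))) ∧ p 0 ∈ A ∧ p m ∈ B :=
    ⟨Nat.find ex, Nat.find_spec ex, fun m hm => Nat.find_min ex hm⟩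
  obtain ⟨p, hpD, hpa, h0, hB'⟩ := hn
  -- replacing `p (i + 1), …, p (j - 1)` by nothing yields a shorter walk
  have cut : ∀ i d, 0 < d → i + d ≤ n → (i + d = n → p i ∈ B) →
      (i + d < n → G.Adj (p i) (p (i + d + 1))) → False := by
    intro i d hd hid hlast hadj
    refine hmin (n - d) (by omega) ⟨fun k => if k ≤ i then p k else p (k + d), ?_, ?_, by simpa, ?_⟩
    · intro k hk
      by_cases h : k ≤ i
      · simpa [h] using hpD k (by omega)
      · simpa [h] using hpD (k + d) (by omega)
    · intro k hk
      by_cases h : k + 1 ≤ i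
      · simpa [h, show k ≤ i by omega] using hpa k (by omega)
      · by_cases h' : k = i
        · subst h'
          simpa [show k + 1 + d = k + d + 1 by omega] using hadj (by omega)
        · simpa [h, show ¬ k ≤ i by omega, show k + 1 + d = k + d + 1 by omega]
            using hpa (k + d) (by omega)
    · by_cases h : n - d ≤ i
      · have : n - d = i := by omega
        simpa [this] using hlast (by omega)
      · simpa [h, show n - d + d = n by omega] using hB'
  refine ⟨p, n, ?_, hpD, h0, hB', ?_, ?_⟩
  · intro i j hij hj
    have key : p i ≠ p j := by
      intro e
      refine cut i (j - i) (by omega) (by omega) ?_ ?_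
      · intro h; rw [e, show j = n by omega]; exact hB'
      · intro h; rw [e, show i + (j - i) = j by omega]; exact hpa j (by omega)
    refine ⟨key, ?_, ?_⟩
    · intro e
      by_contra hne
      refine cut i (j - i - 1) (by omega) (by omega) ?_ ?_
      · intro h; omega
      · intro h; rwa [show i + (j - i - 1) + 1 = j by omega]
    · rintro rfl; exact hpa i (by omega)
  · intro i hi hA'
    by_contra hne
    refine hmin (n - i) (by omega) ⟨fun k => p (i + k), ?_, ?_, by simpa, ?_⟩
    · intro k hk; exact hpD _ (by omega)
    · intro k hk; exact hpa (i + k) (by omega)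
    · simpa [show i + (n - i) = n by omega] using hB'
  · intro i hi hBi
    by_contra hne
    exact hmin i (by omega) ⟨p, fun k hk => hpD k (by omega), fun k hk => hpa k (by omega), h0, hBi⟩

/-! ### Paths and holes as functions on the natural numbers -/

/-- `h 0, …, h (n - 1)` is, in this cyclic order, a chordless cycle of length `n ≥ 4`. -/
def IsHole {V : Type*} (G : SimpleGraph V) (h : ℕ → V) (n : ℕ) : Prop :=
  4 ≤ n ∧ ∀ i j, i < j → j < n →
    h i ≠ h j ∧ (G.Adj (h i) (h j) ↔ j = i + 1 ∨ (i = 0 ∧ j + 1 = n))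

/-- The vertex set of a hole. -/
def HoleSet {V : Type*} (G : SimpleGraph V) (H : Set V) : Prop :=
  ∃ (h : ℕ → V) (n : ℕ), IsHole G h n ∧ H = {x | ∃ k < n, h k = x}

/-- The vertex `x` has three distinct neighbours in `H`. -/
def Three {V : Type*} (G : SimpleGraph V) (x : V) (H : Set V) : Prop :=
  ∃ a ∈ H, ∃ b ∈ H, ∃ c ∈ H, a ≠ b ∧ a ≠ c ∧ b ≠ c ∧ G.Adj x a ∧ G.Adj x b ∧ G.Adj x c

/-- The vertex `x` has two distinct neighbours in `H`. -/
def Two {V : Type*} (G : SimpleGraph V) (x : V) (H : Set V) : Prop :=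
  ∃ a ∈ H, ∃ b ∈ H, a ≠ b ∧ G.Adj x a ∧ G.Adj x b

/-- The set form of `WacFree`. See `wacFree_iff`. -/
def NoWac {V : Type*} (G : SimpleGraph V) : Prop :=
  ∀ (H : Set V) (x y : V), HoleSet G H → x ∉ H → y ∉ H → G.Adj x y →
    Three G x H → Three G y H → False

theorem IsHole.adj_iff {h : ℕ → V} {n : ℕ} (hh : IsHole G h n) {i j : ℕ} (hi : i < n) (hj : j < n) :
    G.Adj (h i) (h j) ↔ j = i + 1 ∨ i = j + 1 ∨ (i = 0 ∧ j + 1 = n) ∨ (j = 0 ∧ i + 1 = n) := by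
  have h4 := hh.1
  rcases lt_trichotomy i j with hij | rfl | hij
  · rw [(hh.2 i j hij hj).2]; omega
  · simp; omega
  · rw [G.adj_comm, (hh.2 j i hij hi).2]; omega

theorem IsHole.inj {h : ℕ → V} {n : ℕ} (hh : IsHole G h n) {i j : ℕ} (hi : i < n) (hj : j < n) :
    h i = h j ↔ i = j := by
  rcases lt_trichotomy i j with hij | rfl | hij
  · have := (hh.2 i j hij hj).1
    constructor
    · intro e; exact absurd e this
    · intro e; omega
  · simp
  · have := (hh.2 j i hij hi).1
    constructor
    · intro e; exact absurd e.symm this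
    · intro e; omega

/-- A chordless path, as a function on the natural numbers, underlies an `ABPath`. -/
theorem IsP.exists_abPath {p : ℕ → V} {n : ℕ} (h : IsP G p n) :
    ∃ P : ABPath G (p 0) (p n), P.length = n ∧ P.verts = seg p 0 n := by
  refine ⟨⟨n, ⟨⟨fun i => p i, ?_⟩, ?_⟩, rfl, rfl⟩, rfl, ?_⟩
  · intro i j e
    exact Fin.ext ((h.inj (by omega) (by omega)).1 e)
  · intro i j
    change G.Adj (p i) (p j) ↔ _
    rw [h.adj_iff (by omega) (by omega), pathGraph_adj]
    omega
  · ext x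
    constructor
    · rintro ⟨i, rfl⟩
      exact ⟨i, by omega, Nat.le_of_lt_succ i.2, rfl⟩
    · rintro ⟨k, _, hk, rfl⟩
      exact ⟨⟨k, Nat.lt_succ_of_le hk⟩, rfl⟩

theorem ABPath.exists_isP {a b : V} (P : ABPath G a b) :
    ∃ p : ℕ → V, IsP G p P.length ∧ p 0 = a ∧ p P.length = b ∧ P.verts = seg p 0 P.length := by
  refine ⟨fun k => P.toEmb (Fin.ofNat _ k), ?_, ?_, ?_, ?_⟩
  · intro i j hij hj
    refine ⟨fun e => ?_, ?_⟩
    · have := P.toEmb.injective e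
      rw [Fin.ext_iff] at this
      simp [Nat.mod_eq_of_lt (show i < P.length + 1 by omega),
        Nat.mod_eq_of_lt (show j < P.length + 1 by omega)] at this
      omega
    · rw [P.toEmb.map_adj_iff, pathGraph_adj]
      simp [Nat.mod_eq_of_lt (show i < P.length + 1 by omega),
        Nat.mod_eq_of_lt (show j < P.length + 1 by omega)]
      omega
  · exact P.first_eq
  · refine Eq.trans ?_ P.last_eq
    exact congrArg _ (Fin.ext (by simp))
  · ext x
    constructor
    · rintro ⟨i, rfl⟩
      exact ⟨i, by omega, by omega, congrArg _ (Fin.ext (by simp))⟩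
    · rintro ⟨k, _, hk, rfl⟩
      exact ⟨_, rfl⟩

/-- The interior of a chordless path, in terms of indices. -/
theorem IsP.mem_interior {p : ℕ → V} {n : ℕ} (h : IsP G p n) {x : V} :
    (x ∈ seg p 0 n ∧ x ≠ p 0 ∧ x ≠ p n) ↔ ∃ k, 0 < k ∧ k < n ∧ p k = x := by
  constructor
  · rintro ⟨⟨k, _, hk, rfl⟩, h0, hn⟩
    exact ⟨k, Nat.pos_of_ne_zero fun e => h0 (by rw [e]), lt_of_le_of_ne hk fun e => hn (by rw [e]), rfl⟩
  · rintro ⟨k, h0, hn, rfl⟩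
    refine ⟨⟨k, by omega, by omega, rfl⟩, fun e => ?_, fun e => ?_⟩
    · rw [h.inj (by omega) (by omega)] at e; omega
    · rw [h.inj (by omega) (by omega)] at e; omega

end

/-! ### Thetas and wacs in terms of sets -/

section
variable {V : Type*} {G : SimpleGraph V}

/-- Adding an end at each side of a chordless path. -/
theorem IsP.extend {q : ℕ → V} {n : ℕ} (h : IsP G q n) {u w : V} (huw : u ≠ w)
    (hn : ¬ G.Adj u w) (hu : ∀ k ≤ n, u ≠ q k ∧ (G.Adj u (q k) ↔ k = 0))
    (hw : ∀ k ≤ n, w ≠ q k ∧ (G.Adj w (q k) ↔ k = n)) :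
    IsP G (fun k => if k = 0 then u else if k ≤ n + 1 then q (k - 1) else w) (n + 2) := by
  intro i j hij hj
  have hj0 : j ≠ 0 := by omega
  dsimp only
  rw [if_neg hj0]
  by_cases hi0 : i = 0
  · rw [if_pos hi0]
    by_cases hjn : j ≤ n + 1
    · rw [if_pos hjn, (hu (j - 1) (by omega)).2]
      exact ⟨(hu _ (by omega)).1, by omega⟩
    · rw [if_neg hjn]
      exact ⟨huw, iff_of_false hn (by omega)⟩
  · rw [if_neg hi0, if_pos (by omega)]
    by_cases hjn : j ≤ n + 1
    · rw [if_pos hjn, h.adj_iff (by omega) (by omega)]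
      exact ⟨(h _ _ (by omega) (by omega)).1, by omega⟩
    · rw [if_neg hjn, G.adj_comm, (hw (i - 1) (by omega)).2]
      exact ⟨(hw _ (by omega)).1.symm, by omega⟩

/-- Two nonadjacent vertices attached to a connected set are the ends of a chordless path through
that set. -/
theorem Conn.exists_link {A : Set V} (hA : Conn G A) {u w : V} (huw : u ≠ w) (hn : ¬ G.Adj u w)
    (hu : Att G u A) (hw : Att G w A) (huA : u ∉ A) (hwA : w ∉ A) :
    ∃ (p : ℕ → V) (n : ℕ), IsP G p n ∧ 2 ≤ n ∧ p 0 = u ∧ p n = w ∧ ∀ k, 0 < k → k < n → p k ∈ A := by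
  obtain ⟨q, n, hq, hqA, h0, hn', hA', hB'⟩ :=
    hA.exists_path (A := {x | G.Adj u x}) (B := {x | G.Adj w x}) hu hw
  refine ⟨_, n + 2, hq.extend huw hn (fun k hk => ⟨?_, hA' k hk, ?_⟩) (fun k hk => ⟨?_, hB' k hk, ?_⟩),
    by omega, by simp, by simp, ?_⟩
  · rintro rfl; exact huA (hqA k hk)
  · rintro rfl; exact h0
  · rintro rfl; exact hwA (hqA k hk)
  · rintro rfl; exact hn'
  · intro k h0 hk
    simpa [show k ≠ 0 by omega, show k ≤ n + 1 by omega] using hqA (k - 1) (by omega)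

theorem isP_induce {s : Set V} {p : ℕ → s} {n : ℕ} :
    IsP (G.induce s) p n ↔ IsP G (fun k => (p k : V)) n := by
  simp only [IsP, ne_eq, Subtype.ext_iff, comap_adj, Function.Embedding.subtype_apply]

/-- A graph has no induced theta if and only if no two nonadjacent vertices are joined through three
disjoint anticomplete connected sets: chordless paths through the sets form a theta. -/
theorem thetaFree_iff : ThetaFree G ↔ NoTheta G := by
  constructor
  · intro hT u w A huw hn hA hu hw hAA
    have huA : ∀ i, u ∉ A i := by
      intro i hi
      obtain ⟨j, hij⟩ : ∃ j, i ≠ j := ⟨i + 1, by fin_cases i <;> decide⟩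
      obtain ⟨x, hx, hux⟩ := hu j
      exact (hAA i j hij u hi x hx).2 hux
    have hwA : ∀ i, w ∉ A i := by
      intro i hi
      obtain ⟨j, hij⟩ : ∃ j, i ≠ j := ⟨i + 1, by fin_cases i <;> decide⟩
      obtain ⟨x, hx, hux⟩ := hw j
      exact (hAA i j hij w hi x hx).2 hux
    choose p n hp hn2 hp0 hpn hpA using fun i =>
      (hA i).exists_link huw hn (hu i) (hw i) (huA i) (hwA i)
    let s : Set V := {x | ∃ i, x ∈ seg (p i) 0 (n i)}
    have hus : u ∈ s := ⟨0, 0, le_rfl, by omega, hp0 0⟩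
    have hws : w ∈ s := ⟨0, n 0, by omega, le_rfl, hpn 0⟩
    have hps : ∀ i k, k ≤ n i → p i k ∈ s := fun i k hk => ⟨i, k, by omega, hk, rfl⟩
    let p' : Fin 3 → ℕ → s := fun i k => if hk : k ≤ n i then ⟨p i k, hps i k hk⟩ else ⟨u, hus⟩
    have hp'v : ∀ i k, k ≤ n i → (p' i k : V) = p i k := fun i k hk => by simp [p', hk]
    have hp' : ∀ i, IsP (G.induce s) (p' i) (n i) := by
      intro i
      rw [isP_induce]
      intro a b hab hb
      simp only [hp'v i a (by omega), hp'v i b hb]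
      exact hp i a b hab hb
    have h0 : ∀ i, p' i 0 = ⟨u, hus⟩ := fun i => Subtype.ext (by rw [hp'v i 0 (by omega), hp0])
    have hl : ∀ i, p' i (n i) = ⟨w, hws⟩ := fun i => Subtype.ext (by rw [hp'v i _ le_rfl, hpn])
    have hP : ∀ i, ∃ P : ABPath (G.induce s) ⟨u, hus⟩ ⟨w, hws⟩, P.length = n i ∧
        P.verts = seg (p' i) 0 (n i) := by
      intro i
      have := (hp' i).exists_abPath
      rwa [h0 i, hl i] at this
    choose P hPl hPv using hP
    have mem : ∀ i (x : s), x ∈ (P i).verts ↔ (x : V) ∈ seg (p i) 0 (n i) := by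
      intro i x
      rw [hPv]
      constructor
      · rintro ⟨k, h0, hk, rfl⟩
        exact ⟨k, h0, hk, (hp'v i k hk).symm⟩
      · rintro ⟨k, h0, hk, h⟩
        exact ⟨k, h0, hk, Subtype.ext ((hp'v i k hk).trans h)⟩
    have inA : ∀ i x, x ∈ seg (p i) 0 (n i) → x = u ∨ x = w ∨ x ∈ A i := by
      rintro i x ⟨k, _, hk, rfl⟩
      by_cases hk0 : k = 0
      · left; rw [hk0, hp0]
      by_cases hkn : k = n i
      · right; left; rw [hkn, hpn]
      · exact Or.inr (Or.inr (hpA i k (by omega) (by omega)))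
    have hu' : ∀ i, u ∈ seg (p i) 0 (n i) := fun i => ⟨0, le_rfl, by omega, hp0 i⟩
    have hw' : ∀ i, w ∈ seg (p i) 0 (n i) := fun i => ⟨n i, by omega, le_rfl, hpn i⟩
    refine hT s ⟨⟨u, hus⟩, ⟨w, hws⟩, P, fun i => by rw [hPl]; exact hn2 i, ?_, ?_, ?_⟩
    · intro i j hij
      ext x
      simp only [Set.mem_inter_iff, mem, Set.mem_insert_iff, Set.mem_singleton_iff, Subtype.ext_iff]
      constructor
      · rintro ⟨hi, hj⟩
        rcases inA i x hi with h | h | h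
        · exact Or.inl h
        · exact Or.inr h
        rcases inA j x hj with h' | h' | h'
        · exact Or.inl h'
        · exact Or.inr h'
        · exact absurd rfl (hAA i j hij _ h _ h').1
      · rintro (h | h) <;> rw [h]
        · exact ⟨hu' i, hu' j⟩
        · exact ⟨hw' i, hw' j⟩
    · rintro ⟨x, i, hx⟩
      exact ⟨i, (mem i _).2 hx⟩
    · rintro ⟨x, i, hx⟩ ⟨y, j, hy⟩ hxy
      change G.Adj x y at hxy
      simp only [mem]
      rcases inA i x hx with h | h | h
      · subst h; exact ⟨j, hu' j, hy⟩
      · subst h; exact ⟨j, hw' j, hy⟩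
      rcases inA j y hy with h' | h' | h'
      · subst h'; exact ⟨i, hx, hu' i⟩
      · subst h'; exact ⟨i, hx, hw' i⟩
      by_cases hij : i = j
      · subst hij; exact ⟨i, hx, hy⟩
      · exact absurd hxy (hAA i j hij _ h _ h').2
  · rintro hT s ⟨a, b, P, hl, hI, -, hE⟩
    choose p hp hp0 hpn hpv using fun i => (P i).exists_isP
    have hp' : ∀ i, IsP G (fun k => (p i k : V)) (P i).length := fun i => isP_induce.1 (hp i)
    have int : ∀ i k, 0 < k → k < (P i).length → p i k ∈ (P i).verts ∧ p i k ≠ a ∧ p i k ≠ b := by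
      intro i k h0 hk
      refine ⟨by rw [hpv]; exact ⟨k, by omega, by omega, rfl⟩, fun e => ?_, fun e => ?_⟩
      · rw [← hp0 i, (hp i).inj (by omega) (by omega)] at e; omega
      · rw [← hpn i, (hp i).inj (by omega) (by omega)] at e; omega
    have same : ∀ i j k, 0 < k → k < (P i).length → p i k ∈ (P j).verts → i = j := by
      intro i j k h0 hk hj
      by_contra hij
      obtain ⟨h1, h2, h3⟩ := int i k h0 hk
      have : p i k ∈ ({a, b} : Set s) := hI i j hij ▸ ⟨h1, hj⟩
      rcases this with h | h
      · exact h2 h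
      · exact h3 h
    refine hT a b (fun i => seg (fun k => (p i k : V)) 1 ((P i).length - 1)) ?_ ?_ ?_ ?_ ?_ ?_
    · have := ((hp 0).inj (Nat.zero_le _) le_rfl).not.2 (by have := hl 0; omega)
      rw [hp0, hpn] at this
      exact fun e => this (Subtype.ext e)
    · have := ((hp 0).adj_iff (Nat.zero_le _) le_rfl).not.2 (by have := hl 0; omega)
      rwa [hp0, hpn] at this
    · intro i
      exact (hp' i).conn (by omega)
    · intro i
      have := hl i
      refine ⟨_, ⟨1, le_rfl, by omega, rfl⟩, ?_⟩
      have := ((hp i).adj_iff (Nat.zero_le _) (by omega : 1 ≤ _)).2 (Or.inl rfl)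
      rwa [hp0] at this
    · intro i
      have := hl i
      refine ⟨_, ⟨(P i).length - 1, by omega, le_rfl, rfl⟩, ?_⟩
      have := ((hp i).adj_iff le_rfl (by omega : (P i).length - 1 ≤ _)).2 (Or.inr (by omega))
      rwa [hpn] at this
    · rintro i j hij _ ⟨k, hk1, hk2, rfl⟩ _ ⟨l, hl1, hl2, rfl⟩
      have hli := hl i
      have hlj := hl j
      refine ⟨fun e => ?_, fun e => ?_⟩
      · have e' : p i k = p j l := Subtype.ext e
        exact hij (same i j k (by omega) (by omega) (e' ▸ (int j l (by omega) (by omega)).1))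
      · obtain ⟨r, hr1, hr2⟩ := hE _ _ e
        exact hij ((same i r k (by omega) (by omega) hr1).trans
          (same j r l (by omega) (by omega) hr2).symm)

theorem Hole.isHole (C : Hole G) : IsHole G (fun k => C.c (Fin.ofNat _ k)) (C.m + 4) ∧
    Set.range C.c = {x | ∃ k < C.m + 4, C.c (Fin.ofNat _ k) = x} := by
  refine ⟨⟨by omega, fun i j hij hj => ⟨fun e => ?_, ?_⟩⟩, ?_⟩
  · have := congrArg Fin.val (C.c.injective e)
    simp [Nat.mod_eq_of_lt hj, Nat.mod_eq_of_lt (hij.trans hj)] at this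
    omega
  · rw [C.c.map_adj_iff, cycleGraph_adj']
    have h1 : (Fin.ofNat (C.m + 4) i) < Fin.ofNat (C.m + 4) j := by
      rw [Fin.lt_def]; simpa [Nat.mod_eq_of_lt hj, Nat.mod_eq_of_lt (hij.trans hj)]
    rw [Fin.coe_sub_iff_lt.2 h1, Fin.coe_sub_iff_le.2 h1.le]
    simp [Nat.mod_eq_of_lt hj, Nat.mod_eq_of_lt (hij.trans hj)]
    omega
  · ext x
    constructor
    · rintro ⟨i, rfl⟩
      exact ⟨i, i.2, congrArg _ (Fin.ext (by simp))⟩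
    · rintro ⟨k, _, rfl⟩
      exact ⟨_, rfl⟩

theorem IsHole.exists_hole {h : ℕ → V} {n : ℕ} (hh : IsHole G h n) :
    ∃ C : Hole G, C.m + 4 = n ∧ ∀ i, C.c i = h i := by
  obtain ⟨m, rfl⟩ : ∃ m, n = m + 4 := ⟨n - 4, by have := hh.1; omega⟩
  refine ⟨⟨m, ⟨⟨fun i => h i, ?_⟩, ?_⟩⟩, rfl, fun i => rfl⟩
  · intro i j e
    exact Fin.ext ((hh.inj i.2 j.2).1 e)
  · intro i j
    change G.Adj (h i) (h j) ↔ _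
    rw [hh.adj_iff i.2 j.2, cycleGraph_adj']
    rcases lt_trichotomy i j with hij | rfl | hij
    · rw [Fin.coe_sub_iff_lt.2 hij, Fin.coe_sub_iff_le.2 hij.le]
      rw [Fin.lt_def] at hij
      omega
    · have : ((i - i : Fin (m + 4)) : ℕ) = 0 := by simp
      omega
    · rw [Fin.coe_sub_iff_lt.2 hij, Fin.coe_sub_iff_le.2 hij.le]
      rw [Fin.lt_def] at hij
      omega

theorem Hole.three_iff (C : Hole G) {x : V} :
    3 ≤ {i | G.Adj x (C.c i)}.ncard ↔ Three G x (Set.range C.c) := by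
  rw [show (3 ≤ {i | G.Adj x (C.c i)}.ncard) ↔ 2 < {i | G.Adj x (C.c i)}.ncard from Iff.rfl,
    Set.two_lt_ncard_iff (Set.toFinite _)]
  constructor
  · rintro ⟨a, b, c, ha, hb, hc, hab, hac, hbc⟩
    exact ⟨_, ⟨a, rfl⟩, _, ⟨b, rfl⟩, _, ⟨c, rfl⟩, C.c.injective.ne hab, C.c.injective.ne hac,
      C.c.injective.ne hbc, ha, hb, hc⟩
  · rintro ⟨_, ⟨a, rfl⟩, _, ⟨b, rfl⟩, _, ⟨c, rfl⟩, hab, hac, hbc, ha, hb, hc⟩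
    exact ⟨a, b, c, ha, hb, hc, fun e => hab (e ▸ rfl), fun e => hac (e ▸ rfl), fun e => hbc (e ▸ rfl)⟩

theorem Hole.holeSet (C : Hole G) : HoleSet G (Set.range C.c) := ⟨_, _, C.isHole⟩

theorem HoleSet.exists_hole {H : Set V} (h : HoleSet G H) : ∃ C : Hole G, Set.range C.c = H := by
  obtain ⟨h, n, hh, rfl⟩ := h
  obtain ⟨C, rfl, hC⟩ := hh.exists_hole
  refine ⟨C, ?_⟩
  ext x
  constructor
  · rintro ⟨i, rfl⟩; exact ⟨i, i.2, (hC i).symm⟩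
  · rintro ⟨k, hk, rfl⟩; exact ⟨⟨k, hk⟩, hC _⟩

theorem wacFree_iff : WacFree G ↔ NoWac G := by
  constructor
  · rintro hW H x y hH hxH hyH hxy hx hy
    obtain ⟨C, rfl⟩ := hH.exists_hole
    let s : Set V := {z | z ∈ Set.range C.c ∨ z = x ∨ z = y}
    let c' : cycleGraph (C.m + 4) ↪g G.induce s :=
      ⟨⟨fun i => ⟨C.c i, Or.inl ⟨i, rfl⟩⟩, fun i j e => C.c.injective (congrArg Subtype.val e)⟩,
        C.c.map_rel_iff'⟩
    refine hW s ⟨⟨C.m, c'⟩, ⟨x, Or.inr (Or.inl rfl)⟩, ⟨y, Or.inr (Or.inr rfl)⟩, ?_, ?_, hxy, ?_, ?_, ?_⟩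
    · rintro ⟨i, hi⟩; exact hxH ⟨i, congrArg Subtype.val hi⟩
    · rintro ⟨i, hi⟩; exact hyH ⟨i, congrArg Subtype.val hi⟩
    · exact C.three_iff.2 hx
    · exact C.three_iff.2 hy
    · rintro ⟨z, ⟨i, rfl⟩ | rfl | rfl⟩
      · exact Or.inl ⟨i, rfl⟩
      · exact Or.inr (Or.inl rfl)
      · exact Or.inr (Or.inr rfl)
  · rintro hW s ⟨C, x, y, hx, hy, hxy, hx3, hy3, -⟩
    let C' : Hole G := ⟨C.m, C.c.trans (Embedding.induce s)⟩
    refine hW (Set.range C'.c) x y C'.holeSet ?_ ?_ hxy (C'.three_iff.1 hx3) (C'.three_iff.1 hy3)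
    · rintro ⟨i, hi⟩; exact hx ⟨i, Subtype.ext hi⟩
    · rintro ⟨i, hi⟩; exact hy ⟨i, Subtype.ext hi⟩

end

/-! ### Holes as unions of two paths -/

/-- The graph is theta-free, triangle-free and wac-free, in set form. See `free_iff`. -/
structure Free {V : Type*} (G : SimpleGraph V) : Prop where
  theta : NoTheta G
  tri : ∀ x y z, G.Adj x y → G.Adj x z → ¬ G.Adj y z
  wac : NoWac G

/-- Two chordless paths `s 0, …, s m` and `t 0, …, t n` with common ends that form a hole. -/
structure TwoPaths {V : Type*} (G : SimpleGraph V) (s : ℕ → V) (m : ℕ) (t : ℕ → V) (n : ℕ) :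
    Prop where
  hm : 2 ≤ m
  hn : 2 ≤ n
  hs : IsP G s m
  ht : IsP G t n
  first : s 0 = t 0
  last : s m = t n
  anti : ∀ i j, 0 < i → i < m → 0 < j → j < n → s i ≠ t j ∧ ¬ G.Adj (s i) (t j)

section
variable {V : Type*} {G : SimpleGraph V}

theorem free_iff : (ThetaFree G ∧ G.CliqueFree 3 ∧ WacFree G) ↔ Free G := by
  rw [thetaFree_iff, wacFree_iff]
  constructor
  · rintro ⟨h1, h2, h3⟩
    refine ⟨h1, fun x y z hxy hxz hyz => ?_, h3⟩
    classical
    exact h2 {x, y, z} (is3Clique_triple_iff.2 ⟨hxy, hxz, hyz⟩)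
  · rintro ⟨h1, h2, h3⟩
    refine ⟨h1, fun S hS => ?_, h3⟩
    classical
    obtain ⟨x, y, z, hxy, hxz, hyz, -⟩ := is3Clique_iff.1 hS
    exact h2 x y z hxy hxz hyz

theorem seg_mem {p : ℕ → V} {i j k : ℕ} (h1 : i ≤ k) (h2 : k ≤ j) : p k ∈ seg p i j :=
  ⟨k, h1, h2, rfl⟩

theorem seg_rev {p : ℕ → V} {n i j : ℕ} (hij : i ≤ j) (hj : j ≤ n) :
    seg (fun k => p (n - k)) (n - j) (n - i) = seg p i j := by
  ext x
  constructor
  · rintro ⟨k, h1, h2, rfl⟩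
    exact ⟨n - k, by omega, by omega, rfl⟩
  · rintro ⟨k, h1, h2, rfl⟩
    exact ⟨n - k, by omega, by omega, congrArg p (by omega)⟩

namespace TwoPaths
variable {s t : ℕ → V} {m n : ℕ}

theorem swap (h : TwoPaths G s m t n) : TwoPaths G t n s m :=
  ⟨h.hn, h.hm, h.ht, h.hs, h.first.symm, h.last.symm, fun i j hi hi' hj hj' =>
    ⟨(h.anti j i hj hj' hi hi').1.symm, fun e => (h.anti j i hj hj' hi hi').2 e.symm⟩⟩

theorem rev (h : TwoPaths G s m t n) :
    TwoPaths G (fun k => s (m - k)) m (fun k => t (n - k)) n :=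
  ⟨h.hm, h.hn, h.hs.rev, h.ht.rev, h.last, by simpa using h.first, fun i j hi hi' hj hj' =>
    h.anti _ _ (by omega) (by omega) (by omega) (by omega)⟩

theorem adj (h : TwoPaths G s m t n) {i j : ℕ} (hi : i ≤ m) (hj : j ≤ n)
    (e : G.Adj (s i) (t j)) :
    (i = 0 ∧ j = 1) ∨ (i = 1 ∧ j = 0) ∨ (i = m ∧ j + 1 = n) ∨ (i + 1 = m ∧ j = n) := by
  have hm := h.hm
  have hn := h.hn
  by_cases hi0 : i = 0
  · subst hi0; rw [h.first, h.ht.adj_iff (by omega) hj] at e; omega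
  by_cases him : i = m
  · subst him; rw [h.last, h.ht.adj_iff (by omega) hj] at e; omega
  by_cases hj0 : j = 0
  · subst hj0; rw [← h.first, h.hs.adj_iff (by omega) (by omega)] at e; omega
  by_cases hjn : j = n
  · subst hjn; rw [← h.last, h.hs.adj_iff (by omega) (by omega)] at e; omega
  · exact absurd e (h.anti i j (by omega) (by omega) (by omega) (by omega)).2

theorem eq (h : TwoPaths G s m t n) {i j : ℕ} (hi : i ≤ m) (hj : j ≤ n)
    (e : s i = t j) : (i = 0 ∧ j = 0) ∨ (i = m ∧ j = n) := by
  have hm := h.hm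
  have hn := h.hn
  by_cases hi0 : i = 0
  · subst hi0; rw [h.first, h.ht.inj (by omega) hj] at e; omega
  by_cases him : i = m
  · subst him; rw [h.last, h.ht.inj (by omega) hj] at e; omega
  by_cases hj0 : j = 0
  · subst hj0; rw [← h.first, h.hs.inj (by omega) (by omega)] at e; omega
  by_cases hjn : j = n
  · subst hjn; rw [← h.last, h.hs.inj (by omega) (by omega)] at e; omega
  · exact absurd e (h.anti i j (by omega) (by omega) (by omega) (by omega)).1

theorem far (h : TwoPaths G s m t n) {i j : ℕ} (hi : i ≤ m) (hj : j ≤ n)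
    (h0 : 2 ≤ i + j) (hl : i + j + 2 ≤ m + n) : s i ≠ t j ∧ ¬ G.Adj (s i) (t j) := by
  constructor
  · intro e
    have := h.eq hi hj e
    omega
  · intro e
    have := h.adj hi hj e
    omega

theorem isHole (h : TwoPaths G s m t n) :
    IsHole G (fun k => if k ≤ m then s k else t (m + n - k)) (m + n) := by
  have hm := h.hm
  have hn := h.hn
  refine ⟨by omega, fun i j hij hj => ?_⟩
  dsimp only
  by_cases hjm : j ≤ m
  · rw [if_pos hjm, if_pos (by omega), h.hs.adj_iff (by omega) hjm]
    exact ⟨(h.hs _ _ hij hjm).1, by omega⟩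
  · rw [if_neg hjm]
    by_cases him : i ≤ m
    · rw [if_pos him]
      refine ⟨fun e => ?_, fun e => ?_, fun e => ?_⟩
      · have := h.eq him (by omega) e; omega
      · have := h.adj him (by omega) e; omega
      · rcases e with e | ⟨e, e'⟩
        · rw [show i = m by omega, h.last, h.ht.adj_iff (by omega) (by omega)]; omega
        · rw [e, h.first, h.ht.adj_iff (by omega) (by omega)]; omega
    · rw [if_neg him, h.ht.adj_iff (by omega) (by omega), ne_eq, h.ht.inj (by omega) (by omega)]
      omega

theorem holeSet (h : TwoPaths G s m t n) : HoleSet G (seg s 0 m ∪ seg t 0 n) := by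
  have hm := h.hm
  have hn := h.hn
  refine ⟨_, _, h.isHole, ?_⟩
  ext x
  constructor
  · rintro (⟨k, _, hk, rfl⟩ | ⟨k, _, hk, rfl⟩)
    · exact ⟨k, by omega, by simp [hk]⟩
    · by_cases hk0 : k = 0
      · subst hk0; exact ⟨0, by omega, by simp [h.first]⟩
      by_cases hkn : k = n
      · subst hkn; exact ⟨m, by omega, by simp [h.last]⟩
      · exact ⟨m + n - k, by omega, by
          rw [if_neg (by omega)]; congr 1; omega⟩
  · rintro ⟨k, hk, rfl⟩
    by_cases hkm : k ≤ m
    · left; exact ⟨k, by omega, by omega, by simp [hkm]⟩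
    · right; exact ⟨m + n - k, by omega, by omega, by simp [hkm]⟩

end TwoPaths

/-- A chordless path together with a vertex adjacent exactly to its ends forms a hole. -/
theorem IsP.holeSet {s : ℕ → V} {m : ℕ} (hs : IsP G s m) (hm : 2 ≤ m) {v : V}
    (hv : ∀ i ≤ m, v ≠ s i ∧ (G.Adj v (s i) ↔ i = 0 ∨ i = m)) :
    HoleSet G (insert v (seg s 0 m)) := by
  have hT : TwoPaths G s m (fun k => if k = 0 then s 0 else if k = 1 then v else s m) 2 := by
    refine ⟨hm, le_rfl, hs, ?_, rfl, rfl, ?_⟩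
    · intro i j hij hj
      obtain ⟨rfl, rfl⟩ | ⟨rfl, rfl⟩ | ⟨rfl, rfl⟩ :
        (i = 0 ∧ j = 1) ∨ (i = 1 ∧ j = 2) ∨ (i = 0 ∧ j = 2) := by omega
      · have := hv 0 (by omega)
        simpa [G.adj_comm, eq_comm] using this
      · have := hv m (by omega)
        simpa [G.adj_comm, eq_comm] using this
      · simp only [if_true, if_neg (show ¬ (2 = 0) by omega), if_neg (show ¬ (2 = 1) by omega)]
        rw [ne_eq, hs.inj (by omega) le_rfl, hs.adj_iff (by omega) le_rfl]
        omega
    · intro i j hi hi' hj hj'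
      obtain rfl : j = 1 := by omega
      have := hv i (by omega)
      simp only [if_true, if_neg (show ¬ (1 = 0) by omega)]
      rw [G.adj_comm, this.2]
      exact ⟨this.1.symm, by omega⟩
  convert hT.holeSet using 1
  ext x
  constructor
  · rintro (rfl | h)
    · right; exact ⟨1, by omega, by omega, by simp⟩
    · left; exact h
  · rintro (h | ⟨k, _, hk, rfl⟩)
    · exact Or.inr h
    · dsimp only
      split_ifs
      · exact Or.inr (seg_mem (by omega) (by omega))
      · exact Or.inl rfl
      · exact Or.inr (seg_mem (by omega) (by omega))

theorem IsHole.rotate {h : ℕ → V} {n : ℕ} (hh : IsHole G h n) {r : ℕ} (hr : r < n) :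
    IsHole G (fun k => if k + r < n then h (k + r) else h (k + r - n)) n ∧
      {x | ∃ k < n, h k = x} =
        {x | ∃ k < n, (fun k => if k + r < n then h (k + r) else h (k + r - n)) k = x} := by
  have h4 := hh.1
  refine ⟨⟨h4, fun i j hij hj => ?_⟩, ?_⟩
  · dsimp only
    split_ifs <;> rw [hh.adj_iff (by omega) (by omega), ne_eq, hh.inj (by omega) (by omega)] <;> omega
  · ext x
    constructor
    · rintro ⟨k, hk, rfl⟩
      by_cases hkr : r ≤ k
      · exact ⟨k - r, by omega, by simp [show k - r + r = k by omega, hk]⟩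
      · refine ⟨k + n - r, by omega, ?_⟩
        dsimp only
        rw [if_neg (by omega)]; congr 1; omega
    · rintro ⟨k, hk, rfl⟩
      dsimp only
      split_ifs
      · exact ⟨_, by assumption, rfl⟩
      · exact ⟨_, by omega, rfl⟩

theorem HoleSet.exists_first {H : Set V} (hH : HoleSet G H) {w : V} (hw : w ∈ H) :
    ∃ (h : ℕ → V) (n : ℕ), IsHole G h n ∧ h 0 = w ∧ H = {x | ∃ k < n, h k = x} := by
  obtain ⟨h, n, hh, rfl⟩ := hH
  obtain ⟨r, hr, rfl⟩ := hw
  exact ⟨_, n, (hh.rotate hr).1, by simp [hr], (hh.rotate hr).2⟩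

/-- Two nonadjacent vertices of a hole split it into two paths. -/
theorem IsHole.twoPaths {h : ℕ → V} {n r : ℕ} (hh : IsHole G h n) (h2 : 2 ≤ r) (hr : r + 2 ≤ n) :
    TwoPaths G h r (fun k => if k = 0 then h 0 else h (n - k)) (n - r) ∧
      {x | ∃ k < n, h k = x} =
        seg h 0 r ∪ seg (fun k => if k = 0 then h 0 else h (n - k)) 0 (n - r) := by
  refine ⟨⟨h2, by omega, fun i j hij hj => ?_, fun i j hij hj => ?_, rfl, ?_, ?_⟩, ?_⟩
  · rw [hh.adj_iff (by omega) (by omega), ne_eq, hh.inj (by omega) (by omega)]; omega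
  · split_ifs
    · omega
    · rw [hh.adj_iff (by omega) (by omega), ne_eq, hh.inj (by omega) (by omega)]; omega
    · omega
    · rw [hh.adj_iff (by omega) (by omega), ne_eq, hh.inj (by omega) (by omega)]; omega
  · rw [if_neg (by omega)]; congr 1; omega
  · intro i j hi hi' hj hj'
    rw [if_neg (by omega), hh.adj_iff (by omega) (by omega), ne_eq, hh.inj (by omega) (by omega)]
    omega
  · ext x
    constructor
    · rintro ⟨k, hk, rfl⟩
      by_cases hkr : k ≤ r
      · exact Or.inl ⟨k, by omega, hkr, rfl⟩
      · refine Or.inr ⟨n - k, by omega, by omega, ?_⟩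
        dsimp only
        rw [if_neg (by omega)]; congr 1; omega
    · rintro (⟨k, _, hk, rfl⟩ | ⟨k, _, hk, rfl⟩)
      · exact ⟨k, by omega, rfl⟩
      · dsimp only
        split_ifs
        · exact ⟨0, by omega, rfl⟩
        · exact ⟨_, by omega, rfl⟩

/-- Two distinct nonadjacent vertices of a hole split it into two paths. -/
theorem HoleSet.exists_twoPaths {H : Set V} (hH : HoleSet G H) {a b : V} (ha : a ∈ H) (hb : b ∈ H)
    (hab : a ≠ b) (hn : ¬ G.Adj a b) :
    ∃ s m t n, TwoPaths G s m t n ∧ s 0 = a ∧ s m = b ∧ H = seg s 0 m ∪ seg t 0 n := by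
  obtain ⟨h, n, hh, rfl, rfl⟩ := hH.exists_first ha
  obtain ⟨r, hr, rfl⟩ := hb
  have h4 := hh.1
  rw [ne_eq, hh.inj (by omega) hr] at hab
  rw [hh.adj_iff (by omega) hr] at hn
  obtain ⟨h1, h2⟩ := hh.twoPaths (r := r) (by omega) (by omega)
  exact ⟨_, _, _, _, h1, rfl, rfl, h2⟩

theorem TwoPaths.ne_ends {s t : ℕ → V} {m n : ℕ} (h : TwoPaths G s m t n) :
    s 0 ≠ s m ∧ ¬ G.Adj (s 0) (s m) := by
  have := h.hm
  rw [h.hs.adj_iff (by omega) le_rfl, ne_eq, h.hs.inj (by omega) le_rfl]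
  omega

/-- The two open sides of a two-path hole attach to both ends, so a third connected set that does so
and sends no edges to the sides yields a theta. -/
theorem TwoPaths.theta {s t : ℕ → V} {m n : ℕ} (h : TwoPaths G s m t n) (F : NoTheta G) {A : Set V}
    (hA : Conn G A) (h0 : Att G (s 0) A) (hl : Att G (s m) A)
    (hs : Anti G (seg s 1 (m - 1)) A) (ht : Anti G (seg t 1 (n - 1)) A) : False := by
  have hm := h.hm
  have hn := h.hn
  refine F.elim (s 0) (s m) (seg s 1 (m - 1)) (seg t 1 (n - 1)) A h.ne_ends.1 h.ne_ends.2
    (h.hs.conn (by omega)) (h.ht.conn (by omega)) hA ?_ ?_ h0 ?_ ?_ hl ?_ hs ht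
  · exact ⟨s 1, seg_mem (by omega) (by omega), (h.hs.adj_iff (by omega) (by omega)).2 (by omega)⟩
  · exact ⟨t 1, seg_mem (by omega) (by omega), by
      rw [h.first]; exact (h.ht.adj_iff (by omega) (by omega)).2 (by omega)⟩
  · exact ⟨s (m - 1), seg_mem (by omega) (by omega),
      (h.hs.adj_iff (by omega) (by omega)).2 (by omega)⟩
  · exact ⟨t (n - 1), seg_mem (by omega) (by omega), by
      rw [h.last]; exact (h.ht.adj_iff (by omega) (by omega)).2 (by omega)⟩
  · rintro _ ⟨i, hi, hi', rfl⟩ _ ⟨j, hj, hj', rfl⟩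
    exact h.anti i j (by omega) (by omega) (by omega) (by omega)

/-- In a theta-free and triangle-free graph a vertex with two neighbours on a hole has three. -/
theorem Free.three (F : Free G) {H : Set V} (hH : HoleSet G H) {x : V} (hx : x ∉ H)
    (h2 : Two G x H) : Three G x H := by
  obtain ⟨a, ha, b, hb, hab, hxa, hxb⟩ := h2
  by_contra hcon
  have h3 : ∀ c ∈ H, G.Adj x c → c = a ∨ c = b := by
    intro c hc hxc
    by_contra hne
    rw [not_or] at hne
    exact hcon ⟨a, ha, b, hb, c, hc, hab, fun e => hne.1 e.symm, fun e => hne.2 e.symm, hxa, hxb, hxc⟩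
  obtain ⟨s, m, t, n, hT, rfl, rfl, rfl⟩ := hH.exists_twoPaths ha hb hab (F.tri x a b hxa hxb)
  have hm := hT.hm
  have hn := hT.hn
  refine hT.theta F.theta (conn_singleton x) ⟨x, rfl, hxa.symm⟩ ⟨x, rfl, hxb.symm⟩ ?_ ?_
  · rintro _ ⟨i, hi, hi', rfl⟩ y rfl
    have hmem : s i ∈ seg s 0 m ∪ seg t 0 n := Or.inl (seg_mem (by omega) (by omega))
    refine ⟨fun e => hx (e ▸ hmem), fun e => ?_⟩
    rcases h3 _ hmem e.symm with e | e
    · rw [hT.hs.inj (by omega) (by omega)] at e; omega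
    · rw [hT.hs.inj (by omega) (by omega)] at e; omega
  · rintro _ ⟨i, hi, hi', rfl⟩ y rfl
    have hmem : t i ∈ seg s 0 m ∪ seg t 0 n := Or.inr (seg_mem (by omega) (by omega))
    refine ⟨fun e => hx (e ▸ hmem), fun e => ?_⟩
    rcases h3 _ hmem e.symm with e | e
    · have := hT.eq (by omega) (by omega) e.symm; omega
    · have := hT.eq (by omega) (by omega) e.symm; omega

/-- Two adjacent vertices outside a hole do not both have two neighbours in it. -/
theorem Free.wac_two (F : Free G) {H : Set V} (hH : HoleSet G H) {x y : V} (hx : x ∉ H) (hy : y ∉ H)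
    (hxy : G.Adj x y) (h2x : Two G x H) (h2y : Two G y H) : False :=
  F.wac H x y hH hx hy hxy (F.three hH hx h2x) (F.three hH hy h2y)

end

/-! ### Wheels -/

/-- A hole made of two paths `s` and `t` with common ends, and a vertex `v` outside it adjacent to
the ends but to no internal vertex of `s`. By `Free.three` the hole and `v` form a wheel with
sector `s`; equally, `v` and `s` form a hole for which `t` is a petal centred at `v`. -/
structure Wheel {V : Type*} (G : SimpleGraph V) (s : ℕ → V) (m : ℕ) (t : ℕ → V) (n : ℕ) (v : V) :
    Prop extends TwoPaths G s m t n where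
  va : G.Adj v (s 0)
  vb : G.Adj v (s m)
  vs : ∀ i, 0 < i → i < m → ¬ G.Adj v (s i)
  ns : ∀ i ≤ m, v ≠ s i
  nt : ∀ i ≤ n, v ≠ t i

section
variable {V : Type*} {G : SimpleGraph V}

theorem anti_union_left {A B C : Set V} (h1 : Anti G A C) (h2 : Anti G B C) : Anti G (A ∪ B) C := by
  rintro x (hx | hx)
  · exact h1 x hx
  · exact h2 x hx

theorem anti_union_right {A B C : Set V} (h1 : Anti G C A) (h2 : Anti G C B) :
    Anti G C (A ∪ B) := by
  rintro x hx y (hy | hy)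
  · exact h1 x hx y hy
  · exact h2 x hx y hy

theorem anti_seg_seg {p q : ℕ → V} {a b c d : ℕ}
    (h : ∀ i j, a ≤ i → i ≤ b → c ≤ j → j ≤ d → p i ≠ q j ∧ ¬ G.Adj (p i) (q j)) :
    Anti G (seg p a b) (seg q c d) := by
  rintro _ ⟨i, h1, h2, rfl⟩ _ ⟨j, h3, h4, rfl⟩
  exact h i j h1 h2 h3 h4

theorem anti_single_seg {x : V} {q : ℕ → V} {c d : ℕ}
    (h : ∀ j, c ≤ j → j ≤ d → x ≠ q j ∧ ¬ G.Adj x (q j)) : Anti G {x} (seg q c d) := by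
  rintro _ rfl _ ⟨j, h3, h4, rfl⟩
  exact h j h3 h4

theorem anti_seg_single {x : V} {q : ℕ → V} {c d : ℕ}
    (h : ∀ j, c ≤ j → j ≤ d → x ≠ q j ∧ ¬ G.Adj x (q j)) : Anti G (seg q c d) {x} :=
  (anti_single_seg h).symm

theorem anti_single_single {x y : V} (h : x ≠ y ∧ ¬ G.Adj x y) : Anti G {x} {y} := by
  rintro _ rfl _ rfl
  exact h

theorem att_seg {u : V} {p : ℕ → V} {i j : ℕ} (k : ℕ) (h1 : i ≤ k) (h2 : k ≤ j)
    (h : G.Adj u (p k)) : Att G u (seg p i j) := ⟨_, seg_mem h1 h2, h⟩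

theorem att_single {u x : V} (h : G.Adj u x) : Att G u {x} := ⟨x, rfl, h⟩

theorem Att.left {u : V} {A B : Set V} (h : Att G u A) : Att G u (A ∪ B) :=
  let ⟨x, hx, e⟩ := h; ⟨x, Or.inl hx, e⟩

theorem Att.right {u : V} {A B : Set V} (h : Att G u B) : Att G u (A ∪ B) :=
  let ⟨x, hx, e⟩ := h; ⟨x, Or.inr hx, e⟩

theorem Conn.insert_seg {x : V} {p : ℕ → V} {i j : ℕ} (h : Conn G (seg p i j)) (k : ℕ) (h1 : i ≤ k)
    (h2 : k ≤ j) (e : G.Adj x (p k)) : Conn G ({x} ∪ seg p i j) :=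
  (conn_singleton x).union h ⟨x, rfl, _, seg_mem h1 h2, Or.inr e⟩

/-- The least and the greatest index of a neighbour. -/
theorem exists_min_max {P : ℕ → Prop} {a b : ℕ} (h : ∃ k, a ≤ k ∧ k ≤ b ∧ P k) :
    ∃ i j, a ≤ i ∧ i ≤ j ∧ j ≤ b ∧ P i ∧ P j ∧ ∀ k, a ≤ k → k ≤ b → P k → i ≤ k ∧ k ≤ j := by
  classical
  let S := (Finset.Icc a b).filter P
  obtain ⟨k, hk1, hk2, hk⟩ := h
  have hS : S.Nonempty := ⟨k, by simp [S, *]⟩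
  have h1 := S.min'_mem hS
  have h2 := S.max'_mem hS
  simp only [S, Finset.mem_filter, Finset.mem_Icc] at h1 h2
  refine ⟨S.min' hS, S.max' hS, h1.1.1, S.min'_le_max' hS, h2.1.2, h1.2, h2.2, fun l hl hl' hP => ?_⟩
  have : l ∈ S := by simp [S, *]
  exact ⟨S.min'_le _ this, S.le_max' _ this⟩

theorem seg_union_rev (s : ℕ → V) (m : ℕ) (t : ℕ → V) (n : ℕ) :
    seg (fun k => s (m - k)) 0 m ∪ seg (fun k => t (n - k)) 0 n = seg s 0 m ∪ seg t 0 n := by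
  have h1 := seg_rev (p := s) (Nat.zero_le m) le_rfl
  have h2 := seg_rev (p := t) (Nat.zero_le n) le_rfl
  simp only [Nat.sub_self, Nat.sub_zero] at h1 h2
  rw [h1, h2]

namespace Wheel
variable {s t : ℕ → V} {m n : ℕ} {v : V}

theorem rev (h : Wheel G s m t n v) :
    Wheel G (fun k => s (m - k)) m (fun k => t (n - k)) n v :=
  ⟨h.toTwoPaths.rev, h.vb, by simpa using h.va, fun i hi hi' => h.vs _ (by omega) (by omega),
    fun i _ => h.ns _ (by omega), fun i _ => h.nt _ (by omega)⟩

theorem vs_iff (h : Wheel G s m t n v) {i : ℕ} (hi : i ≤ m) : G.Adj v (s i) ↔ i = 0 ∨ i = m := by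
  constructor
  · intro e
    by_contra hne
    exact h.vs i (by omega) (by omega) e
  · rintro (rfl | rfl)
    · exact h.va
    · exact h.vb

theorem v_far (h : Wheel G s m t n v) {i : ℕ} (h0 : 0 < i) (hi : i < m) :
    v ≠ s i ∧ ¬ G.Adj v (s i) := ⟨h.ns i hi.le, h.vs i h0 hi⟩

theorem v_notMem (h : Wheel G s m t n v) : v ∉ seg s 0 m ∪ seg t 0 n := by
  rintro (⟨k, _, hk, e⟩ | ⟨k, _, hk, e⟩)
  · exact h.ns k hk e.symm
  · exact h.nt k hk e.symm

theorem two_v (h : Wheel G s m t n v) : Two G v (seg s 0 m ∪ seg t 0 n) :=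
  ⟨s 0, Or.inl (seg_mem le_rfl (by omega)), s m, Or.inl (seg_mem (by omega) le_rfl),
    h.ne_ends.1, h.va, h.vb⟩

theorem holeSet_sector (h : Wheel G s m t n v) : HoleSet G (insert v (seg s 0 m)) :=
  h.hs.holeSet h.hm fun i hi => ⟨h.ns i hi, h.vs_iff hi⟩

/-- The centre has a neighbour in the interior of the path `t`. -/
theorem exists_vt (h : Wheel G s m t n v) (F : Free G) : ∃ j, 0 < j ∧ j < n ∧ G.Adj v (t j) := by
  have hm := h.hm
  have hn := h.hn
  by_contra hcon
  push Not at hcon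
  refine h.theta F.theta (conn_singleton v) (att_single h.va.symm) (att_single h.vb.symm)
    (anti_seg_single fun j h1 h2 => ⟨h.ns j (by omega), h.vs j (by omega) (by omega)⟩)
    (anti_seg_single fun j h1 h2 => ⟨h.nt j (by omega), hcon j (by omega) (by omega)⟩)

/-- Outside the hole, a neighbour of the centre of a wheel has no neighbour on the hole. -/
theorem no_adj_of_adj_v (h : Wheel G s m t n v) (F : Free G) {u : V}
    (hu : u ∉ seg s 0 m ∪ seg t 0 n) (huv : G.Adj u v) {z : V} (hz : z ∈ seg s 0 m ∪ seg t 0 n) :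
    ¬ G.Adj u z := by
  intro huz
  have hne : ¬ Two G u (seg s 0 m ∪ seg t 0 n) := fun h2 =>
    F.wac_two h.holeSet hu h.v_notMem huv h2 h.two_v
  have hvz : ¬ G.Adj v z := fun e => F.tri u v z huv huz e
  -- a chordless path of the hole whose ends are neighbours of `v`, its interior containing `z`
  have key : ∀ (p : ℕ → V) (l k : ℕ), IsP G p l → 2 ≤ l → k ≤ l → p k = z →
      (∀ i ≤ l, v ≠ p i ∧ (G.Adj v (p i) ↔ i = 0 ∨ i = l)) →
      seg p 0 l ⊆ seg s 0 m ∪ seg t 0 n → False := by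
    intro p l k hp hl hk hpk hv hsub
    have hu' : u ∉ insert v (seg p 0 l) := by
      rintro (e | e)
      · exact huv.ne e
      · exact hu (hsub e)
    have hzm : z ∈ seg p 0 l := ⟨k, by omega, hk, hpk⟩
    obtain ⟨a, ha, b, hb, c, hc, hab, hac, hbc, hua, hub, huc⟩ := F.three (hp.holeSet hl hv) hu'
      ⟨v, Or.inl rfl, z, Or.inr hzm, fun e => h.v_notMem (e ▸ hz), huv, huz⟩
    rcases ha with ha | ha
    · subst ha
      rcases hb with hb | hb
      · exact hab hb.symm
      rcases hc with hc | hc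
      · exact hac hc.symm
      exact hne ⟨b, hsub hb, c, hsub hc, hbc, hub, huc⟩
    rcases hb with hb | hb
    · rcases hc with hc | hc
      · exact hbc (hb.trans hc.symm)
      exact hne ⟨a, hsub ha, c, hsub hc, hac, hua, huc⟩
    · exact hne ⟨a, hsub ha, b, hsub hb, hab, hua, hub⟩
  rcases hz with ⟨k, _, hk, rfl⟩ | ⟨k, _, hk, rfl⟩
  · exact key s m k h.hs h.hm hk rfl (fun i hi => ⟨h.ns i hi, h.vs_iff hi⟩) Set.subset_union_left
  · have hn := h.hn
    obtain ⟨_, i, _, _, hik, _, hvi, hi⟩ := exists_min_max (P := fun j => G.Adj v (t j)) (a := 0)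
      (b := k) ⟨0, by omega, by omega, by rw [← h.first]; exact h.va⟩
    obtain ⟨j, j', hkj, hjj, hjn, hvj, _, hj⟩ := exists_min_max (P := fun j => G.Adj v (t j)) (a := k)
      (b := n) ⟨n, by omega, by omega, by rw [← h.last]; exact h.vb⟩
    have hik' : i ≠ k := fun e => hvz (e ▸ hvi)
    have hjk' : j ≠ k := fun e => hvz (e ▸ hvj)
    refine key (fun l => t (i + l)) (j - i) (k - i) (h.ht.sub (by omega)) (by omega) (by omega)
      (congrArg t (by omega)) (fun l hl => ⟨h.nt _ (by omega), ?_⟩) ?_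
    · constructor
      · intro e
        by_cases hlk : i + l ≤ k
        · have := (hi (i + l) (by omega) hlk e).2; omega
        · have := (hj (i + l) (by omega) (by omega) e).1; omega
      · rintro (rfl | rfl)
        · exact hvi
        · rw [show i + (j - i) = j by omega]; exact hvj
    · rintro _ ⟨l, _, hl, rfl⟩
      exact Or.inr (seg_mem (by omega) (by omega))

end Wheel
end

/-! ### A second vertex attached to a wheel -/

section
variable {V : Type*} {G : SimpleGraph V} {s t : ℕ → V} {m n : ℕ} {v : V}

theorem ne_nadj_symm {x y : V} (h : x ≠ y ∧ ¬ G.Adj x y) : y ≠ x ∧ ¬ G.Adj y x :=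
  ⟨h.1.symm, fun e => h.2 e.symm⟩

/-- A vertex outside a wheel with two neighbours in the path `s` is not adjacent to `t 1`. -/
theorem Wheel.no_two_one (h : Wheel G s m t n v) (F : Free G) {p : V}
    (hp : p ∉ seg s 0 m ∪ seg t 0 n) {i j : ℕ} (hij : i < j) (hj : j ≤ m)
    (hi : G.Adj p (s i)) (hj' : G.Adj p (s j)) : ¬ G.Adj p (t 1) := by
  intro hk
  have hm := h.hm
  have hn := h.hn
  obtain ⟨l, hl0, hln, hl⟩ := h.exists_vt F
  have hps : ∀ i, i ≤ m → s i ≠ p := fun i hi e => hp (Or.inl (e ▸ seg_mem (Nat.zero_le _) hi))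
  have hat1 : G.Adj (s 0) (t 1) := by
    rw [h.first]; exact (h.ht.adj_iff (by omega) (by omega)).2 (Or.inl rfl)
  have hpa : ¬ G.Adj (s 0) p := fun e => F.tri _ _ _ e.symm hk hat1
  have hi0 : i ≠ 0 := by rintro rfl; exact hpa hi.symm
  have hvt1 : ¬ G.Adj v (t 1) := fun e => F.tri _ _ _ e h.va hat1.symm
  have hl1 : l ≠ 1 := by rintro rfl; exact hvt1 hl
  have hj1 : i + 1 ≠ j := by
    rintro rfl
    exact F.tri _ _ _ hi hj' ((h.hs.adj_iff (by omega) (by omega)).2 (Or.inl rfl))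
  exact F.theta.elim (s 0) p (seg s 1 i) {t 1} ({v} ∪ seg s j m) (hps 0 (by omega)) hpa
    (h.hs.conn (by omega)) (conn_singleton _)
    ((h.hs.conn le_rfl).insert_seg m hj le_rfl h.vb)
    (att_seg 1 (by omega) (by omega) ((h.hs.adj_iff (by omega) (by omega)).2 (Or.inl rfl)))
    (att_single hat1) (att_single h.va.symm).left
    (att_seg i (by omega) (by omega) hi) (att_single hk) (att_seg j le_rfl hj hj').right
    (anti_seg_single fun k _ _ => ne_nadj_symm (h.far (by omega) (by omega) (by omega) (by omega)))
    (anti_union_right (anti_seg_single fun k _ _ => h.v_far (by omega) (by omega))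
      (anti_seg_seg fun k l _ _ _ _ => h.hs.far (by omega) (by omega) (by omega)))
    (anti_union_right (anti_single_single (ne_nadj_symm ⟨h.nt 1 (by omega), hvt1⟩))
      (anti_single_seg fun k _ _ => ne_nadj_symm
        (h.far (by omega) (by omega) (by omega) (by omega))))

/-- A vertex outside a wheel with two neighbours in the path `s` has none inside `t`. -/
theorem Wheel.no_two (h : Wheel G s m t n v) (F : Free G) {p : V}
    (hp : p ∉ seg s 0 m ∪ seg t 0 n) (hpv : v ≠ p) {i j : ℕ} (hij : i < j) (hj : j ≤ m)
    (hi : G.Adj p (s i)) (hj' : G.Adj p (s j)) {k : ℕ} (hk0 : 0 < k) (hkn : k < n) :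
    ¬ G.Adj p (t k) := by
  intro hk
  have hpv' : ¬ G.Adj v p := fun e =>
    h.no_adj_of_adj_v F hp e.symm (Or.inl (seg_mem (by omega) hj)) hj'
  have h1 : k ≠ 1 := by
    rintro rfl
    exact h.no_two_one F hp hij hj hi hj' hk
  have hn1 : k ≠ n - 1 := by
    rintro rfl
    refine h.rev.no_two_one F (p := p) (i := m - j) (j := m - i) ?_ (by omega) (by omega) ?_ ?_ hk
    · rwa [seg_union_rev]
    · rwa [show m - (m - j) = j by omega]
    · rwa [show m - (m - i) = i by omega]
  have hm := h.hm
  have hn := h.hn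
  obtain ⟨l, hl0, hln, hl⟩ := h.exists_vt F
  have hl1 : l ≠ 1 := by
    rintro rfl
    refine F.tri _ _ _ hl h.va ?_
    rw [h.first, h.ht.adj_iff (by omega) (by omega)]; omega
  have hl2 : l ≠ n - 1 := by
    rintro rfl
    refine F.tri _ _ _ hl h.vb ?_
    rw [h.last, h.ht.adj_iff (by omega) (by omega)]; omega
  have hj1 : i + 1 ≠ j := by
    rintro rfl
    exact F.tri _ _ _ hi hj' ((h.hs.adj_iff (by omega) (by omega)).2 (Or.inl rfl))
  exact F.theta.elim v p (seg s 0 i) (seg s j m) (seg t (min k l) (max k l)) hpv hpv'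
    (h.hs.conn (by omega)) (h.hs.conn (by omega)) (h.ht.conn (by omega))
    (att_seg 0 (by omega) (by omega) h.va) (att_seg m (by omega) (by omega) h.vb)
    (att_seg l (by omega) (by omega) hl)
    (att_seg i (by omega) (by omega) hi) (att_seg j (by omega) (by omega) hj')
    (att_seg k (by omega) (by omega) hk)
    (anti_seg_seg fun _ _ _ _ _ _ => h.hs.far (by omega) (by omega) (by omega))
    (anti_seg_seg fun _ _ _ _ _ _ => h.far (by omega) (by omega) (by omega) (by omega))
    (anti_seg_seg fun _ _ _ _ _ _ => h.far (by omega) (by omega) (by omega) (by omega))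

/-- A wheel with a second vertex `p` that has exactly one neighbour in the path `s`, inside it;
`t j₁`, `t j₂` are the extreme neighbours of `p` inside `t` and `t l₁`, `t l₂` those of `v`. -/
structure Crossing (G : SimpleGraph V) (s : ℕ → V) (m : ℕ) (t : ℕ → V) (n : ℕ) (v p : V)
    (i₀ j₁ j₂ l₁ l₂ : ℕ) : Prop extends Wheel G s m t n v where
  hp : p ∉ seg s 0 m ∪ seg t 0 n
  hvp : v ≠ p ∧ ¬ G.Adj v p
  i₀_pos : 0 < i₀
  i₀_lt : i₀ < m
  ps : G.Adj p (s i₀)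
  ps' : ∀ i ≤ m, G.Adj p (s i) → i = i₀
  pj₁ : G.Adj p (t j₁)
  pj₂ : G.Adj p (t j₂)
  j_lt : j₁ < j₂
  pt : ∀ j ≤ n, G.Adj p (t j) → j₁ ≤ j ∧ j ≤ j₂
  j₁_pos : 0 < j₁
  j₂_lt : j₂ < n
  vl₁ : G.Adj v (t l₁)
  vl₂ : G.Adj v (t l₂)
  l_le : l₁ ≤ l₂
  vt : ∀ l, 0 < l → l < n → G.Adj v (t l) → l₁ ≤ l ∧ l ≤ l₂
  l₁_pos : 0 < l₁
  l₂_lt : l₂ < n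

namespace Crossing
variable {p : V} {i₀ j₁ j₂ l₁ l₂ : ℕ}

theorem rev (h : Crossing G s m t n v p i₀ j₁ j₂ l₁ l₂) :
    Crossing G (fun k => s (m - k)) m (fun k => t (n - k)) n v p (m - i₀) (n - j₂) (n - j₁)
      (n - l₂) (n - l₁) := by
  have := h.i₀_pos
  have := h.i₀_lt
  have := h.j_lt
  have := h.j₁_pos
  have := h.j₂_lt
  have := h.l_le
  have := h.l₁_pos
  have := h.l₂_lt
  refine ⟨h.toWheel.rev, by rw [seg_union_rev]; exact h.hp, h.hvp, by omega, by omega, ?_, ?_, ?_,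
    ?_, by omega, ?_, by omega, by omega, ?_, ?_, by omega, ?_, by omega, by omega⟩
  · rw [show m - (m - i₀) = i₀ by omega]; exact h.ps
  · intro i hi e; have := h.ps' _ (by omega) e; omega
  · rw [show n - (n - j₂) = j₂ by omega]; exact h.pj₂
  · rw [show n - (n - j₁) = j₁ by omega]; exact h.pj₁
  · intro i hi e; have := h.pt _ (by omega) e; omega
  · rw [show n - (n - l₂) = l₂ by omega]; exact h.vl₂
  · rw [show n - (n - l₁) = l₁ by omega]; exact h.vl₁
  · intro i hi hi' e; have := h.vt _ (by omega) (by omega) e; omega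

theorem p_s (h : Crossing G s m t n v p i₀ j₁ j₂ l₁ l₂) {i : ℕ} (hi : i ≤ m) (hne : i ≠ i₀) :
    s i ≠ p ∧ ¬ G.Adj (s i) p :=
  ⟨fun e => h.hp (e ▸ Or.inl (seg_mem (Nat.zero_le _) hi)), fun e => hne (h.ps' i hi e.symm)⟩

theorem v_t (h : Crossing G s m t n v p i₀ j₁ j₂ l₁ l₂) {l : ℕ} (h0 : 0 < l) (hl : l < n)
    (hne : l < l₁ ∨ l₂ < l) : t l ≠ v ∧ ¬ G.Adj (t l) v :=
  ⟨(h.nt l hl.le).symm, fun e => by have := h.vt l h0 hl e.symm; omega⟩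

theorem s_succ (h : Crossing G s m t n v p i₀ j₁ j₂ l₁ l₂) {i j : ℕ} (hi : i ≤ m) (hj : j ≤ m)
    (e : j = i + 1 ∨ i = j + 1) : G.Adj (s i) (s j) := (h.hs.adj_iff hi hj).2 e

theorem t_gap (h : Crossing G s m t n v p i₀ j₁ j₂ l₁ l₂) (F : Free G) {x : V} {i j : ℕ} (hij : i < j)
    (hj : j ≤ n) (hi : G.Adj x (t i)) (hj' : G.Adj x (t j)) : i + 2 ≤ j := by
  by_contra hlt
  exact F.tri _ _ _ hi hj' ((h.ht.adj_iff (by omega) hj).2 (by omega))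

theorem two_le_l₁ (h : Crossing G s m t n v p i₀ j₁ j₂ l₁ l₂) (F : Free G) : 2 ≤ l₁ := by
  have := h.t_gap F (x := v) (i := 0) h.l₁_pos (by have := h.l_le; have := h.l₂_lt; omega)
    (by rw [← h.first]; exact h.va) h.vl₁
  omega

theorem j₁_lt_l₁ (h : Crossing G s m t n v p i₀ j₁ j₂ l₁ l₂) (F : Free G) : j₁ < l₁ := by
  have h1 := h.i₀_pos
  have h2 := h.i₀_lt
  have h3 := h.j_lt
  have h4 := h.j₁_pos
  have h5 := h.j₂_lt
  have h6 := h.two_le_l₁ F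
  have h7 := h.t_gap F h.j_lt h.j₂_lt.le h.pj₁ h.pj₂
  by_contra hlt
  by_cases hi : i₀ + 1 = m
  · exact F.theta.elim (s i₀) v (seg s 0 (i₀ - 1)) {s m} ({p} ∪ seg t l₁ j₁)
      (h.ns _ (by omega)).symm (fun e => h.vs i₀ (by omega) (by omega) e.symm)
      (h.hs.conn (by omega)) (conn_singleton _)
      ((h.ht.conn (by omega)).insert_seg j₁ (by omega) (by omega) h.pj₁)
      (att_seg (i₀ - 1) (by omega) (by omega) (h.s_succ (by omega) (by omega) (by omega)))
      (att_single (h.s_succ (by omega) (by omega) (by omega))) (att_single h.ps.symm).left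
      (att_seg 0 (by omega) (by omega) h.va) (att_single h.vb)
      (att_seg l₁ (by omega) (by omega) h.vl₁).right
      (anti_seg_single fun _ _ _ => h.hs.far (by omega) (by omega) (by omega))
      (anti_union_right (anti_seg_single fun _ _ _ => ne_nadj_symm (h.p_s (by omega) (by omega)))
        (anti_seg_seg fun _ _ _ _ _ _ => h.far (by omega) (by omega) (by omega) (by omega)))
      (anti_union_right (anti_single_single (h.p_s (by omega) (by omega)))
        (anti_single_seg fun _ _ _ => h.far (by omega) (by omega) (by omega) (by omega)))
  · exact F.theta.elim v p (seg s 0 i₀) (seg t l₁ j₁) (seg t j₂ n) h.hvp.1 h.hvp.2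
      (h.hs.conn (by omega)) (h.ht.conn (by omega)) (h.ht.conn (by omega))
      (att_seg 0 (by omega) (by omega) h.va) (att_seg l₁ (by omega) (by omega) h.vl₁)
      (att_seg n (by omega) (by omega) (h.last ▸ h.vb))
      (att_seg i₀ (by omega) (by omega) h.ps) (att_seg j₁ (by omega) (by omega) h.pj₁)
      (att_seg j₂ (by omega) (by omega) h.pj₂)
      (anti_seg_seg fun _ _ _ _ _ _ => h.far (by omega) (by omega) (by omega) (by omega))
      (anti_seg_seg fun _ _ _ _ _ _ => h.far (by omega) (by omega) (by omega) (by omega))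
      (anti_seg_seg fun _ _ _ _ _ _ => h.ht.far (by omega) (by omega) (by omega))

theorem l₂_lt_j₂ (h : Crossing G s m t n v p i₀ j₁ j₂ l₁ l₂) (F : Free G) : l₂ < j₂ := by
  have := h.rev.j₁_lt_l₁ F
  omega

theorem p_l₁ (h : Crossing G s m t n v p i₀ j₁ j₂ l₁ l₂) (F : Free G) : ¬ G.Adj p (t l₁) := by
  intro hz
  have h1 := h.i₀_pos
  have h2 := h.i₀_lt
  have h4 := h.j₁_pos
  have h5 := h.j₂_lt
  have h6 := h.j₁_lt_l₁ F
  have h6' := h.l_le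
  have h6'' := h.l₂_lt_j₂ F
  have h7 := h.t_gap F h6 (by omega) h.pj₁ hz
  have h8 := h.t_gap F (by omega) (by omega) hz h.pj₂
  by_cases hi : i₀ + 1 = m
  · by_cases hi' : i₀ = 1
    · exact F.theta.elim (s 0) p {s 1} (seg t 1 j₁) ({v} ∪ {t l₁})
        (h.p_s (by omega) (by omega)).1 (h.p_s (by omega) (by omega)).2
        (conn_singleton _) (h.ht.conn (by omega))
        ((conn_singleton _).union (conn_singleton _) ⟨v, rfl, _, rfl, Or.inr h.vl₁⟩)
        (att_single (h.s_succ (by omega) (by omega) (by omega)))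
        (att_seg 1 (by omega) (by omega)
          (by rw [h.first]; exact (h.ht.adj_iff (by omega) (by omega)).2 (by omega)))
        (att_single h.va.symm).left
        (att_single (hi' ▸ h.ps)) (att_seg j₁ (by omega) (by omega) h.pj₁) (att_single hz).right
        (anti_single_seg fun _ _ _ => h.far (by omega) (by omega) (by omega) (by omega))
        (anti_union_right (anti_single_single (ne_nadj_symm (h.v_far (by omega) (by omega))))
          (anti_single_single (h.far (by omega) (by omega) (by omega) (by omega))))
        (anti_union_right
          (anti_seg_single fun _ _ _ => ne_nadj_symm (h.v_t (by omega) (by omega) (by omega)))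
          (anti_seg_single fun _ _ _ => h.ht.far (by omega) (by omega) (by omega)))
    · exact F.theta.elim v p (seg s i₀ m) (seg t 0 j₁) {t l₁} h.hvp.1 h.hvp.2
        (h.hs.conn (by omega)) (h.ht.conn (by omega)) (conn_singleton _)
        (att_seg m (by omega) (by omega) h.vb) (att_seg 0 (by omega) (by omega) (h.first ▸ h.va))
        (att_single h.vl₁)
        (att_seg i₀ (by omega) (by omega) h.ps) (att_seg j₁ (by omega) (by omega) h.pj₁)
        (att_single hz)
        (anti_seg_seg fun _ _ _ _ _ _ => h.far (by omega) (by omega) (by omega) (by omega))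
        (anti_seg_single fun _ _ _ => ne_nadj_symm
          (h.far (by omega) (by omega) (by omega) (by omega)))
        (anti_seg_single fun _ _ _ => h.ht.far (by omega) (by omega) (by omega))
  · exact F.theta.elim v p (seg s 0 i₀) (seg t j₂ n) {t l₁} h.hvp.1 h.hvp.2
      (h.hs.conn (by omega)) (h.ht.conn (by omega)) (conn_singleton _)
      (att_seg 0 (by omega) (by omega) h.va) (att_seg n (by omega) (by omega) (h.last ▸ h.vb))
      (att_single h.vl₁)
      (att_seg i₀ (by omega) (by omega) h.ps) (att_seg j₂ (by omega) (by omega) h.pj₂)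
      (att_single hz)
      (anti_seg_seg fun _ _ _ _ _ _ => h.far (by omega) (by omega) (by omega) (by omega))
      (anti_seg_single fun _ _ _ => ne_nadj_symm
        (h.far (by omega) (by omega) (by omega) (by omega)))
      (anti_seg_single fun _ _ _ => h.ht.far (by omega) (by omega) (by omega))

theorem j₁_eq (h : Crossing G s m t n v p i₀ j₁ j₂ l₁ l₂) (F : Free G) : j₁ = 1 := by
  have h1 := h.i₀_pos
  have h2 := h.i₀_lt
  have h4 := h.j₁_pos
  have h5 := h.j₂_lt
  have h6 := h.j₁_lt_l₁ F
  have h6' := h.l_le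
  have h6'' := h.l₂_lt_j₂ F
  by_contra hj
  by_cases hi : i₀ + 1 = m
  · exact F.theta.elim (s i₀) v (seg s 0 (i₀ - 1)) {s m} ({p} ∪ seg t j₁ l₁)
      (h.ns _ (by omega)).symm (fun e => h.vs i₀ (by omega) (by omega) e.symm)
      (h.hs.conn (by omega)) (conn_singleton _)
      ((h.ht.conn (by omega)).insert_seg j₁ (by omega) (by omega) h.pj₁)
      (att_seg (i₀ - 1) (by omega) (by omega) (h.s_succ (by omega) (by omega) (by omega)))
      (att_single (h.s_succ (by omega) (by omega) (by omega))) (att_single h.ps.symm).left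
      (att_seg 0 (by omega) (by omega) h.va) (att_single h.vb)
      (att_seg l₁ (by omega) (by omega) h.vl₁).right
      (anti_seg_single fun _ _ _ => h.hs.far (by omega) (by omega) (by omega))
      (anti_union_right (anti_seg_single fun _ _ _ => ne_nadj_symm (h.p_s (by omega) (by omega)))
        (anti_seg_seg fun _ _ _ _ _ _ => h.far (by omega) (by omega) (by omega) (by omega)))
      (anti_union_right (anti_single_single (h.p_s (by omega) (by omega)))
        (anti_single_seg fun _ _ _ => h.far (by omega) (by omega) (by omega) (by omega)))
  · by_cases hj2 : j₂ = l₁ + 1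
    · exact F.theta.elim p (t l₁) {t j₂} (seg t j₁ (l₁ - 1)) ({v} ∪ seg s 0 i₀)
        (fun e => h.hp (Or.inr (e ▸ seg_mem (Nat.zero_le _) (by omega)))) (h.p_l₁ F)
        (conn_singleton _) (h.ht.conn (by omega))
        ((h.hs.conn (by omega)).insert_seg 0 (by omega) (by omega) h.va)
        (att_single h.pj₂) (att_seg j₁ (by omega) (by omega) h.pj₁)
        (att_seg i₀ (by omega) (by omega) h.ps).right
        (att_single ((h.ht.adj_iff (by omega) (by omega)).2 (by omega)))
        (att_seg (l₁ - 1) (by omega) (by omega) ((h.ht.adj_iff (by omega) (by omega)).2 (by omega)))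
        (att_single h.vl₁.symm).left
        (anti_single_seg fun _ _ _ => h.ht.far (by omega) (by omega) (by omega))
        (anti_union_right (anti_single_single (h.v_t (by omega) (by omega) (by omega)))
          (anti_single_seg fun _ _ _ => ne_nadj_symm
            (h.far (by omega) (by omega) (by omega) (by omega))))
        (anti_union_right
          (anti_seg_single fun _ _ _ => ne_nadj_symm (h.v_t (by omega) (by omega) (by omega)))
          (anti_seg_seg fun _ _ _ _ _ _ => ne_nadj_symm
            (h.far (by omega) (by omega) (by omega) (by omega))))
    · exact F.theta.elim v p (seg s 0 i₀) (seg t j₁ l₁) (seg t j₂ n) h.hvp.1 h.hvp.2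
        (h.hs.conn (by omega)) (h.ht.conn (by omega)) (h.ht.conn (by omega))
        (att_seg 0 (by omega) (by omega) h.va) (att_seg l₁ (by omega) (by omega) h.vl₁)
        (att_seg n (by omega) (by omega) (h.last ▸ h.vb))
        (att_seg i₀ (by omega) (by omega) h.ps) (att_seg j₁ (by omega) (by omega) h.pj₁)
        (att_seg j₂ (by omega) (by omega) h.pj₂)
        (anti_seg_seg fun _ _ _ _ _ _ => h.far (by omega) (by omega) (by omega) (by omega))
        (anti_seg_seg fun _ _ _ _ _ _ => h.far (by omega) (by omega) (by omega) (by omega))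
        (anti_seg_seg fun _ _ _ _ _ _ => h.ht.far (by omega) (by omega) (by omega))

theorem j₂_eq (h : Crossing G s m t n v p i₀ j₁ j₂ l₁ l₂) (F : Free G) : j₂ + 1 = n := by
  have := h.rev.j₁_eq F
  omega

theorem i₀_eq (h : Crossing G s m t n v p i₀ j₁ j₂ l₁ l₂) (F : Free G) : i₀ = 1 := by
  have h1 := h.i₀_pos
  have h2 := h.i₀_lt
  have h4 := h.j₁_eq F
  have h5 := h.j₂_eq F
  have h6 := h.j₁_lt_l₁ F
  have h6' := h.l_le
  have h6'' := h.l₂_lt_j₂ F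
  by_contra hi
  exact F.theta.elim (s m) p {t j₂} (seg s i₀ (m - 1)) ({v} ∪ seg t 0 j₁)
    (h.p_s (by omega) (by omega)).1 (h.p_s (by omega) (by omega)).2
    (conn_singleton _) (h.hs.conn (by omega))
    ((h.ht.conn (by omega)).insert_seg 0 (by omega) (by omega) (h.first ▸ h.va))
    (att_single (by rw [h.last]; exact (h.ht.adj_iff (by omega) (by omega)).2 (by omega)))
    (att_seg (m - 1) (by omega) (by omega) (h.s_succ (by omega) (by omega) (by omega)))
    (att_single h.vb.symm).left
    (att_single h.pj₂) (att_seg i₀ (by omega) (by omega) h.ps)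
    (att_seg j₁ (by omega) (by omega) h.pj₁).right
    (anti_single_seg fun _ _ _ => ne_nadj_symm (h.far (by omega) (by omega) (by omega) (by omega)))
    (anti_union_right (anti_single_single (h.v_t (by omega) (by omega) (by omega)))
      (anti_single_seg fun _ _ _ => h.ht.far (by omega) (by omega) (by omega)))
    (anti_union_right (anti_seg_single fun _ _ _ => h.v_far (by omega) (by omega))
      (anti_seg_seg fun _ _ _ _ _ _ => h.far (by omega) (by omega) (by omega) (by omega)))

theorem l₂_le (h : Crossing G s m t n v p i₀ j₁ j₂ l₁ l₂) (F : Free G) : l₂ ≤ 2 := by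
  have h1 := h.i₀_eq F
  have h2 := h.rev.i₀_eq F
  have h4 := h.j₁_eq F
  have h5 := h.j₂_eq F
  have h6 := h.j₁_lt_l₁ F
  have h6' := h.l_le
  have h6'' := h.l₂_lt_j₂ F
  by_contra hl
  exact F.theta.elim (s 0) p {s 1} {t 1} ({v} ∪ seg t l₂ j₂)
    (h.p_s (by omega) (by omega)).1 (h.p_s (by omega) (by omega)).2
    (conn_singleton _) (conn_singleton _)
    ((h.ht.conn (by omega)).insert_seg l₂ (by omega) (by omega) h.vl₂)
    (att_single (h.s_succ (by omega) (by omega) (by omega)))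
    (att_single (by rw [h.first]; exact (h.ht.adj_iff (by omega) (by omega)).2 (by omega)))
    (att_single h.va.symm).left
    (att_single (h1 ▸ h.ps)) (att_single (h4 ▸ h.pj₁)) (att_seg j₂ (by omega) (by omega) h.pj₂).right
    (anti_single_single (h.far (by omega) (by omega) (by omega) (by omega)))
    (anti_union_right (anti_single_single (ne_nadj_symm (h.v_far (by omega) (by omega))))
      (anti_single_seg fun _ _ _ => h.far (by omega) (by omega) (by omega) (by omega)))
    (anti_union_right (anti_single_single (h.v_t (by omega) (by omega) (by omega)))
      (anti_single_seg fun _ _ _ => h.ht.far (by omega) (by omega) (by omega)))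

/-- The crossing wheels form a cube. -/
theorem params (h : Crossing G s m t n v p i₀ j₁ j₂ l₁ l₂) (F : Free G) :
    m = 2 ∧ n = 4 ∧ i₀ = 1 ∧ j₁ = 1 ∧ j₂ = 3 ∧ l₁ = 2 := by
  have h1 := h.i₀_eq F
  have h2 := h.rev.i₀_eq F
  have h2' := h.hm
  have h4 := h.j₁_eq F
  have h5 := h.j₂_eq F
  have h6 := h.j₁_lt_l₁ F
  have h6' := h.l_le
  have h6'' := h.l₂_lt_j₂ F
  have h7 := h.l₂_le F
  have h8 := h.rev.l₂_le F
  omega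

end Crossing
end

/-! ### Crossing wheels give the cube -/

section
variable {V : Type*} {G : SimpleGraph V} {s t : ℕ → V} {m n : ℕ} {v : V}

theorem Three.elim {x : V} {H : Set V} (h : Three G x H) {a b : V}
    (hall : ∀ c ∈ H, G.Adj x c → c = a ∨ c = b) : False := by
  obtain ⟨p, hp, q, hq, r, hr, hpq, hpr, hqr, hxp, hxq, hxr⟩ := h
  rcases hall p hp hxp with h1 | h1 <;> rcases hall q hq hxq with h2 | h2 <;>
    rcases hall r hr hxr with h3 | h3 <;>
    first
      | exact hpq (h1.trans h2.symm)
      | exact hpr (h1.trans h3.symm)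
      | exact hqr (h2.trans h3.symm)

theorem cube_facts : (∀ x y : Fin 3 → Bool, x ≠ y → ¬ hammingDist x y = 1 →
    y = (fun i => !x i) ∨ ∃ z, hammingDist x z = 1 ∧ hammingDist z y = 1) ∧
    (∀ x y z : Fin 3 → Bool, hammingDist x z = 1 → hammingDist z y = 1 → x ≠ y →
      hammingDist (fun i => !x i) y = 1) := by
  constructor <;> decide

theorem cube_dist : ∀ x y : Fin 3 → Bool, hammingDist x y = 1 →
    ∃ i, y = Function.update x i (!x i) := by decide

/-- In a triangle-free graph the twelve edges of a cube and the nonadjacency of antipodes determine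
an induced cube. -/
theorem exists_cube (tri : ∀ x y z, G.Adj x y → G.Adj x z → ¬ G.Adj y z) (f : (Fin 3 → Bool) → V)
    (hE : ∀ x i, G.Adj (f x) (f (Function.update x i (!x i))))
    (hA : ∀ x, f x ≠ f (fun i => !x i) ∧ ¬ G.Adj (f x) (f (fun i => !x i))) :
    Nonempty (cubeGraph ↪g G) := by
  have hE' : ∀ x y, hammingDist x y = 1 → G.Adj (f x) (f y) := by
    intro x y h
    obtain ⟨i, rfl⟩ := cube_dist x y h
    exact hE x i
  have key : ∀ x y, x ≠ y → f x ≠ f y ∧ (G.Adj (f x) (f y) → hammingDist x y = 1) := by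
    intro x y hxy
    by_cases h1 : hammingDist x y = 1
    · exact ⟨(hE' x y h1).ne, fun _ => h1⟩
    rcases cube_facts.1 x y hxy h1 with rfl | ⟨z, hxz, hzy⟩
    · exact ⟨(hA x).1, fun e => absurd e (hA x).2⟩
    · refine ⟨fun e => ?_, fun e => absurd e (tri _ _ _ (hE' x z hxz).symm (hE' z y hzy))⟩
      have := hE' _ _ (cube_facts.2 x y z hxz hzy hxy)
      rw [← e] at this
      exact (hA x).2 this.symm
  refine ⟨⟨⟨f, fun x y e => ?_⟩, ?_⟩⟩
  · by_contra hxy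
    exact (key x y hxy).1 e
  · intro x y
    constructor
    · intro e
      by_cases hxy : x = y
      · subst hxy; exact absurd rfl e.ne
      · exact (key x y hxy).2 e
    · exact hE' x y

theorem Crossing.cube {p : V} {i₀ j₁ j₂ l₁ l₂ : ℕ} (h : Crossing G s m t n v p i₀ j₁ j₂ l₁ l₂)
    (F : Free G) : Nonempty (cubeGraph ↪g G) := by
  obtain ⟨rfl, rfl, rfl, rfl, rfl, rfl⟩ := h.params F
  have e1 : G.Adj v (s 0) := h.va
  have e2 : G.Adj v (s 2) := h.vb
  have e3 : G.Adj v (t 2) := h.vl₁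
  have e4 : G.Adj p (s 1) := h.ps
  have e5 : G.Adj p (t 1) := h.pj₁
  have e6 : G.Adj p (t 3) := h.pj₂
  have e7 : G.Adj (s 0) (s 1) := h.s_succ (by omega) (by omega) (by omega)
  have e8 : G.Adj (s 1) (s 2) := h.s_succ (by omega) (by omega) (by omega)
  have e9 : G.Adj (s 0) (t 1) := h.first ▸ (h.ht.adj_iff (by omega) (by omega)).2 (by omega)
  have e10 : G.Adj (s 2) (t 3) := h.last ▸ (h.ht.adj_iff (by omega) (by omega)).2 (by omega)
  have e11 : G.Adj (t 1) (t 2) := (h.ht.adj_iff (by omega) (by omega)).2 (by omega)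
  have e12 : G.Adj (t 2) (t 3) := (h.ht.adj_iff (by omega) (by omega)).2 (by omega)
  have a1 := h.hvp
  have a2 := h.far (i := 0) (j := 3) (by omega) (by omega) (by omega) (by omega)
  have a3 := h.far (i := 2) (j := 1) (by omega) (by omega) (by omega) (by omega)
  have a4 := h.far (i := 1) (j := 2) (by omega) (by omega) (by omega) (by omega)
  refine exists_cube F.tri (fun x => if x 0 then (if x 1 then (if x 2 then p else s 1)
    else (if x 2 then t 1 else s 0)) else (if x 1 then (if x 2 then t 3 else s 2)
    else (if x 2 then t 2 else v))) ?_ ?_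
  · intro x i
    fin_cases i <;> rcases h0 : x 0 <;> rcases h1 : x 1 <;> rcases h2 : x 2 <;>
      simp [Function.update, h0, h1, h2] <;> first | assumption | (rw [G.adj_comm]; assumption)
  · intro x
    rcases h0 : x 0 <;> rcases h1 : x 1 <;> rcases h2 : x 2 <;>
      simp only [h0, h1, h2, Bool.not_true, Bool.not_false, if_true, if_false, Bool.false_eq_true] <;>
      first | assumption | (apply ne_nadj_symm; assumption)

/-- In the absence of a cube, a vertex outside a wheel does not have neighbours both inside the
path `s` and inside the path `t`. -/
theorem Wheel.nested (h : Wheel G s m t n v) (F : Free G) (hc : IsEmpty (cubeGraph ↪g G)) {p : V}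
    (hp : p ∉ seg s 0 m ∪ seg t 0 n) (hvp : v ≠ p) {i j : ℕ} (hi0 : 0 < i) (him : i < m)
    (hj0 : 0 < j) (hjn : j < n) (hi : G.Adj p (s i)) : ¬ G.Adj p (t j) := by
  intro hj
  obtain ⟨i₁, i₂, _, hi12, hi2m, hi1, hi2, hmin⟩ := exists_min_max (P := fun i => G.Adj p (s i))
    ⟨i, Nat.zero_le i, him.le, hi⟩
  by_cases hne : i₁ = i₂
  · have hps' : ∀ k ≤ m, G.Adj p (s k) → k = i := by
      intro k hk hpk
      have := hmin i (by omega) (by omega) hi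
      have := hmin k (by omega) hk hpk
      omega
    have hp0 : ¬ G.Adj p (t 0) := fun e => by
      have := hps' 0 (by omega) (h.first.symm ▸ e); omega
    have hpn : ¬ G.Adj p (t n) := fun e => by
      have := hps' m (by omega) (h.last.symm ▸ e); omega
    obtain ⟨j₁, j₂, hj1, hj12, hj2n, hpj1, hpj2, hjmin⟩ := exists_min_max
      (P := fun i => G.Adj p (t i)) ⟨j, Nat.zero_le j, hjn.le, hj⟩
    have hj10 : j₁ ≠ 0 := fun e => hp0 (e ▸ hpj1)
    have hj2n' : j₂ ≠ n := fun e => hpn (e ▸ hpj2)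
    have hlt : j₁ ≠ j₂ := by
      intro e
      have hj' : ∀ k ≤ n, G.Adj p (t k) → k = j := by
        intro k hk hpk
        have := hjmin k (by omega) hk hpk
        have := hjmin j (by omega) hjn.le hj
        omega
      have hall : ∀ c ∈ seg s 0 m ∪ seg t 0 n, G.Adj p c → c = s i ∨ c = t j := by
        rintro c (⟨k, _, hk, rfl⟩ | ⟨k, _, hk, rfl⟩) hpc
        · rw [hps' k hk hpc]; exact Or.inl rfl
        · rw [hj' k hk hpc]; exact Or.inr rfl
      exact (F.three h.holeSet hp
        ⟨s i, Or.inl (seg_mem (by omega) (by omega)), t j, Or.inr (seg_mem (by omega) (by omega)),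
          (h.anti i j hi0 him hj0 hjn).1, hi, hj⟩).elim hall
    obtain ⟨l, hl0, hln, hl⟩ := h.exists_vt F
    obtain ⟨l₁, l₂, hl1, hl12, hl2, hvl1, hvl2, hlmin⟩ := exists_min_max
      (P := fun i => G.Adj v (t i)) (a := 1) (b := n - 1) ⟨l, by omega, by omega, hl⟩
    have hvp' : ¬ G.Adj v p := fun e =>
      h.no_adj_of_adj_v F hp e.symm (Or.inl (seg_mem (by omega) him.le)) hi
    have hX : Crossing G s m t n v p i j₁ j₂ l₁ l₂ :=
      ⟨h, hp, ⟨hvp, hvp'⟩, hi0, him, hi, hps', hpj1, hpj2, by omega,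
        fun k hk e => hjmin k (by omega) hk e, by omega, by omega, hvl1, hvl2, hl12,
        fun k hk hk' e => hlmin k (by omega) (by omega) e, by omega, by omega⟩
    exact hc.false (hX.cube F).some
  · exact h.no_two F hp hvp (by omega : i₁ < i₂) hi2m hi1 hi2 hj0 hjn hj

end

/-! ### Sectors of a wheel are separated -/

section
variable {V : Type*} {G : SimpleGraph V} {s t : ℕ → V} {m n : ℕ} {v : V}

/-- Replacing the part of a chordless path between the extreme neighbours of a vertex `p` by `p`. -/
theorem IsP.reroute (hs : IsP G s m) {p : V} (hp : ∀ k ≤ m, s k ≠ p) {i₁ i₂ : ℕ} (h12 : i₁ + 2 ≤ i₂)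
    (h2 : i₂ ≤ m) (e1 : G.Adj p (s i₁)) (e2 : G.Adj p (s i₂))
    (hall : ∀ k ≤ m, G.Adj p (s k) → i₁ ≤ k ∧ k ≤ i₂) :
    ∃ (s' : ℕ → V) (m' : ℕ), IsP G s' m' ∧ 2 ≤ m' ∧ s' 0 = s 0 ∧ s' m' = s m ∧
      (∃ k, 0 < k ∧ k < m' ∧ s' k = p) ∧
      ∀ k, 0 < k → k < m' → s' k = p ∨ ∃ l, 0 < l ∧ l < m ∧ s' k = s l := by
  have hadj : ∀ k ≤ m, (k ≤ i₁ ∨ i₂ ≤ k) → (G.Adj p (s k) ↔ k = i₁ ∨ k = i₂) := by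
    intro k hk hk'
    constructor
    · intro e; have := hall k hk e; omega
    · rintro (rfl | rfl) <;> assumption
  refine ⟨fun k => if k ≤ i₁ then s k else if k = i₁ + 1 then p else s (k - (i₁ + 2) + i₂),
    i₁ + 2 + (m - i₂), ?_, by omega, by simp, ?_, ⟨i₁ + 1, by omega, by omega, by simp⟩, ?_⟩
  · intro a b hab hb
    dsimp only
    by_cases hb1 : b ≤ i₁
    · rw [if_pos hb1, if_pos (by omega), hs.adj_iff (by omega) (by omega), ne_eq,
        hs.inj (by omega) (by omega)]
      omega
    rw [if_neg hb1]
    by_cases hb2 : b = i₁ + 1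
    · rw [if_pos hb2, if_pos (by omega), G.adj_comm, hadj _ (by omega) (by omega)]
      exact ⟨hp _ (by omega), by omega⟩
    rw [if_neg hb2]
    by_cases ha1 : a ≤ i₁
    · rw [if_pos ha1, hs.adj_iff (by omega) (by omega), ne_eq, hs.inj (by omega) (by omega)]
      omega
    rw [if_neg ha1]
    by_cases ha2 : a = i₁ + 1
    · rw [if_pos ha2, hadj _ (by omega) (by omega)]
      exact ⟨(hp _ (by omega)).symm, by omega⟩
    · rw [if_neg ha2, hs.adj_iff (by omega) (by omega), ne_eq, hs.inj (by omega) (by omega)]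
      omega
  · dsimp only
    rw [if_neg (by omega), if_neg (by omega)]
    congr 1; omega
  · intro k h0 hk
    dsimp only
    by_cases hk1 : k ≤ i₁
    · right; exact ⟨k, h0, by omega, by rw [if_pos hk1]⟩
    rw [if_neg hk1]
    by_cases hk2 : k = i₁ + 1
    · left; rw [if_pos hk2]
    · right; exact ⟨k - (i₁ + 2) + i₂, by omega, by omega, by rw [if_neg hk2]⟩

/-- Deleting a vertex from a hole leaves a chordless path. -/
theorem IsHole.isP {h : ℕ → V} (hh : IsHole G h n) : IsP G (fun k => h (k + 1)) (n - 2) := by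
  have := hh.1
  intro i j hij hj
  rw [hh.adj_iff (by omega) (by omega), ne_eq, hh.inj (by omega) (by omega)]
  omega

/-- A path outside the wheel from the inside of `s` to the inside of `t` whose ends have just one
neighbour in `s` and in `t` respectively, and that has no neighbour of the common end `s m`. -/
structure Linkage (G : SimpleGraph V) (s : ℕ → V) (m : ℕ) (t : ℕ → V) (n : ℕ) (v : V)
    (p : ℕ → V) (K i₀ j₀ : ℕ) : Prop extends Wheel G s m t n v where
  hp : IsP G p K
  K_pos : 0 < K
  out : ∀ l ≤ K, p l ∉ seg s 0 m ∪ seg t 0 n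
  vp : ∀ l ≤ K, v ≠ p l
  i₀_pos : 0 < i₀
  i₀_lt : i₀ < m
  j₀_pos : 0 < j₀
  j₀_lt : j₀ < n
  p₀ : G.Adj (p 0) (s i₀)
  pK : G.Adj (p K) (t j₀)
  p₀' : ∀ i ≤ m, G.Adj (p 0) (s i) → i = i₀
  pK' : ∀ j ≤ n, G.Adj (p K) (t j) → j = j₀
  no_s : ∀ l ≤ K, l ≠ 0 → ∀ i, 0 < i → i < m → ¬ G.Adj (p l) (s i)
  no_t : ∀ l ≤ K, l ≠ K → ∀ j, 0 < j → j < n → ¬ G.Adj (p l) (t j)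

namespace Linkage
variable {p : ℕ → V} {K i₀ j₀ : ℕ}

theorem ne_s (h : Linkage G s m t n v p K i₀ j₀) {l i : ℕ} (hl : l ≤ K) (hi : i ≤ m) : p l ≠ s i :=
  fun e => h.out l hl (Or.inl (e ▸ seg_mem (Nat.zero_le _) hi))

theorem ne_t (h : Linkage G s m t n v p K i₀ j₀) {l i : ℕ} (hl : l ≤ K) (hi : i ≤ n) : p l ≠ t i :=
  fun e => h.out l hl (Or.inr (e ▸ seg_mem (Nat.zero_le _) hi))

theorem far_s (h : Linkage G s m t n v p K i₀ j₀) {l i : ℕ} (hl : l ≤ K) (h0 : 0 < i)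
    (hi : i < m) (hne : l ≠ 0 ∨ i ≠ i₀) : p l ≠ s i ∧ ¬ G.Adj (p l) (s i) := by
  refine ⟨h.ne_s hl hi.le, fun e => ?_⟩
  by_cases hl0 : l = 0
  · subst hl0; have := h.p₀' i hi.le e; omega
  · exact h.no_s l hl hl0 i h0 hi e

theorem far_t (h : Linkage G s m t n v p K i₀ j₀) {l j : ℕ} (hl : l ≤ K) (h0 : 0 < j)
    (hj : j < n) (hne : l ≠ K ∨ j ≠ j₀) : p l ≠ t j ∧ ¬ G.Adj (p l) (t j) := by
  refine ⟨h.ne_t hl hj.le, fun e => ?_⟩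
  by_cases hl0 : l = K
  · subst hl0; have := h.pK' j hj.le e; omega
  · exact h.no_t l hl hl0 j h0 hj e

theorem end_range (h : Linkage G s m t n v p K i₀ j₀) {l : ℕ} (hl : l ≤ K)
    (e : G.Adj (p l) (s 0)) : 0 < l ∧ l < K := by
  have h1 := h.i₀_pos
  have h2 := h.j₀_pos
  refine ⟨Nat.pos_of_ne_zero fun e' => ?_, lt_of_le_of_ne hl fun e' => ?_⟩
  · subst e'; have := h.p₀' 0 (by omega) e; omega
  · subst e'; have := h.pK' 0 (by omega) (h.first ▸ e); omega

theorem rev (h : Linkage G s m t n v p K i₀ j₀) :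
    Linkage G (fun k => s (m - k)) m (fun k => t (n - k)) n v p K (m - i₀) (n - j₀) := by
  have h1 := h.i₀_pos
  have h2 := h.i₀_lt
  have h3 := h.j₀_pos
  have h4 := h.j₀_lt
  refine ⟨h.toWheel.rev, h.hp, h.K_pos, by rw [seg_union_rev]; exact h.out, h.vp, by omega,
    by omega, by omega, by omega, ?_, ?_, ?_, ?_, fun l hl hl0 i hi hi' =>
      h.no_s l hl hl0 _ (by omega) (by omega), fun l hl hl0 i hi hi' =>
      h.no_t l hl hl0 _ (by omega) (by omega)⟩
  · rw [show m - (m - i₀) = i₀ by omega]; exact h.p₀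
  · rw [show n - (n - j₀) = j₀ by omega]; exact h.pK
  · intro i hi e; have := h.p₀' _ (by omega) e; omega
  · intro i hi e; have := h.pK' _ (by omega) e; omega

variable (F : Free G)
include F

/-- If the path has a neighbour of only one of the two common ends, then that end `s 0`, adjacent to
`s 1` and `t 1`, and the centre `v` are two adjacent vertices with two neighbours each in the hole
that goes through the path. -/
theorem false_of_end (h : Linkage G s m t n v p K i₀ j₀)
    (hb : ∀ l ≤ K, ¬ G.Adj (p l) (s m)) : False := by
  have h1 := h.i₀_pos
  have h2 := h.i₀_lt
  have h3 := h.j₀_pos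
  have h4 := h.j₀_lt
  have hK := h.K_pos
  have hm := h.hm
  have hn := h.hn
  have sadj : ∀ {i j}, i ≤ m → j ≤ m → (j = i + 1 ∨ i = j + 1) → G.Adj (s i) (s j) :=
    fun hi hj e => (h.hs.adj_iff hi hj).2 e
  have tadj : ∀ {i j}, i ≤ n → j ≤ n → (j = i + 1 ∨ i = j + 1) → G.Adj (t i) (t j) :=
    fun hi hj e => (h.ht.adj_iff hi hj).2 e
  have ps : ∀ {l i}, l ≤ K → 0 < i → i ≤ m → (l ≠ 0 ∨ i ≠ i₀) → p l ≠ s i ∧ ¬ G.Adj (p l) (s i) := by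
    intro l i hl h0 hi hne
    by_cases him : i = m
    · subst him; exact ⟨h.ne_s hl le_rfl, hb l hl⟩
    · exact h.far_s hl h0 (by omega) hne
  have pt : ∀ {l i}, l ≤ K → 0 < i → i ≤ n → (l ≠ K ∨ i ≠ j₀) → p l ≠ t i ∧ ¬ G.Adj (p l) (t i) := by
    intro l i hl h0 hi hne
    by_cases him : i = n
    · subst him; exact ⟨h.ne_t hl le_rfl, fun e => hb l hl (h.last ▸ e)⟩
    · exact h.far_t hl h0 (by omega) hne
  by_cases ha : ∀ l ≤ K, ¬ G.Adj (p l) (s 0)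
  · have ps0 : ∀ {l i}, l ≤ K → i ≤ m → (l ≠ 0 ∨ i ≠ i₀) → p l ≠ s i ∧ ¬ G.Adj (p l) (s i) := by
      intro l i hl hi hne
      by_cases h0 : i = 0
      · subst h0; exact ⟨h.ne_s hl (by omega), ha l hl⟩
      · exact ps hl (by omega) hi hne
    have pt0 : ∀ {l i}, l ≤ K → i ≤ n → (l ≠ K ∨ i ≠ j₀) → p l ≠ t i ∧ ¬ G.Adj (p l) (t i) := by
      intro l i hl hi hne
      by_cases h0 : i = 0
      · subst h0; exact ⟨h.ne_t hl (by omega), fun e => ha l hl (h.first ▸ e)⟩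
      · exact pt hl (by omega) hi hne
    have hij := h.far (i := i₀) (j := j₀) (by omega) (by omega) (by omega) (by omega)
    exact F.theta.elim (s i₀) (t j₀) (seg p 0 K) (seg s 0 (i₀ - 1) ∪ seg t 0 (j₀ - 1))
      (seg s (i₀ + 1) m ∪ seg t (j₀ + 1) n) hij.1 hij.2 (h.hp.conn le_rfl)
      ((h.hs.conn (by omega)).union (h.ht.conn (by omega))
        ⟨_, seg_mem le_rfl (by omega), _, seg_mem le_rfl (by omega), Or.inl h.first⟩)
      ((h.hs.conn (by omega)).union (h.ht.conn (by omega))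
        ⟨_, seg_mem (by omega) le_rfl, _, seg_mem (by omega) le_rfl, Or.inl h.last⟩)
      (att_seg 0 le_rfl (by omega) h.p₀.symm)
      (att_seg (i₀ - 1) (by omega) (by omega) (sadj (by omega) (by omega) (by omega))).left
      (att_seg (i₀ + 1) (by omega) (by omega) (sadj (by omega) (by omega) (by omega))).left
      (att_seg K (by omega) le_rfl h.pK.symm)
      (att_seg (j₀ - 1) (by omega) (by omega) (tadj (by omega) (by omega) (by omega))).right
      (att_seg (j₀ + 1) (by omega) (by omega) (tadj (by omega) (by omega) (by omega))).right
      (anti_union_right (anti_seg_seg fun _ _ _ _ _ _ => ps0 (by omega) (by omega) (by omega))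
        (anti_seg_seg fun _ _ _ _ _ _ => pt0 (by omega) (by omega) (by omega)))
      (anti_union_right (anti_seg_seg fun _ _ _ _ _ _ => ps0 (by omega) (by omega) (by omega))
        (anti_seg_seg fun _ _ _ _ _ _ => pt0 (by omega) (by omega) (by omega)))
      (anti_union_left
        (anti_union_right
          (anti_seg_seg fun _ _ _ _ _ _ => h.hs.far (by omega) (by omega) (by omega))
          (anti_seg_seg fun _ _ _ _ _ _ => h.far (by omega) (by omega) (by omega) (by omega)))
        (anti_union_right
          (anti_seg_seg fun _ _ _ _ _ _ => ne_nadj_symm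
            (h.far (by omega) (by omega) (by omega) (by omega)))
          (anti_seg_seg fun _ _ _ _ _ _ => h.ht.far (by omega) (by omega) (by omega))))
  push Not at ha
  obtain ⟨l₀, hl₀, ha⟩ := ha
  obtain ⟨k₁, k₂, hk1, hk12, hk2, ha1, ha2, -⟩ := exists_min_max (P := fun l => G.Adj (p l) (s 0))
    ⟨l₀, Nat.zero_le _, hl₀, ha⟩
  have hr1 := h.end_range (by omega) ha1
  have hr2 := h.end_range (by omega) ha2
  have hi : i₀ = 1 := by
    by_contra hi
    have hu := h.hs.far (i := 0) (j := i₀) (by omega) (by omega) (by omega)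
    exact F.theta.elim (s 0) (s i₀) (seg p 0 k₁) (seg s 1 (i₀ - 1))
      (seg s (i₀ + 1) m ∪ seg t 1 n) hu.1 hu.2 (h.hp.conn (by omega)) (h.hs.conn (by omega))
      ((h.hs.conn (by omega)).union (h.ht.conn (by omega))
        ⟨_, seg_mem (by omega) le_rfl, _, seg_mem (by omega) le_rfl, Or.inl h.last⟩)
      (att_seg k₁ (by omega) le_rfl ha1.symm)
      (att_seg 1 (by omega) (by omega) (sadj (by omega) (by omega) (by omega)))
      (att_seg 1 (by omega) (by omega) (h.first ▸ tadj (by omega) (by omega) (by omega))).right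
      (att_seg 0 (by omega) (by omega) h.p₀.symm)
      (att_seg (i₀ - 1) (by omega) (by omega) (sadj (by omega) (by omega) (by omega)))
      (att_seg (i₀ + 1) (by omega) (by omega) (sadj (by omega) (by omega) (by omega))).left
      (anti_seg_seg fun _ _ _ _ _ _ => ps (by omega) (by omega) (by omega) (by omega))
      (anti_union_right
        (anti_seg_seg fun _ _ _ _ _ _ => ps (by omega) (by omega) (by omega) (by omega))
        (anti_seg_seg fun _ _ _ _ _ _ => pt (by omega) (by omega) (by omega) (by omega)))
      (anti_union_right (anti_seg_seg fun _ _ _ _ _ _ => h.hs.far (by omega) (by omega) (by omega))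
        (anti_seg_seg fun _ _ _ _ _ _ => h.far (by omega) (by omega) (by omega) (by omega)))
  have hj : j₀ = 1 := by
    by_contra hj
    have hu := h.ht.far (i := 0) (j := j₀) (by omega) (by omega) (by omega)
    rw [← h.first] at hu
    exact F.theta.elim (s 0) (t j₀) (seg p k₂ K) (seg t 1 (j₀ - 1))
      (seg t (j₀ + 1) n ∪ seg s 1 m) hu.1 hu.2 (h.hp.conn (by omega)) (h.ht.conn (by omega))
      ((h.ht.conn (by omega)).union (h.hs.conn (by omega))
        ⟨_, seg_mem (by omega) le_rfl, _, seg_mem (by omega) le_rfl, Or.inl h.last.symm⟩)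
      (att_seg k₂ (by omega) (by omega) ha2.symm)
      (att_seg 1 (by omega) (by omega) (h.first ▸ tadj (by omega) (by omega) (by omega)))
      (att_seg 1 (by omega) (by omega) (sadj (by omega) (by omega) (by omega))).right
      (att_seg K (by omega) (by omega) h.pK.symm)
      (att_seg (j₀ - 1) (by omega) (by omega) (tadj (by omega) (by omega) (by omega)))
      (att_seg (j₀ + 1) (by omega) (by omega) (tadj (by omega) (by omega) (by omega))).left
      (anti_seg_seg fun _ _ _ _ _ _ => pt (by omega) (by omega) (by omega) (by omega))
      (anti_union_right
        (anti_seg_seg fun _ _ _ _ _ _ => pt (by omega) (by omega) (by omega) (by omega))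
        (anti_seg_seg fun _ _ _ _ _ _ => ps (by omega) (by omega) (by omega) (by omega)))
      (anti_union_right (anti_seg_seg fun _ _ _ _ _ _ => h.ht.far (by omega) (by omega) (by omega))
        (anti_seg_seg fun _ _ _ _ _ _ => ne_nadj_symm
          (h.far (by omega) (by omega) (by omega) (by omega))))
  subst hi hj
  have h11 := h.far (i := 1) (j := 1) (by omega) (by omega) (by omega) (by omega)
  have hP1 := h.hp.extend h11.1 h11.2
    (fun k hk => ⟨(h.ne_s hk (by omega)).symm, fun e => by
      by_contra hk0
      exact (ps hk (by omega) (by omega) (Or.inl hk0)).2 e.symm, fun e => e ▸ h.p₀.symm⟩)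
    (fun k hk => ⟨(h.ne_t hk (by omega)).symm, fun e => by
      by_contra hk0
      exact (pt hk (by omega) (by omega) (Or.inl hk0)).2 e.symm, fun e => e ▸ h.pK.symm⟩)
  have hP2 := h.isHole.isP
  have hP2' : ∀ k, k ≤ m + n - 2 →
      (∃ i, 1 ≤ i ∧ i ≤ m ∧ (0 < k → 2 ≤ i) ∧ (if k + 1 ≤ m then s (k + 1) else t (m + n - (k + 1))) = s i) ∨
      (∃ j, 1 ≤ j ∧ j ≤ n ∧ (k < m + n - 2 → 2 ≤ j) ∧
        (if k + 1 ≤ m then s (k + 1) else t (m + n - (k + 1))) = t j) := by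
    intro k hk
    split_ifs
    · exact Or.inl ⟨k + 1, by omega, by omega, by omega, rfl⟩
    · exact Or.inr ⟨m + n - (k + 1), by omega, by omega, by omega, rfl⟩
  have hT : TwoPaths G (fun k => if k = 0 then s 1 else if k ≤ K + 1 then p (k - 1) else t 1)
      (K + 2) (fun k => if k + 1 ≤ m then s (k + 1) else t (m + n - (k + 1))) (m + n - 2) := by
    refine ⟨by omega, by omega, hP1, hP2, ?_, ?_, ?_⟩
    · simp [show 1 ≤ m by omega]
    · simp only [show m + n - 2 + 1 = m + n - 1 by omega]
      rw [if_neg (by omega), if_neg (by omega), if_neg (by omega)]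
      congr 1; omega
    · intro i j hi hi' hj hj'
      rw [if_neg (by omega), if_pos (by omega)]
      rcases hP2' j (by omega) with ⟨q, hq1, hq2, hq3, e⟩ | ⟨q, hq1, hq2, hq3, e⟩
      · rw [e]; exact ps (by omega) (by omega) hq2 (by omega)
      · rw [e]; exact pt (by omega) (by omega) hq2 (by omega)
  have hsub : ∀ x ∈ seg (fun k => if k = 0 then s 1 else if k ≤ K + 1 then p (k - 1) else t 1) 0 (K + 2) ∪
      seg (fun k => if k + 1 ≤ m then s (k + 1) else t (m + n - (k + 1))) 0 (m + n - 2),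
      (∃ l ≤ K, x = p l) ∨ (∃ i, 1 ≤ i ∧ i ≤ m ∧ x = s i) ∨ (∃ j, 1 ≤ j ∧ j ≤ n ∧ x = t j) := by
    rintro x (⟨k, _, hk, rfl⟩ | ⟨k, _, hk, rfl⟩)
    · dsimp only
      split_ifs
      · exact Or.inr (Or.inl ⟨1, by omega, by omega, rfl⟩)
      · exact Or.inl ⟨k - 1, by omega, rfl⟩
      · exact Or.inr (Or.inr ⟨1, by omega, by omega, rfl⟩)
    · rcases hP2' k hk with ⟨q, hq1, hq2, _, e⟩ | ⟨q, hq1, hq2, _, e⟩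
      · exact Or.inr (Or.inl ⟨q, hq1, hq2, e⟩)
      · exact Or.inr (Or.inr ⟨q, hq1, hq2, e⟩)
  have mem_s : ∀ i, 1 ≤ i → i ≤ m → s i ∈
      seg (fun k => if k + 1 ≤ m then s (k + 1) else t (m + n - (k + 1))) 0 (m + n - 2) := by
    intro i hi hi'
    exact ⟨i - 1, by omega, by omega, by simp [show i - 1 + 1 = i by omega, hi']⟩
  have mem_t : ∀ j, 1 ≤ j → j < n → t j ∈
      seg (fun k => if k + 1 ≤ m then s (k + 1) else t (m + n - (k + 1))) 0 (m + n - 2) := by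
    intro j hj hj'
    refine ⟨m + n - j - 1, by omega, by omega, ?_⟩
    dsimp only
    rw [if_neg (by omega)]; congr 1; omega
  obtain ⟨l, hl0, hln, hl⟩ := h.exists_vt F
  have hl1 : l ≠ 1 := by
    rintro rfl
    exact F.tri _ _ _ hl h.va (h.first ▸ tadj (by omega) (by omega) (by omega))
  refine F.wac_two hT.holeSet (x := s 0) (y := v) ?_ ?_ h.va.symm ?_ ?_
  · intro hx
    rcases hsub _ hx with ⟨l, hl, e⟩ | ⟨i, hi, hi', e⟩ | ⟨j, hj, hj', e⟩
    · exact h.ne_s hl (Nat.zero_le _) e.symm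
    · rw [h.hs.inj (by omega) hi'] at e; omega
    · rw [h.first, h.ht.inj (by omega) hj'] at e; omega
  · intro hx
    rcases hsub _ hx with ⟨l, hl, e⟩ | ⟨i, hi, hi', e⟩ | ⟨j, hj, hj', e⟩
    · exact h.vp l hl e
    · exact h.ns i hi' e
    · exact h.nt j hj' e
  · exact ⟨s 1, Or.inr (mem_s 1 le_rfl (by omega)), t 1, Or.inr (mem_t 1 le_rfl (by omega)), h11.1,
      sadj (by omega) (by omega) (by omega), h.first ▸ tadj (by omega) (by omega) (by omega)⟩
  · refine ⟨s m, Or.inr (mem_s m (by omega) le_rfl), t l, Or.inr (mem_t l (by omega) hln), ?_,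
      h.vb, hl⟩
    rw [h.last, ne_eq, h.ht.inj le_rfl (by omega)]; omega

theorem false (h : Linkage G s m t n v p K i₀ j₀) : False := by
  by_cases hb : ∀ l ≤ K, ¬ G.Adj (p l) (s m)
  · exact h.false_of_end F hb
  by_cases ha : ∀ l ≤ K, ¬ G.Adj (p l) (s 0)
  · exact h.rev.false_of_end F (by simpa using ha)
  push Not at ha hb
  obtain ⟨l, hl, ha⟩ := ha
  obtain ⟨k, hk, hb⟩ := hb
  have r1 := h.end_range hl ha
  have r2 := h.rev.end_range (l := k) hk (by simpa using hb)
  exact h.theta F.theta (h.hp.conn (by omega)) (att_seg l (by omega) (by omega) ha.symm)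
    (att_seg k (by omega) (by omega) hb.symm)
    (anti_seg_seg (c := min l k) (d := max l k) fun _ _ _ _ _ _ => ne_nadj_symm
      (h.far_s (by omega) (by omega) (by omega) (by omega)))
    (anti_seg_seg fun _ _ _ _ _ _ => ne_nadj_symm
      (h.far_t (by omega) (by omega) (by omega) (by omega)))

end Linkage
end

/-! ### Paths between the two parts of a wheel -/

section
variable {V : Type*} {G : SimpleGraph V} {s t : ℕ → V} {m n : ℕ} {v : V}

/-- There is no chordless path outside the wheel whose first vertex only attaches to the interior of
`s` and whose last vertex only attaches to the interior of `t`. Induction on the length: if an end has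
two neighbours on the side that it attaches to, that side can be rerouted through it. -/
theorem Wheel.no_path (F : Free G) (hc : IsEmpty (cubeGraph ↪g G)) (k : ℕ) :
    ∀ (s : ℕ → V) (m : ℕ) (t : ℕ → V) (n : ℕ) (p : ℕ → V), Wheel G s m t n v → IsP G p k →
    (∀ l ≤ k, p l ∉ seg s 0 m ∪ seg t 0 n) → (∀ l ≤ k, v ≠ p l) →
    (∃ i, 0 < i ∧ i < m ∧ G.Adj (p 0) (s i)) → (∃ j, 0 < j ∧ j < n ∧ G.Adj (p k) (t j)) →
    (∀ l ≤ k, l ≠ 0 → ∀ i, 0 < i → i < m → ¬ G.Adj (p l) (s i)) →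
    (∀ l ≤ k, l ≠ k → ∀ j, 0 < j → j < n → ¬ G.Adj (p l) (t j)) → False := by
  induction k with
  | zero =>
    rintro s m t n p h hp out vp ⟨i, hi0, him, hi⟩ ⟨j, hj0, hjn, hj⟩ _ _
    exact h.nested F hc (out 0 le_rfl) (vp 0 le_rfl) hi0 him hj0 hjn hi hj
  | succ K ih =>
    rintro s m t n p h hp out vp ⟨i, hi0, him, hi⟩ ⟨j, hj0, hjn, hj⟩ no_s no_t
    have ne_s : ∀ {l i}, l ≤ K + 1 → i ≤ m → p l ≠ s i :=
      fun hl hi e => out _ hl (Or.inl (e ▸ seg_mem (Nat.zero_le _) hi))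
    have ne_t : ∀ {l i}, l ≤ K + 1 → i ≤ n → p l ≠ t i :=
      fun hl hi e => out _ hl (Or.inr (e ▸ seg_mem (Nat.zero_le _) hi))
    have gap : ∀ {q : ℕ → V} {r : ℕ} {x : V} {a b : ℕ}, IsP G q r → a ≤ b → b ≤ r → a ≠ b →
        G.Adj x (q a) → G.Adj x (q b) → a + 2 ≤ b := by
      intro q r x a b hq hab hb hne ea eb
      by_contra hlt
      exact F.tri _ _ _ ea eb ((hq.adj_iff (by omega) hb).2 (by omega))
    have vp0 : ¬ G.Adj v (p 0) := fun e =>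
      h.no_adj_of_adj_v F (out 0 (by omega)) e.symm (Or.inl (seg_mem (by omega) him.le)) hi
    obtain ⟨i₁, i₂, -, hi12, hi2m, hi1, hi2, hi'⟩ := exists_min_max (P := fun i => G.Adj (p 0) (s i))
      ⟨i, Nat.zero_le _, him.le, hi⟩
    by_cases hi12' : i₁ = i₂
    swap
    · obtain ⟨s', m', hs', hm', e0, em, ⟨a, ha0, ham, ha⟩, hint⟩ := h.hs.reroute
        (fun k hk => (ne_s (Nat.zero_le _) hk).symm) (gap h.hs hi12 hi2m hi12' hi1 hi2) hi2m hi1 hi2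
        (fun k hk e => hi' k (Nat.zero_le _) hk e)
      have hall : ∀ k ≤ m', s' k = p 0 ∨ ∃ l ≤ m, s' k = s l := by
        intro k hk
        by_cases h0 : k = 0
        · exact Or.inr ⟨0, by omega, by rw [h0, e0]⟩
        by_cases h1 : k = m'
        · exact Or.inr ⟨m, le_rfl, by rw [h1, em]⟩
        · exact (hint k (by omega) (by omega)).imp id fun ⟨l, _, hl, e⟩ => ⟨l, hl.le, e⟩
      refine ih s' m' t n (fun l => p (1 + l)) ⟨⟨hm', h.hn, hs', h.ht, e0.trans h.first,
        em.trans h.last, ?_⟩, e0 ▸ h.va, em ▸ h.vb, ?_, ?_, h.nt⟩ (hp.sub (by omega)) ?_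
        (fun l hl => vp _ (by omega)) ⟨a, ha0, ham, ?_⟩ ⟨j, hj0, hjn, ?_⟩ ?_
        (fun l hl hne => no_t _ (by omega) (by omega))
      · intro k l hk hk' hl hl'
        rcases hint k hk hk' with e | ⟨q, hq0, hq, e⟩ <;> rw [e]
        · exact ⟨ne_t (by omega) hl'.le, no_t 0 (by omega) (by omega) l hl hl'⟩
        · exact h.anti q l hq0 hq hl hl'
      · intro k hk hk'
        rcases hint k hk hk' with e | ⟨q, hq0, hq, e⟩ <;> rw [e]
        · exact vp0
        · exact h.vs q hq0 hq
      · intro k hk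
        rcases hall k hk with e | ⟨q, hq, e⟩ <;> rw [e]
        · exact vp 0 (by omega)
        · exact h.ns q hq
      · rintro l hl (⟨k, _, hk, e⟩ | ⟨k, _, hk, e⟩)
        · rcases hall k hk with e' | ⟨q, hq, e'⟩ <;> rw [e'] at e
          · rw [hp.inj (by omega) (by omega)] at e; omega
          · exact ne_s (by omega) hq e.symm
        · exact ne_t (by omega) hk e.symm
      · rw [ha, hp.adj_iff (by omega) (by omega)]; omega
      · rwa [show 1 + K = K + 1 by omega]
      · intro l hl hl0 k hk hk'
        rcases hint k hk hk' with e | ⟨q, hq0, hq, e⟩ <;> rw [e]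
        · rw [hp.adj_iff (by omega) (by omega)]; omega
        · exact no_s _ (by omega) (by omega) q hq0 hq
    obtain ⟨j₁, j₂, -, hj12, hj2m, hj1, hj2, hj'⟩ :=
      exists_min_max (P := fun j => G.Adj (p (K + 1)) (t j)) ⟨j, Nat.zero_le _, hjn.le, hj⟩
    by_cases hj12' : j₁ = j₂
    swap
    · obtain ⟨t', n', ht', hn', e0, en, ⟨a, ha0, han, ha⟩, hint⟩ := h.ht.reroute
        (fun k hk => (ne_t (le_refl (K + 1)) hk).symm) (gap h.ht hj12 hj2m hj12' hj1 hj2) hj2m hj1 hj2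
        (fun k hk e => hj' k (Nat.zero_le _) hk e)
      have hall : ∀ k ≤ n', t' k = p (K + 1) ∨ ∃ l ≤ n, t' k = t l := by
        intro k hk
        by_cases h0 : k = 0
        · exact Or.inr ⟨0, by omega, by rw [h0, e0]⟩
        by_cases h1 : k = n'
        · exact Or.inr ⟨n, le_rfl, by rw [h1, en]⟩
        · exact (hint k (by omega) (by omega)).imp id fun ⟨l, _, hl, e⟩ => ⟨l, hl.le, e⟩
      refine ih s m t' n' p ⟨⟨h.hm, hn', h.hs, ht', h.first.trans e0.symm,
        h.last.trans en.symm, ?_⟩, h.va, h.vb, h.vs, h.ns, ?_⟩ (fun a b hab hb => hp a b hab (by omega)) ?_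
        (fun l hl => vp _ (by omega)) ⟨i, hi0, him, hi⟩ ⟨a, ha0, han, ?_⟩
        (fun l hl hne => no_s _ (by omega) (by omega)) ?_
      · intro l k hl hl' hk hk'
        rcases hint k hk hk' with e | ⟨q, hq0, hq, e⟩ <;> rw [e]
        · exact ⟨(ne_s le_rfl hl'.le).symm, fun e => no_s _ le_rfl (by omega) l hl hl' e.symm⟩
        · exact h.anti l q hl hl' hq0 hq
      · intro k hk
        rcases hall k hk with e | ⟨q, hq, e⟩ <;> rw [e]
        · exact vp _ le_rfl
        · exact h.nt q hq
      · rintro l hl (⟨k, _, hk, e⟩ | ⟨k, _, hk, e⟩)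
        · exact ne_s (by omega) hk e.symm
        · rcases hall k hk with e' | ⟨q, hq, e'⟩ <;> rw [e'] at e
          · rw [hp.inj (by omega) (by omega)] at e; omega
          · exact ne_t (by omega) hq e.symm
      · rw [ha, hp.adj_iff (by omega) (by omega)]; omega
      · intro l hl hl0 k hk hk'
        rcases hint k hk hk' with e | ⟨q, hq0, hq, e⟩ <;> rw [e]
        · rw [hp.adj_iff (by omega) (by omega)]; omega
        · exact no_t _ (by omega) (by omega) q hq0 hq
    have hi₀ := hi' i (Nat.zero_le _) him.le hi
    have hj₀ := hj' j (Nat.zero_le _) hjn.le hj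
    refine Linkage.false F (p := p) (K := K + 1) (i₀ := i) (j₀ := j) ⟨h, hp, by omega, out, vp, hi0,
      him, hj0, hjn, hi, hj, fun k hk e => ?_, fun k hk e => ?_, no_s, no_t⟩
    · have := hi' k (Nat.zero_le _) hk e; omega
    · have := hj' k (Nat.zero_le _) hk e; omega

/-- The two sides of a wheel are in different components once the ends and the centre are
removed. -/
theorem Wheel.separated (h : Wheel G s m t n v) (F : Free G) (hc : IsEmpty (cubeGraph ↪g G))
    {D : Set V} (hD : Conn G D) (h0 : s 0 ∉ D) (hm : s m ∉ D) (hv : v ∉ D)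
    (hs : ∃ i, 0 < i ∧ i < m ∧ s i ∈ D) (ht : ∃ j, 0 < j ∧ j < n ∧ t j ∈ D) : False := by
  obtain ⟨i, hi0, him, hi⟩ := hs
  obtain ⟨j, hj0, hjn, hj⟩ := ht
  obtain ⟨p, k, hp, hpD, hp0, hpk, hpA, hpB⟩ := hD.exists_path (A := seg s 1 (m - 1))
    (B := seg t 1 (n - 1)) ⟨_, hi, i, hi0, by omega, rfl⟩ ⟨_, hj, j, hj0, by omega, rfl⟩
  have hsm := h.hm
  have htn := h.hn
  have ends : ∀ x ∈ seg s 1 (m - 1), ∀ y ∈ seg t 1 (n - 1), x ≠ y ∧ ¬ G.Adj x y := by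
    rintro _ ⟨a, ha, ha', rfl⟩ _ ⟨b, hb, hb', rfl⟩
    exact h.anti a b (by omega) (by omega) (by omega) (by omega)
  have hk2 : 2 ≤ k := by
    have := ends _ hp0 _ hpk
    rw [hp.adj_iff (by omega) le_rfl, ne_eq, hp.inj (by omega) le_rfl] at this
    omega
  -- the interior of the path is disjoint from the wheel
  have hq : Conn G (seg p 1 (k - 1)) := hp.conn (by omega)
  obtain ⟨q, K, hqP, hqD, hq0, hqK, hqA, hqB⟩ := hq.exists_path
    (A := {x | Att G x (seg s 1 (m - 1))}) (B := {x | Att G x (seg t 1 (n - 1))})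
    ⟨_, seg_mem le_rfl (by omega : 1 ≤ k - 1), _, hp0, (hp.adj_iff (by omega) (by omega)).2 (by omega)⟩
    ⟨_, seg_mem (by omega : 1 ≤ k - 1) le_rfl, _, hpk, (hp.adj_iff (by omega) (by omega)).2 (by omega)⟩
  have hmem : ∀ l ≤ K, q l ∈ D ∧ q l ∉ seg s 1 (m - 1) ∧ q l ∉ seg t 1 (n - 1) := by
    intro l hl
    obtain ⟨a, ha, ha', e⟩ := hqD l hl
    rw [← e]
    refine ⟨hpD a (by omega), fun e => ?_, fun e => ?_⟩
    · have := hpA a (by omega) e; omega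
    · have := hpB a (by omega) e; omega
  refine Wheel.no_path F hc K s m t n q h hqP ?_ (fun l hl e => hv (e ▸ (hmem l hl).1)) ?_ ?_ ?_ ?_
  · intro l hl
    obtain ⟨hD', hs', ht'⟩ := hmem l hl
    rintro (⟨a, _, ha, e⟩ | ⟨a, _, ha, e⟩)
    · by_cases e0 : a = 0
      · subst e0; exact h0 (e ▸ hD')
      by_cases em : a = m
      · subst em; exact hm (e ▸ hD')
      · exact hs' ⟨a, by omega, by omega, e⟩
    · by_cases e0 : a = 0
      · subst e0; exact h0 (h.first ▸ e ▸ hD')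
      by_cases em : a = n
      · subst em; exact hm (h.last ▸ e ▸ hD')
      · exact ht' ⟨a, by omega, by omega, e⟩
  · obtain ⟨_, ⟨a, ha, ha', rfl⟩, e⟩ := hq0
    exact ⟨a, by omega, by omega, e⟩
  · obtain ⟨_, ⟨a, ha, ha', rfl⟩, e⟩ := hqK
    exact ⟨a, by omega, by omega, e⟩
  · intro l hl hne a ha ha' e
    exact hne (hqA l hl ⟨_, seg_mem (by omega) (by omega), e⟩)
  · intro l hl hne a ha ha' e
    exact hne (hqB l hl ⟨_, seg_mem (by omega) (by omega), e⟩)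

end

/-! ### Components, separations and minimal attachment paths -/

/-- The component of `x` in the subgraph induced by `U` (empty if `x ∉ U`). -/
def comp {V : Type*} (G : SimpleGraph V) (U : Set V) (x : V) : Set V :=
  {y | ∃ D : Set V, Conn G D ∧ D ⊆ U ∧ x ∈ D ∧ y ∈ D}

/-- The set `K` separates the nonempty sets `X` and `Y`, and there are no other vertices. -/
structure Separates {V : Type*} (G : SimpleGraph V) (X Y K : Set V) : Prop where
  anti : Anti G X Y
  nX : X.Nonempty
  nY : Y.Nonempty
  cover : ∀ x, x ∈ X ∨ x ∈ Y ∨ x ∈ K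
  XK : ∀ x ∈ X, x ∉ K
  YK : ∀ x ∈ Y, x ∉ K

/-- `G` has a (possibly empty) clique separator. -/
def CliqueSep {V : Type*} (G : SimpleGraph V) : Prop :=
  ∃ X Y K : Set V, Separates G X Y K ∧ ∀ x ∈ K, ∀ y ∈ K, x ≠ y → G.Adj x y

/-- `G` has a separator that consists of the ends of two sides of a hole, with a vertex outside the
hole on both sides. -/
def TwoSep {V : Type*} (G : SimpleGraph V) : Prop :=
  ∃ s m t n X Y, TwoPaths G s m t n ∧ Separates G X Y {s 0, s m} ∧
    (∀ i, 0 < i → i < m → s i ∈ X) ∧ (∀ j, 0 < j → j < n → t j ∈ Y) ∧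
    (∃ x ∈ X, x ∉ seg s 0 m) ∧ (∃ y ∈ Y, y ∉ seg t 0 n)

/-- `G` has a separator that consists of the ends and the centre of a wheel, with a vertex outside
the wheel on both sides. -/
def P3Sep {V : Type*} (G : SimpleGraph V) : Prop :=
  ∃ s m t n v X Y, Wheel G s m t n v ∧ Separates G X Y {s 0, s m, v} ∧
    (∀ i, 0 < i → i < m → s i ∈ X) ∧ (∀ j, 0 < j → j < n → t j ∈ Y) ∧
    (∃ x ∈ X, x ∉ seg s 0 m) ∧ (∃ y ∈ Y, y ∉ seg t 0 n)

section
variable {V : Type*} {G : SimpleGraph V}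

theorem comp_subset {U : Set V} {x : V} : comp G U x ⊆ U := fun _ ⟨_, _, hU, _, hy⟩ => hU hy

theorem mem_comp {U : Set V} {x : V} (hx : x ∈ U) : x ∈ comp G U x :=
  ⟨{x}, conn_singleton x, by simpa using hx, rfl, rfl⟩

theorem comp_conn (U : Set V) (x : V) : Conn G (comp G U x) := by
  rintro B ⟨y, ⟨D, hD, hDU, hxD, hyD⟩, hyB⟩ hB z ⟨E, hE, hEU, hxE, hzE⟩
  have hxB : x ∈ B := hD B ⟨y, hyD, hyB⟩
    (fun a ha haB b hb hab => hB a ⟨D, hD, hDU, hxD, ha⟩ haB b ⟨D, hD, hDU, hxD, hb⟩ hab) hxD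
  exact hE B ⟨x, hxE, hxB⟩
    (fun a ha haB b hb hab => hB a ⟨E, hE, hEU, hxE, ha⟩ haB b ⟨E, hE, hEU, hxE, hb⟩ hab) hzE

theorem comp_closed {U : Set V} {x y z : V} (hy : y ∈ comp G U x) (hz : z ∈ U) (hyz : G.Adj y z) :
    z ∈ comp G U x := by
  obtain ⟨D, hD, hDU, hxD, hyD⟩ := hy
  refine ⟨D ∪ {z}, hD.union (conn_singleton z) ⟨y, hyD, z, rfl, Or.inr hyz⟩, ?_, Or.inl hxD, Or.inr rfl⟩
  rintro w (hw | rfl)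
  · exact hDU hw
  · exact hz

theorem subset_comp {U D : Set V} {x : V} (hD : Conn G D) (hDU : D ⊆ U) (h : ∃ y ∈ D, y ∈ comp G U x) :
    D ⊆ comp G U x :=
  hD _ h fun _ _ ha _ hb hab => comp_closed ha (hDU hb) hab

/-- A component outside `B` whose attachments in `B` form a clique other than `B` yields a clique
separator. -/
theorem cliqueSep_of_comp {B : Set V} {x : V} (hx : x ∉ B)
    (hK : ∀ y ∈ B, ∀ z ∈ B, y ≠ z → Att G y (comp G Bᶜ x) → Att G z (comp G Bᶜ x) → G.Adj y z)
    (hB : ∃ z ∈ B, ¬ Att G z (comp G Bᶜ x)) : CliqueSep G := by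
  obtain ⟨z, hz, hzK⟩ := hB
  refine ⟨comp G Bᶜ x, {y | y ∉ comp G Bᶜ x ∧ ¬ (y ∈ B ∧ Att G y (comp G Bᶜ x))},
    {y | y ∈ B ∧ Att G y (comp G Bᶜ x)}, ⟨?_, ⟨x, mem_comp hx⟩, ⟨z, ?_, fun h => hzK h.2⟩, ?_, ?_, ?_⟩, ?_⟩
  · rintro y hy w ⟨hw, hwK⟩
    refine ⟨fun e => hw (e ▸ hy), fun e => ?_⟩
    by_cases hwB : w ∈ B
    · exact hwK ⟨hwB, y, hy, e.symm⟩
    · exact hw (comp_closed hy hwB e)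
  · exact fun h => comp_subset h hz
  · intro y
    by_cases h1 : y ∈ comp G Bᶜ x
    · exact Or.inl h1
    by_cases h2 : y ∈ B ∧ Att G y (comp G Bᶜ x)
    · exact Or.inr (Or.inr h2)
    · exact Or.inr (Or.inl ⟨h1, h2⟩)
  · exact fun y hy h => comp_subset hy h.1
  · exact fun y hy h => hy.2 h
  · exact fun y hy w hw hne => hK y hy.1 w hw.1 hne hy.2 hw.2

/-- A shortest path of `D` between two nonadjacent attachments `z₁`, `z₂` of `D` in `K`. Unless it is
a single vertex, its ends have no other neighbours in `K`, and only one vertex of `K` can have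
neighbours inside the path, which is then a common neighbour of `z₁` and `z₂`. -/
theorem exists_attachment_path (tri : ∀ x y z, G.Adj x y → G.Adj x z → ¬ G.Adj y z) {D K : Set V}
    (hD : Conn G D) {z z' : V} (hz : z ∈ K) (hz' : z' ∈ K) (hne : z ≠ z')
    (hadj : ¬ G.Adj z z') (ha : Att G z D) (ha' : Att G z' D) :
    ∃ (p : ℕ → V) (k : ℕ) (z₁ z₂ : V), IsP G p k ∧ (∀ i ≤ k, p i ∈ D) ∧ z₁ ∈ K ∧ z₂ ∈ K ∧ z₁ ≠ z₂ ∧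
      ¬ G.Adj z₁ z₂ ∧ G.Adj (p 0) z₁ ∧ G.Adj (p k) z₂ ∧
      (k ≠ 0 → (∀ c ∈ K, G.Adj (p 0) c → c = z₁) ∧ (∀ c ∈ K, G.Adj (p k) c → c = z₂) ∧
        (∀ l, 0 < l → l < k → ∀ c ∈ K, G.Adj (p l) c → G.Adj c z₁ ∧ G.Adj c z₂) ∧
        ∀ l l', 0 < l → l < k → 0 < l' → l' < k → ∀ c ∈ K, ∀ c' ∈ K, G.Adj (p l) c →
          G.Adj (p l') c' → c = c') := by
  classical
  have ex : ∃ k, ∃ (p : ℕ → V) (z₁ z₂ : V), IsP G p k ∧ (∀ i ≤ k, p i ∈ D) ∧ z₁ ∈ K ∧ z₂ ∈ K ∧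
      z₁ ≠ z₂ ∧ ¬ G.Adj z₁ z₂ ∧ G.Adj (p 0) z₁ ∧ G.Adj (p k) z₂ := by
    obtain ⟨x, hx, e⟩ := ha
    obtain ⟨x', hx', e'⟩ := ha'
    obtain ⟨p, k, hp, hpD, hp0, hpk, -, -⟩ := hD.exists_path (A := {x}) (B := {x'}) ⟨x, hx, rfl⟩
      ⟨x', hx', rfl⟩
    obtain rfl : p 0 = x := hp0
    obtain rfl : p k = x' := hpk
    exact ⟨k, p, z, z', hp, hpD, hz, hz', hne, hadj, e.symm, e'.symm⟩
  obtain ⟨p, z₁, z₂, hp, hpD, h1, h2, h12, hn12, e1, e2⟩ := Nat.find_spec ex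
  set k := Nat.find ex with hk
  -- no shorter subpath joins nonadjacent vertices of `K`
  have key : ∀ i j, i ≤ j → j ≤ k → j - i < k → ∀ c ∈ K, ∀ c' ∈ K, G.Adj (p i) c → G.Adj (p j) c' →
      c = c' ∨ G.Adj c c' := by
    intro i j hij hj hlt c hc c' hc' ec ec'
    by_contra hcon
    rw [not_or] at hcon
    exact Nat.find_min ex hlt ⟨fun l => p (i + l), c, c', hp.sub (by omega),
      fun l hl => hpD _ (by omega), hc, hc', hcon.1, hcon.2, ec, by
        have hj : i + (j - i) = j := by omega
        simpa only [hj] using ec'⟩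
  refine ⟨p, k, z₁, z₂, hp, hpD, h1, h2, h12, hn12, e1, e2, fun hk0 => ⟨?_, ?_, ?_, ?_⟩⟩
  · intro c hc e
    exact (key 0 0 le_rfl (by omega) (by omega) c hc z₁ h1 e e1).resolve_right (tri _ _ _ e e1)
  · intro c hc e
    exact (key k k le_rfl le_rfl (by omega) c hc z₂ h2 e e2).resolve_right (tri _ _ _ e e2)
  · intro l hl hlk c hc e
    have r1 := key 0 l (by omega) (by omega) (by omega) z₁ h1 c hc e1 e
    have r2 := key l k (by omega) (by omega) (by omega) c hc z₂ h2 e e2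
    rcases r1 with rfl | r1
    · rcases r2 with rfl | r2
      · exact absurd rfl h12
      · exact absurd r2 hn12
    rcases r2 with rfl | r2
    · exact absurd r1 hn12
    · exact ⟨r1.symm, r2⟩
  · intro l l' hl hlk hl' hlk' c hc c' hc' e e'
    have a1 : G.Adj z₁ c := by
      rcases key 0 l (by omega) (by omega) (by omega) z₁ h1 c hc e1 e with rfl | r
      · rcases key l k (by omega) (by omega) (by omega) _ hc z₂ h2 e e2 with rfl | r
        · exact absurd rfl h12
        · exact absurd r hn12
      · exact r
    have a2 : G.Adj z₁ c' := by
      rcases key 0 l' (by omega) (by omega) (by omega) z₁ h1 c' hc' e1 e' with rfl | r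
      · rcases key l' k (by omega) (by omega) (by omega) _ hc' z₂ h2 e' e2 with rfl | r
        · exact absurd rfl h12
        · exact absurd r hn12
      · exact r
    rcases le_total l l' with h | h
    · exact (key l l' h (by omega) (by omega) c hc c' hc' e e').resolve_right (tri _ _ _ a1 a2)
    · exact ((key l' l h (by omega) (by omega) c' hc' c hc e' e).resolve_right (tri _ _ _ a2 a1)).symm

/-- A vertex with two neighbours in a hole is the centre of a wheel; the hole may be cut so that a given
nonneighbour is inside the first side. -/
theorem Free.exists_wheel (F : Free G) {H : Set V} (hH : HoleSet G H) {v z : V} (hv : v ∉ H)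
    (h2 : Two G v H) (hz : z ∈ H) (hvz : ¬ G.Adj v z) :
    ∃ s m t n, Wheel G s m t n v ∧ H = seg s 0 m ∪ seg t 0 n ∧ ∃ i, 0 < i ∧ i < m ∧ s i = z := by
  obtain ⟨h, N, hh, rfl, rfl⟩ := hH.exists_first hz
  obtain ⟨_, ⟨a, ha, rfl⟩, _, ⟨b, hb, rfl⟩, hab, ea, eb⟩ := h2
  have hN := hh.1
  obtain ⟨i, j, hi1, hij, hjN, ei, ej, hmin⟩ := exists_min_max (P := fun k => G.Adj v (h k)) (a := 1)
    (b := N - 1) ⟨a, Nat.pos_of_ne_zero fun e => hvz (e ▸ ea), by omega, ea⟩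
  have hab' : a ≠ b := fun e => hab (by rw [e])
  have ra := hmin a (Nat.pos_of_ne_zero fun e => hvz (e ▸ ea)) (by omega) ea
  have rb := hmin b (Nat.pos_of_ne_zero fun e => hvz (e ▸ eb)) (by omega) eb
  have hij2 : i + 2 ≤ j := by
    by_contra hlt
    exact F.tri _ _ _ ei ej ((hh.adj_iff (by omega) (by omega)).2 (by omega))
  obtain ⟨hr, hset⟩ := hh.rotate (r := i) (by omega)
  obtain ⟨hT, hset'⟩ := hr.twoPaths (r := j - i) (by omega) (by omega)
  rw [← hset, Set.union_comm] at hset'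
  refine ⟨_, _, _, _, ⟨hT.swap, ?_, ?_, ?_, ?_, ?_⟩, hset', i, by omega, by omega, ?_⟩
  · rw [if_pos rfl, if_pos (by omega), Nat.zero_add]; exact ei
  · rw [if_neg (by omega), if_pos (by omega), show N - (N - (j - i)) + i = j by omega]; exact ej
  · intro k hk hk' e
    rw [if_neg (by omega)] at e
    split_ifs at e
    · have := hmin _ (by omega) (by omega) e; omega
    · by_cases h0 : N - k + i - N = 0
      · rw [h0] at e; exact hvz e
      · have := hmin _ (by omega) (by omega) e; omega
  · intro k hk e
    apply hv
    rw [hset', e]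
    exact Or.inl (seg_mem (Nat.zero_le _) hk)
  · intro k hk e
    apply hv
    rw [hset', e]
    exact Or.inr (seg_mem (Nat.zero_le _) hk)
  · rw [if_neg (by omega), if_neg (by omega)]
    congr 1; omega

/-- A hole contains a nonneighbour of every vertex. -/
theorem Free.exists_nonadj (F : Free G) {H : Set V} (hH : HoleSet G H) (v : V) : ∃ z ∈ H, ¬ G.Adj v z := by
  obtain ⟨h, N, hh, rfl⟩ := hH
  have := hh.1
  by_cases e : G.Adj v (h 0)
  · exact ⟨h 1, ⟨1, by omega, rfl⟩, fun e' =>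
      F.tri _ _ _ e e' ((hh.adj_iff (by omega) (by omega)).2 (by omega))⟩
  · exact ⟨h 0, ⟨0, by omega, rfl⟩, e⟩

/-- A clique does not contain all vertices of a hole. -/
theorem HoleSet.exists_pair {H : Set V} (hH : HoleSet G H) :
    ∃ x ∈ H, ∃ y ∈ H, x ≠ y ∧ ¬ G.Adj x y := by
  obtain ⟨h, N, hh, rfl⟩ := hH
  have := hh.1
  refine ⟨h 0, ⟨0, by omega, rfl⟩, h 2, ⟨2, by omega, rfl⟩, ?_⟩
  rw [hh.adj_iff (by omega) (by omega), ne_eq, hh.inj (by omega) (by omega)]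
  omega

end

/-! ### Cubes, forests, and holes without wheels -/

section
variable {V : Type*} {G : SimpleGraph V}

set_option synthInstance.maxSize 1000 in
set_option synthInstance.maxHeartbeats 200000 in
/-- The square through two vertices of the cube at distance two, and the path between their antipodes'
translates on the opposite side. -/
theorem cube_dist_two : ∀ x y c : Fin 3 → Bool, x ≠ y → hammingDist x c = 1 → hammingDist y c = 1 →
    ∃ c' x' y' d : Fin 3 → Bool,
    (hammingDist x c' = 1 ∧ hammingDist y c' = 1 ∧ hammingDist x y' = 1 ∧ hammingDist y' d = 1 ∧
      hammingDist d x' = 1 ∧ hammingDist y x' = 1) ∧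
    (c' ≠ x ∧ c' ≠ y ∧ c' ≠ c ∧ hammingDist c' c ≠ 1 ∧ y' ≠ x ∧ y' ≠ y ∧ y' ≠ c ∧ d ≠ x ∧ d ≠ y ∧
      d ≠ c ∧ x' ≠ x ∧ x' ≠ y ∧ x' ≠ c) ∧
    (c' ≠ y' ∧ hammingDist c' y' ≠ 1 ∧ c' ≠ d ∧ hammingDist c' d ≠ 1 ∧ c' ≠ x' ∧
      hammingDist c' x' ≠ 1) := by
  intro x y c h1 h2 h3
  refine ⟨fun i => xor (c i) (xor (x i) (y i)), fun i => !x i, fun i => !y i,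
    fun i => !xor (c i) (xor (x i) (y i)), ?_⟩
  revert x y c
  decide

/-- Two disjoint paths between antipodal vertices of the cube, without edges between them. -/
theorem cube_dist_three : ∀ x : Fin 3 → Bool, ∃ a b c d y : Fin 3 → Bool,
    y = (fun i => !x i) ∧ (hammingDist x a = 1 ∧ hammingDist a b = 1 ∧ hammingDist b y = 1 ∧
      hammingDist x c = 1 ∧ hammingDist c d = 1 ∧ hammingDist d y = 1) ∧
    (a ≠ c ∧ a ≠ d ∧ b ≠ c ∧ b ≠ d ∧ hammingDist a c ≠ 1 ∧ hammingDist a d ≠ 1 ∧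
      hammingDist b c ≠ 1 ∧ hammingDist b d ≠ 1) ∧
    (a ≠ x ∧ a ≠ y ∧ b ≠ x ∧ b ≠ y ∧ c ≠ x ∧ c ≠ y ∧ d ≠ x ∧ d ≠ y) := by
  intro x
  refine ⟨Function.update x 0 (!x 0), Function.update (Function.update x 0 (!x 0)) 1 (!x 1),
    Function.update x 2 (!x 2), Function.update (Function.update x 2 (!x 2)) 1 (!x 1), fun i => !x i, ?_⟩
  revert x
  decide

theorem conn_pair {x y : V} (h : G.Adj x y) : Conn G ({x} ∪ {y}) :=
  (conn_singleton x).union (conn_singleton y) ⟨x, rfl, y, rfl, Or.inr h⟩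

/-- A cube is the whole graph, unless there is a clique separator. -/
theorem Free.eq_cube (F : Free G) (hs : ¬ CliqueSep G) (f : cubeGraph ↪g G) :
    Nonempty (G ≃g cubeGraph) := by
  have adj : ∀ {x y}, G.Adj (f x) (f y) ↔ hammingDist x y = 1 := fun {x y} => f.map_adj_iff
  have inj : ∀ {x y}, f x = f y ↔ x = y := fun {x y} => f.injective.eq_iff
  by_cases hsurj : Function.Surjective f
  · exact ⟨(RelIso.ofSurjective f hsurj).symm⟩
  exfalso
  rw [Function.Surjective] at hsurj
  push Not at hsurj
  obtain ⟨v, hv⟩ := hsurj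
  have hv' : v ∉ Set.range f := fun ⟨x, e⟩ => hv x e
  have hDK : ∀ x ∈ comp G (Set.range f)ᶜ v, x ∉ Set.range f := fun x hx => comp_subset hx
  apply hs
  by_contra hs'
  have hK : ¬ ∀ y ∈ Set.range f, ∀ z ∈ Set.range f, y ≠ z → Att G y (comp G (Set.range f)ᶜ v) →
      Att G z (comp G (Set.range f)ᶜ v) → G.Adj y z := by
    intro hK
    refine hs' (cliqueSep_of_comp hv' hK ?_)
    by_contra hall
    push Not at hall
    have := hK (f fun _ => false) ⟨_, rfl⟩ (f fun _ => true) ⟨_, rfl⟩ (by rw [ne_eq, inj]; decide)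
      (hall _ ⟨_, rfl⟩) (hall _ ⟨_, rfl⟩)
    rw [adj] at this
    revert this
    decide
  push Not at hK
  obtain ⟨z, hz, z', hz', hne, ha, ha', hadj⟩ := hK
  obtain ⟨p, k, z₁, z₂, hp, hpD, ⟨x, rfl⟩, ⟨y, rfl⟩, h12, hn12, e1, e2, hk⟩ :=
    exists_attachment_path F.tri (comp_conn _ _) hz hz' hne hadj ha ha'
  have hpf : ∀ i ≤ k, ∀ w, p i ≠ f w := fun i hi w e => hDK _ (hpD i hi) ⟨w, e.symm⟩
  -- the vertices of the cube with a neighbour in the path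
  have hnb : ∀ i ≤ k, ∀ w, w ≠ x → w ≠ y → G.Adj (p i) (f w) →
      k = 0 ∨ (hammingDist x w = 1 ∧ hammingDist y w = 1 ∧ ∀ w' j, j ≤ k → w' ≠ x → w' ≠ y →
        G.Adj (p j) (f w') → w' = w) := by
    intro i hi w hwx hwy e
    by_cases hk0 : k = 0
    · exact Or.inl hk0
    obtain ⟨q1, q2, q3, q4⟩ := hk hk0
    have hint : ∀ i ≤ k, ∀ w, w ≠ x → w ≠ y → G.Adj (p i) (f w) → 0 < i ∧ i < k := by
      intro i hi w hwx hwy e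
      refine ⟨Nat.pos_of_ne_zero fun h => ?_, lt_of_le_of_ne hi fun h => ?_⟩
      · subst h; exact hwx (inj.1 (q1 _ ⟨w, rfl⟩ e))
      · subst h; exact hwy (inj.1 (q2 _ ⟨w, rfl⟩ e))
    have hi' := hint i hi w hwx hwy e
    have := q3 i hi'.1 hi'.2 _ ⟨w, rfl⟩ e
    refine Or.inr ⟨adj.1 this.1.symm, adj.1 this.2.symm, fun w' j hj hwx' hwy' e' => ?_⟩
    have hj' := hint j hj w' hwx' hwy' e'
    exact inj.1 (q4 j i hj'.1 hj'.2 hi'.1 hi'.2 _ ⟨w', rfl⟩ _ ⟨w, rfl⟩ e' e)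
  have hP := hp.conn (i := 0) le_rfl
  have ax : Att G (f x) (seg p 0 k) := att_seg 0 le_rfl (by omega) e1.symm
  have ay : Att G (f y) (seg p 0 k) := att_seg k (by omega) le_rfl e2.symm
  rw [ne_eq, inj] at h12
  rcases cube_facts.1 x y h12 (by rwa [adj] at hn12) with rfl | ⟨c, hxc, hcy⟩
  · obtain ⟨a, b, c, d, y', hy', ⟨xa, ab, yb, xc, cd, yd⟩, ⟨ac, ad, bc, bd, ac', ad', bc', bd'⟩,
      ⟨ax', ay', bx', by', cx', cy', dx', dy'⟩⟩ := cube_dist_three x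
    subst hy'
    have no : ∀ w, w ≠ x → w ≠ (fun i => !x i) → (hammingDist x w = 1 ∨
        hammingDist w (fun i => !x i) = 1) → ∀ i, 0 ≤ i → i ≤ k →
        f w ≠ p i ∧ ¬ G.Adj (f w) (p i) := by
      intro w hwx hwy hw i _ hi
      refine ⟨fun e => hpf i hi w e.symm, fun e => ?_⟩
      rcases hnb i hi w hwx hwy e.symm with rfl | ⟨h1, h2, _⟩
      · obtain rfl : i = 0 := by omega
        rcases hw with hw | hw
        · exact F.tri _ _ _ e1 e.symm (adj.2 hw)
        · exact F.tri _ _ _ e.symm e2 (adj.2 hw)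
      · have := cube_facts.2 x (fun i => !x i) w h1 (by rwa [hammingDist_comm]) h12
        rw [← adj] at this
        exact G.loopless.irrefl _ this
    exact F.theta.elim (f x) (f fun i => !x i) ({f a} ∪ {f b}) ({f c} ∪ {f d}) (seg p 0 k)
      (by rwa [ne_eq, inj]) hn12 (conn_pair (adj.2 ab)) (conn_pair (adj.2 cd)) hP
      (att_single (adj.2 xa)).left (att_single (adj.2 xc)).left ax
      (att_single (adj.2 yb).symm).right (att_single (adj.2 yd).symm).right ay
      (anti_union_left
        (anti_union_right (anti_single_single ⟨by rwa [ne_eq, inj], by rwa [adj]⟩)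
          (anti_single_single ⟨by rwa [ne_eq, inj], by rwa [adj]⟩))
        (anti_union_right (anti_single_single ⟨by rwa [ne_eq, inj], by rwa [adj]⟩)
          (anti_single_single ⟨by rwa [ne_eq, inj], by rwa [adj]⟩)))
      (anti_union_left (anti_single_seg (no a ax' ay' (Or.inl xa)))
        (anti_single_seg (no b bx' by' (Or.inr yb))))
      (anti_union_left (anti_single_seg (no c cx' cy' (Or.inl xc)))
        (anti_single_seg (no d dx' dy' (Or.inr yd))))
  · -- choose `c` to be the common neighbour that may have neighbours in the path
    obtain ⟨c, hxc, hyc, hc⟩ : ∃ c, hammingDist x c = 1 ∧ hammingDist y c = 1 ∧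
        (k ≠ 0 → ∀ w, w ≠ x → w ≠ y → w ≠ c → ∀ i, 0 ≤ i → i ≤ k →
          f w ≠ p i ∧ ¬ G.Adj (f w) (p i)) := by
      by_cases hex : ∃ i ≤ k, ∃ w, w ≠ x ∧ w ≠ y ∧ G.Adj (p i) (f w)
      · obtain ⟨i, hi, w, hwx, hwy, e⟩ := hex
        rcases hnb i hi w hwx hwy e with h0 | ⟨h1, h2, h3⟩
        · exact ⟨c, hxc, by rwa [hammingDist_comm], fun h => absurd h0 h⟩
        · exact ⟨w, h1, h2, fun _ w' hwx' hwy' hne j _ hj => ⟨fun e => hpf j hj w' e.symm,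
            fun e' => hne (h3 w' j hj hwx' hwy' e'.symm)⟩⟩
      · push Not at hex
        exact ⟨c, hxc, by rwa [hammingDist_comm], fun _ w hwx hwy _ i _ hi =>
          ⟨fun e => hpf i hi w e.symm, fun e => hex i hi w hwx hwy e.symm⟩⟩
    obtain ⟨c', x', y', d, ⟨xc', yc', xd, de, eg, yg⟩, ⟨n1, n2, n3, n4, n5, n6, n7, n8, n9, n10, n11, n12, n13⟩,
      ⟨m1, m2, m3, m4, m5, m6⟩⟩ := cube_dist_two x y c h12 hxc hyc
    by_cases hk0 : k = 0
    · subst hk0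
      have no : ∀ w, hammingDist x w = 1 → ∀ i, 0 ≤ i → i ≤ 0 → f w ≠ p i ∧ ¬ G.Adj (f w) (p i) := by
        intro w hw i _ hi
        obtain rfl : i = 0 := by omega
        exact ⟨fun e => hpf 0 le_rfl w e.symm, fun e => F.tri _ _ _ e1 e.symm (adj.2 hw)⟩
      exact F.theta.elim (f x) (f y) {f c'} {f c} (seg p 0 0)
        (by rwa [ne_eq, inj]) hn12 (conn_singleton _) (conn_singleton _) hP
        (att_single (adj.2 xc')) (att_single (adj.2 hxc)) ax
        (att_single (adj.2 yc')) (att_single (adj.2 hyc)) ay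
        (anti_single_single ⟨by rwa [ne_eq, inj], by rwa [adj]⟩)
        (anti_single_seg (no _ xc')) (anti_single_seg (no _ hxc))
    · exact F.theta.elim (f x) (f y) {f c'}
        (({f y'} ∪ {f d}) ∪ {f x'})
        (seg p 0 k) (by rwa [ne_eq, inj]) hn12 (conn_singleton _)
        ((conn_pair (adj.2 de)).union (conn_singleton _) ⟨_, Or.inr rfl, _, rfl, Or.inr (adj.2 eg)⟩) hP
        (att_single (adj.2 xc')) (att_single (adj.2 xd)).left.left ax
        (att_single (adj.2 yc')) (att_single (adj.2 yg)).right ay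
        (anti_union_right
          (anti_union_right (anti_single_single ⟨by rwa [ne_eq, inj], by rwa [adj]⟩)
            (anti_single_single ⟨by rwa [ne_eq, inj], by rwa [adj]⟩))
          (anti_single_single ⟨by rwa [ne_eq, inj], by rwa [adj]⟩))
        (anti_single_seg (hc hk0 _ n1 n2 n3))
        (anti_union_left (anti_union_left (anti_single_seg (hc hk0 _ n5 n6 n7))
          (anti_single_seg (hc hk0 _ n8 n9 n10))) (anti_single_seg (hc hk0 _ n11 n12 n13)))

/-- If there is no hole, the attachments in the neighbourhood of `y` of a component of the set of the
nonneighbours of `y` form a clique. -/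
theorem cliqueSep_of_no_hole (hh : ∀ H, ¬ HoleSet G H) {x y : V} (hxy : x ≠ y)
    (hadj : ¬ G.Adj x y) : CliqueSep G := by
  have hx : x ∉ {z | z = y ∨ G.Adj y z} := by
    rintro (rfl | e)
    · exact hxy rfl
    · exact hadj e.symm
  have hy : ¬ Att G y (comp G {z | z = y ∨ G.Adj y z}ᶜ x) := by
    rintro ⟨z, hz, e⟩
    exact comp_subset hz (Or.inr e)
  refine cliqueSep_of_comp hx ?_ ⟨y, Or.inl rfl, hy⟩
  rintro z hz z' hz' hne ha ha'
  by_contra hn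
  have hyz : G.Adj y z := hz.resolve_left fun e => hy (e ▸ ha)
  have hyz' : G.Adj y z' := hz'.resolve_left fun e => hy (e ▸ ha')
  obtain ⟨p, n, hp, hpD, h0, hn', h1, h2⟩ := (comp_conn _ _).exists_path (A := {w | G.Adj z w})
    (B := {w | G.Adj z' w}) ha ha'
  have ne : ∀ {w}, w = y ∨ G.Adj y w → ∀ k ≤ n, w ≠ p k :=
    fun hw k hk e => comp_subset (hpD k hk) (e ▸ hw)
  have hP := hp.extend (u := z) (w := z') hne hn
    (fun k hk => ⟨ne hz k hk, h1 k hk, fun e => e ▸ h0⟩)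
    (fun k hk => ⟨ne hz' k hk, h2 k hk, fun e => e ▸ hn'⟩)
  refine hh _ (hP.holeSet (v := y) (by omega) fun i hi => ?_)
  split_ifs with hi0 hi1
  · exact ⟨hyz.ne, by simp [hi0, hyz]⟩
  · refine ⟨ne (Or.inl rfl) _ (by omega), ⟨fun e => ?_, fun e => by omega⟩⟩
    exact absurd (Or.inr e) (comp_subset (hpD (i - 1) (by omega)))
  · exact ⟨hyz'.ne, by simp [hyz', show i = n + 2 by omega]⟩

/-- A hole is the whole graph, unless there is a clique separator or a wheel. -/
theorem Free.exists_wheel_or (F : Free G) (hs : ¬ CliqueSep G) {H : Set V} (hH : HoleSet G H) :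
    H = Set.univ ∨ ∃ s m t n v, Wheel G s m t n v := by
  by_contra hcon
  rw [not_or] at hcon
  obtain ⟨h1, hw⟩ := hcon
  have no_two : ∀ {H : Set V} {v : V}, HoleSet G H → v ∉ H → ¬ Two G v H := by
    intro H v hH hv h2
    obtain ⟨z, hz, hvz⟩ := F.exists_nonadj hH v
    obtain ⟨s, m, t, n, h, -⟩ := F.exists_wheel hH hv h2 hz hvz
    exact hw ⟨s, m, t, n, v, h⟩
  obtain ⟨x, hx⟩ := (Set.ne_univ_iff_exists_notMem H).1 h1
  have hK : ¬ ∀ y ∈ H, ∀ z ∈ H, y ≠ z → Att G y (comp G Hᶜ x) → Att G z (comp G Hᶜ x) → G.Adj y z := by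
    intro hK
    refine hs (cliqueSep_of_comp hx hK ?_)
    by_contra hall
    push Not at hall
    obtain ⟨a, ha, b, hb, hab, hn⟩ := hH.exists_pair
    exact hn (hK a ha b hb hab (hall a ha) (hall b hb))
  push Not at hK
  obtain ⟨z, hz, z', hz', hne, ha, ha', hadj⟩ := hK
  obtain ⟨p, k, z₁, z₂, hp, hpD, h1, h2, h12, hn12, e1, e2, hk⟩ :=
    exists_attachment_path F.tri (comp_conn _ _) hz hz' hne hadj ha ha'
  have hpH : ∀ i ≤ k, p i ∉ H := fun i hi => comp_subset (hpD i hi)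
  by_cases hk0 : k = 0
  · subst hk0
    exact no_two hH (hpH 0 le_rfl) ⟨z₁, h1, z₂, h2, h12, e1, e2⟩
  obtain ⟨q1, q2, q3, q4⟩ := hk hk0
  have hne' : ∀ {w}, w ∈ H → ∀ i ≤ k, w ≠ p i := fun hw i hi e => hpH i hi (e ▸ hw)
  have hint : ∀ i ≤ k, ∀ w ∈ H, w ≠ z₁ → w ≠ z₂ → G.Adj (p i) w → G.Adj w z₁ ∧ G.Adj w z₂ := by
    intro i hi w hw hw1 hw2 e
    refine q3 i (Nat.pos_of_ne_zero fun h => ?_) (lt_of_le_of_ne hi fun h => ?_) w hw e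
    · subst h; exact hw1 (q1 _ hw e)
    · subst h; exact hw2 (q2 _ hw e)
  have z₁p : ∀ i ≤ k, G.Adj z₁ (p i) → i = 0 := by
    intro i hi e
    by_contra hi0
    by_cases hik : i = k
    · subst hik; exact h12 (q2 _ h1 e.symm)
    · exact G.loopless.irrefl _ (q3 i (by omega) (by omega) z₁ h1 e.symm).1
  have z₂p : ∀ i ≤ k, G.Adj z₂ (p i) → i = k := by
    intro i hi e
    by_contra hik
    by_cases hi0 : i = 0
    · subst hi0; exact h12 (q1 _ h2 e.symm).symm
    · exact G.loopless.irrefl _ (q3 i (by omega) (by omega) z₂ h2 e.symm).2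
  have hP := hp.extend h12 hn12 (fun i hi => ⟨hne' h1 i hi, z₁p i hi, fun e => e ▸ e1.symm⟩)
    (fun i hi => ⟨hne' h2 i hi, z₂p i hi, fun e => e ▸ e2.symm⟩)
  obtain ⟨s, m, t, n, hT, rfl, rfl, rfl⟩ := hH.exists_twoPaths h1 h2 h12 hn12
  have hm := hT.hm
  have hn := hT.hn
  by_cases hc : ∃ i ≤ k, ∃ w ∈ seg s 0 m ∪ seg t 0 n, w ≠ s 0 ∧ w ≠ s m ∧ G.Adj (p i) w
  · obtain ⟨i, hi, c, hc, hc1, hc2, e⟩ := hc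
    have hcz := hint i hi c hc hc1 hc2 e
    -- the side of the hole that avoids `c`
    have key : ∀ (t : ℕ → V) (n : ℕ), 2 ≤ n → IsP G t n →
        t 0 = s 0 → t n = s m → c ∉ seg t 0 n → (∀ j, 0 < j → j < n → ∀ i ≤ k, t j ≠ p i ∧
          ¬ G.Adj (p i) (t j)) → False := by
      intro t n hn ht ht0 htn hct hfar
      have hT' : TwoPaths G t n (fun i => if i = 0 then s 0 else if i ≤ k + 1 then p (i - 1) else s m)
          (k + 2) := by
        refine ⟨hn, by omega, ht, hP, by simpa using ht0, by simpa using htn, fun j i hj hj' hi hi' => ?_⟩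
        rw [if_neg (by omega), if_pos (by omega)]
        have := hfar j hj hj' (i - 1) (by omega)
        exact ⟨this.1, fun e => this.2 e.symm⟩
      refine no_two hT'.holeSet (v := c) ?_ ⟨s 0, ?_, s m, ?_, h12, hcz⟩
      · rintro (h | ⟨i, _, hi, e⟩)
        · exact hct h
        · dsimp only at e
          split_ifs at e
          · exact hc1 e.symm
          · exact hne' hc _ (by omega) e.symm
          · exact hc2 e.symm
      · exact Or.inl ⟨0, by omega, by omega, ht0⟩
      · exact Or.inl ⟨n, by omega, by omega, htn⟩
    have hcu : ∀ i ≤ k, ∀ w ∈ seg s 0 m ∪ seg t 0 n, w ≠ s 0 → w ≠ s m → w ≠ c → w ≠ p i ∧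
        ¬ G.Adj (p i) w := by
      intro j hj w hw hw1 hw2 hwc
      refine ⟨hne' hw j hj, fun e' => hwc ?_⟩
      have range : ∀ l ≤ k, ∀ w ∈ seg s 0 m ∪ seg t 0 n, w ≠ s 0 → w ≠ s m → G.Adj (p l) w →
          0 < l ∧ l < k := by
        intro l hl w hw hw1 hw2 e
        refine ⟨Nat.pos_of_ne_zero fun h => ?_, lt_of_le_of_ne hl fun h => ?_⟩
        · subst h; exact hw1 (q1 _ hw e)
        · subst h; exact hw2 (q2 _ hw e)
      have r1 := range j hj w hw hw1 hw2 e'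
      have r2 := range i hi c hc hc1 hc2 e
      exact q4 j i r1.1 r1.2 r2.1 r2.2 w hw c hc e' e
    by_cases hct : c ∈ seg t 0 n
    · refine key s m hm hT.hs rfl rfl ?_ ?_
      · rintro ⟨a, _, ha, rfl⟩
        obtain ⟨b, _, hb, e⟩ := hct
        have := hT.eq ha hb e.symm
        rcases this with ⟨rfl, _⟩ | ⟨rfl, _⟩
        · exact hc1 rfl
        · exact hc2 rfl
      · intro j hj hj' i hi
        refine hcu i hi _ (Or.inl (seg_mem (by omega) hj'.le)) ?_ ?_ ?_
        · rw [ne_eq, hT.hs.inj hj'.le (by omega)]; omega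
        · rw [ne_eq, hT.hs.inj hj'.le (by omega)]; omega
        · rintro rfl
          obtain ⟨b, _, hb, e⟩ := hct
          have := hT.eq hj'.le hb e.symm
          omega
    · refine key t n hn hT.ht hT.first.symm hT.last.symm hct ?_
      intro j hj hj' i hi
      refine hcu i hi _ (Or.inr (seg_mem (by omega) hj'.le)) ?_ ?_ ?_
      · rw [hT.first, ne_eq, hT.ht.inj hj'.le (by omega)]; omega
      · rw [hT.last, ne_eq, hT.ht.inj hj'.le (by omega)]; omega
      · rintro rfl
        exact hct (seg_mem (by omega) hj'.le)
  · push Not at hc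
    refine hT.theta F.theta (hp.conn (i := 0) le_rfl) (att_seg 0 le_rfl (by omega) e1.symm)
      (att_seg k (by omega) le_rfl e2.symm) (anti_seg_seg fun a b ha ha' _ hb => ?_)
      (anti_seg_seg fun a b ha ha' _ hb => ?_)
    · refine ⟨hne' (Or.inl (seg_mem (by omega) (by omega))) b hb, fun e => hc b hb _
        (Or.inl (seg_mem (by omega) (by omega : a ≤ m))) ?_ ?_ e.symm⟩
      · rw [ne_eq, hT.hs.inj (by omega) (by omega)]; omega
      · rw [ne_eq, hT.hs.inj (by omega) (by omega)]; omega
    · refine ⟨hne' (Or.inr (seg_mem (by omega) (by omega))) b hb, fun e => hc b hb _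
        (Or.inr (seg_mem (by omega) (by omega : a ≤ n))) ?_ ?_ e.symm⟩
      · rw [hT.first, ne_eq, hT.ht.inj (by omega) (by omega)]; omega
      · rw [hT.last, ne_eq, hT.ht.inj (by omega) (by omega)]; omega

end

/-! ### Full petals -/

/-- The path `t 1, …, t (n - 1)` lies outside `C`, its ends are attached to two neighbours `t 0` and
`t n` of `v` in `C`, and its only other neighbour is `v`: it is a petal centred at `v` that is a
whole component of the complement of `C`. -/
structure FullPetal {V : Type*} (G : SimpleGraph V) (C : Set V) (v : V) (t : ℕ → V) (n : ℕ) : Prop where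
  hn : 2 ≤ n
  ht : IsP G t n
  first_mem : t 0 ∈ C
  last_mem : t n ∈ C
  va : G.Adj v (t 0)
  vb : G.Adj v (t n)
  out : ∀ j, 0 < j → j < n → t j ∉ C
  iso : ∀ j, 0 < j → j < n → ∀ x, G.Adj (t j) x → x ∈ seg t 0 n ∨ x = v

/-- The centres of the full petals of `C`. -/
def centres {V : Type*} (G : SimpleGraph V) (C : Set V) : Set V :=
  {v | v ∈ C ∧ ∃ t n, FullPetal G C v t n}

/-- A graph without the forbidden induced subgraphs that cannot be decomposed along a clique or along
a path on three vertices, and is not the cube. -/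
structure Indecomposable {V : Type*} (G : SimpleGraph V) : Prop where
  free : Free G
  cube : IsEmpty (cubeGraph ↪g G)
  clique : ¬ CliqueSep G
  p3 : ¬ P3Sep G

section
variable {V : Type*} {G : SimpleGraph V} {s t : ℕ → V} {m n : ℕ} {v : V} {C : Set V}

theorem HoleSet.exists_arc (hC : HoleSet G C) {a b : V} (hv : v ∈ C) (ha : a ∈ C) (hb : b ∈ C)
    (hab : a ≠ b) (va : G.Adj v a) (vb : G.Adj v b) :
    ∃ s m, 2 ≤ m ∧ IsP G s m ∧ s 0 = a ∧ s m = b ∧ C = insert v (seg s 0 m) ∧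
      ∀ i ≤ m, v ≠ s i ∧ (G.Adj v (s i) ↔ i = 0 ∨ i = m) := by
  obtain ⟨h, N, hh, rfl, rfl⟩ := hC.exists_first hv
  obtain ⟨i, hi, rfl⟩ := ha
  obtain ⟨j, hj, rfl⟩ := hb
  have hN := hh.1
  have hij : i ≠ j := fun e => hab (by rw [e])
  rw [hh.adj_iff (by omega) (by omega)] at va vb
  have hset : {x | ∃ k < N, h k = x} = insert (h 0) (seg (fun k => h (k + 1)) 0 (N - 2)) := by
    ext x
    constructor
    · rintro ⟨k, hk, rfl⟩
      by_cases h0 : k = 0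
      · exact Or.inl (by rw [h0])
      · exact Or.inr ⟨k - 1, by omega, by omega, congrArg h (by omega)⟩
    · rintro (rfl | ⟨k, _, hk, rfl⟩)
      · exact ⟨0, by omega, rfl⟩
      · exact ⟨k + 1, by omega, rfl⟩
  have hadj : ∀ k ≤ N - 2, h 0 ≠ h (k + 1) ∧ (G.Adj (h 0) (h (k + 1)) ↔ k = 0 ∨ k = N - 2) := by
    intro k hk
    rw [hh.adj_iff (by omega) (by omega), ne_eq, hh.inj (by omega) (by omega)]
    omega
  obtain ⟨rfl, rfl⟩ | ⟨rfl, rfl⟩ : (i = 1 ∧ j = N - 1) ∨ (j = 1 ∧ i = N - 1) := by omega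
  · exact ⟨fun k => h (k + 1), N - 2, by omega, hh.isP, rfl, congrArg h (by omega), hset, hadj⟩
  · refine ⟨fun k => h (N - 2 - k + 1), N - 2, by omega, hh.isP.rev, congrArg h (by omega),
      congrArg h (by omega), ?_, fun k hk => ?_⟩
    · have := seg_rev (p := fun k => h (k + 1)) (Nat.zero_le (N - 2)) le_rfl
      simp only [Nat.sub_self, Nat.sub_zero] at this
      rw [this, hset]
    · have := hadj (N - 2 - k) (by omega)
      refine ⟨this.1, this.2.trans (by omega)⟩

theorem FullPetal.ne_ends (h : FullPetal G C v t n) : t 0 ≠ t n := by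
  have := h.hn
  rw [ne_eq, h.ht.inj (by omega) le_rfl]
  omega

/-- The neighbours in `C` of an internal vertex of a full petal. -/
theorem FullPetal.eq_of_adj (h : FullPetal G C v t n) {j : ℕ} (h0 : 0 < j) (hj : j < n) {x : V}
    (hx : x ∈ C) (e : G.Adj (t j) x) : x = t 0 ∨ x = t n ∨ x = v := by
  rcases h.iso j h0 hj x e with ⟨l, _, hl, rfl⟩ | rfl
  · by_cases hl0 : l = 0
    · exact Or.inl (by rw [hl0])
    by_cases hln : l = n
    · exact Or.inr (Or.inl (by rw [hln]))
    · exact absurd hx (h.out l (by omega) (by omega))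
  · exact Or.inr (Or.inr rfl)

/-- A hole and one of its full petals, whose centre `v` is removed from the hole, form a wheel with centre `v`. -/
theorem FullPetal.exists_wheel (h : FullPetal G C v t n) (hC : HoleSet G C) (hv : v ∈ C) :
    ∃ s m, Wheel G s m t n v ∧ C = insert v (seg s 0 m) := by
  obtain ⟨s, m, hm, hs, h0, hl, hset, hadj⟩ := hC.exists_arc hv h.first_mem h.last_mem h.ne_ends h.va h.vb
  have hsC : ∀ i ≤ m, s i ∈ C := fun i hi => by rw [hset]; exact Or.inr (seg_mem (Nat.zero_le _) hi)
  refine ⟨s, m, ⟨⟨hm, h.hn, hs, h.ht, h0, hl, fun i j hi hi' hj hj' => ⟨?_, fun e => ?_⟩⟩,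
    h0 ▸ h.va, hl ▸ h.vb, ?_, ?_, ?_⟩, hset⟩
  · exact fun e => h.out j hj hj' (e ▸ hsC i hi'.le)
  · rcases h.eq_of_adj hj hj' (hsC i hi'.le) e.symm with e | e | e
    · rw [← h0, hs.inj hi'.le (by omega)] at e; omega
    · rw [← hl, hs.inj hi'.le (by omega)] at e; omega
    · exact (hadj i hi'.le).1 e.symm
  · intro i hi hi' e
    have := (hadj i hi'.le).2.1 e
    omega
  · exact fun i hi => (hadj i hi).1
  · intro j hj e
    by_cases hj0 : j = 0
    · subst hj0; exact h.va.ne e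
    by_cases hjn : j = n
    · subst hjn; exact h.vb.ne e
    · exact h.out j (by omega) (by omega) (e ▸ hv)

theorem Wheel.fullPetal (h : Wheel G s m t n v)
    (iso : ∀ j, 0 < j → j < n → ∀ x, G.Adj (t j) x → x ∈ seg t 0 n ∨ x = v) :
    FullPetal G (insert v (seg s 0 m)) v t n := by
  refine ⟨h.hn, h.ht, Or.inr ⟨0, by omega, by omega, h.first⟩, Or.inr ⟨m, by omega, le_rfl, h.last⟩,
    h.first ▸ h.va, h.last ▸ h.vb, ?_, iso⟩
  rintro j h0 hj (e | ⟨i, _, hi, e⟩)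
  · exact h.nt j hj.le e.symm
  · have := h.eq hi hj.le e; omega

/-- If something outside the wheel is joined to the inside of `s`, then nothing outside is joined to
the inside of `t`, for otherwise there is a separator formed by the ends and the centre. -/
theorem Wheel.iso_second (h : Wheel G s m t n v) (I : Indecomposable G) {D : Set V} (hD : Conn G D)
    (hD' : ∀ x ∈ D, x ∉ ({s 0, s m, v} : Set V)) (hs : ∃ i, 0 < i ∧ i < m ∧ s i ∈ D)
    (hx : ∃ x ∈ D, x ∉ seg s 0 m) :
    ∀ j, 0 < j → j < n → ∀ x, G.Adj (t j) x → x ∈ seg t 0 n ∨ x = v := by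
  have hm := h.hm
  have hn := h.hn
  set U : Set V := ({s 0, s m, v} : Set V)ᶜ with hU
  have hXU := comp_subset (G := G) (U := U) (x := s 1)
  have hsU : ∀ i, 0 < i → i < m → s i ∈ U := by
    rintro i hi hi' (e | e | e)
    · rw [h.hs.inj hi'.le (by omega)] at e; omega
    · rw [h.hs.inj hi'.le (by omega)] at e; omega
    · exact h.ns i hi'.le e.symm
  have htU : ∀ j, 0 < j → j < n → t j ∈ U := by
    rintro j hj hj' (e | e | e)
    · rw [h.first, h.ht.inj hj'.le (by omega)] at e; omega
    · rw [h.last, h.ht.inj hj'.le (by omega)] at e; omega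
    · exact h.nt j hj'.le e.symm
  have hsX : ∀ i, 0 < i → i < m → s i ∈ comp G U (s 1) := by
    intro i hi hi'
    refine subset_comp (h.hs.conn (i := 1) (j := m - 1) (by omega)) ?_
      ⟨_, seg_mem le_rfl (by omega), mem_comp (hsU 1 (by omega) (by omega))⟩ (seg_mem hi (by omega))
    rintro _ ⟨k, hk, hk', rfl⟩
    exact hsU k hk (by omega)
  have htX : ∀ j, 0 < j → j < n → t j ∉ comp G U (s 1) := by
    intro j hj hj' hmem
    exact h.separated I.free I.cube (comp_conn U (s 1)) (fun e => hXU e (by simp))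
      (fun e => hXU e (by simp)) (fun e => hXU e (by simp)) ⟨1, by omega, by omega, hsX 1 (by omega)
      (by omega)⟩ ⟨j, hj, hj', hmem⟩
  obtain ⟨i, hi, hi', hiD⟩ := hs
  have hDX := subset_comp hD (fun x hx => hD' x hx : D ⊆ U) ⟨_, hiD, hsX i hi hi'⟩
  have hY : ∀ y ∈ U, y ∉ comp G U (s 1) → y ∈ seg t 0 n := by
    intro y hy hyX
    by_contra hyt
    obtain ⟨x, hx, hxs⟩ := hx
    refine I.p3 ⟨s, m, t, n, v, comp G U (s 1), {y | y ∈ U ∧ y ∉ comp G U (s 1)}, h,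
      ⟨?_, ⟨_, hsX 1 (by omega) (by omega)⟩, ⟨y, hy, hyX⟩, ?_, fun x hx => hXU hx, fun x hx => hx.1⟩,
      hsX, fun j hj hj' => ⟨htU j hj hj', htX j hj hj'⟩, ⟨x, hDX hx, hxs⟩, ⟨y, ⟨hy, hyX⟩, hyt⟩⟩
    · rintro x hx z ⟨hz, hzX⟩
      exact ⟨fun e => hzX (e ▸ hx), fun e => hzX (comp_closed hx hz e)⟩
    · intro x
      by_cases h1 : x ∈ comp G U (s 1)
      · exact Or.inl h1
      by_cases h2 : x ∈ U
      · exact Or.inr (Or.inl ⟨h2, h1⟩)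
      · exact Or.inr (Or.inr (not_not.1 h2))
  intro j hj hj' x e
  by_cases hxU : x ∈ U
  · refine Or.inl (hY x hxU fun hxX => htX j hj hj' (comp_closed hxX (htU j hj hj') e.symm))
  · rcases not_not.1 hxU with rfl | rfl | rfl
    · exact Or.inl ⟨0, le_rfl, by omega, h.first.symm⟩
    · exact Or.inl ⟨n, by omega, le_rfl, h.last.symm⟩
    · exact Or.inr rfl

/-- The counterpart of `Wheel.iso_second` with the two sides exchanged. -/
theorem Wheel.iso_first (h : Wheel G s m t n v) (I : Indecomposable G) {D : Set V} (hD : Conn G D)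
    (hD' : ∀ x ∈ D, x ∉ ({s 0, s m, v} : Set V)) (hs : ∃ j, 0 < j ∧ j < n ∧ t j ∈ D)
    (hx : ∃ x ∈ D, x ∉ seg t 0 n) :
    ∀ i, 0 < i → i < m → ∀ x, G.Adj (s i) x → x ∈ seg s 0 m := by
  have hm := h.hm
  have hn := h.hn
  intro i hi hi' y e
  by_contra hy
  refine absurd (h.iso_second I (D := {y} ∪ seg s 1 (m - 1)) ((h.hs.conn (by omega)).insert_seg i hi
    (by omega) e.symm) ?_ ⟨i, hi, hi', Or.inr (seg_mem hi (by omega))⟩ ⟨y, Or.inl rfl, hy⟩) ?_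
  · rintro x (rfl | ⟨k, hk, hk', rfl⟩)
    · rintro (rfl | rfl | rfl)
      · exact hy (seg_mem le_rfl (by omega))
      · exact hy (seg_mem (by omega) le_rfl)
      · exact h.vs i hi hi' e.symm
    · rintro (e | e | e)
      · rw [h.hs.inj (by omega) (by omega)] at e; omega
      · rw [h.hs.inj (by omega) (by omega)] at e; omega
      · exact h.ns k (by omega) e.symm
  · intro iso
    obtain ⟨j, hj, hj', hjD⟩ := hs
    obtain ⟨x, hxD, hx⟩ := hx
    refine hx ?_
    have : D ⊆ seg t 0 n := by
      refine hD _ ⟨_, hjD, seg_mem (Nat.zero_le _) hj'.le⟩ ?_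
      rintro _ hkD ⟨k, _, hk, rfl⟩ z hzD ez
      by_cases hk0 : k = 0
      · subst hk0; exact absurd (Or.inl h.first.symm) (hD' _ hkD)
      by_cases hkn : k = n
      · subst hkn; exact absurd (Or.inr (Or.inl h.last.symm)) (hD' _ hkD)
      · exact (iso k (by omega) (by omega) z ez).resolve_right fun e =>
          hD' z hzD (Or.inr (Or.inr e))
    exact this hxD

/-- A component outside a set `B` that is not a clique is attached to two nonadjacent vertices of `B`. -/
theorem Indecomposable.exists_attachments (I : Indecomposable G) {B : Set V}
    (hB : ∃ a ∈ B, ∃ b ∈ B, a ≠ b ∧ ¬ G.Adj a b) {x : V} (hx : x ∉ B) :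
    ∃ z ∈ B, ∃ z' ∈ B, z ≠ z' ∧ ¬ G.Adj z z' ∧ Att G z (comp G Bᶜ x) ∧ Att G z' (comp G Bᶜ x) := by
  by_contra hcon
  push Not at hcon
  have hK : ∀ y ∈ B, ∀ z ∈ B, y ≠ z → Att G y (comp G Bᶜ x) → Att G z (comp G Bᶜ x) → G.Adj y z := by
    intro y hy z hz hne h1 h2
    by_contra hn
    exact hcon y hy z hz hne hn h1 h2
  refine I.clique (cliqueSep_of_comp hx hK ?_)
  by_contra hall
  push Not at hall
  obtain ⟨a, ha, b, hb, hab, hn⟩ := hB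
  exact hn (hK a ha b hb hab (hall a ha) (hall b hb))

/-- If there is a wheel, then some hole has a full petal. -/
theorem Indecomposable.exists_centre (I : Indecomposable G) (h : Wheel G s m t n v) :
    ∃ C, HoleSet G C ∧ (centres G C).Nonempty := by
  have F := I.free
  suffices ∃ s m t n, Wheel G s m t n v ∧ ∀ j, 0 < j → j < n → ∀ x, G.Adj (t j) x → x ∈ seg t 0 n ∨ x = v by
    obtain ⟨s, m, t, n, h, iso⟩ := this
    exact ⟨_, h.holeSet_sector, v, Or.inl rfl, t, n, h.fullPetal iso⟩
  by_cases hall : ∀ x, x ∈ insert v (seg s 0 m ∪ seg t 0 n)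
  · refine ⟨s, m, t, n, h, fun j hj hj' x e => ?_⟩
    rcases hall x with rfl | ⟨i, _, hi, rfl⟩ | hx
    · exact Or.inr rfl
    · have := h.adj hi hj'.le e.symm
      obtain rfl | rfl : i = 0 ∨ i = m := by omega
      · exact Or.inl ⟨0, le_rfl, by omega, h.first.symm⟩
      · exact Or.inl ⟨n, by omega, le_rfl, h.last.symm⟩
    · exact Or.inl hx
  push Not at hall
  obtain ⟨x, hx⟩ := hall
  set H := seg s 0 m ∪ seg t 0 n with hH
  have hHole := h.holeSet
  rw [← hH] at hHole
  have hDsub := comp_subset (G := G) (U := (insert v H)ᶜ) (x := x)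
  have hDconn := comp_conn (G := G) (insert v H)ᶜ x
  set D := comp G (insert v H)ᶜ x with hDdef
  have hDH : ∀ y ∈ D, y ∉ H := fun y hy hyH => hDsub hy (Or.inr hyH)
  have hDv : ∀ y ∈ D, y ≠ v := fun y hy e => hDsub hy (Or.inl e)
  obtain ⟨z, hzH, hvz, hzD⟩ : ∃ z ∈ H, ¬ G.Adj v z ∧ Att G z D := by
    by_contra hcon
    push Not at hcon
    have hcon' : ∀ z ∈ H, Att G z D → G.Adj v z := by
      intro z hz ha
      by_contra hn
      exact hcon z hz hn ha
    obtain ⟨z, hz, z', hz', hne, hn, ha, ha'⟩ := I.exists_attachments (B := insert v H) (by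
      obtain ⟨a, ha, b, hb, hab⟩ := hHole.exists_pair
      exact ⟨a, Or.inr ha, b, Or.inr hb, hab⟩) hx
    have hzH : z ∈ H := by
      rcases hz with rfl | hz
      · exact absurd (hcon' z' (hz'.resolve_left fun e => hne e.symm) ha') hn
      · exact hz
    have hzH' : z' ∈ H := by
      rcases hz' with rfl | hz'
      · exact absurd (hcon' z hzH ha).symm hn
      · exact hz'
    obtain ⟨p, k, z₁, z₂, hp, hpD, h1, h2, h12, hn12, e1, e2, hk⟩ :=
      exists_attachment_path F.tri hDconn hzH hzH' hne hn ha ha'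
    have hvp : ∀ i ≤ k, ∀ w ∈ H, G.Adj (p i) w → G.Adj v w :=
      fun i hi w hw e => hcon' w hw ⟨p i, hpD i hi, e.symm⟩
    by_cases hk0 : k = 0
    · subst hk0
      have h0 := hpD 0 le_rfl
      obtain ⟨a, ha, b, hb, c, hc, hab, hac, hbc, ea, eb, ec⟩ := F.three hHole (hDH _ h0)
        ⟨z₁, h1, z₂, h2, h12, e1, e2⟩
      have va := hvp 0 le_rfl a ha ea
      have vb := hvp 0 le_rfl b hb eb
      have vc := hvp 0 le_rfl c hc ec
      exact F.theta.elim (p 0) v {a} {b} {c} (hDv _ h0) (fun e => F.tri _ _ _ e.symm va ea)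
        (conn_singleton _) (conn_singleton _) (conn_singleton _)
        (att_single ea) (att_single eb) (att_single ec)
        (att_single va) (att_single vb) (att_single vc)
        (anti_single_single ⟨hab, F.tri _ _ _ ea eb⟩) (anti_single_single ⟨hac, F.tri _ _ _ ea ec⟩)
        (anti_single_single ⟨hbc, F.tri _ _ _ eb ec⟩)
    · obtain ⟨q1, q2, q3, -⟩ := hk hk0
      have far : ∀ w ∈ H, w ≠ z₁ → w ≠ z₂ → ∀ i ≤ k, w ≠ p i ∧ ¬ G.Adj w (p i) := by
        intro w hw hw1 hw2 i hi
        refine ⟨fun e => hDH _ (hpD i hi) (e ▸ hw), fun e => ?_⟩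
        have hi0 : i ≠ 0 := by rintro rfl; exact hw1 (q1 w hw e.symm)
        have hik : i ≠ k := by rintro rfl; exact hw2 (q2 w hw e.symm)
        have := q3 i (by omega) (by omega) w hw e.symm
        exact F.tri _ _ _ (hvp i hi w hw e.symm) (hvp 0 (by omega) z₁ h1 e1) this.1
      obtain ⟨s', m', t', n', hT, rfl, rfl, hset⟩ := hHole.exists_twoPaths h1 h2 h12 hn12
      have hm' := hT.hm
      have hn' := hT.hn
      refine hT.theta F.theta (hp.conn (i := 0) le_rfl) (att_seg 0 le_rfl (by omega) e1.symm)
        (att_seg k (by omega) le_rfl e2.symm) (anti_seg_seg fun a b ha ha' _ hb => far _ ?_ ?_ ?_ b hb)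
        (anti_seg_seg fun a b ha ha' _ hb => far _ ?_ ?_ ?_ b hb)
      · rw [hset]; exact Or.inl (seg_mem (by omega) (by omega))
      · rw [ne_eq, hT.hs.inj (by omega) (by omega)]; omega
      · rw [ne_eq, hT.hs.inj (by omega) (by omega)]; omega
      · rw [hset]; exact Or.inr (seg_mem (by omega) (by omega))
      · rw [hT.first, ne_eq, hT.ht.inj (by omega) (by omega)]; omega
      · rw [hT.last, ne_eq, hT.ht.inj (by omega) (by omega)]; omega
  obtain ⟨s', m', t', n', h', hset, i, hi, hi', rfl⟩ :=
    F.exists_wheel hHole h.v_notMem h.two_v hzH hvz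
  have hm' := h'.hm
  obtain ⟨y, hyD, ey⟩ := hzD
  refine ⟨s', m', t', n', h', h'.iso_second I (D := seg s' 1 (m' - 1) ∪ D)
    ((h'.hs.conn (by omega)).union hDconn ⟨_, seg_mem hi (by omega), y, hyD, Or.inr ey⟩) ?_
    ⟨i, hi, hi', Or.inl (seg_mem hi (by omega))⟩ ⟨y, Or.inr hyD, fun hy => hDH y hyD ?_⟩⟩
  · rintro w (⟨k, hk, hk', rfl⟩ | hw)
    · rintro (e | e | e)
      · rw [h'.hs.inj (by omega) (by omega)] at e; omega
      · rw [h'.hs.inj (by omega) (by omega)] at e; omega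
      · exact h'.ns k (by omega) e.symm
    · rintro (rfl | rfl | rfl)
      · exact hDH _ hw (hset ▸ Or.inl (seg_mem le_rfl (by omega)))
      · exact hDH _ hw (hset ▸ Or.inl (seg_mem (by omega) le_rfl))
      · exact hDv _ hw rfl
  · rw [hset]; exact Or.inl hy

end

/-! ### Holes with the maximum number of centres -/

section
variable {V : Type*} {G : SimpleGraph V} {s t : ℕ → V} {m n : ℕ} {v : V} {C : Set V}

theorem FullPetal.ne_of_two (h : FullPetal G C v t n) (F : Free G) (hC : HoleSet G C) (hv : v ∈ C) {u : V}
    (h2 : Two G u C) {j : ℕ} (hj : 0 < j) (hj' : j < n) : u ≠ t j := by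
  rintro rfl
  obtain ⟨s, m, hw, hset⟩ := h.exists_wheel hC hv
  have key : G.Adj (t j) v → ∀ y ∈ C, G.Adj (t j) y → y = v := by
    intro e y hy ey
    rcases h.eq_of_adj hj hj' hy ey with rfl | rfl | rfl
    · exact absurd h.va (F.tri _ _ _ e ey)
    · exact absurd h.vb (F.tri _ _ _ e ey)
    · rfl
  obtain ⟨x, hx, y, hy, hxy, ex, ey⟩ := h2
  have hvj : ¬ G.Adj (t j) v := fun e => hxy ((key e x hx ex).trans (key e y hy ey).symm)
  have ends : ∀ x ∈ C, G.Adj (t j) x → x = t 0 ∨ x = t n := by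
    intro x hx e
    rcases h.eq_of_adj hj hj' hx e with e' | e' | rfl
    · exact Or.inl e'
    · exact Or.inr e'
    · exact absurd e hvj
  have h0n : G.Adj (t j) (t 0) ∧ G.Adj (t j) (t n) := by
    rcases ends x hx ex with rfl | rfl <;> rcases ends y hy ey with rfl | rfl
    · exact absurd rfl hxy
    · exact ⟨ex, ey⟩
    · exact ⟨ey, ex⟩
    · exact absurd rfl hxy
  rw [h.ht.adj_iff (by omega) (by omega), h.ht.adj_iff (by omega) (by omega)] at h0n
  obtain ⟨l, hl, hl', e⟩ := hw.exists_vt F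
  obtain rfl : l = j := by omega
  exact hvj e.symm

/-- A vertex with two neighbours in `C` is not adjacent to a centre of a full petal. -/
theorem FullPetal.not_adj_of_two (h : FullPetal G C v t n) (F : Free G) (hC : HoleSet G C) (hv : v ∈ C)
    {u : V} (hu : u ∉ C) (h2 : Two G u C) : ¬ G.Adj u v := by
  intro e
  obtain ⟨s, m, hw, hset⟩ := h.exists_wheel hC hv
  have huH : u ∉ seg s 0 m ∪ seg t 0 n := by
    rintro (h' | ⟨j, _, hj, rfl⟩)
    · exact hu (hset ▸ Or.inr h')
    · by_cases hj0 : j = 0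
      · subst hj0; exact hu h.first_mem
      by_cases hjn : j = n
      · subst hjn; exact hu h.last_mem
      · exact h.ne_of_two F hC hv h2 (j := j) (by omega) (by omega) rfl
  have key : ∀ y ∈ C, G.Adj u y → y = v := by
    intro y hy ey
    rw [hset] at hy
    exact hy.resolve_right fun hy => hw.no_adj_of_adj_v F huH e (Or.inl hy) ey
  obtain ⟨x, hx, y, hy, hxy, ex, ey⟩ := h2
  exact hxy ((key x hx ex).trans (key y hy ey).symm)

/-- If the hole `C` has the maximum number of centres, then no other vertex has two neighbours in
`C`, since replacing a side of `C` by that vertex would give a new centre and keep the old ones. -/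
theorem Indecomposable.not_two [Finite V] (I : Indecomposable G) (hC : HoleSet G C)
    (hne : (centres G C).Nonempty)
    (hmax : ∀ C', HoleSet G C' → (centres G C').ncard ≤ (centres G C).ncard) {u : V} (hu : u ∉ C) :
    ¬ Two G u C := by
  intro h2
  have F := I.free
  obtain ⟨v₀, hv₀, t₀, n₀, h₀⟩ := hne
  obtain ⟨s, m, t, n, h, hset, i₀, hi₀, hi₀', rfl⟩ := F.exists_wheel hC hu h2 hv₀
    (h₀.not_adj_of_two F hC hv₀ hu h2)
  have hm := h.hm
  have hsC : ∀ i ≤ m, s i ∈ C := fun i hi => hset ▸ Or.inl (seg_mem (Nat.zero_le _) hi)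
  have hn₀ := h₀.hn
  obtain ⟨_, _, hw₀, -⟩ := h₀.exists_wheel hC hv₀
  obtain ⟨l, hl, hl', el⟩ := hw₀.exists_vt F
  have iso := h.iso_second I (D := seg s 1 (m - 1) ∪ seg t₀ 1 (n₀ - 1))
    ((h.hs.conn (by omega)).union (h₀.ht.conn (by omega)) ⟨_, seg_mem hi₀ (by omega), _,
      seg_mem hl (by omega), Or.inr el⟩) (by
      rintro w (⟨k, hk, hk', rfl⟩ | ⟨k, hk, hk', rfl⟩)
      · rintro (e | e | e)
        · rw [h.hs.inj (by omega) (by omega)] at e; omega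
        · rw [h.hs.inj (by omega) (by omega)] at e; omega
        · exact h.ns k (by omega) e.symm
      · rintro (e | e | e)
        · exact h₀.out k (by omega) (by omega) (e ▸ hsC 0 (by omega))
        · exact h₀.out k (by omega) (by omega) (e ▸ hsC m le_rfl)
        · exact h₀.ne_of_two F hC hv₀ h2 (by omega) (by omega) e.symm)
    ⟨i₀, hi₀, hi₀', Or.inl (seg_mem hi₀ (by omega))⟩
    ⟨_, Or.inr (seg_mem le_rfl (by omega)), fun hmem => h₀.out 1 (by omega) (by omega)
      (hset ▸ Or.inl hmem)⟩
  have hsub : centres G C ⊆ centres G (insert u (seg s 0 m)) := by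
    rintro v ⟨hv, t', n', h'⟩
    have huv := h'.not_adj_of_two F hC hv hu h2
    obtain ⟨_, _, hw', -⟩ := h'.exists_wheel hC hv
    obtain ⟨l, hl, hl', el⟩ := hw'.exists_vt F
    obtain ⟨i, hi, hi', rfl⟩ : ∃ i, 0 < i ∧ i < m ∧ s i = v := by
      have hv' := hv
      rw [hset] at hv'
      rcases hv' with ⟨i, _, hi, rfl⟩ | ⟨j, _, hj, rfl⟩
      · refine ⟨i, Nat.pos_of_ne_zero ?_, lt_of_le_of_ne hi ?_, rfl⟩
        · rintro rfl; exact huv h.va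
        · rintro rfl; exact huv h.vb
      · exfalso
        have hj0 : j ≠ 0 := by rintro rfl; exact huv (h.first ▸ h.va)
        have hjn : j ≠ n := by rintro rfl; exact huv (h.last ▸ h.vb)
        rcases iso j (by omega) (by omega) _ el with hx | hx
        · exact h'.out l hl hl' (hset ▸ Or.inr hx)
        · exact h'.ne_of_two F hC hv h2 hl hl' hx.symm
    have nb : ∀ x ∈ C, G.Adj (s i) x → x ∈ insert u (seg s 0 m) := by
      intro x hx e
      rw [hset] at hx
      rcases hx with hx | ⟨j, _, hj, rfl⟩
      · exact Or.inr hx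
      · have := h.adj hi'.le hj e
        obtain rfl | rfl : j = 0 ∨ j = n := by omega
        · exact Or.inr ⟨0, by omega, by omega, h.first⟩
        · exact Or.inr ⟨m, by omega, le_rfl, h.last⟩
    refine ⟨Or.inr (seg_mem (Nat.zero_le _) hi'.le), t', n', h'.hn, h'.ht, nb _ h'.first_mem h'.va,
      nb _ h'.last_mem h'.vb, h'.va, h'.vb, ?_, h'.iso⟩
    rintro j hj hj' (e | e)
    · exact h'.ne_of_two F hC hv h2 hj hj' e.symm
    · exact h'.out j hj hj' (hset ▸ Or.inl e)
  have hlt : (centres G C).ncard < (centres G (insert u (seg s 0 m))).ncard :=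
    Set.ncard_lt_ncard ⟨hsub, fun hsup => hu (hsup ⟨Or.inl rfl, t, n, h.fullPetal iso⟩).1⟩
      (Set.toFinite _)
  exact absurd (hmax _ h.holeSet_sector) (by omega)

/-- A connected set outside `C` that meets a full petal is contained in it. -/
theorem FullPetal.subset (h : FullPetal G C v t n) (hv : v ∈ C) {D : Set V} (hD : Conn G D)
    (hDC : ∀ x ∈ D, x ∉ C) (hj : ∃ j, 0 < j ∧ j < n ∧ t j ∈ D) : D ⊆ seg t 1 (n - 1) := by
  have hn := h.hn
  obtain ⟨j, hj, hj', hjD⟩ := hj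
  refine hD _ ⟨_, hjD, seg_mem hj (by omega)⟩ ?_
  rintro _ hkD ⟨k, hk, hk', rfl⟩ z hzD ez
  rcases h.iso k (by omega) (by omega) z ez with ⟨l, _, hl, rfl⟩ | rfl
  · have hl0 : l ≠ 0 := by rintro rfl; exact hDC _ hzD h.first_mem
    have hln : l ≠ n := by rintro rfl; exact hDC _ hzD h.last_mem
    exact seg_mem (by omega) (by omega)
  · exact absurd hv (hDC _ hzD)

/-- There is only one petal with a given centre. -/
theorem Wheel.no_second_petal (h : Wheel G s m t n v) (F : Free G) {t₀ : ℕ → V} {n₀ : ℕ}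
    (h₀ : FullPetal G (insert v (seg s 0 m)) v t₀ n₀)
    (hfar : Anti G (seg t 1 (n - 1)) (seg t₀ 1 (n₀ - 1))) : False := by
  have hn₀ := h₀.hn
  have ends : ∀ w ∈ insert v (seg s 0 m), G.Adj v w → w = s 0 ∨ w = s m := by
    rintro w (rfl | ⟨a, _, ha, rfl⟩) e
    · exact absurd rfl e.ne
    · exact ((h.vs_iff ha).1 e).imp (fun h => by rw [h]) fun h => by rw [h]
  have e0 := ends _ h₀.first_mem h₀.va
  have el := ends _ h₀.last_mem h₀.vb
  have a1 : G.Adj (t₀ 0) (t₀ 1) := (h₀.ht.adj_iff (by omega) (by omega)).2 (by omega)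
  have a2 : G.Adj (t₀ n₀) (t₀ (n₀ - 1)) := (h₀.ht.adj_iff (by omega) (by omega)).2 (by omega)
  have a3 : Att G (t₀ 0) (seg t₀ 1 (n₀ - 1)) := att_seg 1 le_rfl (by omega) a1
  have a4 : Att G (t₀ n₀) (seg t₀ 1 (n₀ - 1)) := att_seg _ (by omega) le_rfl a2
  have hatt : Att G (s 0) (seg t₀ 1 (n₀ - 1)) ∧ Att G (s m) (seg t₀ 1 (n₀ - 1)) := by
    rcases e0 with e0 | e0 <;> rcases el with el | el
    · exact absurd (e0.trans el.symm) h₀.ne_ends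
    · exact ⟨e0 ▸ a3, el ▸ a4⟩
    · exact ⟨el ▸ a4, e0 ▸ a3⟩
    · exact absurd (e0.trans el.symm) h₀.ne_ends
  refine h.theta F.theta (h₀.ht.conn (by omega)) hatt.1 hatt.2 (anti_seg_seg fun a b ha ha' hb hb' => ?_)
    hfar
  have haC : s a ∈ insert v (seg s 0 m) := Or.inr (seg_mem (by omega) (by omega))
  refine ⟨fun e => h₀.out b (by omega) (by omega) (e ▸ haC), fun e => ?_⟩
  have : s a = s 0 ∨ s a = s m := by
    rcases h₀.eq_of_adj (by omega) (by omega) haC e.symm with e | e | e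
    · exact e ▸ e0
    · exact e ▸ el
    · exact absurd e.symm (h.ns a (by omega))
  rw [h.hs.inj (by omega) (by omega), h.hs.inj (by omega) (by omega)] at this
  omega

/-- If `C` has the maximum number of centres, then every other vertex belongs to a full petal. -/
theorem Indecomposable.exists_fullPetal [Finite V] (I : Indecomposable G) (hC : HoleSet G C)
    (hne : (centres G C).Nonempty)
    (hmax : ∀ C', HoleSet G C' → (centres G C').ncard ≤ (centres G C).ncard) {x : V} (hx : x ∉ C) :
    ∃ v ∈ C, ∃ t n, FullPetal G C v t n ∧ x ∈ seg t 1 (n - 1) := by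
  have F := I.free
  obtain ⟨z, hz, z', hz', hzz, hnz, ha, ha'⟩ := I.exists_attachments hC.exists_pair hx
  have hDsub := comp_subset (G := G) (U := Cᶜ) (x := x)
  have hDconn := comp_conn (G := G) Cᶜ x
  have hxD := mem_comp (G := G) (U := Cᶜ) hx
  have hDcl := fun y z => comp_closed (G := G) (U := Cᶜ) (x := x) (y := y) (z := z)
  set D := comp G Cᶜ x with hDdef
  obtain ⟨p, k, z₁, z₂, hp, hpD, h1, h2, h12, hn12, e1, e2, hk⟩ :=
    exists_attachment_path F.tri hDconn hz hz' hzz hnz ha ha'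
  have hpC : ∀ i ≤ k, p i ∉ C := fun i hi => hDsub (hpD i hi)
  have hk0 : k ≠ 0 := by
    rintro rfl
    exact I.not_two hC hne hmax (hpC 0 le_rfl) ⟨z₁, h1, z₂, h2, h12, e1, e2⟩
  obtain ⟨q1, q2, q3, q4⟩ := hk hk0
  have nep : ∀ {w}, w ∈ C → ∀ i ≤ k, w ≠ p i := fun hw i hi e => hpC i hi (e ▸ hw)
  have inner : ∀ i ≤ k, ∀ w ∈ C, w ≠ z₁ → w ≠ z₂ → G.Adj (p i) w → 0 < i ∧ i < k := by
    intro i hi w hw hw1 hw2 e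
    refine ⟨Nat.pos_of_ne_zero fun h => ?_, lt_of_le_of_ne hi fun h => ?_⟩
    · subst h; exact hw1 (q1 _ hw e)
    · subst h; exact hw2 (q2 _ hw e)
  -- the vertex that becomes the centre
  obtain ⟨i, hi, c, hcC, hc1, hc2, ec⟩ : ∃ i ≤ k, ∃ c ∈ C, c ≠ z₁ ∧ c ≠ z₂ ∧ G.Adj (p i) c := by
    by_contra hcon
    push Not at hcon
    have far : ∀ w ∈ C, w ≠ z₁ → w ≠ z₂ → ∀ i ≤ k, w ≠ p i ∧ ¬ G.Adj w (p i) :=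
      fun w hw hw1 hw2 i hi => ⟨nep hw i hi, fun e => hcon i hi w hw hw1 hw2 e.symm⟩
    obtain ⟨s', m', t', n', hT, rfl, rfl, hset⟩ := hC.exists_twoPaths h1 h2 h12 hn12
    have hm' := hT.hm
    have hn' := hT.hn
    refine hT.theta F.theta (hp.conn (i := 0) le_rfl) (att_seg 0 le_rfl (by omega) e1.symm)
      (att_seg k (by omega) le_rfl e2.symm) (anti_seg_seg fun a b ha ha' _ hb => far _ ?_ ?_ ?_ b hb)
      (anti_seg_seg fun a b ha ha' _ hb => far _ ?_ ?_ ?_ b hb)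
    · rw [hset]; exact Or.inl (seg_mem (by omega) (by omega))
    · rw [ne_eq, hT.hs.inj (by omega) (by omega)]; omega
    · rw [ne_eq, hT.hs.inj (by omega) (by omega)]; omega
    · rw [hset]; exact Or.inr (seg_mem (by omega) (by omega))
    · rw [hT.first, ne_eq, hT.ht.inj (by omega) (by omega)]; omega
    · rw [hT.last, ne_eq, hT.ht.inj (by omega) (by omega)]; omega
  have hi' := inner i hi c hcC hc1 hc2 ec
  have hc := q3 i hi'.1 hi'.2 c hcC ec
  have uniq : ∀ j ≤ k, ∀ w ∈ C, w ≠ z₁ → w ≠ z₂ → G.Adj (p j) w → w = c := by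
    intro j hj w hw hw1 hw2 e
    have hj' := inner j hj w hw hw1 hw2 e
    exact q4 j i hj'.1 hj'.2 hi'.1 hi'.2 w hw c hcC e ec
  have z₁p : ∀ i ≤ k, G.Adj z₁ (p i) → i = 0 := by
    intro i hi e
    by_contra hi0
    by_cases hik : i = k
    · subst hik; exact h12 (q2 _ h1 e.symm)
    · exact G.loopless.irrefl _ (q3 i (by omega) (by omega) z₁ h1 e.symm).1
  have z₂p : ∀ i ≤ k, G.Adj z₂ (p i) → i = k := by
    intro i hi e
    by_contra hik
    by_cases hi0 : i = 0
    · subst hi0; exact h12 (q1 _ h2 e.symm).symm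
    · exact G.loopless.irrefl _ (q3 i (by omega) (by omega) z₂ h2 e.symm).2
  have hP := hp.extend h12 hn12 (fun i hi => ⟨nep h1 i hi, z₁p i hi, fun e => e ▸ e1.symm⟩)
    (fun i hi => ⟨nep h2 i hi, z₂p i hi, fun e => e ▸ e2.symm⟩)
  obtain ⟨s, m, hm, hs, rfl, rfl, hset, hadj⟩ := hC.exists_arc hcC h1 h2 h12 hc.1 hc.2
  have hsC : ∀ i ≤ m, s i ∈ C := fun i hi => by rw [hset]; exact Or.inr (seg_mem (Nat.zero_le _) hi)
  set t : ℕ → V := fun i => if i = 0 then s 0 else if i ≤ k + 1 then p (i - 1) else s m with ht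
  have t0 : t 0 = s 0 := rfl
  have tlast : t (k + 2) = s m := by simp [ht]
  have tin : ∀ j, 0 < j → j < k + 2 → t j = p (j - 1) := by
    intro j hj hj'
    simp only [ht]
    rw [if_neg (by omega), if_pos (by omega)]
  have hw : Wheel G s m t (k + 2) c := by
    refine ⟨⟨hm, by omega, hs, hP, t0.symm, tlast.symm, fun a b ha ha' hb hb' => ?_⟩, hc.1, hc.2, ?_,
      fun i hi => (hadj i hi).1, ?_⟩
    · rw [tin b hb hb']
      refine ⟨nep (hsC a ha'.le) _ (by omega), fun e => ?_⟩
      have := uniq (b - 1) (by omega) _ (hsC a ha'.le) (by rw [ne_eq, hs.inj (by omega) (by omega)]; omega)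
        (by rw [ne_eq, hs.inj (by omega) (by omega)]; omega) e.symm
      exact (hadj a ha'.le).1 this.symm
    · intro i hi hi' e
      have := (hadj i hi'.le).2.1 e
      omega
    · intro j hj
      by_cases hj0 : j = 0
      · subst hj0; exact t0 ▸ hc1
      by_cases hjn : j = k + 2
      · subst hjn; exact tlast ▸ hc2
      · rw [tin j (by omega) (by omega)]; exact nep hcC _ (by omega)
  by_cases hDp : D ⊆ seg p 0 k
  · -- the path is the whole component
    have hfull : FullPetal G C c t (k + 2) := by
      rw [hset]
      refine hw.fullPetal fun j hj hj' y e => ?_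
      rw [tin j hj hj'] at e
      by_cases hyC : y ∈ C
      · by_cases hy1 : y = s 0
        · exact Or.inl ⟨0, by omega, by omega, hy1 ▸ t0⟩
        by_cases hy2 : y = s m
        · exact Or.inl ⟨k + 2, by omega, by omega, hy2 ▸ tlast⟩
        · exact Or.inr (uniq _ (by omega) y hyC hy1 hy2 e)
      · obtain ⟨l, _, hl, rfl⟩ := hDp (hDcl _ _ (hpD _ (by omega)) hyC e)
        exact Or.inl ⟨l + 1, by omega, by omega, tin _ (by omega) (by omega)⟩
    obtain ⟨l, _, hl, e⟩ := hDp hxD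
    exact ⟨c, hcC, t, k + 2, hfull, l + 1, by omega, by omega, by rw [tin _ (by omega) (by omega)]; exact e⟩
  -- otherwise nothing is attached to the inside of `s`
  obtain ⟨y, hyD, hyp⟩ := Set.not_subset.1 hDp
  have iso := hw.iso_first I hDconn (by
    rintro w hwD (rfl | rfl | rfl)
    · exact hDsub hwD h1
    · exact hDsub hwD h2
    · exact hDsub hwD hcC) ⟨1, by omega, by omega, by rw [tin 1 (by omega) (by omega)]; exact hpD _ (by omega)⟩
    ⟨y, hyD, by
      rintro ⟨j, _, hj, e⟩
      by_cases hj0 : j = 0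
      · subst hj0; exact hDsub hyD (e ▸ h1)
      by_cases hjn : j = k + 2
      · subst hjn; exact hDsub hyD (e ▸ tlast ▸ h2)
      · exact hyp ⟨j - 1, by omega, by omega, by rw [← tin j (by omega) (by omega)]; exact e⟩⟩
  obtain ⟨v₀, hv₀, t₀, n₀, h₀⟩ := hne
  have hn₀ := h₀.hn
  by_cases hmeet : ∃ j, 0 < j ∧ j < n₀ ∧ t₀ j ∈ D
  · exact ⟨v₀, hv₀, t₀, n₀, h₀, h₀.subset hv₀ hDconn hDsub hmeet hxD⟩
  exfalso
  push Not at hmeet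
  by_cases hvc : v₀ = c
  · subst hvc
    refine hw.no_second_petal F (hset ▸ h₀) (anti_seg_seg fun a b ha ha' hb hb' => ?_)
    rw [tin a (by omega) (by omega)]
    have hb0 := hmeet b (by omega) (by omega)
    refine ⟨fun e => hb0 (e ▸ hpD _ (by omega)), fun e => hb0 ?_⟩
    exact hDcl _ _ (hpD _ (by omega)) (h₀.out b (by omega) (by omega)) e
  · -- the inside of `s` contains the centre or an end of the petal
    have att : ∀ w, (∃ a, 0 < a ∧ a < m ∧ s a = w) → (∃ j, 0 < j ∧ j < n₀ ∧ G.Adj w (t₀ j)) → False := by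
      rintro _ ⟨a, ha, ha', rfl⟩ ⟨j, hj, hj', e⟩
      obtain ⟨l, _, hl, e'⟩ := iso a ha ha' _ e
      exact h₀.out j hj hj' (e' ▸ hsC l hl)
    have hv₀' := hv₀
    rw [hset] at hv₀'
    obtain ⟨a, _, ha, rfl⟩ := hv₀'.resolve_left hvc
    by_cases hin : 0 < a ∧ a < m
    · obtain ⟨_, _, hw₀, -⟩ := h₀.exists_wheel hC hv₀
      obtain ⟨l, hl, hl', el⟩ := hw₀.exists_vt F
      exact att _ ⟨a, hin.1, hin.2, rfl⟩ ⟨l, hl, hl', el⟩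
    · have key : ∀ w ∈ C, G.Adj (s a) w → w ≠ c → ∃ b, 0 < b ∧ b < m ∧ s b = w := by
        intro w hw e hwc
        rw [hset] at hw
        obtain ⟨b, _, hb, rfl⟩ := hw.resolve_left hwc
        rw [hs.adj_iff ha hb] at e
        exact ⟨b, by omega, by omega, rfl⟩
      by_cases h0c : t₀ 0 = c
      · refine att _ (key _ h₀.last_mem h₀.vb fun e => h₀.ne_ends (h0c.trans e.symm)) ⟨n₀ - 1, by omega, by omega, ?_⟩
        exact (h₀.ht.adj_iff (by omega) (by omega)).2 (by omega)
      · refine att _ (key _ h₀.first_mem h₀.va h0c) ⟨1, by omega, by omega, ?_⟩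
        exact (h₀.ht.adj_iff (by omega) (by omega)).2 (by omega)

end

/-! ### Daisies -/

section
variable {V : Type*} {G : SimpleGraph V} {t t' : ℕ → V} {n n' : ℕ} {v v' : V} {C : Set V}

theorem FullPetal.rev (h : FullPetal G C v t n) : FullPetal G C v (fun k => t (n - k)) n := by
  have hr := seg_rev (p := t) (Nat.zero_le n) le_rfl
  simp only [Nat.sub_self, Nat.sub_zero] at hr
  refine ⟨h.hn, h.ht.rev, h.last_mem, by simpa using h.first_mem, h.vb, by simpa using h.va,
    fun j hj hj' => h.out _ (by omega) (by omega), fun j hj hj' x e => ?_⟩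
  rw [hr]
  exact h.iso _ (by omega) (by omega) x e

theorem FullPetal.interior_rev (h : FullPetal G C v t n) :
    seg (fun k => t (n - k)) 1 (n - 1) = seg t 1 (n - 1) := by
  have := h.hn
  have hr := seg_rev (p := t) (i := 1) (j := n - 1) (n := n) (by omega) (by omega)
  rwa [show n - (n - 1) = 1 by omega] at hr

theorem FullPetal.interior_subset (h : FullPetal G C v t n) (hv : v ∈ C) (h' : FullPetal G C v' t' n')
    {x : V} (hx : x ∈ seg t 1 (n - 1)) (hx' : x ∈ seg t' 1 (n' - 1)) :
    seg t' 1 (n' - 1) ⊆ seg t 1 (n - 1) := by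
  have := h.hn
  have := h'.hn
  obtain ⟨j, hj, hj', rfl⟩ := hx
  refine h.subset hv (h'.ht.conn (by omega)) ?_ ⟨j, hj, by omega, hx'⟩
  rintro _ ⟨k, hk, hk', rfl⟩
  exact h'.out k (by omega) (by omega)

/-- Two petals with the same internal vertices and adjacent centres do not exist: a neighbour of the petal
in the hole is `v` or a neighbour of `v`, and `v`, `v'` and the other end would form a triangle. -/
theorem FullPetal.ne_of_adj (h : FullPetal G C v t n) (hv : v ∈ C) (F : Free G)
    (h' : FullPetal G C v' t' n') (hC : HoleSet G C) (hv' : v' ∈ C)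
    (heq : seg t' 1 (n' - 1) = seg t 1 (n - 1)) : v ≠ t' 0 := by
  intro e
  have hn := h.hn
  have hn' := h'.hn
  have key : ∀ w ∈ C, w ≠ v → (∃ j, 0 < j ∧ j < n' ∧ G.Adj (t' j) w) → G.Adj v w := by
    rintro w hw hne ⟨j, hj, hj', e⟩
    obtain ⟨k, hk, hk', ek⟩ : t' j ∈ seg t 1 (n - 1) := heq ▸ seg_mem hj (by omega)
    rw [← ek] at e
    rcases h.eq_of_adj (by omega) (by omega) hw e with rfl | rfl | rfl
    · exact h.va
    · exact h.vb
    · exact absurd rfl hne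
  obtain ⟨_, _, hw', -⟩ := h'.exists_wheel hC hv'
  obtain ⟨l, hl, hl', el⟩ := hw'.exists_vt F
  refine F.tri v v' (t' n') (e ▸ h'.va.symm) (key _ h'.last_mem ?_ ⟨n' - 1, by omega, by omega, ?_⟩) h'.vb
  · exact fun e' => h'.ne_ends (e.symm.trans e'.symm)
  · exact (h'.ht.adj_iff (by omega) (by omega)).2 (by omega)

/-- Full petals with distinct centres are disjoint and there are no edges between them. -/
theorem FullPetal.eq_centre (h : FullPetal G C v t n) (h' : FullPetal G C v' t' n') (F : Free G)
    (hC : HoleSet G C) (hv : v ∈ C) (hv' : v' ∈ C) {x y : V} (hx : x ∈ seg t 1 (n - 1))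
    (hy : y ∈ seg t' 1 (n' - 1)) (hxy : x = y ∨ G.Adj x y) : v = v' := by
  have hn := h.hn
  have hn' := h'.hn
  have hyt : y ∈ seg t 1 (n - 1) := by
    rcases hxy with rfl | e
    · exact hx
    obtain ⟨i, hi, hi', rfl⟩ := hx
    obtain ⟨j, hj, hj', rfl⟩ := hy
    have hjC := h'.out j (by omega) (by omega)
    rcases h.iso i (by omega) (by omega) _ e with ⟨l, _, hl, e'⟩ | e'
    · have hl0 : l ≠ 0 := by rintro rfl; exact hjC (e' ▸ h.first_mem)
      have hln : l ≠ n := by rintro rfl; exact hjC (e' ▸ h.last_mem)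
      exact ⟨l, by omega, by omega, e'⟩
    · exact absurd (e' ▸ hv) hjC
  have heq := (h.interior_subset hv h' hyt hy).antisymm (h'.interior_subset hv' h hy hyt)
  obtain ⟨_, _, hw, -⟩ := h.exists_wheel hC hv
  obtain ⟨l, hl, hl', el⟩ := hw.exists_vt F
  obtain ⟨k, hk, hk', ek⟩ : t l ∈ seg t' 1 (n' - 1) := heq ▸ seg_mem hl (by omega)
  rcases h'.eq_of_adj (by omega) (by omega) hv (ek ▸ el.symm) with e | e | e
  · exact absurd e (h.ne_of_adj hv F h' hC hv' heq)
  · refine absurd ?_ (h.ne_of_adj hv F h'.rev hC hv' (h'.interior_rev.trans heq))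
    simpa using e
  · exact e

/-- Two full petals with the same centre have the same internal vertices. -/
theorem FullPetal.mem_of_mem (h : FullPetal G C v t n) (h' : FullPetal G C v t' n') (F : Free G)
    (hC : HoleSet G C) (hv : v ∈ C) : seg t' 1 (n' - 1) ⊆ seg t 1 (n - 1) := by
  by_cases hex : ∃ x ∈ seg t 1 (n - 1), x ∈ seg t' 1 (n' - 1)
  · obtain ⟨x, hx, hx'⟩ := hex
    exact h.interior_subset hv h' hx hx'
  exfalso
  push Not at hex
  obtain ⟨s, m, hw, hset⟩ := h.exists_wheel hC hv
  refine hw.no_second_petal F (hset ▸ h') ?_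
  rintro x hx y hy
  have hn := h.hn
  have hn' := h'.hn
  refine ⟨fun e => hex x hx (e ▸ hy), fun e => hex y ?_ hy⟩
  obtain ⟨i, hi, hi', rfl⟩ := hx
  obtain ⟨j, hj, hj', rfl⟩ := hy
  have hjC := h'.out j (by omega) (by omega)
  rcases h.iso i (by omega) (by omega) _ e with ⟨l, _, hl, e'⟩ | e'
  · have hl0 : l ≠ 0 := by rintro rfl; exact hjC (e' ▸ h.first_mem)
    have hln : l ≠ n := by rintro rfl; exact hjC (e' ▸ h.last_mem)
    exact ⟨l, by omega, by omega, e'⟩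
  · exact absurd (e' ▸ hv) hjC

theorem Hole.adj_iff (C : Hole G) (i j : Fin (C.m + 4)) :
    G.Adj (C.c i) (C.c j) ↔ j = i - 1 ∨ j = i + 1 := by
  rw [C.c.map_adj_iff, cycleGraph_adj]
  constructor
  · rintro (h | h)
    · left; rw [← h]; abel
    · right; rw [← h]; abel
  · rintro (rfl | rfl)
    · left; abel
    · right; abel

/-- A full petal of a hole is a petal. -/
theorem FullPetal.exists_petal {C : Hole G} {i : Fin (C.m + 4)} (F : Free G)
    (h : FullPetal G (Set.range C.c) (C.c i) t n) :
    ∃ P : Petal G C i, P.path.verts = seg t 1 (n - 1) := by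
  -- orient the path
  obtain ⟨t, heq, h, h0, hl⟩ : ∃ t', seg t' 1 (n - 1) = seg t 1 (n - 1) ∧
      FullPetal G (Set.range C.c) (C.c i) t' n ∧ t' 0 = C.c (i - 1) ∧ t' n = C.c (i + 1) := by
    obtain ⟨a, ha⟩ := h.first_mem
    obtain ⟨b, hb⟩ := h.last_mem
    have e1 := h.va
    have e2 := h.vb
    have hne := h.ne_ends
    rw [← ha, C.adj_iff] at e1
    rw [← hb, C.adj_iff] at e2
    rw [← ha, ← hb] at hne
    rcases e1 with rfl | rfl <;> rcases e2 with rfl | rfl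
    · exact absurd rfl hne
    · exact ⟨t, rfl, h, ha.symm, hb.symm⟩
    · exact ⟨_, h.interior_rev, h.rev, by simpa using hb.symm, by simpa using ha.symm⟩
    · exact absurd rfl hne
  rw [← heq]
  have hn := h.hn
  have hadj : ∀ {a b}, a ≤ n → b ≤ n → (b = a + 1 ∨ a = b + 1) → G.Adj (t a) (t b) :=
    fun ha hb e => (h.ht.adj_iff ha hb).2 e
  have hp : IsP G (fun k => t (1 + k)) (n - 2) := h.ht.sub (by omega)
  obtain ⟨P, hP, hverts⟩ := hp.exists_abPath
  have hseg : seg (fun k => t (1 + k)) 0 (n - 2) = seg t 1 (n - 1) := by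
    ext x
    constructor
    · rintro ⟨k, _, hk, rfl⟩; exact ⟨1 + k, by omega, by omega, rfl⟩
    · rintro ⟨k, hk, hk', rfl⟩; exact ⟨k - 1, by omega, by omega, congrArg t (by omega)⟩
  have hlast : 1 + (n - 2) = n - 1 := by omega
  have tri : ∀ u w, G.Adj u w → ¬ (G.Adj (C.c i) u ∧ G.Adj (C.c i) w) :=
    fun u w e ⟨h1, h2⟩ => F.tri _ _ _ h1 h2 e
  refine ⟨⟨t (1 + 0), t (1 + (n - 2)), P, ?_, ?_, ?_, ?_, fun u _ w _ => tri u w, fun e => ?_,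
    fun e => ?_, ?_⟩, hverts.trans hseg⟩
  · rw [hverts, hseg, Set.disjoint_left]
    rintro _ ⟨k, hk, hk', rfl⟩
    exact h.out k (by omega) (by omega)
  · rw [← h0]; exact hadj (by omega) (by omega) (by omega)
  · rw [← hl]; exact hadj (by omega) (by omega) (by omega)
  · obtain ⟨s, m, hw, -⟩ := h.exists_wheel C.holeSet ⟨i, rfl⟩
    obtain ⟨l, hl0, hln, hl⟩ := hw.exists_vt F
    have hl1 : l ≠ 1 := by
      rintro rfl
      exact tri _ _ (hadj (by omega) (by omega) (by omega) : G.Adj (t 0) (t 1)) ⟨h.va, hl⟩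
    have hl2 : l ≠ n - 1 := by
      rintro rfl
      exact tri _ _ (hadj le_rfl (by omega) (by omega) : G.Adj (t n) (t (n - 1))) ⟨h.vb, hl⟩
    refine ⟨t l, ?_, hl⟩
    have := hp.mem_interior (x := t l)
    rw [← hverts] at this
    exact this.2 ⟨l - 1, by omega, by omega, congrArg t (by omega)⟩
  · exact tri _ _ (hadj (by omega) (by omega) (by omega) : G.Adj (t 0) (t (1 + 0))) ⟨h.va, e⟩
  · exact tri _ _ (hadj le_rfl (by omega) (by omega) : G.Adj (t n) (t (1 + (n - 2)))) ⟨h.vb, e⟩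
  · intro w hw j e
    rw [hverts, hseg] at hw
    obtain ⟨k, hk, hk', rfl⟩ := hw
    rcases h.eq_of_adj (by omega) (by omega) ⟨j, rfl⟩ e with e' | e' | e'
    · left
      have hk1 := e
      rw [e', h.ht.adj_iff (by omega) (by omega)] at hk1
      exact ⟨congrArg t (by omega), C.c.injective (e'.trans h0)⟩
    · right; left
      have hk1 := e
      rw [e', h.ht.adj_iff (by omega) (by omega)] at hk1
      exact ⟨congrArg t (by omega), C.c.injective (e'.trans hl)⟩
    · right; right
      exact C.c.injective e'

/-- A hole all of whose other vertices are in full petals: unless there is a proper 2-separator, the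
centres are consecutive. -/
theorem centres_interval {h : ℕ → V} {N : ℕ} (F : Free G) (hh : IsHole G h N)
    (hcov : ∀ x ∉ {x | ∃ k < N, h k = x}, ∃ v ∈ {x | ∃ k < N, h k = x}, ∃ t n,
      FullPetal G {x | ∃ k < N, h k = x} v t n ∧ x ∈ seg t 1 (n - 1)) (h2 : ¬ TwoSep G)
    (h0 : h 0 ∉ centres G {x | ∃ k < N, h k = x}) {i j r : ℕ} (hir : i ≤ r) (hrj : r ≤ j) (hj : j < N)
    (hi : h i ∈ centres G {x | ∃ k < N, h k = x}) (hj' : h j ∈ centres G {x | ∃ k < N, h k = x}) :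
    h r ∈ centres G {x | ∃ k < N, h k = x} := by
  by_contra hr
  have hN := hh.1
  have hne : ∀ {a b}, h a ∈ centres G {x | ∃ k < N, h k = x} →
      h b ∉ centres G {x | ∃ k < N, h k = x} → a ≠ b := by
    rintro a b ha hb rfl; exact hb ha
  have hi0 := hne hi h0
  have hir' := hne hi hr
  have hrj' := hne hj' hr
  have hC : HoleSet G {x | ∃ k < N, h k = x} := ⟨h, N, hh, rfl⟩
  set C := {x | ∃ k < N, h k = x} with hCdef
  have hmem : ∀ {k}, k < N → h k ∈ C := fun hk => ⟨_, hk, rfl⟩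
  obtain ⟨hT, hset⟩ := hh.twoPaths (r := r) (by omega) (by omega)
  -- the part of the graph between two vertices of the hole
  let S : ℕ → ℕ → Set V := fun a b => {x | ∃ k, a < k ∧ k < b ∧ (x = h k ∨ ∃ t n,
    FullPetal G C (h k) t n ∧ x ∈ seg t 1 (n - 1))}
  have hpet : ∀ {k}, k < N → h k ∈ centres G C → ∃ t n, FullPetal G C (h k) t n ∧
      t 1 ∈ seg t 1 (n - 1) ∧ t 1 ∉ C := by
    rintro k hk ⟨_, t, n, ht⟩
    have := ht.hn
    exact ⟨t, n, ht, seg_mem le_rfl (by omega), ht.out 1 (by omega) (by omega)⟩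
  have hXK : ∀ {a b x}, b ≤ N → x ∈ S a b → (∃ k, a < k ∧ k < b ∧ x = h k) ∨ x ∉ C := by
    rintro a b x hb ⟨k, hk, hk', rfl | ⟨t, n, ht, l, hl, hl', rfl⟩⟩
    · exact Or.inl ⟨k, hk, hk', rfl⟩
    · have := ht.hn
      exact Or.inr (ht.out l (by omega) (by omega))
  have hK : ∀ {a b x}, b ≤ N → x ∈ S a b → (0 < a ∨ a = 0) → (b ≤ r ∨ r ≤ a) →
      x ∉ ({h 0, h r} : Set V) := by
    intro a b x hb hx _ hab hxK
    rcases hXK hb hx with ⟨k, hk, hk', rfl⟩ | hx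
    · rcases hxK with e | e
      · rw [hh.inj (by omega) (by omega)] at e; omega
      · have e : h k = h r := e
        rw [hh.inj (by omega) (by omega)] at e; omega
    · rcases hxK with rfl | rfl
      · exact hx (hmem (by omega))
      · exact hx (hmem (by omega))
  -- a petal has neighbours in the hole only next to its centre
  have hole_petal : ∀ {a b : ℕ} {t n x}, a < N → b < N → FullPetal G C (h b) t n → x ∈ seg t 1 (n - 1) →
      (a + 2 ≤ b ∧ b + 2 ≤ N + a) ∨ (b + 2 ≤ a ∧ a + 2 ≤ N + b) → h a ≠ x ∧ ¬ G.Adj (h a) x := by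
    rintro a b t n _ ha hb ht ⟨l, hl, hl', rfl⟩ hab
    have := ht.hn
    refine ⟨fun e => ht.out l (by omega) (by omega) (e ▸ hmem ha), fun e => ?_⟩
    have : G.Adj (h b) (h a) ∨ h a = h b := by
      rcases ht.eq_of_adj (by omega) (by omega) (hmem ha) e.symm with e | e | e
      · exact Or.inl (e ▸ ht.va)
      · exact Or.inl (e ▸ ht.vb)
      · exact Or.inr e
    rw [hh.adj_iff hb ha, hh.inj ha hb] at this
    omega
  refine h2 ⟨h, r, _, N - r, S 0 r, S r N, hT, ⟨?_, ⟨h i, i, by omega, by omega, Or.inl rfl⟩,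
    ⟨h j, j, by omega, by omega, Or.inl rfl⟩, ?_, fun x hx => hK (by omega) hx (by omega) (by omega),
    fun x hx => hK (by omega) hx (by omega) (by omega)⟩, ?_, ?_, ?_, ?_⟩
  · rintro x ⟨a, ha, ha', hx⟩ y ⟨b, hb, hb', hy⟩
    rcases hx with rfl | ⟨t, n, ht, hx⟩ <;> rcases hy with rfl | ⟨t', n', ht', hy⟩
    · rw [hh.adj_iff (by omega) (by omega), ne_eq, hh.inj (by omega) (by omega)]; omega
    · exact hole_petal (by omega) (by omega) ht' hy (by omega)
    · exact ne_nadj_symm (hole_petal (by omega) (by omega) ht hx (by omega))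
    · have hne : h a ≠ h b := by rw [ne_eq, hh.inj (by omega) (by omega)]; omega
      have key := ht.eq_centre ht' F hC (hmem (by omega)) (hmem (by omega)) hx hy
      exact ⟨fun e => hne (key (Or.inl e)), fun e => hne (key (Or.inr e))⟩
  · have place : ∀ k < N, ∀ x, (x = h k ∨ ∃ t n, FullPetal G C (h k) t n ∧ x ∈ seg t 1 (n - 1)) →
        k ≠ 0 → k ≠ r → x ∈ S 0 r ∨ x ∈ S r N := by
      intro k hk x hx hk0 hkr
      rcases lt_or_gt_of_ne hkr with hlt | hlt
      · exact Or.inl ⟨k, by omega, hlt, hx⟩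
      · exact Or.inr ⟨k, hlt, hk, hx⟩
    intro x
    by_cases hx : x ∈ C
    · obtain ⟨k, hk, rfl⟩ := hx
      by_cases hk0 : k = 0
      · subst hk0; exact Or.inr (Or.inr (Or.inl rfl))
      by_cases hkr : k = r
      · subst hkr; exact Or.inr (Or.inr (Or.inr rfl))
      · exact (place k hk _ (Or.inl rfl) hk0 hkr).imp id Or.inl
    · obtain ⟨_, ⟨k, hk, rfl⟩, t, n, ht, hxt⟩ := hcov x hx
      have hk' : h k ∈ centres G C := ⟨hmem hk, t, n, ht⟩
      exact (place k hk _ (Or.inr ⟨t, n, ht, hxt⟩) (hne hk' h0) (hne hk' hr)).imp id Or.inl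
  · exact fun k hk hk' => ⟨k, hk, hk', Or.inl rfl⟩
  · intro k hk hk'
    exact ⟨N - k, by omega, by omega, Or.inl (by rw [if_neg (by omega)])⟩
  · obtain ⟨t, n, ht, h1, h1C⟩ := hpet (by omega) hi
    exact ⟨t 1, ⟨i, by omega, by omega, Or.inr ⟨t, n, ht, h1⟩⟩, fun hx => h1C (hset.ge (Or.inl hx))⟩
  · obtain ⟨t, n, ht, h1, h1C⟩ := hpet (by omega) hj'
    exact ⟨t 1, ⟨j, by omega, by omega, Or.inr ⟨t, n, ht, h1⟩⟩, fun hx => h1C (hset.ge (Or.inr hx))⟩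

/-- A hole whose full petals cover the rest of the graph makes the graph a daisy, unless there is a proper
2-separator. -/
theorem isDaisy_of_fullPetals (F : Free G) (h2 : ¬ TwoSep G) (hC : HoleSet G C)
    (hcov : ∀ x ∉ C, ∃ v ∈ C, ∃ t n, FullPetal G C v t n ∧ x ∈ seg t 1 (n - 1)) : IsDaisy G := by
  -- if there is a vertex that is not a centre, the numbering of the hole starts there
  obtain ⟨h, N, hh, rfl, h0⟩ : ∃ h N, IsHole G h N ∧ C = {x | ∃ k < N, h k = x} ∧
      (C ⊆ centres G C ∨ h 0 ∉ centres G C) := by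
    by_cases hall : C ⊆ centres G C
    · obtain ⟨h, N, hh, hset⟩ := hC
      exact ⟨h, N, hh, hset, Or.inl hall⟩
    · obtain ⟨w, hw, hwc⟩ := Set.not_subset.1 hall
      obtain ⟨h, N, hh, rfl, hset⟩ := hC.exists_first hw
      exact ⟨h, N, hh, hset, Or.inr hwc⟩
  obtain ⟨D, hN, hD⟩ := hh.exists_hole
  have hrange : {x | ∃ k < N, h k = x} = Set.range D.c := by
    ext x
    constructor
    · rintro ⟨k, hk, rfl⟩; exact ⟨⟨k, by omega⟩, hD _⟩
    · rintro ⟨i, rfl⟩; exact ⟨i, by omega, (hD i).symm⟩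
  have hP : ∀ i : {i | D.c i ∈ centres G {x | ∃ k < N, h k = x}}, ∃ P : Petal G D i,
      ∃ t n, FullPetal G {x | ∃ k < N, h k = x} (D.c i) t n ∧ P.path.verts = seg t 1 (n - 1) := by
    rintro ⟨i, _, t, n, ht⟩
    obtain ⟨P, hP⟩ := FullPetal.exists_petal F (hrange ▸ ht)
    exact ⟨P, t, n, ht, hP⟩
  choose P hP using hP
  refine ⟨D, {i | D.c i ∈ centres G {x | ∃ k < N, h k = x}}, P, ?_, ?_, ?_⟩
  · rcases h0 with h0 | h0
    · left
      rw [Set.eq_univ_iff_forall]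
      exact fun i => h0 (hrange ▸ ⟨i, rfl⟩)
    · right
      by_cases hex : ∃ k, 0 ≤ k ∧ k ≤ N - 1 ∧ h k ∈ centres G {x | ∃ k < N, h k = x}
      · have hN4 := hh.1
        obtain ⟨i, j, -, hij, hj, hi', hj', hmin⟩ := exists_min_max hex
        have hlt : ∀ a : Fin (j - i + 1), i + a < D.m + 4 := fun a => by omega
        refine ⟨j - i + 1, ⟨⟨fun a => ⟨i + a, hlt a⟩, fun a b e => ?_⟩, fun {a b} => ?_⟩, ?_⟩
        · rw [Fin.mk.injEq] at e
          exact Fin.ext (by omega)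
        · rw [← D.c.map_adj_iff]
          change G.Adj (D.c ⟨i + a, hlt a⟩) (D.c ⟨i + b, hlt b⟩) ↔ _
          rw [hD, hD, pathGraph_adj, hh.adj_iff (by simp; omega) (by simp; omega)]
          have h1 : i ≠ 0 := by rintro rfl; exact h0 hi'
          simp only
          omega
        · ext k
          constructor
          · rintro ⟨a, rfl⟩
            change D.c ⟨i + a, hlt a⟩ ∈ centres G {x | ∃ k < N, h k = x}
            rw [hD]
            exact centres_interval F hh hcov h2 h0 (i := i) (j := j) (by simp) (by simp; omega) (by omega)
              hi' hj'
          · intro hk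
            replace hk : D.c k ∈ centres G {x | ∃ k < N, h k = x} := hk
            rw [hD] at hk
            have := hmin k (Nat.zero_le _) (by omega) hk
            exact ⟨⟨k - i, by omega⟩, Fin.ext (by change i + (k.val - i) = k.val; omega)⟩
      · refine ⟨0, ⟨⟨fun a => a.elim0, fun a => a.elim0⟩, fun {a} => a.elim0⟩, ?_⟩
        ext k
        refine ⟨fun ⟨a, _⟩ => a.elim0, fun hk => False.elim ?_⟩
        replace hk : D.c k ∈ centres G {x | ∃ k < N, h k = x} := hk
        rw [hD] at hk
        exact hex ⟨k, Nat.zero_le _, by omega, hk⟩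
  · intro i j hij x hx y hy
    obtain ⟨t, n, ht, hv⟩ := hP i
    obtain ⟨t', n', ht', hv'⟩ := hP j
    rw [hv] at hx
    rw [hv'] at hy
    have hne : D.c i ≠ D.c j := fun e => hij (Subtype.ext (D.c.injective e))
    have key := ht.eq_centre ht' F hC i.2.1 j.2.1 hx hy
    exact ⟨fun e => hne (key (Or.inl e)), fun e => hne (key (Or.inr e))⟩
  · intro x
    by_cases hx : x ∈ {x | ∃ k < N, h k = x}
    · exact Or.inl (hrange ▸ hx)
    · right
      obtain ⟨v, hv, t, n, ht, hxt⟩ := hcov x hx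
      obtain ⟨i, rfl⟩ : v ∈ Set.range D.c := hrange ▸ hv
      refine ⟨⟨i, hv, t, n, ht⟩, ?_⟩
      obtain ⟨t', n', ht', hv'⟩ := hP ⟨i, hv, t, n, ht⟩
      rw [hv']
      exact ht'.mem_of_mem ht F hC hv hxt

end

/-! ### Decompositions as gluings of induced subgraphs -/

section
variable {V : Type*} {G : SimpleGraph V}

theorem exists_abPath_induce {S : Set V} {p : ℕ → V} {n : ℕ} (hp : IsP G p n) (hS : ∀ k ≤ n, p k ∈ S)
    {a b : S} (ha : (a : V) = p 0) (hb : (b : V) = p n) :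
    ∃ P : ABPath (G.induce S) a b, P.length = n ∧ (∀ x : S, x ∈ P.verts ↔ (x : V) ∈ seg p 0 n) ∧
      ∀ x : S, x ∈ P.interior ↔ ∃ k, 0 < k ∧ k < n ∧ p k = x := by
  classical
  let q : ℕ → S := fun k => if h : k ≤ n then ⟨p k, hS k h⟩ else ⟨p 0, hS 0 (Nat.zero_le _)⟩
  have hq : ∀ k ≤ n, (q k : V) = p k := fun k hk => by simp [q, hk]
  have hqP : IsP (G.induce S) q n := by
    rw [isP_induce]
    intro i j hij hj
    simp only [hq i (by omega), hq j hj]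
    exact hp i j hij hj
  obtain rfl : a = q 0 := Subtype.ext (by rw [hq 0 (by omega), ha])
  obtain rfl : b = q n := Subtype.ext (by rw [hq n le_rfl, hb])
  obtain ⟨P, hP, hv⟩ := hqP.exists_abPath
  have hverts : ∀ x : S, x ∈ P.verts ↔ (x : V) ∈ seg p 0 n := by
    intro x
    rw [hv]
    constructor
    · rintro ⟨k, h1, h2, rfl⟩; exact ⟨k, h1, h2, (hq k h2).symm⟩
    · rintro ⟨k, h1, h2, e⟩; exact ⟨k, h1, h2, Subtype.ext ((hq k h2).trans e)⟩
  refine ⟨P, hP, hverts, fun x => ?_⟩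
  have := hqP.mem_interior (x := x)
  rw [← hv] at this
  refine this.trans ⟨?_, ?_⟩
  · rintro ⟨k, h1, h2, rfl⟩; exact ⟨k, h1, h2, (hq k h2.le).symm⟩
  · rintro ⟨k, h1, h2, e⟩; exact ⟨k, h1, h2, Subtype.ext ((hq k h2.le).trans e)⟩

theorem neighborSet_induce_ncard {S : Set V} (x : S) :
    ((G.induce S).neighborSet x).ncard = {y | y ∈ S ∧ G.Adj x y}.ncard := by
  rw [← Set.ncard_image_of_injective _ Subtype.val_injective]
  congr 1
  ext y
  constructor
  · rintro ⟨y, hy, rfl⟩; exact ⟨y.2, hy⟩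
  · rintro ⟨h1, h2⟩; exact ⟨⟨y, h1⟩, h2, rfl⟩

theorem isGluingDeleting_of_separates {J : Type*} {X Y K SX SY : Set V} (h : Separates G X Y K)
    {DX : Set SX} {DY : Set SY} (hX : X ∪ K ⊆ SX) (hY : Y ∪ K ⊆ SY)
    (hDX : ∀ x : SX, x ∈ DX ↔ (x : V) ∉ X ∪ K) (hDY : ∀ y : SY, y ∈ DY ↔ (y : V) ∉ Y ∪ K)
    {tX : J → SX} {tY : J → SY} (ht : ∀ j, (tX j : V) = tY j) (hK : K = Set.range fun j => (tX j : V)) :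
    IsGluingDeleting (G.induce SX) (G.induce SY) tX tY DX DY G := by
  have hXm : ∀ x : ↥DXᶜ, ((x : SX) : V) ∈ X ∪ K := fun x => not_not.1 fun e => x.2 ((hDX x).2 e)
  have hYm : ∀ y : ↥DYᶜ, ((y : SY) : V) ∈ Y ∪ K := fun x => not_not.1 fun e => x.2 ((hDY x).2 e)
  have mkX : ∀ v ∈ X ∪ K, ∃ x : ↥DXᶜ, ((x : SX) : V) = v :=
    fun v hv => ⟨⟨⟨v, hX hv⟩, fun e => (hDX _).1 e hv⟩, rfl⟩
  have mkY : ∀ v ∈ Y ∪ K, ∃ x : ↥DYᶜ, ((x : SY) : V) = v :=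
    fun v hv => ⟨⟨⟨v, hY hv⟩, fun e => (hDY _).1 e hv⟩, rfl⟩
  refine ⟨fun x => x.1.1, fun y => y.1.1, fun x x' e => Subtype.ext (Subtype.ext e),
    fun x x' e => Subtype.ext (Subtype.ext e), ?_, ?_, ?_⟩
  · intro v
    rcases h.cover v with hv | hv | hv
    · exact Or.inl (mkX v (Or.inl hv))
    · exact Or.inr (mkY v (Or.inl hv))
    · exact Or.inl (mkX v (Or.inr hv))
  · intro x y
    constructor
    · intro e
      have hx := hXm x
      have hy := hYm y
      replace e : ((x : SX) : V) = ((y : SY) : V) := e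
      have hk : ((x : SX) : V) ∈ K := by
        rcases hx with hx | hx
        · rcases hy with hy | hy
          · exact absurd e (h.anti _ hx _ hy).1
          · exact e ▸ hy
        · exact hx
      rw [hK] at hk
      obtain ⟨j, hj⟩ := hk
      exact ⟨j, Subtype.ext hj.symm, Subtype.ext (by rw [← e, ← ht, ← hj])⟩
    · rintro ⟨j, h1, h2⟩
      change ((x : SX) : V) = ((y : SY) : V)
      rw [h1, h2, ht]
  · intro u w
    constructor
    · intro e
      have key : (u ∈ X ∪ K ∧ w ∈ X ∪ K) ∨ (u ∈ Y ∪ K ∧ w ∈ Y ∪ K) := by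
        rcases h.cover u with hu | hu | hu <;> rcases h.cover w with hw | hw | hw
        · exact Or.inl ⟨Or.inl hu, Or.inl hw⟩
        · exact absurd e (h.anti _ hu _ hw).2
        · exact Or.inl ⟨Or.inl hu, Or.inr hw⟩
        · exact absurd e.symm (h.anti _ hw _ hu).2
        · exact Or.inr ⟨Or.inl hu, Or.inl hw⟩
        · exact Or.inr ⟨Or.inl hu, Or.inr hw⟩
        · exact Or.inl ⟨Or.inr hu, Or.inl hw⟩
        · exact Or.inr ⟨Or.inr hu, Or.inl hw⟩
        · exact Or.inl ⟨Or.inr hu, Or.inr hw⟩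
      rcases key with ⟨hu, hw⟩ | ⟨hu, hw⟩
      · obtain ⟨x, rfl⟩ := mkX u hu
        obtain ⟨y, rfl⟩ := mkX w hw
        exact Or.inl ⟨x, y, e, rfl, rfl⟩
      · obtain ⟨x, rfl⟩ := mkY u hu
        obtain ⟨y, rfl⟩ := mkY w hw
        exact Or.inr ⟨x, y, e, rfl, rfl⟩
    · rintro (⟨x, x', e, rfl, rfl⟩ | ⟨x, x', e, rfl, rfl⟩)
      · exact e
      · exact e

/-- The neighbours of an internal vertex `t j` in the block `X ∪ {ends} ∪ t`, where `C` is the rest of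
the separator. -/
theorem TwoPaths.block_neighbors {s t : ℕ → V} {m n : ℕ} (h : TwoPaths G s m t n) {X Y K C : Set V}
    (hs : Separates G X Y K) (hK : K = {s 0, s m} ∪ C) (ht : ∀ j, 0 < j → j < n → t j ∈ Y) {j : ℕ} (hj : 0 < j)
    (hj' : j < n) :
    {y | y ∈ X ∪ K ∪ seg t 0 n ∧ G.Adj (t j) y} = {t (j - 1), t (j + 1)} ∪ {c | c ∈ C ∧ G.Adj (t j) c} := by
  have hm := h.hm
  have e1 : G.Adj (t j) (t (j - 1)) := (h.ht.adj_iff (by omega) (by omega)).2 (by omega)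
  have e2 : G.Adj (t j) (t (j + 1)) := (h.ht.adj_iff (by omega) (by omega)).2 (by omega)
  have hseg : ∀ l ≤ n, G.Adj (t j) (t l) → t l ∈ ({t (j - 1), t (j + 1)} : Set V) := by
    intro l hl e
    rw [h.ht.adj_iff (by omega) hl] at e
    rcases e with rfl | rfl
    · exact Or.inr rfl
    · exact Or.inl rfl
  ext y
  constructor
  · rintro ⟨(hy | hy) | ⟨l, _, hl, rfl⟩, e⟩
    · exact absurd e.symm (hs.anti _ hy _ (ht j hj hj')).2
    · rw [hK] at hy
      rcases hy with (rfl | rfl) | hy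
      · rw [h.first] at e ⊢; exact Or.inl (hseg 0 (by omega) e)
      · rw [h.last] at e ⊢; exact Or.inl (hseg n le_rfl e)
      · exact Or.inr ⟨hy, e⟩
    · exact Or.inl (hseg l hl e)
  · rintro ((rfl | rfl) | ⟨hy, e⟩)
    · exact ⟨Or.inr (seg_mem (by omega) (by omega)), e1⟩
    · exact ⟨Or.inr (seg_mem (by omega) (by omega)), e2⟩
    · exact ⟨Or.inl (Or.inr (hK ▸ Or.inr hy)), e⟩

theorem TwoPaths.ncard_neighbors {s t : ℕ → V} {m n : ℕ} (h : TwoPaths G s m t n) {j : ℕ} (hj : 0 < j)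
    (hj' : j < n) : ({t (j - 1), t (j + 1)} : Set V).ncard = 2 := by
  rw [Set.ncard_pair]
  rw [ne_eq, h.ht.inj (by omega) (by omega)]
  omega

theorem Separates.symm {X Y K : Set V} (h : Separates G X Y K) : Separates G Y X K :=
  ⟨h.anti.symm, h.nY, h.nX, fun x => by rcases h.cover x with h | h | h <;> simp [h], h.YK, h.XK⟩

/-- The vertices deleted from the block `X ∪ K ∪ t` are the internal vertices of `t`. -/
theorem TwoPaths.mem_interior_iff {s t : ℕ → V} {m n : ℕ} (h : TwoPaths G s m t n) {X Y K : Set V}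
    (hs : Separates G X Y K) (h0 : s 0 ∈ K) (hl : s m ∈ K) (ht : ∀ j, 0 < j → j < n → t j ∈ Y) {x : V}
    (hx : x ∈ X ∪ K ∪ seg t 0 n) : (∃ k, 0 < k ∧ k < n ∧ t k = x) ↔ x ∉ X ∪ K := by
  constructor
  · rintro ⟨k, hk, hk', rfl⟩ (h' | h')
    · exact (hs.anti _ h' _ (ht k hk hk')).1 rfl
    · exact hs.YK _ (ht k hk hk') h'
  · intro hxn
    obtain ⟨k, _, hk, rfl⟩ := hx.resolve_left hxn
    refine ⟨k, Nat.pos_of_ne_zero ?_, lt_of_le_of_ne hk ?_, rfl⟩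
    · rintro rfl; exact hxn (Or.inr (h.first ▸ h0))
    · rintro rfl; exact hxn (Or.inr (h.last ▸ hl))

/-- Gluing along a proper 2-separator, with the blocks as induced subgraphs. -/
theorem TwoPaths.isTwoGluing {s t : ℕ → V} {m n : ℕ} (h : TwoPaths G s m t n) {X Y : Set V}
    (hs : Separates G X Y {s 0, s m}) (hX : ∀ i, 0 < i → i < m → s i ∈ X)
    (hY : ∀ j, 0 < j → j < n → t j ∈ Y) :
    IsTwoGluing (G.induce (X ∪ {s 0, s m} ∪ seg t 0 n)) (G.induce (Y ∪ {s 0, s m} ∪ seg s 0 m)) G := by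
  have h0 : s 0 ∈ ({s 0, s m} : Set V) := Or.inl rfl
  have hl : s m ∈ ({s 0, s m} : Set V) := Or.inr rfl
  obtain ⟨Q, hQ, hQv, hQi⟩ := exists_abPath_induce (S := X ∪ {s 0, s m} ∪ seg t 0 n)
    (a := ⟨s 0, Or.inl (Or.inr h0)⟩) (b := ⟨s m, Or.inl (Or.inr hl)⟩) h.ht
    (fun k hk => Or.inr (seg_mem (Nat.zero_le _) hk)) h.first h.last
  obtain ⟨P, hP, hPv, hPi⟩ := exists_abPath_induce (S := Y ∪ {s 0, s m} ∪ seg s 0 m)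
    (a := ⟨s 0, Or.inl (Or.inr h0)⟩) (b := ⟨s m, Or.inl (Or.inr hl)⟩) h.hs
    (fun k hk => Or.inr (seg_mem (Nat.zero_le _) hk)) rfl rfl
  refine ⟨_, _, _, _, Q, P, by rw [hQ]; exact h.hn, by rw [hP]; exact h.hm, ?_, ?_, isGluingDeleting_of_separates hs
    Set.subset_union_left Set.subset_union_left (fun x => ?_) (fun x => ?_) (fun j => ?_) ?_⟩
  · intro x hx
    obtain ⟨k, hk, hk', e⟩ := (hQi x).1 hx
    rw [neighborSet_induce_ncard, ← e, h.block_neighbors hs (C := ∅) (by simp) hY hk hk']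
    simpa using h.ncard_neighbors hk hk'
  · intro x hx
    obtain ⟨k, hk, hk', e⟩ := (hPi x).1 hx
    rw [neighborSet_induce_ncard, ← e, h.swap.block_neighbors hs.symm (C := ∅)
      (by simp [h.first, h.last]) hX hk hk']
    simpa using h.swap.ncard_neighbors hk hk'
  · exact (hQi x).trans (h.mem_interior_iff hs h0 hl hY x.2)
  · refine (hPi x).trans (h.swap.mem_interior_iff hs.symm ?_ ?_ hX x.2)
    · rw [← h.first]; exact h0
    · rw [← h.last]; exact hl
  · fin_cases j <;> rfl
  · ext x
    simp [Fin.exists_fin_two, eq_comm]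

/-- Gluing along a proper `P₃`-separator, with the blocks as induced subgraphs. A path of the second
block that avoids the centre and its neighbours would form a theta with `s` and the centre. -/
theorem Wheel.isP3Gluing {s t : ℕ → V} {m n : ℕ} {v : V} (h : Wheel G s m t n v) (F : Free G) {X Y : Set V}
    (hs : Separates G X Y {s 0, s m, v}) (hX : ∀ i, 0 < i → i < m → s i ∈ X)
    (hY : ∀ j, 0 < j → j < n → t j ∈ Y) :
    IsP3Gluing (G.induce (X ∪ {s 0, s m, v} ∪ seg t 0 n))
      (G.induce (Y ∪ {s 0, s m, v} ∪ seg s 0 m)) G := by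
  have hm := h.hm
  have hn := h.hn
  have h0 : s 0 ∈ ({s 0, s m, v} : Set V) := Or.inl rfl
  have hl : s m ∈ ({s 0, s m, v} : Set V) := Or.inr (Or.inl rfl)
  have hv : v ∈ ({s 0, s m, v} : Set V) := Or.inr (Or.inr rfl)
  have hK : ({s 0, s m, v} : Set V) = {s 0, s m} ∪ {v} := by
    rw [Set.insert_union, Set.singleton_union]
  have hK' : ({s 0, s m, v} : Set V) = {t 0, t n} ∪ {v} := by
    rw [hK, h.first, h.last]
  obtain ⟨Q, hQ, hQv, hQi⟩ := exists_abPath_induce (S := X ∪ {s 0, s m, v} ∪ seg t 0 n)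
    (a := ⟨s 0, Or.inl (Or.inr h0)⟩) (b := ⟨s m, Or.inl (Or.inr hl)⟩) h.ht
    (fun k hk => Or.inr (seg_mem (Nat.zero_le _) hk)) h.first h.last
  obtain ⟨R, hR, hRv, hRi⟩ := exists_abPath_induce (S := X ∪ {s 0, s m, v} ∪ seg t 0 n)
    (a := ⟨s 0, Or.inl (Or.inr h0)⟩) (b := ⟨s m, Or.inl (Or.inr hl)⟩) h.hs (fun k hk => by
      by_cases hk0 : k = 0
      · subst hk0; exact Or.inl (Or.inr h0)
      by_cases hkm : k = m
      · subst hkm; exact Or.inl (Or.inr hl)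
      · exact Or.inl (Or.inl (hX k (by omega) (by omega)))) rfl rfl
  obtain ⟨P, hP, hPv, hPi⟩ := exists_abPath_induce (S := Y ∪ {s 0, s m, v} ∪ seg s 0 m)
    (a := ⟨s 0, Or.inl (Or.inr h0)⟩) (b := ⟨s m, Or.inl (Or.inr hl)⟩) h.hs
    (fun k hk => Or.inr (seg_mem (Nat.zero_le _) hk)) rfl rfl
  refine ⟨_, ⟨v, Or.inl (Or.inr hv)⟩, _, _, ⟨v, Or.inl (Or.inr hv)⟩, _, Q, P,
    ⟨fun e => h.ne_ends.1 (congrArg Subtype.val e), h.va.symm, h.vb, h.ne_ends.2⟩, by rw [hQ]; exact h.hn, ?_, ?_,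
    ⟨R, ?_, ?_⟩, ?_, ⟨fun e => h.ne_ends.1 (congrArg Subtype.val e), h.va.symm, h.vb, h.ne_ends.2⟩,
    by rw [hP]; exact h.hm, ?_, ?_, ?_, ?_, isGluingDeleting_of_separates hs
    Set.subset_union_left Set.subset_union_left (fun x => ?_) (fun x => ?_) (fun j => ?_) ?_⟩
  · rw [hQv]; rintro ⟨k, _, hk, e⟩; exact h.nt k hk e.symm
  · obtain ⟨j, hj, hj', e⟩ := h.exists_vt F
    exact ⟨⟨t j, Or.inr (seg_mem (by omega) hj'.le)⟩, (hQi _).2 ⟨j, hj, hj', rfl⟩, e⟩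
  · rw [hRv]; rintro ⟨k, _, hk, e⟩; exact h.ns k hk e.symm
  · intro x hx e
    obtain ⟨k, hk, hk', e'⟩ := (hRi x).1 hx
    replace e : G.Adj v x := e
    rw [← e'] at e
    exact h.vs k hk hk' e
  · intro x hx
    obtain ⟨k, hk, hk', e⟩ := (hQi x).1 hx
    rw [neighborSet_induce_ncard, ← e, h.block_neighbors hs hK hY hk hk']
    by_cases ev : G.Adj v (t k)
    · right
      have : {c | c ∈ ({v} : Set V) ∧ G.Adj (t k) c} = {v} := by
        ext c
        exact ⟨fun h => h.1, fun h => ⟨h, by rw [h]; exact ev.symm⟩⟩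
      refine ⟨?_, by change G.Adj v x; rwa [← e]⟩
      rw [this, Set.ncard_eq_three]
      refine ⟨t (k - 1), t (k + 1), v, ?_, (h.nt _ (by omega)).symm, (h.nt _ (by omega)).symm, ?_⟩
      · rw [ne_eq, h.ht.inj (by omega) (by omega)]; omega
      · rw [Set.insert_union, Set.singleton_union]
    · left
      have : {c | c ∈ ({v} : Set V) ∧ G.Adj (t k) c} = ∅ := by
        ext c
        refine ⟨fun ⟨h1, h2⟩ => ev ?_, fun h => h.elim⟩
        rw [h1] at h2; exact h2.symm
      rw [this, Set.union_empty]
      exact h.ncard_neighbors hk hk'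
  · rw [hPv]; rintro ⟨k, _, hk, e⟩; exact h.ns k hk e.symm
  · intro x hx e
    obtain ⟨k, hk, hk', e'⟩ := (hPi x).1 hx
    replace e : G.Adj v x := e
    rw [← e'] at e
    exact h.vs k hk hk' e
  · intro R hR1 hR2
    by_contra hcon
    push Not at hcon
    obtain ⟨q, hq, hq0, hql, hqv⟩ := R.exists_isP
    set L := R.length with hL
    have hp := isP_induce.1 hq
    set p : ℕ → V := fun k => (q k : V) with hpdef
    have p0 : p 0 = s 0 := by simp [hpdef, hq0]
    have pl : p L = s m := by simp [hpdef, hql]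
    have hL2 : 2 ≤ L := by
      have := h.ne_ends
      rw [← p0, ← pl, hp.adj_iff (by omega) le_rfl, ne_eq, hp.inj (by omega) le_rfl] at this
      omega
    have hint : ∀ k, 0 < k → k < L → ¬ G.Adj v (p k) := by
      intro k hk hk' e
      refine hcon (q k) ?_ e
      have := hq.mem_interior (x := q k)
      rw [← hqv, hq0, hql] at this
      exact this.2 ⟨k, hk, hk', rfl⟩
    have mem : ∀ k ≤ L, p k ∈ Y ∨ k = 0 ∨ k = L ∨ p k = v ∨ ∃ i, 0 < i ∧ i < m ∧ p k = s i := by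
      intro k hk
      have key : ∀ i ≤ m, p k = s i → k = 0 ∨ k = L ∨ ∃ i, 0 < i ∧ i < m ∧ p k = s i := by
        intro i hi e
        by_cases hi0 : i = 0
        · subst hi0; rw [← p0, hp.inj hk (by omega)] at e; exact Or.inl e
        by_cases him : i = m
        · subst him; rw [← pl, hp.inj hk (by omega)] at e; exact Or.inr (Or.inl e)
        · exact Or.inr (Or.inr ⟨i, by omega, by omega, e⟩)
      rcases (q k).2 with (hy | (e | e | e)) | ⟨i, _, hi, e⟩
      · exact Or.inl hy
      · have := key 0 (by omega) e; tauto
      · have := key m le_rfl e; tauto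
      · exact Or.inr (Or.inr (Or.inr (Or.inl e)))
      · have := key i hi e.symm; tauto
    have hvR : ∀ k ≤ L, p k = v → False := by
      intro k hk e
      have h1 : G.Adj (p k) (p 0) := by rw [e, p0]; exact h.va
      have h2 : G.Adj (p k) (p L) := by rw [e, pl]; exact h.vb
      rw [hp.adj_iff hk (by omega)] at h1 h2
      apply hR2
      rw [hqv]
      have hL' : L = 2 := by omega
      rw [hL']
      have hk1 : k = 1 := by omega
      rw [hk1] at e
      ext x
      constructor
      · rintro ⟨i, _, hi, rfl⟩
        obtain rfl | rfl | rfl : i = 0 ∨ i = 1 ∨ i = 2 := by omega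
        · exact Or.inl hq0
        · exact Or.inr (Or.inl (Subtype.ext e))
        · exact Or.inr (Or.inr (by rw [← hL']; exact hql))
      · rintro (rfl | rfl | rfl)
        · exact ⟨0, by omega, by omega, hq0⟩
        · exact ⟨1, by omega, by omega, Subtype.ext e⟩
        · exact ⟨2, by omega, by omega, by rw [← hL']; exact hql⟩
    by_cases hex : ∃ k ≤ L, ∃ i, 0 < i ∧ i < m ∧ p k = s i
    · -- the path enters the interior of `s`, so it contains all of it
      obtain ⟨k, hk, i, hi, hi', e⟩ := hex
      apply hR1
      have hk0 : k ≠ 0 := by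
        rintro rfl; rw [p0, h.hs.inj (by omega) (by omega)] at e; omega
      have hkL : k ≠ L := by
        rintro rfl; rw [pl, h.hs.inj (by omega) (by omega)] at e; omega
      -- neighbours inside the block of the inside of `s`
      have step : ∀ k ≤ L, ∀ i, 0 < i → i < m → p k = s i → ∀ l ≤ L, G.Adj (p k) (p l) →
          p l ∈ seg s 0 m := by
        intro k hk i hi hi' e l hl el
        rcases mem l hl with hy | rfl | rfl | e' | ⟨i', _, hi2, e'⟩
        · rw [e] at el; exact absurd el (hs.anti _ (hX i hi hi') _ hy).2
        · exact ⟨0, by omega, by omega, p0.symm⟩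
        · exact ⟨m, by omega, by omega, pl.symm⟩
        · exact (hvR l hl e').elim
        · exact ⟨i', by omega, by omega, e'.symm⟩
      have hsub : seg p 0 L ⊆ seg s 0 m := by
        have h1 : seg p 1 (L - 1) ⊆ seg s 1 (m - 1) := by
          refine hp.conn (by omega) _ ⟨p k, seg_mem (by omega) (by omega), i, by omega, by omega, e.symm⟩ ?_
          rintro _ ⟨a, ha, ha', rfl⟩ ⟨i, hi, hi', e⟩ _ ⟨b, hb, hb', rfl⟩ eab
          obtain ⟨i', _, hi2, e'⟩ := step a (by omega) i (by omega) (by omega) e.symm b (by omega) eab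
          refine ⟨i', Nat.pos_of_ne_zero ?_, ?_, e'⟩
          · rintro rfl; rw [← p0, hp.inj (by omega) (by omega)] at e'; omega
          · have : i' ≠ m := by
              rintro rfl; rw [← pl, hp.inj (by omega) (by omega)] at e'; omega
            omega
        rintro _ ⟨a, _, ha, rfl⟩
        by_cases ha0 : a = 0
        · subst ha0; exact ⟨0, by omega, by omega, p0.symm⟩
        by_cases haL : a = L
        · subst haL; exact ⟨m, by omega, by omega, pl.symm⟩
        · obtain ⟨i, _, hi, e⟩ := h1 (seg_mem (by omega) (by omega : a ≤ L - 1))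
          exact ⟨i, by omega, by omega, e⟩
      have hsup : seg s 0 m ⊆ seg p 0 L := by
        -- a connected subset of a path that contains both ends
        by_contra hnot
        obtain ⟨_, ⟨c, _, hc, rfl⟩, hcp⟩ := Set.not_subset.1 hnot
        have hc0 : c ≠ 0 := by rintro rfl; exact hcp ⟨0, by omega, by omega, p0⟩
        have hcm : c ≠ m := by rintro rfl; exact hcp ⟨L, by omega, by omega, pl⟩
        have : seg p 0 L ⊆ seg s 0 (c - 1) := by
          refine hp.conn le_rfl _ ⟨p 0, seg_mem le_rfl (by omega), 0, by omega, by omega, p0.symm⟩ ?_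
          rintro _ _ ⟨a, _, ha, rfl⟩ y hy eab
          obtain ⟨b, _, hb, rfl⟩ := hsub hy
          rw [h.hs.adj_iff (by omega) hb] at eab
          have : b ≠ c := by rintro rfl; exact hcp hy
          exact ⟨b, by omega, by omega, rfl⟩
        obtain ⟨b, _, hb, e⟩ := this (seg_mem (Nat.zero_le _) (le_refl L))
        rw [pl, h.hs.inj (by omega) (by omega)] at e
        omega
      ext x
      rw [hPv, hqv]
      constructor
      · rintro ⟨k, h1, h2, rfl⟩; exact hsub ⟨k, h1, h2, rfl⟩
      · intro hx
        obtain ⟨k, h1, h2, e⟩ := hsup hx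
        exact ⟨k, h1, h2, Subtype.ext e⟩
    · push Not at hex
      have hY' : ∀ k, 0 < k → k < L → p k ∈ Y := by
        intro k hk hk'
        rcases mem k hk'.le with hy | e | e | e | ⟨i, hi, hi', e⟩
        · exact hy
        · omega
        · omega
        · exact (hvR k hk'.le e).elim
        · exact absurd e (hex k hk'.le i hi hi')
      have hT : TwoPaths G s m p L := ⟨hm, hL2, h.hs, hp, p0.symm, pl.symm, fun i j hi hi' hj hj' =>
        hs.anti _ (hX i hi hi') _ (hY' j hj hj')⟩
      refine hT.theta F.theta (conn_singleton v) (att_single h.va.symm) (att_single h.vb.symm)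
        (anti_seg_single fun i hi hi' => h.v_far (by omega) (by omega))
        (anti_seg_single fun i hi hi' => ⟨fun e => hvR i (by omega) e.symm, hint i (by omega) (by omega)⟩)
  · intro x hx
    obtain ⟨k, hk, hk', e⟩ := (hPi x).1 hx
    rw [neighborSet_induce_ncard, ← e, h.swap.block_neighbors hs.symm hK' hX hk hk']
    have : {c | c ∈ ({v} : Set V) ∧ G.Adj (s k) c} = ∅ := by
      ext c
      refine ⟨fun ⟨h1, h2⟩ => h.vs k hk hk' ?_, fun h => h.elim⟩
      rw [h1] at h2; exact h2.symm
    rw [this, Set.union_empty]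
    exact h.swap.ncard_neighbors hk hk'
  · exact (hQi x).trans (h.mem_interior_iff hs h0 hl hY x.2)
  · refine (hPi x).trans (h.swap.mem_interior_iff hs.symm ?_ ?_ hX x.2)
    · rw [← h.first]; exact h0
    · rw [← h.last]; exact hl
  · fin_cases j <;> rfl
  · ext x
    constructor
    · rintro (rfl | rfl | rfl)
      · exact ⟨0, rfl⟩
      · exact ⟨2, rfl⟩
      · exact ⟨1, rfl⟩
    · rintro ⟨j, rfl⟩
      fin_cases j
      · exact h0
      · exact hv
      · exact hl

end

/-! ### Free graphs are buildable -/

section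
variable {V W : Type*} {G : SimpleGraph V} {H : SimpleGraph W}

theorem Conn.image (f : H ↪g G) {A : Set W} (hA : Conn H A) : Conn G (f '' A) := by
  rintro B ⟨_, ⟨x, hx, rfl⟩, hxB⟩ hB _ ⟨y, hy, rfl⟩
  exact hA (f ⁻¹' B) ⟨x, hx, hxB⟩ (fun a ha haB b hb hab =>
    hB _ ⟨a, ha, rfl⟩ haB _ ⟨b, hb, rfl⟩ (f.map_adj_iff.2 hab)) hy

theorem NoTheta.of_embedding (hG : NoTheta G) (f : H ↪g G) : NoTheta H := by
  intro u w A huw hn hA hu hw hAA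
  refine hG (f u) (f w) (fun i => f '' A i) (fun e => huw (f.injective e))
    (fun e => hn (f.map_adj_iff.1 e)) (fun i => (hA i).image f) ?_ ?_ ?_
  · intro i
    obtain ⟨x, hx, e⟩ := hu i
    exact ⟨f x, ⟨x, hx, rfl⟩, f.map_adj_iff.2 e⟩
  · intro i
    obtain ⟨x, hx, e⟩ := hw i
    exact ⟨f x, ⟨x, hx, rfl⟩, f.map_adj_iff.2 e⟩
  · rintro i j hij _ ⟨x, hx, rfl⟩ _ ⟨y, hy, rfl⟩
    have := hAA i j hij x hx y hy
    exact ⟨fun e => this.1 (f.injective e), fun e => this.2 (f.map_adj_iff.1 e)⟩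

theorem IsHole.map (f : H ↪g G) {h : ℕ → W} {n : ℕ} (hh : IsHole H h n) :
    IsHole G (fun k => f (h k)) n := by
  refine ⟨hh.1, fun i j hij hj => ?_⟩
  rw [f.injective.ne_iff, f.map_adj_iff]
  exact hh.2 i j hij hj

theorem HoleSet.image (f : H ↪g G) {A : Set W} (hA : HoleSet H A) : HoleSet G (f '' A) := by
  obtain ⟨h, n, hh, rfl⟩ := hA
  refine ⟨_, n, hh.map f, ?_⟩
  ext x
  constructor
  · rintro ⟨_, ⟨k, hk, rfl⟩, rfl⟩; exact ⟨k, hk, rfl⟩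
  · rintro ⟨k, hk, rfl⟩; exact ⟨_, ⟨k, hk, rfl⟩, rfl⟩

theorem Three.image (f : H ↪g G) {x : W} {A : Set W} (h : Three H x A) : Three G (f x) (f '' A) := by
  obtain ⟨a, ha, b, hb, c, hc, h1, h2, h3, e1, e2, e3⟩ := h
  exact ⟨f a, ⟨a, ha, rfl⟩, f b, ⟨b, hb, rfl⟩, f c, ⟨c, hc, rfl⟩, f.injective.ne h1, f.injective.ne h2,
    f.injective.ne h3, f.map_adj_iff.2 e1, f.map_adj_iff.2 e2, f.map_adj_iff.2 e3⟩

theorem Free.of_embedding (F : Free G) (f : H ↪g G) : Free H := by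
  refine ⟨F.theta.of_embedding f, fun x y z e1 e2 e3 => F.tri _ _ _ (f.map_adj_iff.2 e1)
    (f.map_adj_iff.2 e2) (f.map_adj_iff.2 e3), fun A x y hA hx hy e h1 h2 => ?_⟩
  refine F.wac (f '' A) (f x) (f y) (hA.image f) ?_ ?_ (f.map_adj_iff.2 e) (h1.image f) (h2.image f)
  · rintro ⟨x', hx', e⟩; exact hx (f.injective e ▸ hx')
  · rintro ⟨x', hx', e⟩; exact hy (f.injective e ▸ hx')

theorem Free.induce (F : Free G) (S : Set V) : Free (G.induce S) := F.of_embedding (Embedding.induce S)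

/-- A clique of a triangle-free graph has at most two vertices. -/
theorem exists_clique_enum (tri : ∀ x y z, G.Adj x y → G.Adj x z → ¬ G.Adj y z) {K : Set V}
    (hK : ∀ x ∈ K, ∀ y ∈ K, x ≠ y → G.Adj x y) :
    ∃ (l : ℕ) (k : Fin l → V), l ≤ 2 ∧ Set.range k = K ∧ ∀ i j, i ≠ j → G.Adj (k i) (k j) := by
  by_cases h0 : K = ∅
  · exact ⟨0, Fin.elim0, by omega, by rw [h0]; ext x; exact ⟨fun ⟨i, _⟩ => i.elim0, fun h => h.elim⟩,
      fun i => i.elim0⟩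
  obtain ⟨a, ha⟩ := Set.nonempty_iff_ne_empty.2 h0
  by_cases h1 : ∀ x ∈ K, x = a
  · refine ⟨1, fun _ => a, by omega, ?_, fun i j hij => absurd (Subsingleton.elim i j) hij⟩
    ext x
    exact ⟨fun ⟨_, e⟩ => e ▸ ha, fun hx => ⟨0, (h1 x hx).symm⟩⟩
  push Not at h1
  obtain ⟨b, hb, hba⟩ := h1
  have hab := hK a ha b hb hba.symm
  refine ⟨2, ![a, b], le_rfl, ?_, ?_⟩
  · ext x
    constructor
    · rintro ⟨i, rfl⟩
      fin_cases i
      · exact ha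
      · exact hb
    · intro hx
      by_cases hxa : x = a
      · exact ⟨0, hxa.symm⟩
      by_cases hxb : x = b
      · exact ⟨1, hxb.symm⟩
      · exact absurd (hK b hb x hx (Ne.symm hxb)) (tri _ _ _ hab (hK a ha x hx (Ne.symm hxa)))
  · intro i j hij
    fin_cases i <;> fin_cases j
    · exact absurd rfl hij
    · exact hab
    · exact hab.symm
    · exact absurd rfl hij

theorem Separates.isCliqueGluing (tri : ∀ x y z, G.Adj x y → G.Adj x z → ¬ G.Adj y z) {X Y K : Set V}
    (h : Separates G X Y K) (hK : ∀ x ∈ K, ∀ y ∈ K, x ≠ y → G.Adj x y) :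
    IsCliqueGluing (fun i : Fin 2 => G.induce ((if i = 0 then X else Y) ∪ K)) G := by
  obtain ⟨l, k, hl, rfl, hadj⟩ := exists_clique_enum tri hK
  refine ⟨l, fun i j => ⟨k j, Or.inr ⟨j, rfl⟩⟩, hl, fun i j j' hj => hadj j j' hj,
    fun i w => w.1, fun i => Subtype.val_injective, ?_, ?_, ?_⟩
  · intro v
    rcases h.cover v with hv | hv | hv
    · exact ⟨0, ⟨v, Or.inl hv⟩, rfl⟩
    · exact ⟨1, ⟨v, Or.inl hv⟩, rfl⟩
    · exact ⟨0, ⟨v, Or.inr hv⟩, rfl⟩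
  · intro i i' hii w w'
    constructor
    · intro e
      replace e : (w : V) = w' := e
      have hmem : (w : V) ∈ Set.range k := by
        rcases w.2 with hw | hw
        · rcases w'.2 with hw' | hw'
          · rw [← e] at hw'
            fin_cases i <;> fin_cases i'
            · exact absurd rfl hii
            · exact absurd rfl (h.anti _ hw _ hw').1
            · exact absurd rfl (h.anti _ hw' _ hw).1
            · exact absurd rfl hii
          · rw [e]; exact hw'
        · exact hw
      obtain ⟨j, hj⟩ := hmem
      exact ⟨j, Subtype.ext hj.symm, Subtype.ext (e.symm.trans hj.symm)⟩
    · rintro ⟨j, rfl, rfl⟩; rfl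
  · intro u w
    constructor
    · intro e
      have key : (u ∈ X ∪ Set.range k ∧ w ∈ X ∪ Set.range k) ∨
          (u ∈ Y ∪ Set.range k ∧ w ∈ Y ∪ Set.range k) := by
        rcases h.cover u with hu | hu | hu <;> rcases h.cover w with hw | hw | hw
        · exact Or.inl ⟨Or.inl hu, Or.inl hw⟩
        · exact absurd e (h.anti _ hu _ hw).2
        · exact Or.inl ⟨Or.inl hu, Or.inr hw⟩
        · exact absurd e.symm (h.anti _ hw _ hu).2
        · exact Or.inr ⟨Or.inl hu, Or.inl hw⟩
        · exact Or.inr ⟨Or.inl hu, Or.inr hw⟩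
        · exact Or.inl ⟨Or.inr hu, Or.inl hw⟩
        · exact Or.inr ⟨Or.inr hu, Or.inl hw⟩
        · exact Or.inl ⟨Or.inr hu, Or.inr hw⟩
      rcases key with ⟨hu, hw⟩ | ⟨hu, hw⟩
      · exact ⟨0, ⟨u, hu⟩, ⟨w, hw⟩, e, rfl, rfl⟩
      · exact ⟨1, ⟨u, hu⟩, ⟨w, hw⟩, e, rfl, rfl⟩
    · rintro ⟨i, w, w', e, rfl, rfl⟩
      exact e

theorem card_induce_lt [Finite V] {S : Set V} {y : V} (hy : y ∉ S) : Nat.card S < Nat.card V := by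
  rw [Nat.card_coe_set_eq, ← Set.ncard_univ V]
  exact Set.ncard_lt_ncard (Set.ssubset_univ_iff.2 fun e => hy (e ▸ Set.mem_univ y)) (Set.toFinite _)

/-- A graph that has none of the decompositions is basic. -/
theorem Free.isBasic [Finite V] [Nonempty V] (F : Free G) (h1 : ¬ CliqueSep G) (h2 : ¬ TwoSep G)
    (h3 : ¬ P3Sep G) : IsBasic G := by
  by_cases hc : IsEmpty (cubeGraph ↪g G)
  swap
  · rw [not_isEmpty_iff] at hc
    exact Or.inr (Or.inr (Or.inl (F.eq_cube h1 hc.some)))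
  by_cases hh : ∃ H, HoleSet G H
  · obtain ⟨H, hH⟩ := hh
    refine Or.inr (Or.inr (Or.inr ?_))
    rcases F.exists_wheel_or h1 hH with rfl | ⟨s, m, t, n, v, h⟩
    · exact isDaisy_of_fullPetals F h2 hH fun x hx => absurd (Set.mem_univ x) hx
    · have I : Indecomposable G := ⟨F, hc, h1, h3⟩
      obtain ⟨C₀, hC₀, hne₀⟩ := I.exists_centre h
      obtain ⟨C, hC, hmax⟩ := Set.exists_max_image {C | HoleSet G C} (fun C => (centres G C).ncard)
        (Set.toFinite _) ⟨C₀, hC₀⟩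
      have hne : (centres G C).Nonempty := by
        rw [← Set.ncard_pos]
        exact ((Set.ncard_pos (Set.toFinite _)).2 hne₀).trans_le (hmax C₀ hC₀)
      exact isDaisy_of_fullPetals F h2 hC fun x hx => I.exists_fullPetal hC hne hmax hx
  · push Not at hh
    have hadj : ∀ x y, x ≠ y → G.Adj x y := by
      intro x y hxy
      by_contra hn
      exact h1 (cliqueSep_of_no_hole hh hxy hn)
    obtain ⟨l, k, hl, hr, hk⟩ := exists_clique_enum F.tri (K := Set.univ) fun x _ y _ => hadj x y
    have hinj : Function.Injective k := by
      intro i j e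
      by_contra hij
      exact (hk i j hij).ne e
    have iso : Nonempty (G ≃g completeGraph (Fin l)) := by
      refine ⟨(RelIso.mk (Equiv.ofBijective k ⟨hinj, Set.range_eq_univ.1 hr⟩) ?_).symm⟩
      intro i j
      constructor
      · rintro e rfl; exact e.ne rfl
      · exact fun e => hk i j e
    obtain rfl | rfl | rfl : l = 0 ∨ l = 1 ∨ l = 2 := by omega
    · obtain ⟨x⟩ := ‹Nonempty V›
      obtain ⟨i, _⟩ := hr.symm ▸ Set.mem_univ x
      exact i.elim0
    · exact Or.inl iso
    · exact Or.inr (Or.inl iso)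

end

/-- The decomposition half of the theorem, by induction on the number of vertices. -/
theorem Free.buildable (N : ℕ) : ∀ {V : Type u} [Finite V] [Nonempty V] (G : SimpleGraph V),
    Nat.card V = N → Free G → Buildable G := by
  induction N using Nat.strong_induction_on with
  | _ N ih =>
    intro V _ _ G hN F
    have block : ∀ S : Set V, S.Nonempty → (∃ y, y ∉ S) → Buildable (G.induce S) := by
      rintro S hS ⟨y, hy⟩
      have : Nonempty S := hS.to_subtype
      exact ih _ (hN ▸ card_induce_lt hy) _ rfl (F.induce S)
    by_cases h1 : CliqueSep G
    · obtain ⟨X, Y, K, h, hK⟩ := h1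
      refine Buildable.clique G 2 _ _ le_rfl (fun i => ?_) (h.isCliqueGluing F.tri hK)
      obtain ⟨x, hx⟩ := h.nX
      obtain ⟨y, hy⟩ := h.nY
      fin_cases i
      · exact block _ ⟨x, Or.inl hx⟩ ⟨y, fun hy' => hy'.elim (fun e => (h.anti y e y hy).1 rfl)
          (h.YK y hy)⟩
      · exact block _ ⟨y, Or.inl hy⟩ ⟨x, fun hx' => hx'.elim (fun e => (h.anti x hx x e).1 rfl)
          (h.XK x hx)⟩
    by_cases h3 : P3Sep G
    · obtain ⟨s, m, t, n, v, X, Y, hw, hs, hX, hY, ⟨x, hx, hxs⟩, y, hy, hyt⟩ := h3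
      refine Buildable.p3 G _ _ (block _ ⟨x, Or.inl (Or.inl hx)⟩ ⟨y, ?_⟩)
        (block _ ⟨y, Or.inl (Or.inl hy)⟩ ⟨x, ?_⟩) (hw.isP3Gluing F hs hX hY)
      · rintro ((hy' | hy') | hy')
        · exact (hs.anti y hy' y hy).1 rfl
        · exact hs.YK y hy hy'
        · exact hyt hy'
      · rintro ((hx' | hx') | hx')
        · exact (hs.anti x hx x hx').1 rfl
        · exact hs.XK x hx hx'
        · exact hxs hx'
    by_cases h2 : TwoSep G
    · obtain ⟨s, m, t, n, X, Y, hw, hs, hX, hY, ⟨x, hx, hxs⟩, y, hy, hyt⟩ := h2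
      refine Buildable.two G _ _ (block _ ⟨x, Or.inl (Or.inl hx)⟩ ⟨y, ?_⟩)
        (block _ ⟨y, Or.inl (Or.inl hy)⟩ ⟨x, ?_⟩) (hw.isTwoGluing hs hX hY)
      · rintro ((hy' | hy') | hy')
        · exact (hs.anti y hy' y hy).1 rfl
        · exact hs.YK y hy hy'
        · exact hyt hy'
      · rintro ((hx' | hx') | hx')
        · exact (hs.anti x hx x hx').1 rfl
        · exact hs.XK x hx hx'
        · exact hxs hx'
    exact Buildable.basic G (F.isBasic h1 h2 h3)

/-! ### Basic graphs are free -/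

/-- The hole `C` and the full petals `T i` with centres `cen i` cover the vertices of `G`. -/
structure Daisy {V ι : Type*} (G : SimpleGraph V) (C : Set V) (cen : ι → V) (T : ι → ℕ → V) (N : ι → ℕ) :
    Prop where
  hole : HoleSet G C
  petal : ∀ i, FullPetal G C (cen i) (T i) (N i)
  cen_mem : ∀ i, cen i ∈ C
  inj : ∀ i j, cen i = cen j → i = j
  inner : ∀ i, ∃ k, 0 < k ∧ k < N i ∧ G.Adj (cen i) (T i k)
  sparse : ∀ i k, k < N i → G.Adj (cen i) (T i k) → ¬ G.Adj (cen i) (T i (k + 1))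
  cover : ∀ x, x ∉ C → ∃ i k, 0 < k ∧ k < N i ∧ T i k = x

section
variable {V ι : Type*} {G : SimpleGraph V} {C : Set V} {t : ℕ → V} {n : ℕ} {v : V}

theorem HoleSet.eq_or_eq_of_adj (hC : HoleSet G C) {a b c : V} (hv : v ∈ C) (ha : a ∈ C) (hb : b ∈ C)
    (hc : c ∈ C) (hab : a ≠ b) (va : G.Adj v a) (vb : G.Adj v b) (vc : G.Adj v c) : c = a ∨ c = b := by
  obtain ⟨s, m, -, -, rfl, rfl, rfl, hadj⟩ := hC.exists_arc hv ha hb hab va vb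
  rcases hc with rfl | ⟨i, _, hi, rfl⟩
  · exact absurd rfl vc.ne
  · rcases (hadj i hi).2.1 vc with rfl | rfl
    · exact Or.inl rfl
    · exact Or.inr rfl

theorem HoleSet.two (hC : HoleSet G C) (hv : v ∈ C) : Two G v C := by
  obtain ⟨h, n, hh, rfl, rfl⟩ := hC.exists_first hv
  have := hh.1
  refine ⟨h 1, ⟨1, by omega, rfl⟩, h (n - 1), ⟨n - 1, by omega, rfl⟩, fun e => ?_, ?_, ?_⟩
  · rw [hh.inj (by omega) (by omega)] at e; omega
  · rw [hh.adj_iff (by omega) (by omega)]; omega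
  · rw [hh.adj_iff (by omega) (by omega)]; omega

theorem HoleSet.no_triangle (hC : HoleSet G C) {x y z : V} (hx : x ∈ C) (hy : y ∈ C) (hz : z ∈ C)
    (e1 : G.Adj x y) (e2 : G.Adj x z) : ¬ G.Adj y z := by
  obtain ⟨h, n, hh, rfl⟩ := hC
  obtain ⟨i, hi, rfl⟩ := hx
  obtain ⟨j, hj, rfl⟩ := hy
  obtain ⟨k, hk, rfl⟩ := hz
  have := hh.1
  rw [hh.adj_iff hi hj] at e1
  rw [hh.adj_iff hi hk] at e2
  rw [hh.adj_iff hj hk]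
  omega

theorem FullPetal.eq_or_of_adj (h : FullPetal G C v t n) {k : ℕ} (h0 : 0 < k) (hk : k < n) {x : V}
    (e : G.Adj (t k) x) : x = t (k - 1) ∨ x = t (k + 1) ∨ x = v := by
  rcases h.iso k h0 hk x e with ⟨l, _, hl, rfl⟩ | rfl
  · rw [h.ht.adj_iff hk.le hl] at e
    rcases e with rfl | rfl
    · exact Or.inr (Or.inl rfl)
    · exact Or.inl rfl
  · exact Or.inr (Or.inr rfl)

theorem FullPetal.ne_centre (h : FullPetal G C v t n) (hv : v ∈ C) {k : ℕ} (hk : k ≤ n) : t k ≠ v := by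
  intro e
  by_cases h0 : k = 0
  · subst h0; exact h.va.ne e.symm
  by_cases hkn : k = n
  · subst hkn; exact h.vb.ne e.symm
  · exact h.out k (by omega) (by omega) (e ▸ hv)

/-- A vertex with neighbours in pairwise anticomplete sets belongs to none of them. -/
theorem notMem_of_att {A : Fin 3 → Set V} {u : V} (hu : ∀ i, Att G u (A i))
    (hA : ∀ i j, i ≠ j → Anti G (A i) (A j)) (j : Fin 3) : u ∉ A j := by
  intro h
  obtain ⟨i, hij⟩ : ∃ i, j ≠ i := ⟨j + 1, by fin_cases j <;> decide⟩
  obtain ⟨x, hx, e⟩ := hu i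
  exact (hA j i hij u h x hx).2 e

/-- A vertex inside a petal is not a branch vertex of a theta: two of the three connected sets would be
contained in the two parts of the petal next to it. -/
theorem FullPetal.no_branch (h : FullPetal G C v t n) (hv : v ∈ C) {k : ℕ} (h0 : 0 < k) (hk : k < n)
    {w : V} {A : Fin 3 → Set V} (hw : t k ≠ w) (hA : ∀ i, Conn G (A i)) (hu : ∀ i, Att G (t k) (A i))
    (hwA : ∀ i, Att G w (A i)) (hAA : ∀ i j, i ≠ j → Anti G (A i) (A j)) : False := by
  have huA := notMem_of_att hu hAA
  have hwA' := notMem_of_att hwA hAA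
  choose x hx ex using hu
  have hne : ∀ i j, i ≠ j → x i ≠ x j := fun i j hij => (hAA i j hij _ (hx i) _ (hx j)).1
  have h3 : Three G (t k) (Set.range x) := ⟨x 0, ⟨0, rfl⟩, x 1, ⟨1, rfl⟩, x 2, ⟨2, rfl⟩,
    hne _ _ (by decide), hne _ _ (by decide), hne _ _ (by decide), ex 0, ex 1, ex 2⟩
  have hx' := fun j => h.eq_or_of_adj h0 hk (ex j)
  obtain ⟨j, hj⟩ : ∃ j, x j = v := by
    by_contra hcon
    push Not at hcon
    refine h3.elim (a := t (k - 1)) (b := t (k + 1)) ?_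
    rintro _ ⟨j, rfl⟩ -
    have := hx' j
    have := hcon j
    tauto
  obtain ⟨j₁, hj₁⟩ : ∃ j, x j = t (k - 1) := by
    by_contra hcon
    push Not at hcon
    refine h3.elim (a := v) (b := t (k + 1)) ?_
    rintro _ ⟨j, rfl⟩ -
    have := hx' j
    have := hcon j
    tauto
  obtain ⟨j₂, hj₂⟩ : ∃ j, x j = t (k + 1) := by
    by_contra hcon
    push Not at hcon
    refine h3.elim (a := v) (b := t (k - 1)) ?_
    rintro _ ⟨j, rfl⟩ -
    have := hx' j
    have := hcon j
    tauto
  have hvj : v ∈ A j := hj ▸ hx j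
  have d1 : j ≠ j₁ := by
    rintro rfl
    exact h.ne_centre hv (by omega) (hj₁.symm.trans hj)
  have d2 : j ≠ j₂ := by
    rintro rfl
    exact h.ne_centre hv (by omega) (hj₂.symm.trans hj)
  -- a set other than `A j` contains neither `v` nor a neighbour of `v`, so it stays inside the petal
  have stay : ∀ i, j ≠ i → ∀ l, l ≤ n → t l ∈ A i → 0 < l ∧ l < n := by
    intro i hji l hl hlA
    have := hAA j i hji v hvj _ hlA
    constructor
    · refine Nat.pos_of_ne_zero ?_
      rintro rfl
      exact this.2 h.va
    · refine lt_of_le_of_ne hl ?_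
      rintro rfl
      exact this.2 h.vb
  have side : ∀ i, j ≠ i → ∀ l₀, l₀ ≤ n → t l₀ ∈ A i →
      A i ⊆ {x | ∃ l, 0 < l ∧ l < n ∧ l ≠ k ∧ (l < k ↔ l₀ < k) ∧ t l = x} := by
    intro i hji l₀ hl₀ hl₀A
    have hl₀' := stay i hji l₀ hl₀ hl₀A
    refine hA i _ ⟨_, hl₀A, l₀, hl₀'.1, hl₀'.2, ?_, Iff.rfl, rfl⟩ ?_
    · rintro rfl; exact huA i hl₀A
    · rintro _ hlA ⟨l, hl0, hln, hlk, hiff, rfl⟩ y hyA e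
      have hk' : ∀ l', t l' ∈ A i → l' ≠ k := by
        rintro _ h rfl; exact huA i h
      rcases h.eq_or_of_adj hl0 hln e with rfl | rfl | rfl
      · have := stay i hji _ (by omega) hyA
        have := hk' _ hyA
        exact ⟨l - 1, by omega, by omega, by omega, by omega, rfl⟩
      · have := stay i hji _ (by omega) hyA
        have := hk' _ hyA
        exact ⟨l + 1, by omega, by omega, by omega, by omega, rfl⟩
      · exact absurd rfl (hAA j i hji _ hvj _ hyA).1
  have near : ∀ i, j ≠ i → ∀ l₀, l₀ ≤ n → l₀ ≠ k → t l₀ ∈ A i →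
      ∃ l ≤ n, t l = w ∧ (l₀ < k → l ≤ k) ∧ (k < l₀ → k ≤ l) := by
    intro i hji l₀ hl₀ hne hl₀A
    obtain ⟨y, hy, e⟩ := hwA i
    obtain ⟨l, hl0, hln, hlk, hiff, rfl⟩ := side i hji l₀ hl₀ hl₀A hy
    rcases h.eq_or_of_adj hl0 hln e.symm with rfl | rfl | rfl
    · exact ⟨l - 1, by omega, rfl, by omega, by omega⟩
    · exact ⟨l + 1, by omega, rfl, by omega, by omega⟩
    · exact absurd hvj (hwA' j)
  obtain ⟨l₁, hl₁, rfl, h1, -⟩ := near j₁ d1 (k - 1) (by omega) (by omega) (hj₁ ▸ hx j₁)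
  obtain ⟨l₂, hl₂, e, -, h2⟩ := near j₂ d2 (k + 1) (by omega) (by omega) (hj₂ ▸ hx j₂)
  rw [h.ht.inj hl₂ hl₁] at e
  exact hw (congrArg t (by omega))

/-- A connected set that is attached to the end `t 0` of a petal inside the petal, and to another vertex `w`
of the hole, either contains the centre or runs through the whole petal. -/
theorem FullPetal.traverse (h : FullPetal G C v t n) {w : V} {A : Set V} (hwC : w ∈ C) (hw : t 0 ≠ w)
    (hn : ¬ G.Adj (t 0) w) (hA : Conn G A) (h1 : t 1 ∈ A) (hwA : Att G w A) (hu : t 0 ∉ A) :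
    v ∈ A ∨ seg t 1 (n - 1) ⊆ A := by
  have hn2 := h.hn
  by_cases hv : v ∈ A
  · exact Or.inl hv
  have hend : t n ∈ A ∨ t (n - 1) ∈ A := by
    by_cases hnA : t n ∈ A
    · exact Or.inl hnA
    have hsub : A ⊆ seg t 1 (n - 1) := by
      refine hA _ ⟨_, h1, seg_mem le_rfl (by omega)⟩ ?_
      rintro _ hlA ⟨l, hl, hl', rfl⟩ y hy e
      rcases h.eq_or_of_adj (by omega) (by omega) e with rfl | rfl | rfl
      · refine seg_mem ?_ (by omega)
        refine Nat.pos_of_ne_zero fun e => hu ?_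
        rwa [e] at hy
      · refine seg_mem (by omega) ?_
        by_contra hlt
        exact hnA (by rwa [show l + 1 = n by omega] at hy)
      · exact absurd hy hv
    obtain ⟨y, hy, e⟩ := hwA
    obtain ⟨l, hl, hl', rfl⟩ := hsub hy
    rcases h.eq_of_adj (by omega) (by omega) hwC e.symm with rfl | rfl | rfl
    · exact absurd rfl hw
    · rw [h.ht.adj_iff le_rfl (by omega)] at e
      exact Or.inr (by rwa [show n - 1 = l by omega])
    · exact absurd h.va.symm hn
  refine Or.inr ?_
  rintro _ ⟨l, hl, hl', rfl⟩
  by_contra hlA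
  have hsub : A ⊆ {x | ∃ k, 0 < k ∧ k < l ∧ t k = x} := by
    refine hA _ ⟨_, h1, 1, by omega, lt_of_le_of_ne hl (by rintro rfl; exact hlA h1), rfl⟩ ?_
    rintro _ hkA ⟨k, hk, hk', rfl⟩ y hy e
    rcases h.eq_or_of_adj (by omega) (by omega) e with rfl | rfl | rfl
    · refine ⟨k - 1, Nat.pos_of_ne_zero fun e => hu ?_, by omega, rfl⟩
      rwa [e] at hy
    · refine ⟨k + 1, by omega, lt_of_le_of_ne hk' fun e => hlA ?_, rfl⟩
      rwa [← e]
    · exact absurd hy hv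
  rcases hend with hend | hend
  · obtain ⟨k, hk, hk', e⟩ := hsub hend
    rw [h.ht.inj (by omega) (by omega)] at e
    omega
  · obtain ⟨k, hk, hk', e⟩ := hsub hend
    rw [h.ht.inj (by omega) (by omega)] at e
    omega

/-- If `v` and a vertex `t 0` next to it are outside a hole, then the hole contains no vertex of the petal. -/
theorem FullPetal.avoid (h : FullPetal G C v t n) {H : Set V} (hH : HoleSet G H) (hv : v ∉ H)
    (h0 : t 0 ∉ H) : ∀ k < n, t k ∉ H := by
  intro k
  induction k with
  | zero => exact fun _ => h0
  | succ k ih =>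
    intro hk hkH
    obtain ⟨a, ha, b, hb, hab, ea, eb⟩ := hH.two hkH
    have key : ∀ c ∈ H, G.Adj (t (k + 1)) c → c = t (k + 2) := by
      intro c hc e
      rcases h.eq_or_of_adj (by omega) hk e with rfl | rfl | rfl
      · exact absurd hc (ih (by omega))
      · rfl
      · exact absurd hc hv
    exact hab ((key a ha ea).trans (key b hb eb).symm)

namespace Daisy
variable {cen : ι → V} {T : ι → ℕ → V} {N : ι → ℕ} (D : Daisy G C cen T N)
include D

theorem tri (x y z : V) (e1 : G.Adj x y) (e2 : G.Adj x z) : ¬ G.Adj y z := by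
  have key : ∀ x y z, x ∉ C → G.Adj x y → G.Adj x z → ¬ G.Adj y z := by
    intro x y z hx e1 e2 e3
    obtain ⟨i, k, h0, hk, rfl⟩ := D.cover x hx
    have h := D.petal i
    have s1 := D.sparse i (k - 1) (by omega)
    have s2 := D.sparse i k hk
    rw [show k - 1 + 1 = k by omega] at s1
    have hne : ¬ G.Adj (T i (k - 1)) (T i (k + 1)) := (h.ht.far (by omega) (by omega) (by omega)).2
    rcases h.eq_or_of_adj h0 hk e1 with rfl | rfl | rfl <;>
      rcases h.eq_or_of_adj h0 hk e2 with rfl | rfl | rfl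
    · exact e3.ne rfl
    · exact hne e3
    · exact s1 e3.symm e2.symm
    · exact hne e3.symm
    · exact e3.ne rfl
    · exact s2 e2.symm e3.symm
    · exact s1 e3 e1.symm
    · exact s2 e1.symm e3
    · exact e3.ne rfl
  intro e3
  by_cases hx : x ∈ C
  · by_cases hy : y ∈ C
    · by_cases hz : z ∈ C
      · exact D.hole.no_triangle hx hy hz e1 e2 e3
      · exact key z x y hz e2.symm e3.symm e1
    · exact key y x z hy e1.symm e3 e2
  · exact key x y z hx e1 e2 e3

/-- A connected set attached to two nonadjacent vertices `u` and `w` of the hole contains a neighbour `z` of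
`u` in the hole, or the whole petal centred at such a neighbour. -/
theorem exists_nbr {u w : V} {A : Set V} (huC : u ∈ C) (hwC : w ∈ C) (huw : u ≠ w) (hn : ¬ G.Adj u w)
    (hA : Conn G A) (hu : Att G u A) (hw : Att G w A) (huA : u ∉ A) :
    ∃ z ∈ C, G.Adj u z ∧ (z ∈ A ∨ ∃ i, cen i = z ∧ seg (T i) 1 (N i - 1) ⊆ A) := by
  obtain ⟨x, hx, e⟩ := hu
  by_cases hxC : x ∈ C
  · exact ⟨x, hxC, e, Or.inl hx⟩
  obtain ⟨i, k, h0, hk, rfl⟩ := D.cover x hxC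
  have h := D.petal i
  rcases h.eq_of_adj h0 hk huC e.symm with rfl | rfl | rfl
  · have hk1 := e
    rw [h.ht.adj_iff (by omega) hk.le] at hk1
    obtain rfl : k = 1 := by omega
    exact ⟨cen i, D.cen_mem i, h.va.symm, (h.traverse hwC huw hn hA hx hw huA).imp id fun h => ⟨i, rfl, h⟩⟩
  · have hk1 := e
    rw [h.ht.adj_iff le_rfl hk.le] at hk1
    obtain rfl : k = N i - 1 := by omega
    refine ⟨cen i, D.cen_mem i, h.vb.symm, ?_⟩
    have := h.rev.traverse hwC (by simpa using huw) (by simpa using hn) hA hx hw (by simpa using huA)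
    rw [h.interior_rev] at this
    exact this.imp id fun h => ⟨i, rfl, h⟩
  · -- the set must leave the petal, and does so through `t 0` or `t n`
    by_cases h1 : T i 0 ∈ A
    · exact ⟨_, h.first_mem, h.va, Or.inl h1⟩
    by_cases h2 : T i (N i) ∈ A
    · exact ⟨_, h.last_mem, h.vb, Or.inl h2⟩
    exfalso
    have hsub : A ⊆ seg (T i) 1 (N i - 1) := by
      refine hA _ ⟨_, hx, seg_mem (by omega) (by omega)⟩ ?_
      rintro _ hlA ⟨l, hl, hl', rfl⟩ y hy e
      rcases h.eq_or_of_adj (by omega) (by omega) e with rfl | rfl | rfl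
      · refine seg_mem ?_ (by omega)
        refine Nat.pos_of_ne_zero fun e => h1 ?_
        rwa [e] at hy
      · refine seg_mem (by omega) ?_
        by_contra hlt
        exact h2 (by rwa [show l + 1 = N i by omega] at hy)
      · exact absurd hy huA
    obtain ⟨y, hy, ey⟩ := hw
    obtain ⟨l, hl, hl', rfl⟩ := hsub hy
    rcases h.eq_of_adj (by omega) (by omega) hwC ey.symm with rfl | rfl | rfl
    · exact hn h.va
    · exact hn h.vb
    · exact huw rfl

theorem noTheta : NoTheta G := by
  intro u w A huw hn hA hu hw hAA
  have mem : ∀ {u w}, u ≠ w → (∀ i, Att G u (A i)) → (∀ i, Att G w (A i)) → u ∈ C := by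
    intro u w huw hu hw
    by_contra huC
    obtain ⟨i, k, h0, hk, rfl⟩ := D.cover u huC
    exact (D.petal i).no_branch (D.cen_mem i) h0 hk huw hA hu hw hAA
  have huC := mem huw hu hw
  have hwC := mem huw.symm hw hu
  obtain ⟨p, hp, q, hq, hpq, ep, eq⟩ := D.hole.two huC
  have huA := notMem_of_att hu hAA
  choose z hzC ez hz using fun j => D.exists_nbr huC hwC huw hn (hA j) (hu j) (hw j) (huA j)
  have clash : ∀ j j', j ≠ j' → z j ≠ z j' := by
    intro j j' hj e
    have hinner : ∀ {i j j'}, j ≠ j' → cen i ∈ A j → seg (T i) 1 (N i - 1) ⊆ A j' → False := by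
      intro i j j' hj h1 h2
      obtain ⟨k, h0, hk, ek⟩ := D.inner i
      exact (hAA j j' hj _ h1 _ (h2 (seg_mem (by omega) (by omega)))).2 ek
    rcases hz j with h1 | ⟨i, hi, h1⟩ <;> rcases hz j' with h2 | ⟨i', hi', h2⟩
    · exact (hAA j j' hj _ h1 _ h2).1 e
    · exact hinner hj (by rw [hi', ← e]; exact h1) h2
    · exact hinner hj.symm (by rw [hi, e]; exact h2) h1
    · obtain rfl := D.inj i i' (by rw [hi, hi', e])
      have := (D.petal i).hn
      exact (hAA j j' hj _ (h1 (seg_mem le_rfl (by omega))) _ (h2 (seg_mem le_rfl (by omega)))).1 rfl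
  refine (show Three G u (Set.range z) from ⟨z 0, ⟨0, rfl⟩, z 1, ⟨1, rfl⟩, z 2, ⟨2, rfl⟩,
    clash _ _ (by decide), clash _ _ (by decide), clash _ _ (by decide), ez 0, ez 1, ez 2⟩).elim
    (a := p) (b := q) ?_
  rintro _ ⟨j, rfl⟩ -
  exact D.hole.eq_or_eq_of_adj huC hp hq (hzC j) hpq ep eq (ez j)

theorem noWac : NoWac G := by
  intro H x y hH hx hy e h3x h3y
  have mem : ∀ {x y}, G.Adj x y → y ∉ H → Three G x H → x ∈ C := by
    intro x y e hy h3
    by_contra hxC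
    obtain ⟨i, k, h0, hk, rfl⟩ := D.cover x hxC
    have h := D.petal i
    have key : ∀ c ∈ H, G.Adj (T i k) c → c ≠ y ∧ (c = T i (k - 1) ∨ c = T i (k + 1) ∨ c = cen i) :=
      fun c hc ec => ⟨fun e => hy (e ▸ hc), h.eq_or_of_adj h0 hk ec⟩
    rcases h.eq_or_of_adj h0 hk e with rfl | rfl | rfl
    · refine h3.elim (a := T i (k + 1)) (b := cen i) fun c hc ec => ?_
      have := key c hc ec
      tauto
    · refine h3.elim (a := T i (k - 1)) (b := cen i) fun c hc ec => ?_
      have := key c hc ec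
      tauto
    · refine h3.elim (a := T i (k - 1)) (b := T i (k + 1)) fun c hc ec => ?_
      have := key c hc ec
      tauto
  have hxC := mem e hy h3x
  have hyC := mem e.symm hx h3y
  -- the hole avoids the petals centred at `x` and at `y`
  have avoid : ∀ i k, 0 < k → k < N i → T i k ∈ H → cen i ≠ x ∧ cen i ≠ y := by
    have key : ∀ {x y}, G.Adj x y → x ∉ H → y ∉ H → y ∈ C → ∀ i k, 0 < k → k < N i → T i k ∈ H →
        cen i ≠ x := by
      rintro _ y e hx hy hyC i k h0 hk hkH rfl
      have h := D.petal i
      rcases D.hole.eq_or_eq_of_adj (D.cen_mem i) h.first_mem h.last_mem hyC h.ne_ends h.va h.vb e with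
        rfl | rfl
      · exact h.avoid hH hx hy k hk hkH
      · refine h.rev.avoid hH hx (by simpa using hy) (N i - k) (by omega) ?_
        simpa [show N i - (N i - k) = k by omega] using hkH
    exact fun i k h0 hk hkH => ⟨key e hx hy hyC i k h0 hk hkH, key e.symm hy hx hxC i k h0 hk hkH⟩
  obtain ⟨z, hzC, exz, hz⟩ : ∃ z ∈ C, G.Adj x z ∧ ∀ c ∈ C, G.Adj x c → c = y ∨ c = z := by
    obtain ⟨p, hp, q, hq, hpq, ep, eq⟩ := D.hole.two hxC
    by_cases hpy : p = y
    · subst hpy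
      exact ⟨q, hq, eq, fun c hc ec => D.hole.eq_or_eq_of_adj hxC hp hq hc hpq ep eq ec⟩
    · exact ⟨p, hp, ep, fun c hc ec => D.hole.eq_or_eq_of_adj hxC hyC hp hc (Ne.symm hpy) e ep ec⟩
  -- the petal centred at `z` has one vertex adjacent to `x`
  obtain ⟨d, hd⟩ : ∃ d, ∀ i k, 0 < k → k < N i → cen i = z → G.Adj x (T i k) → T i k = d := by
    by_cases hi : ∃ i, cen i = z
    · obtain ⟨i, rfl⟩ := hi
      have h := D.petal i
      have hend : ∀ k, 0 < k → k < N i → G.Adj x (T i k) →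
          (x = T i 0 ∧ T i k = T i 1) ∨ (x = T i (N i) ∧ T i k = T i (N i - 1)) := by
        intro k h0 hk ek
        rcases h.eq_of_adj h0 hk hxC ek.symm with rfl | rfl | e'
        · rw [h.ht.adj_iff (by omega) hk.le] at ek
          exact Or.inl ⟨rfl, congrArg _ (by omega)⟩
        · rw [h.ht.adj_iff le_rfl hk.le] at ek
          exact Or.inr ⟨rfl, congrArg _ (by omega)⟩
        · exact absurd e' exz.ne
      by_cases h0 : x = T i 0
      · refine ⟨T i 1, fun i' k hk hk' hi ek => ?_⟩
        obtain rfl := D.inj _ _ hi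
        rcases hend k hk hk' ek with e' | e'
        · exact e'.2
        · exact absurd (h0.symm.trans e'.1) h.ne_ends
      · refine ⟨T i (N i - 1), fun i' k hk hk' hi ek => ?_⟩
        obtain rfl := D.inj _ _ hi
        rcases hend k hk hk' ek with e' | e'
        · exact absurd e'.1 h0
        · exact e'.2
    · exact ⟨x, fun i k _ _ e' => absurd ⟨i, e'⟩ hi⟩
  refine h3x.elim (a := z) (b := d) fun c hc ec => ?_
  by_cases hcC : c ∈ C
  · exact (hz c hcC ec).elim (fun e' => absurd (e' ▸ hc) hy) Or.inl
  obtain ⟨i, k, h0, hk, rfl⟩ := D.cover c hcC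
  have h := D.petal i
  have hav := avoid i k h0 hk hc
  have hcz : G.Adj x (cen i) → cen i = z := fun e' => (hz _ (D.cen_mem i) e').resolve_left hav.2
  rcases h.eq_of_adj h0 hk hxC ec.symm with rfl | rfl | e'
  · exact Or.inr (hd i k h0 hk (hcz h.va.symm) ec)
  · exact Or.inr (hd i k h0 hk (hcz h.vb.symm) ec)
  · exact absurd e'.symm hav.1

theorem free : Free G := ⟨D.noTheta, D.tri, D.noWac⟩

end Daisy
end

section
variable {V : Type*} {G : SimpleGraph V}

theorem fin_ne (m : ℕ) (i : Fin (m + 4)) : i - 1 ≠ i + 1 ∧ i - 1 ≠ i ∧ i + 1 ≠ i ∧ i + 1 ≠ i - 1 - 1 := by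
  have h1 : (1 : Fin (m + 4)) ≠ 0 := fun h => absurd (Fin.ext_iff.1 h) (by simp)
  have h2 : (1 + 1 : Fin (m + 4)) ≠ 0 := fun h => by
    have := Fin.ext_iff.1 h
    rw [Fin.val_add] at this
    simp [Nat.mod_eq_of_lt (show 2 < m + 4 by omega)] at this
  have h3 : (1 + 1 + 1 : Fin (m + 4)) ≠ 0 := fun h => by
    have := Fin.ext_iff.1 h
    rw [Fin.val_add, Fin.val_add] at this
    simp [Nat.mod_eq_of_lt (show 3 < m + 4 by omega)] at this
  refine ⟨fun h => h2 ?_, fun h => h1 ?_, fun h => h1 ?_, fun h => h3 ?_⟩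
  · rw [show (1 + 1 : Fin (m + 4)) = (i + 1) - (i - 1) by abel, h, sub_self]
  · rw [show (1 : Fin (m + 4)) = i - (i - 1) by abel, h, sub_self]
  · rw [show (1 : Fin (m + 4)) = (i + 1) - i by abel, h, sub_self]
  · rw [show (1 + 1 + 1 : Fin (m + 4)) = (i + 1) - (i - 1 - 1) by abel, h, sub_self]

/-- A petal without neighbours outside the hole, extended by its two attachments, is a full petal. -/
theorem Petal.exists_fullPetal {C : Hole G} {i : Fin (C.m + 4)} (P : Petal G C i)
    (iso : ∀ u ∈ P.path.verts, ∀ w, G.Adj u w → w ∈ P.path.verts ∨ w ∈ Set.range C.c) :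
    ∃ t n, FullPetal G (Set.range C.c) (C.c i) t n ∧ P.path.verts = seg t 1 (n - 1) ∧
      (∃ k, 0 < k ∧ k < n ∧ G.Adj (C.c i) (t k)) ∧
      ∀ k < n, G.Adj (C.c i) (t k) → ¬ G.Adj (C.c i) (t (k + 1)) := by
  obtain ⟨p, hp, h0, hl, hverts⟩ := P.path.exists_isP
  set L := P.path.length
  obtain ⟨n1, n2, n3, n4⟩ := fin_ne C.m i
  have hpv : ∀ k ≤ L, p k ∈ P.path.verts := fun k hk => hverts ▸ seg_mem (Nat.zero_le k) hk
  have hpC : ∀ k ≤ L, p k ∉ Set.range C.c := fun k hk => Set.disjoint_left.1 P.disjoint (hpv k hk)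
  have only : ∀ k ≤ L, ∀ j, G.Adj (p k) (C.c j) → (k = 0 ∧ j = i - 1) ∨ (k = L ∧ j = i + 1) ∨ j = i := by
    intro k hk j e
    rcases P.only _ (hpv k hk) j e with ⟨e1, e2⟩ | ⟨e1, e2⟩ | e1
    · rw [← h0, hp.inj hk (Nat.zero_le _)] at e1
      exact Or.inl ⟨e1, e2⟩
    · rw [← hl, hp.inj hk le_rfl] at e1
      exact Or.inr (Or.inl ⟨e1, e2⟩)
    · exact Or.inr (Or.inr e1)
  have ht := hp.extend (u := C.c (i - 1)) (w := C.c (i + 1)) (C.c.injective.ne n1)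
    (fun e => by
      rw [C.adj_iff] at e
      rcases e with e | e
      · exact n4 e
      · exact n3 (e.trans (by abel)))
    (fun k hk => ⟨fun e => hpC k hk ⟨_, e⟩, fun e => by
        rcases only k hk _ e.symm with e | e | e
        · exact e.1
        · exact absurd e.2 n1
        · exact absurd e n2, fun e => by rw [e, h0]; exact P.adj_x.symm⟩)
    (fun k hk => ⟨fun e => hpC k hk ⟨_, e⟩, fun e => by
        rcases only k hk _ e.symm with e | e | e
        · exact absurd e.2.symm n1
        · exact e.1
        · exact absurd e n3, fun e => by rw [e, hl]; exact P.adj_y.symm⟩)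
  set t : ℕ → V := fun k => if k = 0 then C.c (i - 1) else if k ≤ L + 1 then p (k - 1) else C.c (i + 1)
    with htdef
  have t0 : t 0 = C.c (i - 1) := rfl
  have tl : t (L + 2) = C.c (i + 1) := by simp [htdef]
  have tk : ∀ k, 0 < k → k < L + 2 → t k = p (k - 1) := by
    intro k hk hk'
    simp [htdef, show k ≠ 0 by omega, show k ≤ L + 1 by omega]
  have hseg : P.path.verts = seg t 1 (L + 2 - 1) := by
    rw [hverts]
    ext x
    constructor
    · rintro ⟨k, _, hk, rfl⟩
      exact ⟨k + 1, by omega, by omega, by rw [tk _ (by omega) (by omega)]; rfl⟩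
    · rintro ⟨k, hk, hk', rfl⟩
      exact ⟨k - 1, by omega, by omega, (tk k (by omega) (by omega)).symm⟩
  refine ⟨t, L + 2, ⟨by omega, ht, ⟨_, t0.symm⟩, ⟨_, tl.symm⟩, ?_, ?_, ?_, ?_⟩, hseg, ?_, ?_⟩
  · rw [t0, C.adj_iff]; exact Or.inl rfl
  · rw [tl, C.adj_iff]; exact Or.inr rfl
  · intro j hj hj'
    rw [tk j hj hj']
    exact hpC _ (by omega)
  · intro j hj hj' x e
    rw [tk j hj hj'] at e
    rcases iso _ (hpv _ (by omega)) x e with hx | ⟨l, rfl⟩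
    · rw [hseg] at hx
      obtain ⟨l, h1, h2, rfl⟩ := hx
      exact Or.inl (seg_mem (by omega) (by omega))
    · rcases only _ (by omega) l e with h | h | h
      · rw [h.2, ← t0]; exact Or.inl (seg_mem le_rfl (by omega))
      · rw [h.2, ← tl]; exact Or.inl (seg_mem (by omega) le_rfl)
      · exact Or.inr (by rw [h])
  · obtain ⟨v, hv, ev⟩ := P.centre_adj
    replace hv := hv.1
    rw [hseg] at hv
    obtain ⟨k, hk, hk', rfl⟩ := hv
    exact ⟨k, by omega, by omega, ev⟩
  · intro k hk e1 e2
    by_cases hk0 : k = 0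
    · subst hk0
      rw [tk _ (by omega) (by omega)] at e2
      exact P.no_edge_x (h0 ▸ e2)
    by_cases hkl : k = L + 1
    · subst hkl
      rw [tk _ (by omega) (by omega)] at e1
      exact P.no_edge_y (hl ▸ e1)
    · have e3 := (ht.adj_iff (i := k) (j := k + 1) (by omega) (by omega)).2 (Or.inl rfl)
      refine P.no_edge (t k) ?_ (t (k + 1)) ?_ e3 ⟨e1, e2⟩
      · rw [hseg]; exact seg_mem (by omega) (by omega)
      · rw [hseg]; exact seg_mem (by omega) (by omega)

theorem IsDaisy.free (h : IsDaisy G) : Free G := by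
  obtain ⟨C, I, P, -, hPP, hcov⟩ := h
  have iso : ∀ i : I, ∀ u ∈ (P i).path.verts, ∀ w, G.Adj u w →
      w ∈ (P i).path.verts ∨ w ∈ Set.range C.c := by
    intro i u hu w e
    rcases hcov w with hw | ⟨j, hw⟩
    · exact Or.inr hw
    · by_cases hij : i = j
      · subst hij; exact Or.inl hw
      · exact absurd e (hPP i j hij u hu w hw).2
  choose T N hF hseg hin hsp using fun i => (P i).exists_fullPetal (iso i)
  refine Daisy.free (C := Set.range C.c) (cen := fun i : I => C.c i) (T := T) (N := N)
    ⟨C.holeSet, hF, fun i => ⟨_, rfl⟩, fun i j e => Subtype.ext (C.c.injective e), hin, hsp, ?_⟩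
  intro x hx
  obtain ⟨i, hi⟩ := (hcov x).resolve_left hx
  rw [hseg i] at hi
  obtain ⟨k, hk, hk', rfl⟩ := hi
  have := (hF i).hn
  exact ⟨i, k, by omega, by omega, rfl⟩

/-- A complete graph on at most two vertices is free. -/
theorem free_completeGraph {l : ℕ} (hl : l ≤ 2) : Free (completeGraph (Fin l)) := by
  refine ⟨fun u w A huw hn => absurd huw hn, fun x y z e1 e2 e3 => ?_, fun H x y hH => ?_⟩
  · have h1 : x ≠ y := e1
    have h2 : x ≠ z := e2
    have h3 : y ≠ z := e3
    rw [ne_eq, Fin.ext_iff] at h1 h2 h3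
    omega
  · obtain ⟨a, -, b, -, hab, hn⟩ := hH.exists_pair
    exact absurd hab hn

/-- Facts about the cube: there is no triangle; a vertex at distance two from `u` is adjacent to two neighbours
of `u`; only `u` is adjacent to all neighbours of `u`. -/
theorem cube_local : (∀ x y z : Fin 3 → Bool, hammingDist x y = 1 → hammingDist x z = 1 →
      ¬ hammingDist y z = 1) ∧
    (∀ u x z : Fin 3 → Bool, hammingDist u x = 1 → hammingDist x z = 1 → z ≠ u →
      ∃ k, Function.update u k (!u k) ≠ x ∧ hammingDist (Function.update u k (!u k)) z = 1) ∧
    (∀ u w : Fin 3 → Bool, (∀ k, hammingDist (Function.update u k (!u k)) w = 1) → w = u) := by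
  refine ⟨?_, ?_, ?_⟩ <;> decide

/-- In a theta of the cube the three connected sets would be the three neighbours of `u`, as every vertex at
distance two from `u` is adjacent to two of them. -/
theorem free_cubeGraph : Free cubeGraph := by
  refine ⟨fun u w A huw hn hA hu hw hAA => ?_, cube_local.1, fun H x y hH hx hy e h3 _ => ?_⟩
  · have huA := notMem_of_att hu hAA
    choose x hx ex using hu
    choose k hk using fun i => cube_dist _ _ (ex i)
    have hkinj : Function.Injective k := by
      intro i j e
      by_contra hij
      refine (hAA i j hij _ (hx i) _ (hx j)).1 ?_
      rw [hk i, hk j, e]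
    have hksurj := Finite.injective_iff_surjective.1 hkinj
    have hsub : ∀ i, A i ⊆ {x i} := by
      intro i
      refine hA i _ ⟨_, hx i, rfl⟩ ?_
      rintro _ _ rfl z hz e
      exfalso
      obtain ⟨l, hl, el⟩ := cube_local.2.1 u (x i) z (ex i) e (fun h => huA i (h ▸ hz))
      obtain ⟨j, rfl⟩ := hksurj l
      rw [← hk j] at hl el
      exact (hAA j i (by rintro rfl; exact hl rfl) _ (hx j) _ hz).2 el
    refine huw (cube_local.2.2 u w fun l => ?_).symm
    obtain ⟨j, rfl⟩ := hksurj l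
    obtain ⟨z, hz, e⟩ := hw j
    obtain rfl : z = x j := hsub j hz
    rw [← hk j]
    exact cubeGraph.symm.symm _ _ e
  · obtain ⟨a, ha, b, hb, c, hc, hab, hac, hbc, ea, eb, ec⟩ := h3
    obtain ⟨i, rfl⟩ := cube_dist _ _ ea
    obtain ⟨j, rfl⟩ := cube_dist _ _ eb
    obtain ⟨k, rfl⟩ := cube_dist _ _ ec
    obtain ⟨l, rfl⟩ := cube_dist _ _ e
    have h1 : i ≠ j := by rintro rfl; exact hab rfl
    have h2 : i ≠ k := by rintro rfl; exact hac rfl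
    have h3 : j ≠ k := by rintro rfl; exact hbc rfl
    have h4 : i ≠ l := by rintro rfl; exact hy ha
    have h5 : j ≠ l := by rintro rfl; exact hy hb
    have h6 : k ≠ l := by rintro rfl; exact hy hc
    omega

theorem IsBasic.free (h : IsBasic G) : Free G := by
  rcases h with ⟨⟨f⟩⟩ | ⟨⟨f⟩⟩ | ⟨⟨f⟩⟩ | h
  · exact (free_completeGraph (by omega)).of_embedding f.toEmbedding
  · exact (free_completeGraph le_rfl).of_embedding f.toEmbedding
  · exact free_cubeGraph.of_embedding f.toEmbedding
  · exact h.free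

end

/-! ### Gluing along two vertices or along a path on three vertices preserves freeness -/

/-- The set `S` is one side, with the separator `{a, b} ∪ C`, of a graph `G`, and `H` is its block:
`φ` embeds the subgraph induced by `S` into `H`, and the rest of `G` is replaced by a path `q` from
`φ a` to `φ b` whose inside has no other neighbours than `φ a`, `φ b` and `φ c` for `c ∈ C`.
The set `C` is empty or consists of one common neighbour of `a` and `b`. -/
structure Block {V W : Type*} (G : SimpleGraph V) (a b : V) (C S : Set V) (H : SimpleGraph W)
    (φ : V → W) (q : ℕ → W) (L : ℕ) : Prop where
  free : Free H
  inj : ∀ x ∈ S, ∀ y ∈ S, φ x = φ y → x = y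
  adj : ∀ x ∈ S, ∀ y ∈ S, (H.Adj (φ x) (φ y) ↔ G.Adj x y)
  hL : 2 ≤ L
  hq : IsP H q L
  q0 : q 0 = φ a
  qL : q L = φ b
  out : ∀ k, 0 < k → k < L → ∀ x ∈ S, q k ≠ φ x
  nb : ∀ k, 0 < k → k < L → ∀ x ∈ S, H.Adj (q k) (φ x) → x = a ∨ x = b ∨ x ∈ C
  aS : a ∈ S
  bS : b ∈ S
  CS : C ⊆ S
  hab : a ≠ b
  nab : ¬ G.Adj a b
  ca : ∀ c ∈ C, G.Adj c a
  cb : ∀ c ∈ C, G.Adj c b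
  single : ∀ c ∈ C, ∀ c' ∈ C, c = c'
  closed : ∀ x ∈ S, ¬ (x = a ∨ x = b ∨ x ∈ C) → ∀ y, G.Adj x y → y ∈ S

section
variable {V W : Type*} {G : SimpleGraph V} {H : SimpleGraph W} {a b : V} {C S : Set V} {φ : V → W}
  {q : ℕ → W} {L : ℕ}

/-- The part of a connected set `A` in a side `S` of the graph, mapped into a block and enlarged by a set `K`,
is connected if its vertices in the separator `T` are joined to each other inside it, and `K` is joined to
it. -/
theorem Conn.block {A T : Set V} (hA : Conn G A) (hS : ∀ x ∈ S, x ∉ T → ∀ y, G.Adj x y → y ∈ S)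
    (hφ : ∀ x ∈ S, ∀ y ∈ S, G.Adj x y → H.Adj (φ x) (φ y)) {K : Set W}
    (hT : ∀ z ∈ A, z ∈ T → z ∈ S → ∀ z' ∈ A, z' ∈ T → z' ∈ S →
      ∃ M ⊆ φ '' (A ∩ S) ∪ K, Conn H M ∧ φ z ∈ M ∧ φ z' ∈ M)
    (hK : ∀ x ∈ K, ∃ z ∈ A ∩ S, ∃ M ⊆ φ '' (A ∩ S) ∪ K, Conn H M ∧ x ∈ M ∧ φ z ∈ M) :
    Conn H (φ '' (A ∩ S) ∪ K) := by
  rintro B hB hcl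
  have hM : ∀ M ⊆ φ '' (A ∩ S) ∪ K, Conn H M → (∃ x ∈ M, x ∈ B) → M ⊆ B :=
    fun M hM hc hx => hc B hx fun x hx hxB y hy e => hcl x (hM hx) hxB y (hM hy) e
  obtain ⟨x₀, hx₀, hx₀B⟩ : ∃ x ∈ A ∩ S, φ x ∈ B := by
    obtain ⟨x, ⟨x, hx, rfl⟩ | hx, hxB⟩ := hB
    · exact ⟨x, hx, hxB⟩
    · obtain ⟨z, hz, M, hMs, hc, h1, h2⟩ := hK x hx
      exact ⟨z, hz, hM M hMs hc ⟨x, h1, hxB⟩ h2⟩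
  have hAB : ∀ x ∈ A, x ∈ S → φ x ∈ B := by
    have := hA {x | (x ∈ S ∧ φ x ∈ B) ∨ (x ∉ S ∧ ∃ z ∈ A, z ∈ T ∧ z ∈ S ∧ φ z ∈ B)}
      ⟨x₀, hx₀.1, Or.inl ⟨hx₀.2, hx₀B⟩⟩ ?_
    · intro x hx hxS
      rcases this hx with h | h
      · exact h.2
      · exact absurd hxS h.1
    · intro x hxA hx y hyA e
      by_cases hyS : y ∈ S
      · refine Or.inl ⟨hyS, ?_⟩
        rcases hx with ⟨hxS, hxB⟩ | ⟨hxS, z, hzA, hzT, hzS, hzB⟩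
        · exact hcl _ (Or.inl ⟨x, ⟨hxA, hxS⟩, rfl⟩) hxB _ (Or.inl ⟨y, ⟨hyA, hyS⟩, rfl⟩) (hφ x hxS y hyS e)
        · have hyT : y ∈ T := by
            by_contra hyT
            exact hxS (hS y hyS hyT x e.symm)
          obtain ⟨M, hMs, hc, h1, h2⟩ := hT z hzA hzT hzS y hyA hyT hyS
          exact hM M hMs hc ⟨_, h1, hzB⟩ h2
      · refine Or.inr ⟨hyS, ?_⟩
        rcases hx with ⟨hxS, hxB⟩ | ⟨hxS, h⟩
        · have hxT : x ∈ T := by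
            by_contra hxT
            exact hyS (hS x hxS hxT y e)
          exact ⟨x, hxA, hxT, hxS, hxB⟩
        · exact h
  rintro x (⟨x, ⟨hxA, hxS⟩, rfl⟩ | hx)
  · exact hAB x hxA hxS
  · obtain ⟨z, hz, M, hMs, hc, h1, h2⟩ := hK x hx
    exact hM M hMs hc ⟨_, h2, hAB z hz.1 hz.2⟩ h1

namespace Block
variable (B : Block G a b C S H φ q L)
include B

theorem conn_image {A : Set V} (hA : Conn G A) (hAS : A ⊆ S) : Conn H (φ '' A) := by
  rintro D ⟨_, ⟨x, hx, rfl⟩, hxD⟩ hD _ ⟨y, hy, rfl⟩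
  exact hA (φ ⁻¹' D) ⟨x, hx, hxD⟩ (fun x hx hxD y hy e =>
    hD _ ⟨x, hx, rfl⟩ hxD _ ⟨y, hy, rfl⟩ ((B.adj x (hAS hx) y (hAS hy)).2 e)) hy

theorem mem_of_sep {z : V} (hz : z = a ∨ z = b ∨ z ∈ C) : z ∈ S := by
  rcases hz with rfl | rfl | hz
  · exact B.aS
  · exact B.bS
  · exact B.CS hz

/-- Two anticomplete connected sets inside one side that attach to both `a` and `b` form a theta with the
path `q` of the block. -/
theorem no_two {D₁ D₂ : Set V} (h1 : Conn G D₁) (h2 : Conn G D₂) (s1 : ∀ x ∈ D₁, x ∈ S ∧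
    ¬ (x = a ∨ x = b ∨ x ∈ C)) (s2 : ∀ x ∈ D₂, x ∈ S ∧ ¬ (x = a ∨ x = b ∨ x ∈ C)) (a1 : Att G a D₁)
    (b1 : Att G b D₁) (a2 : Att G a D₂) (b2 : Att G b D₂) (h12 : Anti G D₁ D₂) : False := by
  have hL := B.hL
  have hatt : ∀ {z : V} {D : Set V}, z ∈ S → (∀ x ∈ D, x ∈ S ∧ ¬ (x = a ∨ x = b ∨ x ∈ C)) → Att G z D →
      Att H (φ z) (φ '' D) := by
    rintro z D hz hD ⟨x, hx, e⟩
    exact ⟨φ x, ⟨x, hx, rfl⟩, (B.adj z hz x (hD x hx).1).2 e⟩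
  have hq : ∀ {D : Set V}, (∀ x ∈ D, x ∈ S ∧ ¬ (x = a ∨ x = b ∨ x ∈ C)) →
      Anti H (φ '' D) (seg q 1 (L - 1)) := by
    rintro D hD _ ⟨x, hx, rfl⟩ _ ⟨k, hk, hk', rfl⟩
    have := hD x hx
    exact ⟨fun e => B.out k (by omega) (by omega) x this.1 e.symm,
      fun e => this.2 (B.nb k (by omega) (by omega) x this.1 e.symm)⟩
  refine B.free.theta.elim (φ a) (φ b) (φ '' D₁) (φ '' D₂) (seg q 1 (L - 1))
    (fun e => B.hab (B.inj _ B.aS _ B.bS e)) (fun e => B.nab ((B.adj _ B.aS _ B.bS).1 e))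
    (B.conn_image h1 fun x hx => (s1 x hx).1) (B.conn_image h2 fun x hx => (s2 x hx).1)
    (B.hq.conn (by omega)) (hatt B.aS s1 a1) (hatt B.aS s2 a2) (att_seg 1 le_rfl (by omega) ?_)
    (hatt B.bS s1 b1) (hatt B.bS s2 b2) (att_seg (L - 1) (by omega) le_rfl ?_) ?_ (hq s1) (hq s2)
  · rw [← B.q0, B.hq.adj_iff (by omega) (by omega)]; omega
  · rw [← B.qL, B.hq.adj_iff (by omega) (by omega)]; omega
  · rintro _ ⟨x, hx, rfl⟩ _ ⟨y, hy, rfl⟩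
    have := h12 x hx y hy
    rw [B.adj _ (s1 x hx).1 _ (s2 y hy).1]
    exact ⟨fun e => this.1 (B.inj _ (s1 x hx).1 _ (s2 y hy).1 e), this.2⟩

/-- A connected set that meets a side and is not contained in it contains a vertex of the separator. -/
theorem exists_sep {A : Set V} (hA : Conn G A) (h1 : ∃ x ∈ A, x ∈ S) (h2 : ∃ x ∈ A, x ∉ S) :
    ∃ z ∈ A, z = a ∨ z = b ∨ z ∈ C := by
  by_contra hcon
  push Not at hcon
  obtain ⟨y, hy, hyS⟩ := h2
  exact hyS (hA S h1 (fun x hx hxS z _ e => B.closed x hxS (by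
    have := hcon x hx; tauto) z e) hy)

/-- A configuration of a theta whose branch vertices are in one side, not both in the separator, yields a
theta in the block: if a connected set passes from `a` to `b` through the other side, then it is
rerouted through the path `q`. -/
theorem no_theta_side {u w : V} {A : Fin 3 → Set V} (huS : u ∈ S) (huT : ¬ (u = a ∨ u = b ∨ u ∈ C))
    (hwS : w ∈ S) (huw : u ≠ w) (hn : ¬ G.Adj u w) (hA : ∀ i, Conn G (A i)) (hu : ∀ i, Att G u (A i))
    (hw : ∀ i, Att G w (A i)) (hAA : ∀ i j, i ≠ j → Anti G (A i) (A j)) : False := by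
  classical
  have hL := B.hL
  have hwA := notMem_of_att hw hAA
  let K : Fin 3 → Set W := fun j => {x | x ∈ seg q 1 (L - 1) ∧ (∀ c ∈ C, c ∉ A j) ∧
    (a ∈ A j ∨ b ∈ A j) ∧ (a ∈ A j ∨ a = w) ∧ (b ∈ A j ∨ b = w)}
  have hKq : ∀ j, (∀ c ∈ C, c ∉ A j) → (a ∈ A j ∨ b ∈ A j) → (a ∈ A j ∨ a = w) → (b ∈ A j ∨ b = w) →
      seg q 1 (L - 1) ⊆ K j := fun j h1 h2 h3 h4 x hx => ⟨hx, h1, h2, h3, h4⟩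
  have hφA : ∀ {j x}, x ∈ A j → x ∈ S → φ x ∈ φ '' (A j ∩ S) ∪ K j :=
    fun hx hxS => Or.inl ⟨_, ⟨hx, hxS⟩, rfl⟩
  refine B.free.theta (φ u) (φ w) (fun j => φ '' (A j ∩ S) ∪ K j)
    (fun e => huw (B.inj _ huS _ hwS e)) (fun e => hn ((B.adj _ huS _ hwS).1 e)) ?_ ?_ ?_ ?_
  · intro j
    refine (hA j).block (T := {x | x = a ∨ x = b ∨ x ∈ C}) B.closed (fun x hx y hy => (B.adj x hx y hy).2)
      ?_ ?_
    · intro z hz hzT hzS z' hz' hzT' hzS'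
      by_cases hc : ∃ c ∈ C, c ∈ A j
      · obtain ⟨c, hc, hcj⟩ := hc
        have hcS := B.CS hc
        have star : ∀ z, (z = a ∨ z = b ∨ z ∈ C) → φ c = φ z ∨ H.Adj (φ c) (φ z) := by
          rintro z (rfl | rfl | hz)
          · exact Or.inr ((B.adj _ hcS _ B.aS).2 (B.ca c hc))
          · exact Or.inr ((B.adj _ hcS _ B.bS).2 (B.cb c hc))
          · exact Or.inl (by rw [B.single c hc z hz])
        refine ⟨({φ c} ∪ {φ z}) ∪ ({φ c} ∪ {φ z'}), ?_, ?_, Or.inl (Or.inr rfl), Or.inr (Or.inr rfl)⟩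
        · rintro _ ((rfl | rfl) | (rfl | rfl))
          · exact hφA hcj hcS
          · exact hφA hz hzS
          · exact hφA hcj hcS
          · exact hφA hz' hzS'
        · exact ((conn_singleton _).union (conn_singleton _) ⟨_, rfl, _, rfl, star z hzT⟩).union
            ((conn_singleton _).union (conn_singleton _) ⟨_, rfl, _, rfl, star z' hzT'⟩)
            ⟨φ c, Or.inl rfl, φ c, Or.inl rfl, Or.inl rfl⟩
      · push Not at hc
        have key : a ∈ A j → b ∈ A j → seg q 0 L ⊆ φ '' (A j ∩ S) ∪ K j := by
          rintro ha hb _ ⟨k, _, hk, rfl⟩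
          by_cases hk0 : k = 0
          · subst hk0; rw [B.q0]; exact hφA ha B.aS
          by_cases hkL : k = L
          · subst hkL; rw [B.qL]; exact hφA hb B.bS
          · exact Or.inr (hKq j hc (Or.inl ha) (Or.inl ha) (Or.inl hb) (seg_mem (by omega) (by omega)))
        have h0 : φ a ∈ seg q 0 L := ⟨0, le_rfl, by omega, B.q0⟩
        have hl : φ b ∈ seg q 0 L := ⟨L, by omega, le_rfl, B.qL⟩
        have one : ∀ z ∈ A j, z ∈ S → ∃ M ⊆ φ '' (A j ∩ S) ∪ K j, Conn H M ∧ φ z ∈ M ∧ φ z ∈ M :=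
          fun z hz hzS => ⟨{φ z}, by rintro _ rfl; exact hφA hz hzS, conn_singleton _, rfl, rfl⟩
        rcases hzT with rfl | rfl | hzC
        · rcases hzT' with rfl | rfl | hzC
          · exact one _ hz hzS
          · exact ⟨_, key hz hz', B.hq.conn le_rfl, h0, hl⟩
          · exact absurd hz' (hc _ hzC)
        · rcases hzT' with rfl | rfl | hzC
          · exact ⟨_, key hz' hz, B.hq.conn le_rfl, hl, h0⟩
          · exact one _ hz hzS
          · exact absurd hz' (hc _ hzC)
        · exact absurd hz (hc _ hzC)
    · rintro x ⟨hx, hc, hab, ha, hb⟩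
      have hsub := hKq j hc hab ha hb
      rcases hab with haj | hbj
      · refine ⟨a, ⟨haj, B.aS⟩, {φ a} ∪ seg q 1 (L - 1), ?_, ?_, Or.inr hx, Or.inl rfl⟩
        · rintro y (rfl | hy)
          · exact hφA haj B.aS
          · exact Or.inr (hsub hy)
        · refine (B.hq.conn (by omega)).insert_seg 1 le_rfl (by omega) ?_
          rw [← B.q0, B.hq.adj_iff (by omega) (by omega)]; omega
      · refine ⟨b, ⟨hbj, B.bS⟩, {φ b} ∪ seg q 1 (L - 1), ?_, ?_, Or.inr hx, Or.inl rfl⟩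
        · rintro y (rfl | hy)
          · exact hφA hbj B.bS
          · exact Or.inr (hsub hy)
        · refine (B.hq.conn (by omega)).insert_seg (L - 1) (by omega) le_rfl ?_
          rw [← B.qL, B.hq.adj_iff (by omega) (by omega)]; omega
  · intro j
    obtain ⟨y, hy, e⟩ := hu j
    have hyS := B.closed u huS huT y e
    exact ⟨φ y, hφA hy hyS, (B.adj _ huS _ hyS).2 e⟩
  · intro j
    obtain ⟨y, hy, e⟩ := hw j
    by_cases hyS : y ∈ S
    · exact ⟨φ y, hφA hy hyS, (B.adj _ hwS _ hyS).2 e⟩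
    have hwT : w = a ∨ w = b ∨ w ∈ C := by
      by_contra hwT
      exact hyS (B.closed w hwS hwT y e)
    obtain ⟨x, hx, ex⟩ := hu j
    obtain ⟨z, hz, hzT⟩ := B.exists_sep (hA j) ⟨x, hx, B.closed u huS huT x ex⟩ ⟨y, hy, hyS⟩
    have direct : ∀ z ∈ A j, z ∈ S → G.Adj w z → Att H (φ w) (φ '' (A j ∩ S) ∪ K j) :=
      fun z hz hzS e => ⟨φ z, hφA hz hzS, (B.adj _ hwS _ hzS).2 e⟩
    by_cases hc : ∃ c ∈ C, c ∈ A j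
    · obtain ⟨c, hc, hcj⟩ := hc
      rcases hwT with rfl | rfl | hwC
      · exact direct c hcj (B.CS hc) (B.ca c hc).symm
      · exact direct c hcj (B.CS hc) (B.cb c hc).symm
      · exact absurd (B.single c hc w hwC ▸ hcj) (hwA j)
    push Not at hc
    have hw0 : w ∉ A j := hwA j
    rcases hzT with rfl | rfl | hzC
    · rcases hwT with rfl | rfl | hwC
      · exact absurd hz hw0
      · refine ⟨q (L - 1), Or.inr (hKq j hc (Or.inl hz) (Or.inl hz) (Or.inr rfl)
          (seg_mem (by omega) le_rfl)), ?_⟩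
        rw [← B.qL, B.hq.adj_iff (by omega) (by omega)]; omega
      · exact direct _ hz B.aS (B.ca w hwC)
    · rcases hwT with rfl | rfl | hwC
      · refine ⟨q 1, Or.inr (hKq j hc (Or.inr hz) (Or.inr rfl) (Or.inl hz)
          (seg_mem le_rfl (by omega))), ?_⟩
        rw [← B.q0, B.hq.adj_iff (by omega) (by omega)]; omega
      · exact absurd hz hw0
      · exact direct _ hz B.bS (B.cb w hwC)
    · exact absurd hz (hc z hzC)
  · have hφφ : ∀ i j, i ≠ j → Anti H (φ '' (A i ∩ S)) (φ '' (A j ∩ S)) := by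
      rintro i j hij _ ⟨x, ⟨hx, hxS⟩, rfl⟩ _ ⟨y, ⟨hy, hyS⟩, rfl⟩
      have := hAA i j hij x hx y hy
      rw [B.adj _ hxS _ hyS]
      exact ⟨fun e => this.1 (B.inj _ hxS _ hyS e), this.2⟩
    have hφK : ∀ i j, i ≠ j → Anti H (φ '' (A i ∩ S)) (K j) := by
      rintro i j hij _ ⟨x, ⟨hx, hxS⟩, rfl⟩ _ ⟨⟨k, hk, hk', rfl⟩, hc, hab, ha, hb⟩
      refine ⟨fun e => B.out k (by omega) (by omega) x hxS e.symm, fun e => ?_⟩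
      rcases B.nb k (by omega) (by omega) x hxS e.symm with rfl | rfl | hxC
      · rcases ha with ha | rfl
        · exact (hAA i j hij _ hx _ ha).1 rfl
        · exact hwA i hx
      · rcases hb with hb | rfl
        · exact (hAA i j hij _ hx _ hb).1 rfl
        · exact hwA i hx
      · rcases hab with ha | hb
        · exact (hAA i j hij _ hx _ ha).2 (B.ca x hxC)
        · exact (hAA i j hij _ hx _ hb).2 (B.cb x hxC)
    intro i j hij
    refine anti_union_left (anti_union_right (hφφ i j hij) (hφK i j hij))
      (anti_union_right (hφK j i hij.symm).symm ?_)
    rintro x ⟨-, -, habi, -, -⟩ y ⟨-, -, -, ha, hb⟩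
    exfalso
    rcases habi with hai | hbi
    · rcases ha with ha | rfl
      · exact (hAA i j hij _ hai _ ha).1 rfl
      · exact hwA i hai
    · rcases hb with hb | rfl
      · exact (hAA i j hij _ hbi _ hb).1 rfl
      · exact hwA i hbi

theorem no_tri {x y z : V} (hx : x ∈ S) (hy : y ∈ S) (hz : z ∈ S) (e1 : G.Adj x y) (e2 : G.Adj x z) :
    ¬ G.Adj y z := fun e3 =>
  B.free.tri _ _ _ ((B.adj _ hx _ hy).2 e1) ((B.adj _ hx _ hz).2 e2) ((B.adj _ hy _ hz).2 e3)

theorem three_image {x : V} {A : Set V} (hx : x ∈ S) (hA : A ⊆ S) (h : Three G x A) :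
    Three H (φ x) (φ '' A) := by
  obtain ⟨y, hy, z, hz, w, hw, h1, h2, h3, e1, e2, e3⟩ := h
  exact ⟨φ y, ⟨y, hy, rfl⟩, φ z, ⟨z, hz, rfl⟩, φ w, ⟨w, hw, rfl⟩,
    fun e => h1 (B.inj _ (hA hy) _ (hA hz) e), fun e => h2 (B.inj _ (hA hy) _ (hA hw) e),
    fun e => h3 (B.inj _ (hA hz) _ (hA hw) e), (B.adj _ hx _ (hA hy)).2 e1,
    (B.adj _ hx _ (hA hz)).2 e2, (B.adj _ hx _ (hA hw)).2 e3⟩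

/-- A vertex with three neighbours in one side belongs to that side. -/
theorem mem_of_three (tri : ∀ x y z, G.Adj x y → G.Adj x z → ¬ G.Adj y z) {x : V} {A : Set V}
    (hA : A ⊆ S) (h : Three G x A) : x ∈ S := by
  by_contra hx
  have hT : ∀ z ∈ A, G.Adj x z → z = a ∨ z = b ∨ z ∈ C := by
    intro z hz e
    by_contra hzT
    exact hx (B.closed z (hA hz) hzT x e.symm)
  obtain ⟨c, hc, ec⟩ : ∃ c ∈ C, G.Adj x c := by
    by_contra hcon
    push Not at hcon
    refine h.elim (a := a) (b := b) fun z hz e => ?_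
    rcases hT z hz e with h | h | h
    · exact Or.inl h
    · exact Or.inr h
    · exact absurd e (hcon z h)
  refine h.elim (a := a) (b := c) fun z hz e => ?_
  rcases hT z hz e with rfl | rfl | h
  · exact Or.inl rfl
  · exact absurd (B.cb c hc) (tri _ _ _ ec e)
  · exact Or.inr (B.single z h c hc)

/-- A wac whose hole is contained in one side is contained in that side, hence in the block. -/
theorem no_wac_side (tri : ∀ x y z, G.Adj x y → G.Adj x z → ¬ G.Adj y z) {A : Set V} (hA : HoleSet G A)
    (hAS : A ⊆ S) {x y : V} (hx : x ∉ A) (hy : y ∉ A) (e : G.Adj x y) (h1 : Three G x A)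
    (h2 : Three G y A) : False := by
  have hxS := B.mem_of_three tri hAS h1
  have hyS := B.mem_of_three tri hAS h2
  refine B.free.wac (φ '' A) (φ x) (φ y) ?_ ?_ ?_ ((B.adj _ hxS _ hyS).2 e)
    (B.three_image hxS hAS h1) (B.three_image hyS hAS h2)
  · obtain ⟨h, n, hh, rfl⟩ := hA
    have hmem : ∀ k < n, h k ∈ S := fun k hk => hAS ⟨k, hk, rfl⟩
    refine ⟨fun k => φ (h k), n, ⟨hh.1, fun i j hij hj => ?_⟩, ?_⟩
    · rw [B.adj _ (hmem i (by omega)) _ (hmem j hj)]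
      exact ⟨fun e => (hh.2 i j hij hj).1 (B.inj _ (hmem i (by omega)) _ (hmem j hj) e), (hh.2 i j hij hj).2⟩
    · ext x
      constructor
      · rintro ⟨_, ⟨k, hk, rfl⟩, rfl⟩; exact ⟨k, hk, rfl⟩
      · rintro ⟨k, hk, rfl⟩; exact ⟨_, ⟨k, hk, rfl⟩, rfl⟩
  · rintro ⟨z, hz, e⟩
    exact hx (B.inj _ (hAS hz) _ hxS e ▸ hz)
  · rintro ⟨z, hz, e⟩
    exact hy (B.inj _ (hAS hz) _ hyS e ▸ hz)

/-- A hole that runs through both sides is cut at `a` and `b`, and its part in the other side is replaced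
by the path `q` of the block. -/
theorem no_wac_cross {s t : ℕ → V} {m n : ℕ} (h : TwoPaths G s m t n) (hs0 : s 0 = a) (hsm : s m = b)
    (hs : ∀ i, 0 < i → i < m → s i ∈ S ∧ s i ∉ C) (ht : ∀ j, 0 < j → j < n → t j ∉ S) {x y : V}
    (hx : x ∉ seg s 0 m ∪ seg t 0 n) (hy : y ∉ seg s 0 m ∪ seg t 0 n) (hxS : x ∈ S) (hyS : y ∈ S)
    (e : G.Adj x y) (h2x : Two G x (seg s 0 m ∪ seg t 0 n)) (h2y : Two G y (seg s 0 m ∪ seg t 0 n)) :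
    False := by
  have hm := h.hm
  have hL := B.hL
  have hsS : ∀ i ≤ m, s i ∈ S := by
    intro i hi
    by_cases h0 : i = 0
    · subst h0; exact hs0 ▸ B.aS
    by_cases hm' : i = m
    · subst hm'; exact hsm ▸ B.bS
    · exact (hs i (by omega) (by omega)).1
  have hT : TwoPaths H (fun k => φ (s k)) m q L := by
    refine ⟨hm, hL, fun i j hij hj => ?_, B.hq, by rw [hs0, B.q0], by rw [hsm, B.qL],
      fun i j hi hi' hj hj' => ⟨fun e => B.out j hj hj' _ (hsS i hi'.le) e.symm, fun e => ?_⟩⟩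
    · rw [B.adj _ (hsS i (by omega)) _ (hsS j hj)]
      exact ⟨fun e => (h.hs i j hij hj).1 (B.inj _ (hsS i (by omega)) _ (hsS j hj) e), (h.hs i j hij hj).2⟩
    · rcases B.nb j hj hj' _ (hsS i hi'.le) e.symm with e | e | e
      · rw [← hs0, h.hs.inj (by omega) (by omega)] at e; omega
      · rw [← hsm, h.hs.inj (by omega) (by omega)] at e; omega
      · exact (hs i hi hi').2 e
  have out : ∀ z, z ∉ seg s 0 m ∪ seg t 0 n → z ∈ S → φ z ∉ seg (fun k => φ (s k)) 0 m ∪ seg q 0 L := by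
    have out' : ∀ z, z ∉ seg s 0 m ∪ seg t 0 n → z ∈ S → ∀ i ≤ m, φ (s i) ≠ φ z := fun z hz hzS i hi e =>
      hz (Or.inl (B.inj _ (hsS i hi) _ hzS e ▸ seg_mem (Nat.zero_le _) hi))
    rintro z hz hzS (⟨i, _, hi, e⟩ | ⟨k, _, hk, e⟩)
    · exact out' z hz hzS i hi e
    · by_cases hk0 : k = 0
      · subst hk0; rw [B.q0, ← hs0] at e; exact out' z hz hzS 0 (by omega) e
      by_cases hkL : k = L
      · subst hkL; rw [B.qL, ← hsm] at e; exact out' z hz hzS m le_rfl e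
      · exact B.out k (by omega) (by omega) z hzS e
  have two : ∀ z, z ∉ seg s 0 m ∪ seg t 0 n → z ∈ S → Two G z (seg s 0 m ∪ seg t 0 n) →
      Two H (φ z) (seg (fun k => φ (s k)) 0 m ∪ seg q 0 L) := by
    intro z hz hzS h2
    by_cases hzC : z ∈ C
    · refine ⟨φ (s 0), Or.inl ⟨0, by omega, by omega, rfl⟩, φ (s m), Or.inl ⟨m, by omega, le_rfl, rfl⟩, ?_,
        (B.adj _ hzS _ (hsS 0 (by omega))).2 (hs0 ▸ B.ca z hzC),
        (B.adj _ hzS _ (hsS m le_rfl)).2 (hsm ▸ B.cb z hzC)⟩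
      exact fun e => h.ne_ends.1 (B.inj _ (hsS 0 (by omega)) _ (hsS m le_rfl) e)
    · have key : ∀ p ∈ seg s 0 m ∪ seg t 0 n, G.Adj z p → ∃ i ≤ m, s i = p := by
        rintro _ (⟨i, _, hi, rfl⟩ | ⟨j, _, hj, rfl⟩) ep
        · exact ⟨i, hi, rfl⟩
        by_cases hj0 : j = 0
        · subst hj0; exact ⟨0, by omega, h.first⟩
        by_cases hjn : j = n
        · subst hjn; exact ⟨m, le_rfl, h.last⟩
        refine absurd (B.closed z hzS ?_ _ ep) (ht j (by omega) (by omega))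
        rintro (rfl | rfl | h')
        · exact hz (Or.inl ⟨0, by omega, by omega, hs0⟩)
        · exact hz (Or.inl ⟨m, by omega, by omega, hsm⟩)
        · exact hzC h'
      obtain ⟨p, hp, r, hr, hpr, ep, er⟩ := h2
      obtain ⟨i, hi, rfl⟩ := key p hp ep
      obtain ⟨j, hj, rfl⟩ := key r hr er
      exact ⟨φ (s i), Or.inl ⟨i, by omega, hi, rfl⟩, φ (s j), Or.inl ⟨j, by omega, hj, rfl⟩,
        fun e => hpr (B.inj _ (hsS i hi) _ (hsS j hj) e), (B.adj _ hzS _ (hsS i hi)).2 ep,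
        (B.adj _ hzS _ (hsS j hj)).2 er⟩
  exact B.free.wac_two hT.holeSet (out x hx hxS) (out y hy hyS) ((B.adj _ hxS _ hyS).2 e)
    (two x hx hxS h2x) (two y hy hyS h2y)

end Block
end

/-! ### Gluing along a clique preserves freeness -/

section
variable {V κ : Type*} {G : SimpleGraph V}

/-- A theta configuration inside `S` is one of the subgraph induced by `S`. -/
theorem Free.theta_on {S : Set V} (F : Free (G.induce S)) {u w : V} {A : Fin 3 → Set V} (hu : u ∈ S)
    (hw : w ∈ S) (huw : u ≠ w) (hn : ¬ G.Adj u w) (hAS : ∀ i, A i ⊆ S) (hA : ∀ i, Conn G (A i))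
    (huA : ∀ i, Att G u (A i)) (hwA : ∀ i, Att G w (A i)) (hAA : ∀ i j, i ≠ j → Anti G (A i) (A j)) :
    False := by
  have att : ∀ {u : V} (hu : u ∈ S), (∀ i, Att G u (A i)) → ∀ i,
      Att (G.induce S) ⟨u, hu⟩ (Subtype.val ⁻¹' A i) := by
    intro u hu h i
    obtain ⟨x, hx, e⟩ := h i
    exact ⟨⟨x, hAS i hx⟩, hx, e⟩
  refine F.theta ⟨u, hu⟩ ⟨w, hw⟩ (fun i => Subtype.val ⁻¹' A i) (fun e => huw (congrArg Subtype.val e)) hn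
    ?_ (att hu huA) (att hw hwA) ?_
  · rintro i B ⟨x, hx, hxB⟩ hB y hy
    obtain ⟨z, hz, e⟩ := hA i (Subtype.val '' B) ⟨x, hx, x, hxB, rfl⟩ (by
      rintro _ hzA ⟨z, hz, rfl⟩ w hw e
      exact ⟨⟨w, hAS i hw⟩, hB z hzA hz ⟨w, hAS i hw⟩ hw e, rfl⟩) hy
    exact Subtype.ext e ▸ hz
  · intro i j hij x hx y hy
    have := hAA i j hij x hx y hy
    exact ⟨fun e => this.1 (congrArg Subtype.val e), this.2⟩

/-- A wac inside `S` is one of the subgraph induced by `S`. -/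
theorem Free.wac_on {S H : Set V} (F : Free (G.induce S)) (hHS : H ⊆ S) (hH : HoleSet G H) {x y : V}
    (hxS : x ∈ S) (hyS : y ∈ S) (hx : x ∉ H) (hy : y ∉ H) (e : G.Adj x y) (h3x : Three G x H)
    (h3y : Three G y H) : False := by
  have three : ∀ {x : V} (hx : x ∈ S), Three G x H → Three (G.induce S) ⟨x, hx⟩ (Subtype.val ⁻¹' H) := by
    rintro x hx ⟨a, ha, b, hb, c, hc, h1, h2, h3, e1, e2, e3⟩
    exact ⟨⟨a, hHS ha⟩, ha, ⟨b, hHS hb⟩, hb, ⟨c, hHS hc⟩, hc, fun e => h1 (congrArg Subtype.val e),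
      fun e => h2 (congrArg Subtype.val e), fun e => h3 (congrArg Subtype.val e), e1, e2, e3⟩
  refine F.wac (Subtype.val ⁻¹' H) ⟨x, hxS⟩ ⟨y, hyS⟩ ?_ hx hy e (three hxS h3x) (three hyS h3y)
  obtain ⟨h, n, hh, rfl⟩ := hH
  have hS : ∀ k < n, h k ∈ S := fun k hk => hHS ⟨k, hk, rfl⟩
  have h4 := hh.1
  classical
  let h' : ℕ → S := fun k => if hk : k < n then ⟨h k, hS k hk⟩ else ⟨h 0, hS 0 (by omega)⟩
  have hv : ∀ k < n, (h' k : V) = h k := fun k hk => by simp [h', hk]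
  refine ⟨h', n, ⟨h4, fun i j hij hj => ?_⟩, ?_⟩
  · have := hh.2 i j hij hj
    refine ⟨fun e => this.1 ?_, ?_⟩
    · rw [← hv i (by omega), ← hv j hj, e]
    · rw [comap_adj, ← this.2]
      change G.Adj (h' i : V) (h' j : V) ↔ _
      rw [hv i (by omega), hv j hj]
  · ext z
    constructor
    · rintro ⟨k, hk, e⟩; exact ⟨k, hk, Subtype.ext ((hv k hk).trans e)⟩
    · rintro ⟨k, hk, rfl⟩; exact ⟨k, hk, (hv k hk).symm⟩

/-- The graph `G` is the union of the induced subgraphs on the sets `S i`, which have the clique `K` in common,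
and no edges leave `S i` except at `K`. -/
structure CliqueCover (G : SimpleGraph V) (S : κ → Set V) (K : Set V) : Prop where
  free : ∀ i, Free (G.induce (S i))
  cover : ∀ x, ∃ i, x ∈ S i
  sub : ∀ i, K ⊆ S i
  clique : ∀ x ∈ K, ∀ y ∈ K, x ≠ y → G.Adj x y
  closed : ∀ i, ∀ x ∈ S i, x ∉ K → ∀ y, G.Adj x y → y ∈ S i

namespace CliqueCover
variable {S : κ → Set V} {K : Set V} (D : CliqueCover G S K)
include D

theorem exists_mem {A : Set V} (hA : Conn G A) {i : κ} (h1 : ∃ x ∈ A, x ∈ S i) (h2 : ∃ x ∈ A, x ∉ S i) :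
    ∃ z ∈ A, z ∈ K := by
  by_contra hcon
  push Not at hcon
  obtain ⟨y, hy, hyS⟩ := h2
  exact hyS (hA (S i) h1 (fun x hx hxS z _ e => D.closed i x hxS (hcon x hx) z e) hy)

theorem tri (x y z : V) (e1 : G.Adj x y) (e2 : G.Adj x z) : ¬ G.Adj y z := by
  intro e3
  obtain ⟨i, hx, hy, hz⟩ : ∃ i, x ∈ S i ∧ y ∈ S i ∧ z ∈ S i := by
    by_cases hx : x ∈ K
    · by_cases hy : y ∈ K
      · obtain ⟨i, hi⟩ := D.cover z
        exact ⟨i, D.sub i hx, D.sub i hy, hi⟩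
      · obtain ⟨i, hi⟩ := D.cover y
        exact ⟨i, D.sub i hx, hi, D.closed i y hi hy z e3⟩
    · obtain ⟨i, hi⟩ := D.cover x
      exact ⟨i, hi, D.closed i x hi hx y e1, D.closed i x hi hx z e2⟩
  exact (D.free i).tri ⟨x, hx⟩ ⟨y, hy⟩ ⟨z, hz⟩ e1 e2 e3

theorem noTheta : NoTheta G := by
  intro u w A huw hn hA hu hw hAA
  wlog huK : u ∉ K generalizing u w
  · refine this w u huw.symm (fun e => hn e.symm) hw hu fun hwK => ?_
    exact hn (D.clique u (not_not.1 huK) w hwK huw)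
  obtain ⟨i, hi⟩ := D.cover u
  have hwA := notMem_of_att hw hAA
  by_cases hwS : w ∈ S i
  · refine (D.free i).theta_on (A := fun j => A j ∩ S i) hi hwS huw hn (fun j => Set.inter_subset_right)
      ?_ ?_ ?_ fun j j' hj x hx y hy => hAA j j' hj x hx.1 y hy.1
    · intro j
      have := (hA j).block (H := G) (φ := id) (K := ∅) (D.closed i) (fun _ _ _ _ e => e) ?_
        (fun x hx => hx.elim)
      · simpa using this
      · intro z hz hzK hzS z' hz' hzK' hzS'
        refine ⟨{z} ∪ {z'}, ?_, (conn_singleton z).union (conn_singleton z') ⟨z, rfl, z', rfl, ?_⟩,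
          Or.inl rfl, Or.inr rfl⟩
        · rintro x (rfl | rfl)
          · exact Or.inl ⟨x, ⟨hz, hzS⟩, rfl⟩
          · exact Or.inl ⟨x, ⟨hz', hzS'⟩, rfl⟩
        · by_cases e : z = z'
          · exact Or.inl e
          · exact Or.inr (D.clique z hzK z' hzK' e)
    · intro j
      obtain ⟨y, hy, e⟩ := hu j
      exact ⟨y, ⟨hy, D.closed i u hi huK y e⟩, e⟩
    · intro j
      obtain ⟨y, hy, e⟩ := hw j
      by_cases hyS : y ∈ S i
      · exact ⟨y, ⟨hy, hyS⟩, e⟩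
      have hwK : w ∈ K := by
        by_contra hwK
        exact hyS (D.closed i w hwS hwK y e)
      obtain ⟨x, hx, ex⟩ := hu j
      obtain ⟨z, hz, hzK⟩ := D.exists_mem (hA j) ⟨x, hx, D.closed i u hi huK x ex⟩ ⟨y, hy, hyS⟩
      exact ⟨z, ⟨hz, D.sub i hzK⟩, D.clique w hwK z hzK fun e' => hwA j (e' ▸ hz)⟩
  -- all three sets would pass through the clique, where their vertices are adjacent
  · have key : ∀ j, ∃ z ∈ A j, z ∈ K := by
      intro j
      obtain ⟨x, hx, ex⟩ := hu j
      obtain ⟨y, hy, ey⟩ := hw j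
      by_cases hyS : y ∈ S i
      · refine ⟨y, hy, ?_⟩
        by_contra hyK
        exact hwS (D.closed i y hyS hyK w ey.symm)
      · exact D.exists_mem (hA j) ⟨x, hx, D.closed i u hi huK x ex⟩ ⟨y, hy, hyS⟩
    obtain ⟨z, hz, hzK⟩ := key 0
    obtain ⟨z', hz', hzK'⟩ := key 1
    have := hAA 0 1 (by decide) z hz z' hz'
    exact this.2 (D.clique z hzK z' hzK' this.1)

theorem noWac : NoWac G := by
  intro H x y hH hx hy e h3x h3y
  obtain ⟨p, hp, hpK⟩ : ∃ p ∈ H, p ∉ K := by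
    obtain ⟨p, hp, r, hr, hpr, hn⟩ := hH.exists_pair
    by_cases hpK : p ∈ K
    · exact ⟨r, hr, fun hrK => hn (D.clique p hpK r hrK hpr)⟩
    · exact ⟨p, hp, hpK⟩
  obtain ⟨i, hi⟩ := D.cover p
  -- a hole that leaves `S i` would cross the clique on both of its parts
  have hHS : H ⊆ S i := by
    intro r hr
    by_contra hrS
    obtain ⟨s, m, t, n, h, rfl, rfl, rfl⟩ := hH.exists_twoPaths hp hr (fun e => hrS (e ▸ hi))
      (fun e => hrS (D.closed i p hi hpK r e))
    have inside : ∀ {q : ℕ → V} {l : ℕ}, IsP G q l → q 0 = s 0 → q l = s m →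
        ∃ k, 0 < k ∧ k < l ∧ q k ∈ K := by
      intro q l hq h0 hl
      obtain ⟨_, ⟨k, -, hk, rfl⟩, hkK⟩ := D.exists_mem (i := i) (hq.conn (i := 0) le_rfl)
        ⟨q 0, seg_mem le_rfl (Nat.zero_le l), h0 ▸ hi⟩ ⟨q l, seg_mem (Nat.zero_le l) le_rfl, hl ▸ hrS⟩
      refine ⟨k, Nat.pos_of_ne_zero ?_, lt_of_le_of_ne hk ?_, hkK⟩
      · rintro rfl
        exact hpK (h0 ▸ hkK)
      · rintro rfl
        exact hrS (hl ▸ D.sub i hkK)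
    obtain ⟨a, ha, ha', haK⟩ := inside h.hs rfl rfl
    obtain ⟨b, hb, hb', hbK⟩ := inside h.ht h.first.symm h.last.symm
    have := h.anti a b ha ha' hb hb'
    exact this.2 (D.clique _ haK _ hbK this.1)
  have mem : ∀ {x}, Three G x H → x ∈ S i := by
    rintro x ⟨a, ha, b, hb, -, -, hab, -, -, ea, eb, -⟩
    by_contra hxS
    have hK : ∀ c ∈ H, G.Adj x c → c ∈ K := by
      intro c hc ec
      by_contra hcK
      exact hxS (D.closed i c (hHS hc) hcK x ec.symm)
    exact D.tri x a b ea eb (D.clique a (hK a ha ea) b (hK b hb eb) hab)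
  exact (D.free i).wac_on hHS hH (mem h3x) (mem h3y) hx hy e h3x h3y

end CliqueCover

theorem IsCliqueGluing.free {W : κ → Type*} {H : ∀ i, SimpleGraph (W i)} (h : IsCliqueGluing H G)
    (hk : Nontrivial κ) (F : ∀ i, Free (H i)) : Free G := by
  obtain ⟨l, t, -, hcl, f, hinj, hsurj, hglue, hadj⟩ := h
  have hf : ∀ i w w', G.Adj (f i w) (f i w') ↔ (H i).Adj w w' := by
    intro i w w'
    rw [hadj]
    constructor
    · rintro ⟨i', u, u', e, h1, h2⟩
      by_cases hi : i = i'
      · subst hi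
        rwa [← hinj i h1, ← hinj i h2]
      · obtain ⟨j, rfl, rfl⟩ := (hglue i' i (Ne.symm hi) _ _).1 h1
        obtain ⟨j', rfl, rfl⟩ := (hglue i' i (Ne.symm hi) _ _).1 h2
        exact hcl i j j' (by rintro rfl; exact e.ne rfl)
    · exact fun e => ⟨i, w, w', e, rfl, rfl⟩
  obtain ⟨i₀⟩ := hk.to_nonempty
  have hK : ∀ i j, f i (t i j) = f i₀ (t i₀ j) := by
    intro i j
    by_cases hi : i = i₀
    · subst hi; rfl
    · exact (hglue i i₀ hi _ _).2 ⟨j, rfl, rfl⟩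
  have D : CliqueCover G (fun i => Set.range (f i)) (Set.range fun j => f i₀ (t i₀ j)) := by
    refine ⟨fun i => (F i).of_embedding ⟨⟨fun x => x.2.choose, fun x y e => ?_⟩, ?_⟩, fun x => hsurj x, ?_, ?_,
      ?_⟩
    · refine Subtype.ext ?_
      rw [← x.2.choose_spec, ← y.2.choose_spec]
      exact congrArg (f i) e
    · intro x y
      change (H i).Adj x.2.choose y.2.choose ↔ G.Adj x y
      rw [← hf, x.2.choose_spec, y.2.choose_spec]
    · rintro i _ ⟨j, rfl⟩
      exact ⟨t i j, hK i j⟩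
    · rintro _ ⟨j, rfl⟩ _ ⟨j', rfl⟩ hne
      refine (hf _ _ _).2 (hcl _ _ _ ?_)
      rintro rfl
      exact hne rfl
    · rintro i _ ⟨w, rfl⟩ hwK y e
      obtain ⟨i', u, u', e', h1, rfl⟩ := (hadj _ _).1 e
      by_cases hi : i' = i
      · subst hi; exact ⟨u', rfl⟩
      · obtain ⟨j, -, rfl⟩ := (hglue i' i hi _ _).1 h1
        exact absurd ⟨j, (hK i j).symm⟩ hwK
  exact ⟨D.noTheta, D.tri, D.noWac⟩

end

/-! ### The union of two blocks is free -/

/-- The graph `G` is the union of two sides `SX` and `SY` with the separator `{a, b} ∪ C` in common, with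
blocks `HX` and `HY`. A connected part of the second side that joins `a` and `b` is also attached to the
vertex of `C`, if there is one. -/
structure Amalgam {V W W' : Type*} (G : SimpleGraph V) (a b : V) (C SX SY : Set V) (HX : SimpleGraph W)
    (HY : SimpleGraph W') (φX : V → W) (φY : V → W') (qX : ℕ → W) (LX : ℕ) (qY : ℕ → W') (LY : ℕ) :
    Prop where
  BX : Block G a b C SX HX φX qX LX
  BY : Block G a b C SY HY φY qY LY
  cover : ∀ x, x ∈ SX ∨ x ∈ SY
  inter : ∀ x ∈ SX, x ∈ SY → x = a ∨ x = b ∨ x ∈ C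
  link : ∀ D, Conn G D → (∀ x ∈ D, x ∈ SY ∧ ¬ (x = a ∨ x = b ∨ x ∈ C)) → Att G a D → Att G b D →
    ∀ c ∈ C, Att G c D

section
variable {V W W' : Type*} {G : SimpleGraph V} {a b : V} {C S SX SY : Set V} {H : SimpleGraph W}
  {φ : V → W} {q : ℕ → W} {L : ℕ}

theorem Three.two {x : V} {A : Set V} (h : Three G x A) : Two G x A :=
  let ⟨a, ha, b, hb, _, _, hab, _, _, ea, eb, _⟩ := h
  ⟨a, ha, b, hb, hab, ea, eb⟩

/-- Two distinct nonadjacent vertices of the separator are `a` and `b`. -/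
theorem Block.sep_pair (B : Block G a b C S H φ q L) {x y : V} (hx : x = a ∨ x = b ∨ x ∈ C)
    (hy : y = a ∨ y = b ∨ y ∈ C) (hxy : x ≠ y) (hn : ¬ G.Adj x y) :
    (x = a ∧ y = b) ∨ (x = b ∧ y = a) := by
  rcases hx with rfl | rfl | hx
  · rcases hy with rfl | rfl | hy
    · exact absurd rfl hxy
    · exact Or.inl ⟨rfl, rfl⟩
    · exact absurd (B.ca y hy).symm hn
  · rcases hy with rfl | rfl | hy
    · exact Or.inr ⟨rfl, rfl⟩
    · exact absurd rfl hxy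
    · exact absurd (B.cb y hy).symm hn
  · rcases hy with rfl | rfl | hy
    · exact absurd (B.ca x hx) hn
    · exact absurd (B.cb x hx) hn
    · exact absurd (B.single x hx y hy) hxy

/-- Of three vertices of the separator two are equal or adjacent, so the three connected sets of a theta
cannot all pass through it. -/
theorem Block.no_branch (B : Block G a b C S H φ q L) {u w : V} {A : Fin 3 → Set V} (huS : u ∈ S)
    (huT : ¬ (u = a ∨ u = b ∨ u ∈ C)) (huw : u ≠ w) (hn : ¬ G.Adj u w) (hA : ∀ i, Conn G (A i))
    (hu : ∀ i, Att G u (A i)) (hw : ∀ i, Att G w (A i)) (hAA : ∀ i j, i ≠ j → Anti G (A i) (A j)) :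
    False := by
  by_cases hwS : w ∈ S
  · exact B.no_theta_side huS huT hwS huw hn hA hu hw hAA
  have key : ∀ j, ∃ z ∈ A j, z = a ∨ z = b ∨ z ∈ C := by
    intro j
    obtain ⟨x, hx, ex⟩ := hu j
    obtain ⟨y, hy, ey⟩ := hw j
    by_cases hyS : y ∈ S
    · refine ⟨y, hy, ?_⟩
      by_contra hyT
      exact hwS (B.closed y hyS hyT w ey.symm)
    · exact B.exists_sep (hA j) ⟨x, hx, B.closed u huS huT x ex⟩ ⟨y, hy, hyS⟩
  choose z hz hzT using key
  have pair : ∀ i j, i ≠ j → (z i = a ∧ z j = b) ∨ (z i = b ∧ z j = a) := fun i j hij =>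
    B.sep_pair (hzT i) (hzT j) (hAA i j hij _ (hz i) _ (hz j)).1 (hAA i j hij _ (hz i) _ (hz j)).2
  have hab := B.hab
  rcases pair 0 1 (by decide) with h1 | h1 <;> rcases pair 0 2 (by decide) with h2 | h2 <;>
    rcases pair 1 2 (by decide) with h3 | h3
  · exact hab (h3.1.symm.trans h1.2)
  · exact hab (h3.2.symm.trans h2.2)
  · exact hab (h1.1.symm.trans h2.1)
  · exact hab (h1.1.symm.trans h2.1)
  · exact hab (h2.1.symm.trans h1.1)
  · exact hab (h2.1.symm.trans h1.1)
  · exact hab (h2.2.symm.trans h3.2)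
  · exact hab (h1.2.symm.trans h3.1)

theorem Block.subset_of_no_sep (B : Block G a b C S H φ q L) {A : Set V} (hA : Conn G A)
    (hT : ∀ x ∈ A, ¬ (x = a ∨ x = b ∨ x ∈ C)) {x : V} (hx : x ∈ A) (hxS : x ∈ S) :
    ∀ y ∈ A, y ∈ S ∧ ¬ (y = a ∨ y = b ∨ y ∈ C) := by
  intro y hy
  refine ⟨?_, hT y hy⟩
  by_contra hyS
  obtain ⟨z, hz, hzT⟩ := B.exists_sep hA ⟨x, hx, hxS⟩ ⟨y, hy, hyS⟩
  exact hT z hz hzT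

namespace Amalgam
variable {HX : SimpleGraph W} {HY : SimpleGraph W'} {φX : V → W} {φY : V → W'} {qX : ℕ → W} {LX : ℕ}
  {qY : ℕ → W'} {LY : ℕ} (M : Amalgam G a b C SX SY HX HY φX φY qX LX qY LY)
include M

/-- Adjacent vertices lie in a common side. -/
theorem side_of_adj {x y : V} (e : G.Adj x y) : (x ∈ SX ∧ y ∈ SX) ∨ (x ∈ SY ∧ y ∈ SY) := by
  by_cases hx : x = a ∨ x = b ∨ x ∈ C
  · exact (M.cover y).imp (fun h => ⟨M.BX.mem_of_sep hx, h⟩) fun h => ⟨M.BY.mem_of_sep hx, h⟩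
  · exact (M.cover x).imp (fun h => ⟨h, M.BX.closed x h hx y e⟩) fun h => ⟨h, M.BY.closed x h hx y e⟩

theorem tri (x y z : V) (e1 : G.Adj x y) (e2 : G.Adj x z) : ¬ G.Adj y z := by
  intro e3
  by_cases hx : x = a ∨ x = b ∨ x ∈ C
  · rcases M.side_of_adj e3 with h | h
    · exact M.BX.no_tri (M.BX.mem_of_sep hx) h.1 h.2 e1 e2 e3
    · exact M.BY.no_tri (M.BY.mem_of_sep hx) h.1 h.2 e1 e2 e3
  · rcases M.cover x with h | h
    · exact M.BX.no_tri h (M.BX.closed x h hx y e1) (M.BX.closed x h hx z e2) e1 e2 e3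
    · exact M.BY.no_tri h (M.BY.closed x h hx y e1) (M.BY.closed x h hx z e2) e1 e2 e3

/-- There is no theta with branch vertices `a` and `b`. If one of the connected sets contains the vertex `c` of
`C`, then the others are not attached to `c` and lie in the first side; in any case two of them lie in the same
side. -/
theorem no_theta_sep {A : Fin 3 → Set V} (hA : ∀ i, Conn G (A i)) (ha : ∀ i, Att G a (A i))
    (hb : ∀ i, Att G b (A i)) (hAA : ∀ i j, i ≠ j → Anti G (A i) (A j)) : False := by
  have haA := notMem_of_att ha hAA
  have hbA := notMem_of_att hb hAA
  have side : ∀ j, (∀ c ∈ C, c ∉ A j) → (∀ x ∈ A j, x ∈ SX ∧ ¬ (x = a ∨ x = b ∨ x ∈ C)) ∨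
      (∀ x ∈ A j, x ∈ SY ∧ ¬ (x = a ∨ x = b ∨ x ∈ C)) := by
    intro j hC
    have hT : ∀ x ∈ A j, ¬ (x = a ∨ x = b ∨ x ∈ C) := by
      rintro x hx (rfl | rfl | h)
      · exact haA j hx
      · exact hbA j hx
      · exact hC x h hx
    obtain ⟨x, hx, -⟩ := ha j
    exact (M.cover x).imp (M.BX.subset_of_no_sep (hA j) hT hx) (M.BY.subset_of_no_sep (hA j) hT hx)
  have noX : ∀ i j, i ≠ j → (∀ x ∈ A i, x ∈ SX ∧ ¬ (x = a ∨ x = b ∨ x ∈ C)) →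
      ¬ (∀ x ∈ A j, x ∈ SX ∧ ¬ (x = a ∨ x = b ∨ x ∈ C)) := fun i j hij hi hj =>
    M.BX.no_two (hA i) (hA j) hi hj (ha i) (hb i) (ha j) (hb j) (hAA i j hij)
  have noY : ∀ i j, i ≠ j → (∀ x ∈ A i, x ∈ SY ∧ ¬ (x = a ∨ x = b ∨ x ∈ C)) →
      ¬ (∀ x ∈ A j, x ∈ SY ∧ ¬ (x = a ∨ x = b ∨ x ∈ C)) := fun i j hij hi hj =>
    M.BY.no_two (hA i) (hA j) hi hj (ha i) (hb i) (ha j) (hb j) (hAA i j hij)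
  by_cases hc : ∃ c ∈ C, ∃ j, c ∈ A j
  · obtain ⟨c, hc, j, hcj⟩ := hc
    have inX : ∀ i, j ≠ i → ∀ x ∈ A i, x ∈ SX ∧ ¬ (x = a ∨ x = b ∨ x ∈ C) := by
      intro i hji
      refine (side i fun c' hc' h' => ?_).resolve_right fun h => ?_
      · exact (hAA j i hji c hcj c' h').1 (M.BX.single c hc c' hc')
      · obtain ⟨x, hx, e⟩ := M.link _ (hA i) h (ha i) (hb i) c hc
        exact (hAA j i hji c hcj x hx).2 e
    have h3 : j ≠ j + 1 ∧ j ≠ j + 2 ∧ j + 1 ≠ j + 2 := by fin_cases j <;> decide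
    exact noX _ _ h3.2.2 (inX _ h3.1) (inX _ h3.2.1)
  · push Not at hc
    rcases side 0 (fun c h => hc c h 0) with h0 | h0 <;> rcases side 1 (fun c h => hc c h 1) with h1 | h1 <;>
      rcases side 2 (fun c h => hc c h 2) with h2 | h2
    · exact noX 0 1 (by decide) h0 h1
    · exact noX 0 1 (by decide) h0 h1
    · exact noX 0 2 (by decide) h0 h2
    · exact noY 1 2 (by decide) h1 h2
    · exact noX 1 2 (by decide) h1 h2
    · exact noY 0 2 (by decide) h0 h2
    · exact noY 0 1 (by decide) h0 h1
    · exact noY 0 1 (by decide) h0 h1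

theorem noTheta : NoTheta G := by
  intro u w A huw hn hA hu hw hAA
  by_cases huT : u = a ∨ u = b ∨ u ∈ C
  · by_cases hwT : w = a ∨ w = b ∨ w ∈ C
    · rcases M.BX.sep_pair huT hwT huw hn with ⟨rfl, rfl⟩ | ⟨rfl, rfl⟩
      · exact M.no_theta_sep hA hu hw hAA
      · exact M.no_theta_sep hA hw hu hAA
    · rcases M.cover w with h | h
      · exact M.BX.no_branch h hwT huw.symm (fun e => hn e.symm) hA hw hu hAA
      · exact M.BY.no_branch h hwT huw.symm (fun e => hn e.symm) hA hw hu hAA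
  · rcases M.cover u with h | h
    · exact M.BX.no_branch h huT huw hn hA hu hw hAA
    · exact M.BY.no_branch h huT huw hn hA hu hw hAA

/-- A hole that is contained in neither side contains `a` and `b` and avoids `C`. -/
theorem hole_sep {A : Set V} (hA : HoleSet G A) (hX : ¬ A ⊆ SX) (hY : ¬ A ⊆ SY) :
    a ∈ A ∧ b ∈ A ∧ ∀ c ∈ C, c ∉ A := by
  obtain ⟨p, hp, hpX⟩ := Set.not_subset.1 hX
  obtain ⟨r, hr, hrY⟩ := Set.not_subset.1 hY
  have hpY := (M.cover p).resolve_left hpX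
  have hpT : ¬ (p = a ∨ p = b ∨ p ∈ C) := fun h => hpX (M.BX.mem_of_sep h)
  obtain ⟨s, m, t, n, h, rfl, rfl, rfl⟩ := hA.exists_twoPaths hp hr (fun e => hrY (e ▸ hpY))
    (fun e => hrY (M.BY.closed p hpY hpT r e))
  have inside : ∀ {q : ℕ → V} {l : ℕ}, q 0 = s 0 → q l = s m → ∀ k ≤ l, (q k = a ∨ q k = b ∨ q k ∈ C) →
      0 < k ∧ k < l := by
    intro q l h0 hl k hk hkT
    refine ⟨Nat.pos_of_ne_zero ?_, lt_of_le_of_ne hk ?_⟩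
    · rintro rfl
      exact hpT (h0 ▸ hkT)
    · rintro rfl
      exact hrY (hl ▸ M.BY.mem_of_sep hkT)
  have ex : ∀ {q : ℕ → V} {l : ℕ}, IsP G q l → q 0 = s 0 → q l = s m →
      ∃ k, 0 < k ∧ k < l ∧ (q k = a ∨ q k = b ∨ q k ∈ C) := by
    intro q l hq h0 hl
    obtain ⟨_, ⟨k, -, hk, rfl⟩, hkT⟩ := M.BY.exists_sep (hq.conn (i := 0) le_rfl)
      ⟨q 0, seg_mem le_rfl (Nat.zero_le l), h0 ▸ hpY⟩ ⟨q l, seg_mem (Nat.zero_le l) le_rfl, hl ▸ hrY⟩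
    exact ⟨k, (inside h0 hl k hk hkT).1, (inside h0 hl k hk hkT).2, hkT⟩
  obtain ⟨i, hi, hi', hiT⟩ := ex h.hs rfl rfl
  obtain ⟨j, hj, hj', hjT⟩ := ex h.ht h.first.symm h.last.symm
  have hij := h.anti i j hi hi' hj hj'
  have hs : s i ∈ seg s 0 m ∪ seg t 0 n := Or.inl (seg_mem (by omega) hi'.le)
  have ht : t j ∈ seg s 0 m ∪ seg t 0 n := Or.inr (seg_mem (by omega) hj'.le)
  have hpair := M.BX.sep_pair hiT hjT hij.1 hij.2
  have hC : ∀ c ∈ C, c ∉ seg s 0 m ∪ seg t 0 n := by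
    have adj : ∀ c ∈ C, G.Adj c (s i) ∧ G.Adj c (t j) := by
      intro c hc
      rcases hpair with ⟨e1, e2⟩ | ⟨e1, e2⟩
      · rw [e1, e2]; exact ⟨M.BX.ca c hc, M.BX.cb c hc⟩
      · rw [e1, e2]; exact ⟨M.BX.cb c hc, M.BX.ca c hc⟩
    rintro _ hc (⟨k, -, hk, rfl⟩ | ⟨k, -, hk, rfl⟩)
    · have := inside rfl rfl k hk (Or.inr (Or.inr hc))
      exact (h.anti k j this.1 this.2 hj hj').2 (adj _ hc).2
    · have := inside h.first.symm h.last.symm k hk (Or.inr (Or.inr hc))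
      exact (h.anti i k hi hi' this.1 this.2).2 (adj _ hc).1.symm
  rcases hpair with ⟨e1, e2⟩ | ⟨e1, e2⟩
  · exact ⟨e1 ▸ hs, e2 ▸ ht, hC⟩
  · exact ⟨e2 ▸ ht, e1 ▸ hs, hC⟩

theorem noWac : NoWac G := by
  intro A x y hA hx hy e h3x h3y
  by_cases hX : A ⊆ SX
  · exact M.BX.no_wac_side M.tri hA hX hx hy e h3x h3y
  by_cases hY : A ⊆ SY
  · exact M.BY.no_wac_side M.tri hA hY hx hy e h3x h3y
  obtain ⟨ha, hb, hC⟩ := M.hole_sep hA hX hY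
  obtain ⟨s, m, t, n, h, hs0, hsm, hAst⟩ := hA.exists_twoPaths ha hb M.BX.hab M.BX.nab
  have arc : ∀ {s t : ℕ → V} {m n : ℕ}, TwoPaths G s m t n → s 0 = a → s m = b →
      A = seg s 0 m ∪ seg t 0 n → (∀ i, 0 < i → i < m → s i ∈ SX ∧ ¬ (s i = a ∨ s i = b ∨ s i ∈ C)) ∨
      ∀ i, 0 < i → i < m → s i ∈ SY ∧ ¬ (s i = a ∨ s i = b ∨ s i ∈ C) := by
    intro s t m n h h0 hm hst
    have hm2 := h.hm
    have hT : ∀ x ∈ seg s 1 (m - 1), ¬ (x = a ∨ x = b ∨ x ∈ C) := by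
      rintro _ ⟨i, hi, hi', rfl⟩ (e | e | e)
      · rw [← h0, h.hs.inj (by omega) (by omega)] at e; omega
      · rw [← hm, h.hs.inj (by omega) (by omega)] at e; omega
      · exact hC _ e (hst ▸ Or.inl (seg_mem (by omega) (by omega)))
    have h1 : s 1 ∈ seg s 1 (m - 1) := seg_mem le_rfl (by omega)
    exact (M.cover (s 1)).imp
      (fun hS i hi hi' => M.BX.subset_of_no_sep (h.hs.conn (by omega)) hT h1 hS _ (seg_mem hi (by omega)))
      (fun hS i hi hi' => M.BY.subset_of_no_sep (h.hs.conn (by omega)) hT h1 hS _ (seg_mem hi (by omega)))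
  have cross : ∀ {s t : ℕ → V} {m n : ℕ}, TwoPaths G s m t n → s 0 = a → s m = b →
      A = seg s 0 m ∪ seg t 0 n → (∀ i, 0 < i → i < m → s i ∈ SX ∧ ¬ (s i = a ∨ s i = b ∨ s i ∈ C)) →
      (∀ j, 0 < j → j < n → t j ∈ SY ∧ ¬ (t j = a ∨ t j = b ∨ t j ∈ C)) → False := by
    intro s t m n h h0 hm hst hs ht
    rcases M.side_of_adj e with ⟨hxS, hyS⟩ | ⟨hxS, hyS⟩
    · subst hst
      exact M.BX.no_wac_cross h h0 hm (fun i hi hi' => ⟨(hs i hi hi').1, fun e => (hs i hi hi').2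
        (Or.inr (Or.inr e))⟩) (fun j hj hj' e => (ht j hj hj').2 (M.inter _ e (ht j hj hj').1))
        hx hy hxS hyS e h3x.two h3y.two
    · rw [Set.union_comm] at hst
      subst hst
      exact M.BY.no_wac_cross h.swap (h.first ▸ h0) (h.last ▸ hm) (fun i hi hi' => ⟨(ht i hi hi').1,
        fun e => (ht i hi hi').2 (Or.inr (Or.inr e))⟩)
        (fun j hj hj' e => (hs j hj hj').2 (M.inter _ (hs j hj hj').1 e)) hx hy hxS hyS e h3x.two h3y.two
  -- both open parts of the hole in one side would put the hole in that side
  have sub : ∀ {S : Set V}, a ∈ S → b ∈ S → (∀ i, 0 < i → i < m → s i ∈ S) → (∀ j, 0 < j → j < n → t j ∈ S) →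
      A ⊆ S := by
    intro S haS hbS hs ht
    rw [hAst]
    rintro _ (⟨i, -, hi, rfl⟩ | ⟨i, -, hi, rfl⟩)
    · by_cases h0 : i = 0
      · subst h0; rwa [hs0]
      by_cases hm : i = m
      · subst hm; rwa [hsm]
      · exact hs i (by omega) (by omega)
    · by_cases h0 : i = 0
      · subst h0; rwa [← h.first, hs0]
      by_cases hm : i = n
      · subst hm; rwa [← h.last, hsm]
      · exact ht i (by omega) (by omega)
  have hst' : A = seg t 0 n ∪ seg s 0 m := by rw [hAst, Set.union_comm]
  rcases arc h hs0 hsm hAst with h1 | h1 <;>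
    rcases arc h.swap (h.first ▸ hs0) (h.last ▸ hsm) hst' with h2 | h2
  · exact hX (sub M.BX.aS M.BX.bS (fun i hi hi' => (h1 i hi hi').1) fun i hi hi' => (h2 i hi hi').1)
  · exact cross h hs0 hsm hAst h1 h2
  · exact cross h.swap (h.first ▸ hs0) (h.last ▸ hsm) hst' h2 h1
  · exact hY (sub M.BY.aS M.BY.bS (fun i hi hi' => (h1 i hi hi').1) fun i hi hi' => (h2 i hi hi').1)

theorem free : Free G := ⟨M.noTheta, M.tri, M.noWac⟩

end Amalgam
end

/-! ### Buildable graphs are free -/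

section
variable {A B J V : Type*} {G : SimpleGraph V} {GX : SimpleGraph A} {GY : SimpleGraph B}

theorem ABPath.mem_interior {a b : A} (Q : ABPath GX a b) {q : ℕ → A} (hq : IsP GX q Q.length) (h0 : q 0 = a)
    (hl : q Q.length = b) (hv : Q.verts = seg q 0 Q.length) {x : A} :
    x ∈ Q.interior ↔ ∃ k, 0 < k ∧ k < Q.length ∧ q k = x := by
  rw [← hq.mem_interior, ← hv, h0, hl]
  rfl

/-- The degree conditions of the gluing operations: an internal vertex has no neighbours outside the path,
except possibly one further neighbour `c`. -/
theorem ABPath.mem_of_ncard {a b : A} (Q : ABPath GX a b) {C : Set A} {v : A} (hv : v ∈ Q.interior)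
    (h : (GX.neighborSet v).ncard = 2 ∨
      ((GX.neighborSet v).ncard = 3 ∧ ∃ c ∈ C, c ∉ Q.verts ∧ GX.Adj c v)) {w : A} (e : GX.Adj v w) :
    w ∈ Q.verts ∨ w ∈ C := by
  obtain ⟨q, hq, h0, hl, hverts⟩ := Q.exists_isP
  obtain ⟨k, hk, hk', rfl⟩ := (Q.mem_interior hq h0 hl hverts).1 hv
  have m1 : q (k - 1) ∈ Q.verts := hverts ▸ seg_mem (by omega) (by omega)
  have m2 : q (k + 1) ∈ Q.verts := hverts ▸ seg_mem (by omega) (by omega)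
  have e1 : GX.Adj (q k) (q (k - 1)) := (hq.adj_iff (by omega) (by omega)).2 (by omega)
  have e2 : GX.Adj (q k) (q (k + 1)) := (hq.adj_iff (by omega) (by omega)).2 (by omega)
  have hne : q (k - 1) ≠ q (k + 1) := (hq _ _ (by omega) (by omega)).1
  rcases h with h | ⟨h, c, hc, hcv, ec⟩
  · have hset : ({q (k - 1), q (k + 1)} : Set A) = GX.neighborSet (q k) := by
      refine Set.eq_of_subset_of_ncard_le ?_ (by rw [h, Set.ncard_pair hne])
        (Set.finite_of_ncard_ne_zero (by omega))
      rintro _ (rfl | rfl)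
      · exact e1
      · exact e2
    have hw : w ∈ ({q (k - 1), q (k + 1)} : Set A) := hset ▸ e
    rcases hw with rfl | rfl
    · exact Or.inl m1
    · exact Or.inl m2
  · have h1 : c ≠ q (k - 1) := fun e => hcv (e ▸ m1)
    have h2 : c ≠ q (k + 1) := fun e => hcv (e ▸ m2)
    have hset : ({c, q (k - 1), q (k + 1)} : Set A) = GX.neighborSet (q k) := by
      refine Set.eq_of_subset_of_ncard_le ?_ ?_ (Set.finite_of_ncard_ne_zero (by omega))
      · rintro _ (rfl | rfl | rfl)
        · exact ec.symm
        · exact e1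
        · exact e2
      · rw [h, Set.ncard_insert_of_notMem (by rintro (e | e) <;> contradiction), Set.ncard_pair hne]
    have hw : w ∈ ({c, q (k - 1), q (k + 1)} : Set A) := hset ▸ e
    rcases hw with rfl | rfl | rfl
    · exact Or.inr hc
    · exact Or.inl m1
    · exact Or.inl m2

/-- One side of a gluing, with the graph it comes from as its block. -/
theorem exists_block {a b : A} {C : Set A} {t : J → A} (Q : ABPath GX a b) (F : Free GX)
    (hL : 2 ≤ Q.length) {f : ↥Q.interiorᶜ → V} (hinj : Function.Injective f)
    (hadj : ∀ x x', G.Adj (f x) (f x') ↔ GX.Adj x x')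
    (hclosed : ∀ x y, G.Adj (f x) y → y ∈ Set.range f ∨ ∃ j, (x : A) = t j)
    (ht : ∀ j, t j = a ∨ t j = b ∨ t j ∈ C)
    (hnb : ∀ v ∈ Q.interior, ∀ w, GX.Adj v w → w ∈ Q.verts ∨ w ∈ C)
    (hC : ∀ c ∈ C, c ∉ Q.verts ∧ GX.Adj c a ∧ GX.Adj c b) (hs : ∀ c ∈ C, ∀ c' ∈ C, c = c')
    {xa xb : ↥Q.interiorᶜ} (ha : (xa : A) = a) (hb : (xb : A) = b) {C' : Set V} (hCS : C' ⊆ Set.range f)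
    (hC' : ∀ x, f x ∈ C' ↔ (x : A) ∈ C) :
    ∃ φ q, Block G (f xa) (f xb) C' (Set.range f) GX φ q Q.length ∧ ∀ x, φ (f x) = x := by
  classical
  obtain ⟨q, hq, h0, hl, hverts⟩ := Q.exists_isP
  have hint := fun x => Q.mem_interior hq h0 hl hverts (x := x)
  let φ : V → A := fun v => if h : ∃ x, f x = v then h.choose else a
  have hφ : ∀ x, φ (f x) = x := by
    intro x
    have h : ∃ x', f x' = f x := ⟨x, rfl⟩
    simp only [φ, dif_pos h]
    exact congrArg Subtype.val (hinj h.choose_spec)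
  refine ⟨φ, q, ⟨F, ?_, ?_, hL, hq, by rw [hφ, ha, h0], by rw [hφ, hb, hl], ?_, ?_, ⟨xa, rfl⟩, ⟨xb, rfl⟩, hCS,
    ?_, ?_, ?_, ?_, ?_, ?_⟩, hφ⟩
  · rintro _ ⟨x, rfl⟩ _ ⟨y, rfl⟩ e
    rw [hφ, hφ] at e
    exact congrArg f (Subtype.ext e)
  · rintro _ ⟨x, rfl⟩ _ ⟨y, rfl⟩
    rw [hφ, hφ, hadj]
  · rintro k hk hk' _ ⟨x, rfl⟩ e
    rw [hφ] at e
    exact x.2 ((hint _).2 ⟨k, hk, hk', e⟩)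
  · rintro k hk hk' _ ⟨x, rfl⟩ e
    rw [hφ] at e
    rcases hnb _ ((hint _).2 ⟨k, hk, hk', rfl⟩) _ e with h | h
    · by_cases hxa : (x : A) = a
      · exact Or.inl (congrArg f (Subtype.ext (hxa.trans ha.symm)))
      by_cases hxb : (x : A) = b
      · exact Or.inr (Or.inl (congrArg f (Subtype.ext (hxb.trans hb.symm))))
      · exact absurd ⟨h, hxa, hxb⟩ x.2
    · exact Or.inr (Or.inr ((hC' x).2 h))
  · intro e
    have := congrArg Subtype.val (hinj e)
    rw [ha, hb, ← h0, ← hl, hq.inj (by omega) le_rfl] at this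
    omega
  · rw [hadj, ha, hb, ← h0, ← hl, hq.adj_iff (by omega) le_rfl]
    omega
  · intro c hc
    obtain ⟨x, rfl⟩ := hCS hc
    rw [hadj, ha]
    exact (hC _ ((hC' x).1 hc)).2.1
  · intro c hc
    obtain ⟨x, rfl⟩ := hCS hc
    rw [hadj, hb]
    exact (hC _ ((hC' x).1 hc)).2.2
  · intro c hc c' hc'
    obtain ⟨x, rfl⟩ := hCS hc
    obtain ⟨y, rfl⟩ := hCS hc'
    exact congrArg f (Subtype.ext (hs _ ((hC' x).1 hc) _ ((hC' y).1 hc')))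
  · rintro _ ⟨x, rfl⟩ hx y e
    refine (hclosed x y e).resolve_right ?_
    rintro ⟨j, hj⟩
    refine hx ?_
    rcases ht j with h | h | h
    · exact Or.inl (congrArg f (Subtype.ext (hj.trans (h.trans ha.symm))))
    · exact Or.inr (Or.inl (congrArg f (Subtype.ext (hj.trans (h.trans hb.symm)))))
    · exact Or.inr (Or.inr ((hC' x).2 (hj ▸ h)))

/-- In a gluing each of the two graphs, without the deleted vertices, is an induced subgraph, and edges leave
it only at the identified vertices. -/
theorem gluing_side {D : Set A} {D' : Set B} {tX : J → A} {tY : J → B} {f : ↥Dᶜ → V} {g : ↥D'ᶜ → V}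
    (hf : Function.Injective f) (hfg : ∀ x y, f x = g y ↔ ∃ j, (x : A) = tX j ∧ (y : B) = tY j)
    (hadj : ∀ u v, G.Adj u v ↔ (∃ x x' : ↥Dᶜ, GX.Adj x x' ∧ f x = u ∧ f x' = v) ∨
      (∃ y y' : ↥D'ᶜ, GY.Adj y y' ∧ g y = u ∧ g y' = v))
    (hcons : ∀ i j, GY.Adj (tY i) (tY j) → GX.Adj (tX i) (tX j)) :
    (∀ x x', G.Adj (f x) (f x') ↔ GX.Adj x x') ∧
      ∀ x y, G.Adj (f x) y → y ∈ Set.range f ∨ ∃ j, (x : A) = tX j := by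
  constructor
  · intro x x'
    rw [hadj]
    constructor
    · rintro (⟨z, z', e, h1, h2⟩ | ⟨y, y', e, h1, h2⟩)
      · rwa [← hf h1, ← hf h2]
      · obtain ⟨i, hi, hi'⟩ := (hfg _ _).1 h1.symm
        obtain ⟨j, hj, hj'⟩ := (hfg _ _).1 h2.symm
        rw [hi, hj]
        rw [hi', hj'] at e
        exact hcons i j e
    · exact fun e => Or.inl ⟨x, x', e, rfl, rfl⟩
  · intro x y e
    rcases (hadj _ _).1 e with ⟨z, z', -, -, h⟩ | ⟨z, z', -, h, -⟩
    · exact Or.inl ⟨z', h⟩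
    · obtain ⟨j, hj, -⟩ := (hfg _ _).1 h.symm
      exact Or.inr ⟨j, hj⟩

/-- The common form of gluing along a proper 2-separator (with `CX` and `CY` empty) and along a proper
`P₃`-separator (where they consist of the middle vertex) preserves freeness. -/
theorem IsGluingDeleting.free {aX bX : A} {aY bY : B} {CX : Set A} {CY : Set B} {Q : ABPath GX aX bX}
    {P : ABPath GY aY bY} {tX : J → A} {tY : J → B}
    (h : IsGluingDeleting GX GY tX tY Q.interior P.interior G) (FX : Free GX) (FY : Free GY)
    (hQ : 2 ≤ Q.length) (hP : 2 ≤ P.length)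
    (ht : ∀ j, (tX j = aX ∧ tY j = aY) ∨ (tX j = bX ∧ tY j = bY) ∨ (tX j ∈ CX ∧ tY j ∈ CY))
    (hcons : ∀ i j, GX.Adj (tX i) (tX j) ↔ GY.Adj (tY i) (tY j))
    (ha : ∃ j, tX j = aX ∧ tY j = aY) (hb : ∃ j, tX j = bX ∧ tY j = bY)
    (hcX : ∀ c ∈ CX, ∃ j, tX j = c) (hcY : ∀ c ∈ CY, ∃ j, tX j ∈ CX ∧ tY j = c)
    (hCX : ∀ c ∈ CX, c ∉ Q.verts ∧ GX.Adj c aX ∧ GX.Adj c bX)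
    (hCY : ∀ c ∈ CY, c ∉ P.verts ∧ GY.Adj c aY ∧ GY.Adj c bY)
    (hsX : ∀ c ∈ CX, ∀ c' ∈ CX, c = c') (hsY : ∀ c ∈ CY, ∀ c' ∈ CY, c = c')
    (hnX : ∀ v ∈ Q.interior, ∀ w, GX.Adj v w → w ∈ Q.verts ∨ w ∈ CX)
    (hnY : ∀ v ∈ P.interior, ∀ w, GY.Adj v w → w ∈ P.verts ∨ w ∈ CY)
    (hlink : ∀ c ∈ CY, ∀ R : ABPath GY aY bY, R.verts ≠ P.verts → R.verts ≠ {aY, c, bY} →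
      ∃ v ∈ R.interior, GY.Adj c v) : Free G := by
  obtain ⟨f, g, hf, hg, hcov, hfg, hadj⟩ := h
  obtain ⟨hfA, hfC⟩ := gluing_side hf hfg hadj fun i j => (hcons i j).2
  obtain ⟨hgA, hgC⟩ := gluing_side (f := g) (g := f) (tX := tY) (tY := tX) hg
    (fun x y => by rw [eq_comm, hfg]; simp only [and_comm]) (fun u v => by rw [hadj, or_comm])
    fun i j => (hcons i j).1
  obtain ⟨xa, hxa⟩ : ∃ x : ↥Q.interiorᶜ, (x : A) = aX := ⟨⟨aX, fun h => h.2.1 rfl⟩, rfl⟩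
  obtain ⟨xb, hxb⟩ : ∃ x : ↥Q.interiorᶜ, (x : A) = bX := ⟨⟨bX, fun h => h.2.2 rfl⟩, rfl⟩
  obtain ⟨ya, hya⟩ : ∃ y : ↥P.interiorᶜ, (y : B) = aY := ⟨⟨aY, fun h => h.2.1 rfl⟩, rfl⟩
  obtain ⟨yb, hyb⟩ : ∃ y : ↥P.interiorᶜ, (y : B) = bY := ⟨⟨bY, fun h => h.2.2 rfl⟩, rfl⟩
  have hA : f xa = g ya := by
    obtain ⟨j, h1, h2⟩ := ha
    exact (hfg _ _).2 ⟨j, by rw [hxa, h1], by rw [hya, h2]⟩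
  have hB : f xb = g yb := by
    obtain ⟨j, h1, h2⟩ := hb
    exact (hfg _ _).2 ⟨j, by rw [hxb, h1], by rw [hyb, h2]⟩
  have hcXY : ∀ j, tX j ∈ CX → tY j ∈ CY := by
    intro j hj
    have hav : aX ∈ Q.verts := ⟨0, Q.first_eq⟩
    have hbv : bX ∈ Q.verts := ⟨_, Q.last_eq⟩
    rcases ht j with h | h | h
    · exact absurd hav (h.1 ▸ (hCX _ hj).1)
    · exact absurd hbv (h.1 ▸ (hCX _ hj).1)
    · exact h.2
  set C : Set V := f '' {x | (x : A) ∈ CX} with hCdef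
  have hCf : ∀ x, f x ∈ C ↔ (x : A) ∈ CX := fun x => hf.mem_set_image
  have hCg : ∀ y, g y ∈ C ↔ (y : B) ∈ CY := by
    intro y
    constructor
    · rintro ⟨x, hx, e⟩
      obtain ⟨j, h1, h2⟩ := (hfg _ _).1 e
      rw [h2]
      exact hcXY j (h1 ▸ hx)
    · intro hy
      obtain ⟨j, h1, h2⟩ := hcY _ hy
      exact ⟨⟨tX j, fun h => (hCX _ h1).1 h.1⟩, h1, (hfg _ _).2 ⟨j, rfl, h2.symm⟩⟩
  have hCgr : C ⊆ Set.range g := by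
    rintro _ ⟨x, hx, rfl⟩
    obtain ⟨j, hj⟩ := hcX _ hx
    have hj' : tX j ∈ CX := by rw [hj]; exact hx
    exact ⟨⟨tY j, fun h => (hCY _ (hcXY j hj')).1 h.1⟩, ((hfg _ _).2 ⟨j, hj.symm, rfl⟩).symm⟩
  obtain ⟨φX, qX, BX, hφX⟩ := exists_block Q FX hQ hf hfA hfC
    (fun j => (ht j).imp And.left (Or.imp And.left And.left)) hnX hCX hsX hxa hxb
    (Set.image_subset_range f _) hCf
  obtain ⟨φY, qY, BY, hφY⟩ := exists_block P FY hP hg hgA hgC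
    (fun j => (ht j).imp And.right (Or.imp And.right And.right)) hnY hCY hsY hya hyb hCgr hCg
  rw [← hA, ← hB] at BY
  refine Amalgam.free (SX := Set.range f) (SY := Set.range g) ⟨BX, BY, hcov, ?_, ?_⟩
  · rintro _ ⟨x, rfl⟩ ⟨y, e⟩
    obtain ⟨j, h1, h2⟩ := (hfg _ _).1 e.symm
    rcases ht j with h | h | h
    · exact Or.inl (congrArg f (Subtype.ext (by rw [h1, h.1, hxa])))
    · exact Or.inr (Or.inl (congrArg f (Subtype.ext (by rw [h1, h.1, hxb]))))
    · exact Or.inr (Or.inr ((hCf x).2 (h1 ▸ h.1)))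
  · -- a chordless path through `D` lifts to `GY`, where it is neither `P` nor the path through `c`
    intro D hD hDY haD hbD c hc
    obtain ⟨yc, rfl⟩ := hCgr hc
    have hcY' := (hCg yc).1 hc
    have hφa : φY (f xa) = aY := by rw [hA, hφY, hya]
    have hφb : φY (f xb) = bY := by rw [hB, hφY, hyb]
    have att : ∀ {z}, z ∈ Set.range g → Att G z D → Att GY (φY z) (φY '' D) := by
      rintro z hz ⟨x, hx, e⟩
      exact ⟨φY x, ⟨x, hx, rfl⟩, (BY.adj _ hz _ (hDY x hx).1).2 e⟩
    have notin : ∀ {z}, z ∈ Set.range g → (z = f xa ∨ z = f xb ∨ z ∈ C) → φY z ∉ φY '' D := by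
      rintro z hz hzT ⟨x, hx, e⟩
      exact (hDY x hx).2 (BY.inj _ (hDY x hx).1 _ hz e ▸ hzT)
    obtain ⟨p, n, hp, hn, h0, hl, hpD⟩ := (BY.conn_image hD fun x hx => (hDY x hx).1).exists_link
      (u := aY) (w := bY) (fun e => BY.hab (BY.inj _ BY.aS _ BY.bS (by rw [hφa, hφb, e])))
      (fun e => BY.nab ((BY.adj _ BY.aS _ BY.bS).1 (by rwa [hφa, hφb]))) (hφa ▸ att BY.aS haD)
      (hφb ▸ att BY.bS hbD) (hφa ▸ notin BY.aS (Or.inl rfl)) (hφb ▸ notin BY.bS (Or.inr (Or.inl rfl)))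
    obtain ⟨R, hR⟩ : ∃ R : ABPath GY aY bY, R.verts = seg p 0 n := by
      rw [← h0, ← hl]
      obtain ⟨R, -, hR⟩ := hp.exists_abPath
      exact ⟨R, hR⟩
    have h1 : p 1 ∈ R.verts := hR ▸ seg_mem (by omega) (by omega)
    have h1a : p 1 ≠ aY := fun e => by
      rw [← h0, hp.inj (by omega) (by omega)] at e; omega
    have h1b : p 1 ≠ bY := fun e => by
      rw [← hl, hp.inj (by omega) (by omega)] at e; omega
    have h1D := hpD 1 (by omega) (by omega)
    obtain ⟨v, hv, ev⟩ := hlink yc hcY' R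
      (fun e => by
        obtain ⟨x, hx, e'⟩ := h1D
        obtain ⟨y, rfl⟩ := (hDY x hx).1
        rw [hφY] at e'
        exact y.2 (by rw [e']; exact ⟨e ▸ h1, h1a, h1b⟩))
      (fun e => by
        rw [e] at h1
        rcases h1 with h1 | h1 | h1
        · exact h1a h1
        · refine notin (z := g yc) ⟨yc, rfl⟩ (Or.inr (Or.inr hc)) ?_
          rwa [hφY, ← h1]
        · exact h1b h1)
    obtain ⟨hvR, hva, hvb⟩ := hv
    rw [hR] at hvR
    obtain ⟨k, hk, hk', rfl⟩ := (hp.mem_interior).1 ⟨hvR, h0 ▸ hva, hl ▸ hvb⟩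
    obtain ⟨x, hx, e⟩ := hpD k hk hk'
    refine ⟨x, hx, (BY.adj _ ⟨yc, rfl⟩ _ (hDY x hx).1).1 ?_⟩
    rwa [hφY, e]

theorem ABPath.ends_not_adj {a b : A} (Q : ABPath GX a b) (h : 2 ≤ Q.length) : ¬ GX.Adj a b := by
  obtain ⟨q, hq, h0, hl, -⟩ := Q.exists_isP
  rw [← h0, ← hl, hq.adj_iff (by omega) le_rfl]
  omega

theorem IsTwoGluing.free (h : IsTwoGluing GX GY G) (FX : Free GX) (FY : Free GY) : Free G := by
  obtain ⟨aX, bX, aY, bY, Q, P, hQ, hP, hdX, hdY, h⟩ := h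
  have nX := Q.ends_not_adj hQ
  have nY := P.ends_not_adj hP
  refine h.free (CX := ∅) (CY := ∅) FX FY hQ hP ?_ ?_ ⟨0, rfl, rfl⟩ ⟨1, rfl, rfl⟩ (fun c hc => hc.elim)
    (fun c hc => hc.elim) (fun c hc => hc.elim) (fun c hc => hc.elim) (fun c hc => hc.elim)
    (fun c hc => hc.elim) (fun v hv w e => Q.mem_of_ncard hv (Or.inl (hdX v hv)) e)
    (fun v hv w e => P.mem_of_ncard hv (Or.inl (hdY v hv)) e) (fun c hc => hc.elim)
  · intro j
    fin_cases j
    · exact Or.inl ⟨rfl, rfl⟩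
    · exact Or.inr (Or.inl ⟨rfl, rfl⟩)
  · intro i j
    fin_cases i <;> fin_cases j
    · exact iff_of_false (fun e => e.ne rfl) fun e => e.ne rfl
    · exact iff_of_false nX nY
    · exact iff_of_false (fun e => nX e.symm) fun e => nY e.symm
    · exact iff_of_false (fun e => e.ne rfl) fun e => e.ne rfl

theorem IsP3Gluing.free (h : IsP3Gluing GX GY G) (FX : Free GX) (FY : Free GY) : Free G := by
  obtain ⟨aX, cX, bX, aY, cY, bY, Q, P, ⟨-, hX1, hX2, nX⟩, hQ, hcQ, -, -, hdX, ⟨-, hY1, hY2, nY⟩, hP, hcP, -,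
    hlink, hdY, h⟩ := h
  refine h.free (CX := {cX}) (CY := {cY}) FX FY hQ hP ?_ ?_ ⟨0, rfl, rfl⟩ ⟨2, rfl, rfl⟩ ?_ ?_ ?_ ?_ ?_ ?_
    (fun v hv w e => Q.mem_of_ncard (C := {cX}) hv
      ((hdX v hv).imp id fun h => ⟨h.1, cX, rfl, hcQ, h.2⟩) e)
    (fun v hv w e => P.mem_of_ncard hv (Or.inl (hdY v hv)) e) ?_
  · intro j
    fin_cases j
    · exact Or.inl ⟨rfl, rfl⟩
    · exact Or.inr (Or.inr ⟨rfl, rfl⟩)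
    · exact Or.inr (Or.inl ⟨rfl, rfl⟩)
  · intro i j
    fin_cases i <;> fin_cases j
    · exact iff_of_false (fun e => e.ne rfl) fun e => e.ne rfl
    · exact iff_of_true hX1 hY1
    · exact iff_of_false nX nY
    · exact iff_of_true hX1.symm hY1.symm
    · exact iff_of_false (fun e => e.ne rfl) fun e => e.ne rfl
    · exact iff_of_true hX2 hY2
    · exact iff_of_false (fun e => nX e.symm) fun e => nY e.symm
    · exact iff_of_true hX2.symm hY2.symm
    · exact iff_of_false (fun e => e.ne rfl) fun e => e.ne rfl
  · rintro _ rfl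
    exact ⟨1, rfl⟩
  · rintro _ rfl
    exact ⟨1, rfl, rfl⟩
  · rintro _ rfl
    exact ⟨hcQ, hX1.symm, hX2⟩
  · rintro _ rfl
    exact ⟨hcP, hY1.symm, hY2⟩
  · rintro _ rfl _ rfl
    rfl
  · rintro _ rfl _ rfl
    rfl
  · rintro _ rfl
    exact hlink

end

theorem Buildable.free {V : Type u} {G : SimpleGraph V} (h : Buildable G) : Free G := by
  induction h with
  | basic G h => exact h.free
  | clique G k W H hk _ h ih => exact h.free (Fin.nontrivial_iff_two_le.2 hk) ih
  | two G GX GY _ _ h ihX ihY => exact h.free ihX ihY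
  | p3 G GX GY _ _ h ihX ihY => exact h.free ihX ihY

theorem mainTheorem6 {V : Type u} [Finite V] [Nonempty V] (G : SimpleGraph V) :
    (ThetaFree G ∧ G.CliqueFree 3 ∧ WacFree G) ↔ Buildable G := by
  rw [free_iff]
  exact ⟨Free.buildable _ G rfl, Buildable.free⟩
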